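/- **Setting.** Let $d,k\ge1$, let $\Omega\subset\mathbb R^d$ be a nonempty, open, bounded Lipschitz polyhedron, and let $J=[0,\infty)$, $V=H^1_0(\Omega)$. Write $(\cdot,\cdot)$ and $\|\cdot\|$ for the $L^2(\Omega)$ inner product and norm. Let $f\in H^1(J;L^2(\Omega))\cap L^\infty(J;L^2(\Omega))$ vanish on some $[0,\delta]$, $\delta>0$, and let $u\in C^2(J;L^2(\Omega))\cap C^0(J;V)$ satisfy $u(0)=\dot u(0)=0$ and $$(\ddot u(t),v)+(\nabla u(t),\nabla v)=(f(t),v)\qquad\forall t\in J,\ \forall v\in V.$$ Let $\mathcal T_h$ be a conforming affine simplicial mesh covering $\Omega$ exactly, whose largest and smallest cell diameters are $h$ and $h_{\min}$, with shape-regularity parameter at most $\sigma$ (each cell $K$ contains a ball of radius $r$ with $\operatorname{diam}K\le\sigma r$). Let $V_h\subset V$ be the continuous Lagrange finite element space of degree $k$ on $\mathcal T_h$. Let $\tau>0$, $\rho>0$ with $\rho\tau\le1$, and $t^n=n\tau$. Let $(U^n)_{n\ge0}\subset V_h$ be given by the leapfrog scheme $U^0=U^1=0$, $$\tau^{-2}(U^{n+1}-2U^n+U^{n-1},v_h)+(\nabla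 U^n,\nabla v_h)=(f(t^n),v_h)\qquad\forall n\ge1,\ \forall v_h\in V_h,$$ and set $U^n:=0$ for $n<0$. For $n\ge0$, $t\in[t^n,t^{n+1})$ and $s=t-t^n$, define $$u_{h\tau}(t)=U^n+\tfrac{U^{n+1}-U^{n-1}}{2\tau}s+\tfrac{U^{n+1}-2U^n+U^{n-1}}{\tau^2}\tfrac{s^2}2,\qquad w_{h\tau}(t)=\alpha^n+\beta^ns+\gamma^n\tfrac{s^2}2+\vartheta^n\tfrac{s^3}6+\epsilon^n\tfrac{s^4}{24},$$ where $$\alpha^n=\tfrac{3U^{n+1}+17U^n+5U^{n-1}-U^{n-2}}{24},\quad \beta^n=\tfrac{5U^{n+1}+3U^n-9U^{n-1}+U^{n-2}}{12\tau},\quad \gamma^n=\tfrac{U^{n+1}-2U^n+U^{n-1}}{\tau^2},$$ $$\vartheta^n=\tfrac{U^{n+2}-2U^{n+1}+2U^{n-1}-U^{n-2}}{2\tau^3},\quad \epsilon^n=\tfrac{U^{n+2}-4U^{n+1}+6U^n-4U^{n-1}+U^{n-2}}{\tau^4}.$$ Set $\mathcal E_\rho^2(\phi)=\int_0^\infty(\|\dot\phi(t)\|^2+\|\nabla\phi(t)\|^2)e^{-2\rho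 t}\,dt$, $\ |v|_{L^2_\rho(Y)}^2=\int_0^\infty|v(t)|_Y^2e^{-2\rho t}\,dt$, $\ |v|_V=\|\nabla v\|$, $\ |v|_{H^m(\mathcal T_h)}^2=\sum_{K\in\mathcal T_h}\|D^m(v|_K)\|_{L^2(K)}^2$ with $|D^m v|^2=\sum_{1\le j_1,\dots,j_m\le d}|\partial_{j_1}\cdots\partial_{j_m}v|^2$, and $\kappa=\max(\operatorname{diam}\Omega,\rho^{-1})$. Let $$C_{tim}(u)=\sum_{r=3}^4\kappa^{r-2}|u^{(r)}|_{L^2_\rho(V)},\qquad C_{spa}(u)=\sum_{r=0}^3\kappa^r|u^{(r)}|_{L^2_\rho(H^{k+1}(\mathcal T_h))},\qquad C_{tim}(f)=\sum_{r=2}^3\kappa^{r-2}\|f^{(r)}\|_{L^2_\rho(L^2)},$$ where time derivatives are understood in the weak (Bochner–Sobolev) sense, those of $u$ with values in $V$ and those of $f$ with values in $L^2(\Omega)$. **Theorem.** Let $\mu_0\in(0,1)$ and $\sigma>0$. Consider the stability condition $$\mu_0\|v_h\|^2\le\|v_h\|^2-\tau^2\|\nabla v_h\|^2\le\|v_h\|^2\qquad\forall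 v_h\in V_h.\tag{S}$$ There are constants $c,C>0$, depending only on $\Omega$ (hence $d$), $k$, $\sigma$ and $\mu_0$, such that the following holds for all $\mathcal T_h$, $\tau$, $\rho$, $f$, $u$ and $(U^n)$ as above. 1. The CFL condition $\tau\le c\,h_{\min}$ implies (S) (irrespective of $\rho$, $f$ and $u$). 2. If (S) holds (in particular, under the CFL condition) and $u$ has weak time derivatives up to order 4 with $C_{tim}(u)<\infty$ and $C_{spa}(u)<\infty$, then $$\mathcal E_\rho^2(u-u_{h\tau})\le C\big(\tau^4C_{tim}(u)^2+h^{2k}C_{spa}(u)^2\big).$$ 3. If, moreover, $f$ has weak time derivatives up to order 3 with $C_{tim}(f)<\infty$, then $$\mathcal E_\rho^2(u-w_{h\tau})\le C\big(\tau^4\big(C_{tim}(u)^2+\kappa^2C_{tim}(f)^2\big)+h^{2k}C_{spa}(u)^2\big).$$ -/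

import Mathlib

open MeasureTheory Set
open scoped ENNReal ContDiff

noncomputable section

namespace WaveFEM

/-- The Euclidean space of dimension `d`. -/
abbrev Eu (d : ℕ) := EuclideanSpace ℝ (Fin d)

variable {d : ℕ}

/-! ### Domains -/

/-- Lipschitz domain: near every boundary point, in a suitable direction `e`, the set is the strict
epigraph of a Lipschitz function of the components orthogonal to `e`. -/
def IsLipschitzDomain (Ω : Set (Eu d)) : Prop :=
  ∀ x ∈ frontier Ω, ∃ e : Eu d, ‖e‖ = 1 ∧ ∃ (K : NNReal) (φ : Eu d → ℝ), LipschitzWith K φ ∧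
    ∃ r > 0, ∀ y ∈ Metric.ball x r, y ∈ Ω ↔ φ (y - inner ℝ e y • e) < inner ℝ e y

/-! ### The spaces `L²(Ω)` and `H¹₀(Ω)` -/

/-- `L²(Ω)`. -/
abbrev L2 (Ω : Set (Eu d)) := Lp ℝ 2 (volume.restrict Ω)

/-- `L²(Ω; ℝᵈ)`. -/
abbrev L2vec (Ω : Set (Eu d)) := Lp (Eu d) 2 (volume.restrict Ω)

/-- Smooth functions with compact support in the open set `O`. -/
def IsTestFunction (O : Set (Eu d)) (φ : Eu d → ℝ) : Prop :=
  ContDiff ℝ ∞ φ ∧ HasCompactSupport φ ∧ tsupport φ ⊆ O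

/-- The pairs `(φ, ∇φ)` with `φ` a test function on `Ω`. -/
def testGraph (Ω : Set (Eu d)) : Set (WithLp 2 (L2 Ω × L2vec Ω)) :=
  {p | ∃ φ : Eu d → ℝ, IsTestFunction Ω φ ∧
    p.fst =ᵐ[volume.restrict Ω] φ ∧ p.snd =ᵐ[volume.restrict Ω] fun x => gradient φ x}

/-- `H¹₀(Ω)`, the closure of the test functions in the `H¹` norm. An element is recorded
as the pair (function, weak gradient). -/
abbrev H10 (Ω : Set (Eu d)) := (Submodule.span ℝ (testGraph Ω)).topologicalClosure

/-- The function underlying an element of `H¹₀(Ω)`. -/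
def fn {Ω : Set (Eu d)} (v : H10 Ω) : L2 Ω := (v : WithLp 2 (L2 Ω × L2vec Ω)).fst

/-- The weak gradient of an element of `H¹₀(Ω)`. -/
def grad {Ω : Set (Eu d)} (v : H10 Ω) : L2vec Ω := (v : WithLp 2 (L2 Ω × L2vec Ω)).snd

/-! ### Sobolev spaces of higher order and their seminorms -/

/-- `g` is the weak partial derivative `∂_{j 0} ⋯ ∂_{j (m-1)} φ` on the open set `O`. -/
def HasWeakDeriv (O : Set (Eu d)) {m : ℕ} (j : Fin m → Fin d) (φ g : Eu d → ℝ) : Prop :=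
  ∀ ψ : Eu d → ℝ, IsTestFunction O ψ →
    ∫ x in O, φ x * iteratedFDeriv ℝ m ψ x (fun i => EuclideanSpace.single (j i) 1)
      = (-1) ^ m * ∫ x in O, g x * ψ x

/-- `φ|_O ∈ H^m(O)`: all weak partial derivatives of order at most `m` are in `L²(O)`. -/
def MemSobolev (O : Set (Eu d)) (m : ℕ) (φ : Eu d → ℝ) : Prop :=
  ∀ r ≤ m, ∀ j : Fin r → Fin d, ∃ g : L2 O, HasWeakDeriv O j φ g

open Classical in
/-- The squared seminorm `|φ|²_{H^m(O)}`: the sum of the squared `L²(O)` norms of all the partial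
derivatives of order `m` (the infimum is over the only possible weak derivative);
it is `∞` if `φ` is not in `H^m(O)`. -/
def sobolevSeminormSq (O : Set (Eu d)) (m : ℕ) (φ : Eu d → ℝ) : ℝ≥0∞ :=
  if MemSobolev O m φ then
    ∑ j : Fin m → Fin d, ⨅ (g : L2 O) (_ : HasWeakDeriv O j φ g), ‖g‖ₑ ^ 2
  else ⊤

/-! ### Simplicial meshes and Lagrange finite elements -/

/-- A conforming affine simplicial mesh covering `Ω` exactly. A cell is recorded as the set of its
`d + 1` vertices. -/
structure Mesh (Ω : Set (Eu d)) where
  cells : Finset (Finset (Eu d))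
  card_eq : ∀ s ∈ cells, s.card = d + 1
  indep : ∀ s ∈ cells, AffineIndependent ℝ ((↑) : s → Eu d)
  conforming : ∀ s ∈ cells, ∀ t ∈ cells,
    convexHull ℝ (s : Set (Eu d)) ∩ convexHull ℝ (t : Set (Eu d)) ⊆
      convexHull ℝ ((s : Set (Eu d)) ∩ t)
  cover : ⋃ s ∈ cells, convexHull ℝ (s : Set (Eu d)) = closure Ω

variable {Ω : Set (Eu d)}

/-- The mesh size: the largest cell diameter. -/
def Mesh.size (T : Mesh Ω) : ℝ :=
  ⨆ s : T.cells, Metric.diam (convexHull ℝ ((s : Finset (Eu d)) : Set (Eu d)))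

/-- The smallest cell diameter. -/
def Mesh.minSize (T : Mesh Ω) : ℝ :=
  ⨅ s : T.cells, Metric.diam (convexHull ℝ ((s : Finset (Eu d)) : Set (Eu d)))

/-- The shape-regularity parameter is at most `σ`: every cell contains a ball whose radius `r`
satisfies `diam ≤ σ r`. -/
def Mesh.IsShapeRegular (T : Mesh Ω) (σ : ℝ) : Prop :=
  ∀ s ∈ T.cells, ∃ (c : Eu d) (r : ℝ), 0 < r ∧
    Metric.closedBall c r ⊆ convexHull ℝ (s : Set (Eu d)) ∧
    Metric.diam (convexHull ℝ (s : Set (Eu d))) ≤ σ * r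

/-- The broken seminorm `|φ|_{H^m(T)}` (`∞` if `φ` is not in the broken space `H^m(T)`). -/
def Mesh.brokenSeminorm (T : Mesh Ω) (m : ℕ) (φ : L2 Ω) : ℝ≥0∞ :=
  (∑ s ∈ T.cells, sobolevSeminormSq (interior (convexHull ℝ (s : Set (Eu d)))) m φ) ^ (1 / 2 : ℝ)

/-- The `H¹₀`-conforming Lagrange finite element space of degree `k`: continuous functions on
the closure of `Ω`, zero on the boundary, polynomial of degree at most `k` on every cell. -/
def Mesh.feSpace (T : Mesh Ω) (k : ℕ) : Submodule ℝ (H10 Ω) where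
  carrier := {v | ∃ g : Eu d → ℝ, ContinuousOn g (closure Ω) ∧ (∀ x ∈ frontier Ω, g x = 0) ∧
    (∀ s ∈ T.cells, ∃ p : MvPolynomial (Fin d) ℝ, p.totalDegree ≤ k ∧
      ∀ x ∈ convexHull ℝ (s : Set (Eu d)), g x = MvPolynomial.eval (fun i => x i) p) ∧
    fn v =ᵐ[volume.restrict Ω] g}
  zero_mem' := ⟨0, continuousOn_const, fun _ _ => rfl,
    fun _ _ => ⟨0, by simp, fun _ _ => by simp⟩, Lp.coeFn_zero ℝ 2 _⟩
  add_mem' := by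
    rintro v w ⟨g, hg, hg0, hgp, hvg⟩ ⟨g', hg', hg0', hgp', hvg'⟩
    refine ⟨g + g', hg.add hg', fun x hx => by simp [hg0 x hx, hg0' x hx], fun s hs => ?_, ?_⟩
    · obtain ⟨p, hp, hpe⟩ := hgp s hs
      obtain ⟨p', hp', hpe'⟩ := hgp' s hs
      exact ⟨p + p', (MvPolynomial.totalDegree_add p p').trans (max_le hp hp'),
        fun x hx => by simp [hpe x hx, hpe' x hx]⟩
    · exact (Lp.coeFn_add (fn v) (fn w)).trans (hvg.add hvg')
  smul_mem' := by
    rintro c v ⟨g, hg, hg0, hgp, hvg⟩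
    refine ⟨c • g, hg.const_smul c, fun x hx => by simp [hg0 x hx], fun s hs => ?_, ?_⟩
    · obtain ⟨p, hp, hpe⟩ := hgp s hs
      exact ⟨c • p, (MvPolynomial.totalDegree_smul_le c p).trans hp,
        fun x hx => by simp [hpe x hx, MvPolynomial.smul_eval]⟩
    · exact (Lp.coeFn_smul c (fn v)).trans (hvg.const_smul c)

/-- The bilinear form `m(v, w) = (v, w) - τ² (∇v, ∇w)`. -/
def mForm (τ : ℝ) (v w : H10 Ω) : ℝ := inner ℝ (fn v) (fn w) - τ ^ 2 * inner ℝ (grad v) (grad w)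

/-- The stability property expressed by the CFL condition:
`μ₀ ‖v‖² ≤ m(v, v) ≤ ‖v‖²` on the finite element space. -/
def Mesh.IsStableStep (T : Mesh Ω) (k : ℕ) (μ₀ τ : ℝ) : Prop :=
  ∀ v ∈ T.feSpace k, μ₀ * inner ℝ (fn v) (fn v) ≤ mForm τ v v ∧ mForm τ v v ≤ inner ℝ (fn v) (fn v)

/-! ### Functions of time -/

/-- `g` is the weak time derivative of the (absolutely continuous) function `v` on `[0, ∞)`. -/
def HasTimeDeriv {Y : Type*} [NormedAddCommGroup Y] [NormedSpace ℝ Y] (v g : ℝ → Y) : Prop :=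
  ∀ t, 0 ≤ t → IntervalIntegrable g volume 0 t ∧ v t = v 0 + ∫ s in (0 : ℝ)..t, g s

/-- `(∫₀^∞ N(t)² e^{-2ρt} dt)^{1/2}`, the damped norm of a time-dependent (semi)norm `N`. -/
def dampedNorm (ρ : ℝ) (N : ℝ → ℝ≥0∞) : ℝ≥0∞ :=
  (∫⁻ t in Ioi (0 : ℝ), N t ^ 2 * ENNReal.ofReal (Real.exp (-2 * ρ * t))) ^ (1 / 2 : ℝ)

open Classical in
/-- The squared damped energy norm
`∫₀^∞ (‖∂ₜφ‖² + ‖∇φ‖²) e^{-2ρt} dt`. The time derivative is taken in `L²(Ω)`; the norm is `∞`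
if it fails to exist on a set of times that is not negligible. -/
def dampedEnergySq (ρ : ℝ) (φ : ℝ → H10 Ω) : ℝ≥0∞ :=
  ∫⁻ t in Ioi (0 : ℝ),
    ((if DifferentiableAt ℝ (fun s => fn (φ s)) t then ‖deriv (fun s => fn (φ s)) t‖ₑ ^ 2 else ⊤)
      + ‖grad (φ t)‖ₑ ^ 2) * ENNReal.ofReal (Real.exp (-2 * ρ * t))

/-- Admissible sources: `f ∈ H¹(J; L²(Ω)) ∩ L^∞(J; L²(Ω))` (with its continuous representative),
supported away from zero. -/
structure IsSource (f : ℝ → L2 Ω) : Prop where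
  sq_integrable : ∫⁻ t in Ioi (0 : ℝ), ‖f t‖ₑ ^ 2 < ⊤
  deriv : ∃ f' : ℝ → L2 Ω, HasTimeDeriv f f' ∧ ∫⁻ t in Ioi (0 : ℝ), ‖f' t‖ₑ ^ 2 < ⊤
  bounded : ∃ M : ℝ, ∀ t, 0 ≤ t → ‖f t‖ ≤ M
  away_from_zero : ∃ δ > 0, ∀ t, 0 ≤ t → t ≤ δ → f t = 0

/-- `u ∈ C²(J; L²(Ω)) ∩ C⁰(J; H¹₀(Ω))` is the strong solution of `ü - Δu = f` with zero initial
and boundary conditions. -/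
structure IsStrongSolution (f : ℝ → L2 Ω) (u : ℝ → H10 Ω) : Prop where
  contDiffOn : ContDiffOn ℝ 2 (fun t => fn (u t)) (Ici 0)
  continuousOn : ContinuousOn u (Ici 0)
  init : fn (u 0) = 0
  init_deriv : derivWithin (fun t => fn (u t)) (Ici 0) 0 = 0
  eqn : ∀ t, 0 ≤ t → ∀ v : H10 Ω,
    inner ℝ (iteratedDerivWithin 2 (fun t => fn (u t)) (Ici 0) t) (fn v)
      + inner ℝ (grad (u t)) (grad v) = inner ℝ (f t) (fn v)

/-- `D 0, D 1, …, D m` are `v` and its successive weak time derivatives on `[0, ∞)`. -/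
def IsTimeDerivs {Y : Type*} [NormedAddCommGroup Y] [NormedSpace ℝ Y]
    (m : ℕ) (v : ℝ → Y) (D : ℕ → ℝ → Y) : Prop :=
  D 0 = v ∧ ∀ r < m, HasTimeDeriv (D r) (D (r + 1))

/-! ### The leapfrog scheme and the time reconstructions -/

/-- The leapfrog scheme with zero initial conditions. -/
structure IsLeapfrog (T : Mesh Ω) (k : ℕ) (τ : ℝ) (f : ℝ → L2 Ω) (U : ℕ → H10 Ω) : Prop where
  mem : ∀ n, U n ∈ T.feSpace k
  zero : U 0 = 0
  one : U 1 = 0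
  step : ∀ n, 1 ≤ n → ∀ v ∈ T.feSpace k,
    1 / τ ^ 2 * inner ℝ (fn (U (n + 1) - (2 : ℝ) • U n + U (n - 1))) (fn v)
      + inner ℝ (grad (U n)) (grad v) = inner ℝ (f (n * τ)) (fn v)

section Reconstruction

variable {Y : Type*} [AddCommGroup Y] [Module ℝ Y]

/-- Extension of a sequence by zero to negative indices. -/
def extendZero (V : ℕ → Y) (n : ℤ) : Y := if 0 ≤ n then V n.toNat else 0

/-- The piecewise quadratic, globally continuous, time reconstruction `R`. -/
def recR (τ : ℝ) (V : ℕ → Y) (t : ℝ) : Y :=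
  let n : ℤ := ⌊t / τ⌋
  let s : ℝ := t - n * τ
  let W := extendZero V
  W n + (s / (2 * τ)) • (W (n + 1) - W (n - 1))
    + (s ^ 2 / (2 * τ ^ 2)) • (W (n + 1) - (2 : ℝ) • W n + W (n - 1))

/-- The piecewise quartic, globally twice continuously differentiable, time reconstruction `L`. -/
def recL (τ : ℝ) (V : ℕ → Y) (t : ℝ) : Y :=
  let n : ℤ := ⌊t / τ⌋
  let s : ℝ := t - n * τ
  let W := extendZero V
  let α : Y := (1 / 24 : ℝ) •
    ((3 : ℝ) • W (n + 1) + (17 : ℝ) • W n + (5 : ℝ) • W (n - 1) - W (n - 2))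
  let β : Y := (1 / (12 * τ)) •
    ((5 : ℝ) • W (n + 1) + (3 : ℝ) • W n - (9 : ℝ) • W (n - 1) + W (n - 2))
  let γ : Y := (1 / τ ^ 2) • (W (n + 1) - (2 : ℝ) • W n + W (n - 1))
  let ϑ : Y := (1 / (2 * τ ^ 3)) •
    (W (n + 2) - (2 : ℝ) • W (n + 1) + (2 : ℝ) • W (n - 1) - W (n - 2))
  let ε : Y := (1 / τ ^ 4) • (W (n + 2) - (4 : ℝ) • W (n + 1) + (6 : ℝ) • W n
    - (4 : ℝ) • W (n - 1) + W (n - 2))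
  α + s • β + (s ^ 2 / 2) • γ + (s ^ 3 / 6) • ϑ + (s ^ 4 / 24) • ε

end Reconstruction

/-! ### The constants in the error estimates -/

/-- The length/time scale `κ = max(diam Ω, 1/ρ)`. -/
def kappa (Ω : Set (Eu d)) (ρ : ℝ) : ℝ := max (Metric.diam Ω) ρ⁻¹

/-- `C_tim(u) = ∑_{r = 3, 4} κ^{r-2} (∫ ‖∇u^{(r)}‖² e^{-2ρt} dt)^{1/2}`,
where `D r` is the `r`-th time derivative of `u`. -/
def Ctim (ρ : ℝ) (D : ℕ → ℝ → H10 Ω) : ℝ≥0∞ :=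
  ∑ r ∈ Finset.Icc 3 4, ENNReal.ofReal (kappa Ω ρ ^ (r - 2)) *
    dampedNorm ρ (fun t => ‖grad (D r t)‖ₑ)

/-- `C_spa(u) = ∑_{r = 0, …, 3} κ^r (∫ |u^{(r)}|²_{H^{k+1}(T)} e^{-2ρt} dt)^{1/2}`. -/
def Cspa (T : Mesh Ω) (k : ℕ) (ρ : ℝ) (D : ℕ → ℝ → H10 Ω) : ℝ≥0∞ :=
  ∑ r ∈ Finset.Icc 0 3, ENNReal.ofReal (kappa Ω ρ ^ r) *
    dampedNorm ρ (fun t => T.brokenSeminorm (k + 1) (fn (D r t)))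

/-- `C_tim(f) = ∑_{r = 2, 3} κ^{r-2} (∫ ‖f^{(r)}‖² e^{-2ρt} dt)^{1/2}`. -/
def CtimSource (ρ : ℝ) (F : ℕ → ℝ → L2 Ω) : ℝ≥0∞ :=
  ∑ r ∈ Finset.Icc 2 3, ENNReal.ofReal (kappa Ω ρ ^ (r - 2)) *
    dampedNorm ρ (fun t => ‖F r t‖ₑ)

end WaveFEM

end

open MeasureTheory Set
open scoped ENNReal ContDiff

noncomputable section

namespace WaveFEM

variable {d : ℕ}

section

/-! ### Integrals along lines -/

/-! Stability is an inverse estimate. On a simplex, a polynomial of degree at most k is a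
homogeneous polynomial of degree k in the barycentric coordinates. Finite dimension and affine
invariance bound its coefficients by its mean square (`exists_coeff_bound`), and the coordinates
have slope at most 1/r if the simplex contains a ball of radius r. Hence ‖∇v‖ ≤ C r⁻¹ ‖v‖ on each
cell (`exists_inverse_estimate`), which turns τ ≤ c h_min into (S) (`stable_of_cfl`).

For the error, let P be the Ritz projection onto V_h and eⁿ = Uⁿ − P u(tⁿ). Then e solves the
leapfrog scheme whose source is the consistency error gⁿ = ü(tⁿ) − τ⁻² P(u(tⁿ⁺¹) − 2u(tⁿ) +
u(tⁿ⁻¹)). Testing with eⁿ⁺¹ − eⁿ⁻¹ makes the discrete energy ‖(eⁿ⁺¹ − eⁿ)/τ‖² + (∇eⁿ⁺¹, ∇eⁿ)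
telescope, and (S) makes this energy positive (`energy_lower`), so e is controlled by Σ τ‖gˡ‖
(`leapfrog_stable`). The consistency error splits into the Taylor remainder of the second difference
of u and the second difference of u − Pu. Poincaré–Friedrichs trades their L² norms for κ times
gradient norms, so no duality argument is needed. The sum over the steps is the integral of a step
function, and a damped Hardy inequality (`lintegral_primitive_sq_le`) bounds its damped norm at the
price of a factor ρ⁻¹ ≤ κ. As f vanishes near 0, so do at 0 the derivatives of u up to order three
(`derivs_zero`). Everything may therefore be extended by zero to negative times.

Both reconstructions have the form Σⱼ cⱼ(θ) Uⁿ⁺ʲ over five points with |j| ≤ 2. Second order in time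
only requires that the cⱼ reproduce affine functions and that the cⱼ' differentiate quadratics
exactly (`IsReconstruction`). So one estimate, `IsDiscretization.energy_error_le`, serves parts 2
and 3.

What remains is the best approximation in V_h of a v in H¹₀ that is only piecewise H^{k+1}
(`exists_approx`). On each cell K, Bramble–Hilbert provides a polynomial p_K, with coefficients in
the barycentric monomials indexed by exponents α on the vertices. A single coefficient is chosen for
each α: the one of a smallest cell around the face spanned by supp α, or zero if this face is not
interior. For two cells with a common facet, the coefficients attached to that facet differ by at
most the traces of v − p_K and v − p_K', because v has one trace; on a boundary facet this trace is
zero. These differences are added up along chains of cells around the face. Such chains exist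
because the cells around an interior face are connected through facets, and in the boundary case
each cell is connected to one with a boundary facet (`Mesh.reachable_of_interior`,
`Mesh.exists_boundary_facet`). Shape regularity bounds their length (`Mesh.card_star_le`). The
resulting piecewise polynomial is Lipschitz and vanishes outside Ω, hence lies in H¹₀
(`exists_H10_of_lipschitz`). -/

theorem sq_lintegral_le {α : Type*} [MeasurableSpace α] {μ : Measure α} {f : α → ℝ≥0∞}
    (hf : AEMeasurable f μ) : (∫⁻ x, f x ∂μ) ^ 2 ≤ μ univ * ∫⁻ x, f x ^ 2 ∂μ := by
  have h := ENNReal.lintegral_mul_le_Lp_mul_Lq μ (p := 2) (q := 2)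
    (Real.holderConjugate_iff.mpr ⟨by norm_num, by norm_num⟩)
    (f := fun _ => 1) (g := f) aemeasurable_const hf
  simp only [Pi.mul_apply, one_mul, lintegral_const, ENNReal.rpow_two,
    one_pow] at h
  calc (∫⁻ x, f x ∂μ) ^ 2 ≤ (μ univ ^ (1 / (2 : ℝ)) * (∫⁻ x, f x ^ 2 ∂μ) ^ (1 / (2 : ℝ))) ^ 2 := by
        gcongr
    _ = μ univ * ∫⁻ x, f x ^ 2 ∂μ := by
        rw [mul_pow, ← ENNReal.rpow_two, ← ENNReal.rpow_two, ← ENNReal.rpow_mul, ← ENNReal.rpow_mul]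
        norm_num

theorem lintegral_lintegral_shift {G : Eu d → ℝ≥0∞} (hG : Measurable G) (e : Eu d) (D : ℝ) :
    ∫⁻ x, ∫⁻ t in Ioc 0 D, G (x + t • e) = ENNReal.ofReal D * ∫⁻ x, G x := by
  rw [lintegral_lintegral_swap]
  · simp_rw [lintegral_add_right_eq_self]
    rw [setLIntegral_const, mul_comm]; simp
  · exact (hG.comp (by fun_prop)).aemeasurable

/-- Fundamental theorem of calculus and Cauchy–Schwarz. This one-dimensional inequality is behind
Poincaré–Friedrichs, the Poincaré inequality on convex sets and the trace inequality on simplices.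
-/
theorem enorm_sub_sq_le_line {g : Eu d → ℝ} (hg : ContDiff ℝ 1 g) (x e : Eu d) {D : ℝ}
    (hD : 0 ≤ D) : ‖g (x + D • e) - g x‖ₑ ^ 2 ≤
      ENNReal.ofReal D * ∫⁻ t in Ioc 0 D, ‖fderiv ℝ g (x + t • e) e‖ₑ ^ 2 := by
  have hc : Continuous fun t : ℝ => fderiv ℝ g (x + t • e) e :=
    ((hg.continuous_fderiv one_ne_zero).comp (by fun_prop)).clm_apply continuous_const
  have h1 : ∫ t in (0 : ℝ)..D, fderiv ℝ g (x + t • e) e = g (x + D • e) - g x := by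
    rw [intervalIntegral.integral_eq_sub_of_hasDerivAt (f := fun t : ℝ => g (x + t • e))]
    · simp
    · intro t _
      have h2 : HasDerivAt (fun t : ℝ => x + t • e) e t := by
        simpa using ((hasDerivAt_id t).smul_const e).const_add x
      exact ((hg.differentiable one_ne_zero) _).hasFDerivAt.comp_hasDerivAt t h2
    · exact hc.intervalIntegrable _ _
  rw [← h1, intervalIntegral.integral_of_le hD]
  calc _ ≤ (∫⁻ t in Ioc 0 D, ‖fderiv ℝ g (x + t • e) e‖ₑ) ^ 2 := by
        gcongr; exact enorm_integral_le_lintegral_enorm _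
    _ ≤ _ := by
        refine (sq_lintegral_le (hc.enorm.measurable.aemeasurable)).trans ?_
        simp

/-! ### Test functions -/

namespace IsTestFunction

variable {O : Set (Eu d)} {φ ψ : Eu d → ℝ}

theorem continuous (h : IsTestFunction O φ) : Continuous φ := h.1.continuous

theorem contDiff_one (h : IsTestFunction O φ) : ContDiff ℝ 1 φ := h.1.of_le (by simp)

theorem differentiable (h : IsTestFunction O φ) : Differentiable ℝ φ :=
  h.1.differentiable (by simp)

theorem mono {O' : Set (Eu d)} (h : IsTestFunction O φ) (hO : O ⊆ O') : IsTestFunction O' φ :=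
  ⟨h.1, h.2.1, h.2.2.trans hO⟩

theorem add (h : IsTestFunction O φ) (h' : IsTestFunction O ψ) : IsTestFunction O (φ + ψ) :=
  ⟨h.1.add h'.1, h.2.1.add h'.2.1, (tsupport_add φ ψ).trans (union_subset h.2.2 h'.2.2)⟩

theorem smul (c : ℝ) (h : IsTestFunction O φ) : IsTestFunction O (c • φ) :=
  ⟨h.1.const_smul c, h.2.1.smul_left (f := fun _ => c),
    (tsupport_smul_subset_right (fun _ => c) φ).trans h.2.2⟩

theorem zero : IsTestFunction O (0 : Eu d → ℝ) :=
  ⟨contDiff_const, HasCompactSupport.zero, by simp [tsupport]⟩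

theorem eq_zero_of_notMem (h : IsTestFunction O φ) {x : Eu d} (hx : x ∉ O) : φ x = 0 :=
  image_eq_zero_of_notMem_tsupport fun h' => hx (h.2.2 h')

theorem continuous_gradient (h : IsTestFunction O φ) : Continuous fun x => gradient φ x :=
  (LinearIsometryEquiv.continuous _).comp (h.1.continuous_fderiv (by simp))

theorem hasCompactSupport_gradient (h : IsTestFunction O φ) :
    HasCompactSupport fun x => gradient φ x :=
  (h.2.1.fderiv (𝕜 := ℝ)).comp_left (g := (InnerProductSpace.toDual ℝ (Eu d)).symm) (map_zero _)

theorem fderiv_apply (h : IsTestFunction O φ) (e : Eu d) :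
    IsTestFunction O (fun x => fderiv ℝ φ x e) :=
  ⟨(h.1.fderiv_right (m := ∞) (by simp)).clm_apply contDiff_const, h.2.1.fderiv_apply (𝕜 := ℝ) e,
    (tsupport_fderiv_apply_subset ℝ e).trans h.2.2⟩

theorem memLp (h : IsTestFunction O φ) (μ : Measure (Eu d)) [IsFiniteMeasureOnCompacts μ]
    (p : ℝ≥0∞) : MemLp φ p μ :=
  h.continuous.memLp_of_hasCompactSupport h.2.1

theorem memLp_gradient (h : IsTestFunction O φ) (μ : Measure (Eu d)) [IsFiniteMeasureOnCompacts μ]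
    (p : ℝ≥0∞) : MemLp (fun x => gradient φ x) p μ :=
  h.continuous_gradient.memLp_of_hasCompactSupport h.hasCompactSupport_gradient

end IsTestFunction

theorem inner_gradient (φ : Eu d → ℝ) (x e : Eu d) : inner ℝ (gradient φ x) e = fderiv ℝ φ x e := by
  simp [gradient]

theorem gradient_apply (φ : Eu d → ℝ) (x : Eu d) (i : Fin d) :
    gradient φ x i = fderiv ℝ φ x (EuclideanSpace.single i 1) := by
  rw [← inner_gradient, EuclideanSpace.inner_single_right]; simp

theorem norm_gradient (φ : Eu d → ℝ) (x : Eu d) : ‖gradient φ x‖ = ‖fderiv ℝ φ x‖ := by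
  simp [gradient]

/-! ### The space `H¹₀` -/

variable {Ω : Set (Eu d)}

/-- `v ↦ fn v` as a continuous linear map. -/
def fnL (Ω : Set (Eu d)) : H10 Ω →L[ℝ] L2 Ω :=
  (WithLp.fstL 2 ℝ (L2 Ω) (L2vec Ω)).comp (Submodule.subtypeL _)

/-- `v ↦ grad v` as a continuous linear map. -/
def gradL (Ω : Set (Eu d)) : H10 Ω →L[ℝ] L2vec Ω :=
  (WithLp.sndL 2 ℝ (L2 Ω) (L2vec Ω)).comp (Submodule.subtypeL _)

@[simp] theorem fnL_apply (v : H10 Ω) : fnL Ω v = fn v := rfl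
@[simp] theorem gradL_apply (v : H10 Ω) : gradL Ω v = grad v := rfl

theorem norm_sq_eq (v : H10 Ω) : ‖v‖ ^ 2 = ‖fn v‖ ^ 2 + ‖grad v‖ ^ 2 :=
  WithLp.prod_norm_sq_eq_of_L2 _

theorem H10.ext {v w : H10 Ω} (h1 : fn v = fn w) (h2 : grad v = grad w) : v = w := by
  apply Subtype.ext
  exact (WithLp.ofLp_injective 2) (Prod.ext h1 h2)

instance : CompleteSpace (H10 Ω) :=
  (Submodule.isClosed_topologicalClosure _).completeSpace_coe

theorem exists_H10_of_test {φ : Eu d → ℝ} (h : IsTestFunction Ω φ) : ∃ v : H10 Ω,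
    fn v =ᵐ[volume.restrict Ω] φ ∧ grad v =ᵐ[volume.restrict Ω] fun x => gradient φ x := by
  have h1 := h.memLp (volume.restrict Ω) 2
  have h2 := h.memLp_gradient (volume.restrict Ω) 2
  refine ⟨⟨WithLp.toLp 2 (h1.toLp, h2.toLp), ?_⟩, h1.coeFn_toLp, h2.coeFn_toLp⟩
  exact subset_closure (Submodule.subset_span ⟨φ, h, h1.coeFn_toLp, h2.coeFn_toLp⟩)

theorem gradient_add_of {φ ψ : Eu d → ℝ} (h : Differentiable ℝ φ) (h' : Differentiable ℝ ψ)
    (x : Eu d) : gradient (φ + ψ) x = gradient φ x + gradient ψ x := by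
  simp [gradient, fderiv_add (h x) (h' x)]

theorem gradient_smul_of {φ : Eu d → ℝ} (h : Differentiable ℝ φ) (c : ℝ)
    (x : Eu d) : gradient (c • φ) x = c • gradient φ x := by
  simp [gradient, fderiv_const_smul (h x)]

/-- Test functions already form a vector space on which the gradient is linear. So H¹₀ is the
closure of the graph itself, and approximants can be taken to be single test functions. -/
theorem span_testGraph : ((Submodule.span ℝ (testGraph Ω) :
    Submodule ℝ (WithLp 2 (L2 Ω × L2vec Ω))) : Set (WithLp 2 (L2 Ω × L2vec Ω))) = testGraph Ω := by
  refine subset_antisymm (fun p hp => ?_) Submodule.subset_span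
  induction hp using Submodule.span_induction with
  | mem x h => exact h
  | zero =>
    refine ⟨0, IsTestFunction.zero, Lp.coeFn_zero _ _ _, ?_⟩
    have : (fun x : Eu d => gradient (0 : Eu d → ℝ) x) = 0 := by ext x; simp [gradient]
    rw [this]; exact Lp.coeFn_zero _ _ _
  | add x y _ _ hx hy =>
    obtain ⟨φ, h, h1, h2⟩ := hx
    obtain ⟨ψ, h', h1', h2'⟩ := hy
    refine ⟨φ + ψ, h.add h', (Lp.coeFn_add _ _).trans (h1.add h1'),
      (Lp.coeFn_add _ _).trans ((h2.add h2').trans ?_)⟩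
    filter_upwards with x
    simp [gradient_add_of h.differentiable h'.differentiable]
  | smul c x _ hx =>
    obtain ⟨φ, h, h1, h2⟩ := hx
    refine ⟨c • φ, h.smul c, (Lp.coeFn_smul _ _).trans (h1.const_smul c),
      (Lp.coeFn_smul _ _).trans ((h2.const_smul c).trans ?_)⟩
    filter_upwards with x
    simp [gradient_smul_of h.differentiable]

/-- Density of the test functions: a closed property only has to be checked on them. -/
theorem H10.induction {p : H10 Ω → Prop} (hp : IsClosed {v | p v})
    (h : ∀ v φ, IsTestFunction Ω φ → fn v =ᵐ[volume.restrict Ω] φ →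
      (grad v =ᵐ[volume.restrict Ω] fun x => gradient φ x) → p v) (v : H10 Ω) : p v := by
  have hd : Dense {v : H10 Ω | (v : WithLp 2 (L2 Ω × L2vec Ω)) ∈ testGraph Ω} := by
    intro w
    have hw : (w : WithLp 2 (L2 Ω × L2vec Ω)) ∈ closure (testGraph Ω) := by
      have := w.2
      rw [← SetLike.mem_coe, Submodule.topologicalClosure_coe, span_testGraph] at this
      exact this
    rw [Metric.mem_closure_iff] at hw ⊢
    intro ε hε
    obtain ⟨b, hb, hb'⟩ := hw ε hε
    exact ⟨⟨b, subset_closure (Submodule.subset_span hb)⟩, hb, hb'⟩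
  have hsub : {v : H10 Ω | (v : WithLp 2 (L2 Ω × L2vec Ω)) ∈ testGraph Ω} ⊆ {v | p v} := by
    rintro v ⟨φ, h1, h2, h3⟩
    exact h v φ h1 h2 h3
  exact (hp.closure_subset_iff.mpr hsub) (hd v)

theorem L2_inner_eq {μ : Measure (Eu d)} (f : Lp ℝ 2 μ) {g : Eu d → ℝ} (hg : MemLp g 2 μ) :
    inner ℝ hg.toLp f = ∫ x, f x * g x ∂μ := by
  rw [L2.inner_def]
  refine integral_congr_ae ?_
  filter_upwards [hg.coeFn_toLp] with x hx
  simp [hx]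

theorem L2_inner_eq_vec {μ : Measure (Eu d)} (f : Lp (Eu d) 2 μ) {g : Eu d → Eu d}
    (hg : MemLp g 2 μ) : inner ℝ hg.toLp f = ∫ x, inner ℝ (g x) (f x) ∂μ := by
  rw [L2.inner_def]
  refine integral_congr_ae ?_
  filter_upwards [hg.coeFn_toLp] with x hx
  simp [hx]

/-- Here ψ need not vanish on the boundary of Ω. There is no boundary term because v is a limit of
functions supported inside Ω, for which this is integration by parts on the whole space. -/
theorem integral_fn_mul_fderiv (v : H10 Ω) {ψ : Eu d → ℝ} (hψ : IsTestFunction univ ψ) (e : Eu d) :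
    ∫ x in Ω, fn v x * fderiv ℝ ψ x e = - ∫ x in Ω, inner ℝ (ψ x • e) (grad v x) := by
  have hψe := (hψ.fderiv_apply e).memLp (volume.restrict Ω) 2
  have hψ2 : MemLp (fun x => ψ x • e) 2 (volume.restrict Ω) :=
    (hψ.continuous.smul continuous_const).memLp_of_hasCompactSupport (hψ.2.1.smul_right)
  revert v
  apply H10.induction
  · refine isClosed_eq ?_ ?_
    · simp_rw [← L2_inner_eq _ hψe]
      exact continuous_const.inner (fnL Ω).continuous
    · simp_rw [← L2_inner_eq_vec _ hψ2]
      exact (continuous_const.inner (gradL Ω).continuous).neg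
  · intro v φ hφ h1 h2
    have e1 : ∫ x in Ω, fn v x * fderiv ℝ ψ x e = ∫ x, φ x * fderiv ℝ ψ x e := by
      rw [integral_congr_ae (g := fun x => φ x * fderiv ℝ ψ x e)
        (by filter_upwards [h1] with x hx; rw [hx])]
      refine setIntegral_eq_integral_of_forall_compl_eq_zero fun x hx => ?_
      rw [hφ.eq_zero_of_notMem hx, zero_mul]
    have e2 : ∫ x in Ω, inner ℝ (ψ x • e) (grad v x) = ∫ x, fderiv ℝ φ x e * ψ x := by
      rw [integral_congr_ae (g := fun x => fderiv ℝ φ x e * ψ x)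
        (by filter_upwards [h2] with x hx; rw [hx, real_inner_smul_left, real_inner_comm,
          inner_gradient, mul_comm])]
      refine setIntegral_eq_integral_of_forall_compl_eq_zero fun x hx => ?_
      rw [(hφ.fderiv_apply e).eq_zero_of_notMem hx, zero_mul]
    rw [e1, e2]
    apply integral_mul_fderiv_eq_neg_fderiv_mul_of_integrable
    · exact ((hφ.fderiv_apply e).continuous.mul hψ.continuous).integrable_of_hasCompactSupport
        hψ.2.1.mul_left
    · exact (hφ.continuous.mul (hψ.fderiv_apply e).continuous).integrable_of_hasCompactSupport
        hφ.2.1.mul_right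
    · exact (hφ.continuous.mul hψ.continuous).integrable_of_hasCompactSupport hφ.2.1.mul_right
    · exact fun x _ => hφ.differentiable x
    · exact fun x _ => hψ.differentiable x

theorem locallyIntegrableOn_of_L2 {E : Type*} [NormedAddCommGroup E] {O : Set (Eu d)}
    (hO : IsOpen O) (f : Lp E 2 (volume.restrict O)) : LocallyIntegrableOn f O volume := by
  rw [locallyIntegrableOn_iff hO.isLocallyClosed]
  intro K hK hKc
  have : IsFiniteMeasure ((volume : Measure (Eu d)).restrict K) := ⟨by simpa using hKc.measure_lt_top⟩
  have h1 : MemLp f 2 (volume.restrict K) :=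
    (Lp.memLp f).mono_measure (Measure.restrict_mono hK le_rfl)
  exact (h1.mono_exponent (p := 1) (by norm_num)).integrable le_rfl

/-- On an open set where the function is `C¹`, the weak gradient is the classical one. -/
theorem grad_ae_eq_gradient (hΩ : IsOpen Ω) {O : Set (Eu d)} (hO : IsOpen O) (hOΩ : O ⊆ Ω)
    {p : Eu d → ℝ} (hp : ContDiff ℝ 1 p) (v : H10 Ω) (hv : fn v =ᵐ[volume.restrict O] p) :
    grad v =ᵐ[volume.restrict O] fun x => gradient p x := by
  have hcg : Continuous fun x => gradient p x :=
    (LinearIsometryEquiv.continuous _).comp (hp.continuous_fderiv one_ne_zero)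
  have key : ∀ i : Fin d, ∀ᵐ x, x ∈ O → (grad v x - gradient p x) i = 0 := by
    intro i
    have hli : LocallyIntegrableOn (fun x => grad v x - gradient p x) O volume :=
      ((locallyIntegrableOn_of_L2 hΩ (grad v)).mono_set hOΩ).sub
        (hcg.locallyIntegrable.locallyIntegrableOn O)
    have hproj : LocallyIntegrableOn (fun x => (grad v x - gradient p x) i) O volume := by
      intro x hx
      obtain ⟨s, hs, hsi⟩ := hli x hx
      exact ⟨s, hs, (EuclideanSpace.proj (𝕜 := ℝ) i).integrable_comp hsi⟩
    refine hO.ae_eq_zero_of_integral_contDiff_smul_eq_zero hproj fun ψ h1 h2 h3 => ?_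
    have hψ : IsTestFunction O ψ := ⟨h1, h2, h3⟩
    have hparts := integral_fn_mul_fderiv v (hψ.mono (subset_univ O)) (EuclideanSpace.single i 1)
    have e1 : ∫ x in Ω, fn v x * fderiv ℝ ψ x (EuclideanSpace.single i 1)
        = ∫ x, p x * fderiv ℝ ψ x (EuclideanSpace.single i 1) := by
      rw [setIntegral_eq_of_subset_of_forall_sdiff_eq_zero hΩ.measurableSet hOΩ]
      · rw [integral_congr_ae (g := fun x => p x * fderiv ℝ ψ x (EuclideanSpace.single i 1))
          (by filter_upwards [hv] with x hx; rw [hx])]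
        refine setIntegral_eq_integral_of_forall_compl_eq_zero fun x hx => ?_
        rw [(hψ.fderiv_apply _).eq_zero_of_notMem hx, mul_zero]
      · intro x hx
        rw [(hψ.fderiv_apply _).eq_zero_of_notMem hx.2, mul_zero]
    have e2 : ∫ x in Ω, inner ℝ (ψ x • (EuclideanSpace.single i 1 : Eu d)) (grad v x)
        = ∫ x, ψ x • grad v x i := by
      rw [setIntegral_eq_integral_of_forall_compl_eq_zero]
      · simp [real_inner_smul_left, EuclideanSpace.inner_single_left]
      · intro x hx
        rw [hψ.eq_zero_of_notMem fun h => hx (hOΩ h)]; simp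
    have e3 : ∫ x, p x * fderiv ℝ ψ x (EuclideanSpace.single i 1)
        = - ∫ x, ψ x • gradient p x i := by
      rw [integral_mul_fderiv_eq_neg_fderiv_mul_of_integrable]
      · simp [gradient_apply, mul_comm]
      · exact (((hp.continuous_fderiv one_ne_zero).clm_apply continuous_const).mul
          hψ.continuous).integrable_of_hasCompactSupport hψ.2.1.mul_left
      · exact (hp.continuous.mul (hψ.fderiv_apply _).continuous).integrable_of_hasCompactSupport
          (hψ.fderiv_apply _).2.1.mul_left
      · exact (hp.continuous.mul hψ.continuous).integrable_of_hasCompactSupport hψ.2.1.mul_left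
      · exact fun x _ => hp.differentiable one_ne_zero x
      · exact fun x _ => hψ.differentiable x
    have e4 : ∫ x, ψ x • grad v x i = ∫ x, ψ x • gradient p x i := by
      rw [e1, e2, e3] at hparts; linarith
    have hint : ∀ {q : Eu d → ℝ}, LocallyIntegrableOn q O volume →
        Integrable (fun x => ψ x • q x) := by
      intro q hq
      refine (integrableOn_iff_integrable_of_support_subset (s := tsupport ψ)
        ((Function.support_smul_subset_left ψ q).trans (subset_tsupport ψ))).1 ?_
      exact (hq.integrableOn_compact_subset h3 h2).continuousOn_smul hψ.continuous.continuousOn h2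
    have hg1 : LocallyIntegrableOn (fun x => grad v x i) O volume := by
      intro x hx
      obtain ⟨s, hs, hsi⟩ := (locallyIntegrableOn_of_L2 hΩ (grad v)).mono_set hOΩ x hx
      exact ⟨s, hs, (EuclideanSpace.proj (𝕜 := ℝ) i).integrable_comp hsi⟩
    have hg2 : LocallyIntegrableOn (fun x => gradient p x i) O volume :=
      (Continuous.locallyIntegrable (by fun_prop)).locallyIntegrableOn O
    simp_rw [PiLp.sub_apply, smul_sub]
    rw [integral_sub (hint hg1) (hint hg2), e4, sub_self]
  have := ae_all_iff.mpr key
  rw [Filter.EventuallyEq, ae_restrict_iff' hO.measurableSet]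
  filter_upwards [this] with x hx hxO
  ext i
  have := hx i hxO
  simpa [sub_eq_zero] using this

/-- The weak gradient is determined by the function, so recording pairs adds no information. -/
theorem fn_injective (hΩ : IsOpen Ω) {v : H10 Ω} (h : fn v = 0) : v = 0 := by
  refine H10.ext h ?_
  have h1 := grad_ae_eq_gradient hΩ hΩ subset_rfl (p := fun _ => 0) contDiff_const v
    (by rw [h]; exact Lp.coeFn_zero _ _ _)
  refine Lp.ext (h1.trans ?_)
  refine Filter.EventuallyEq.trans ?_ (Lp.coeFn_zero _ _ _).symm
  filter_upwards with x
  simp [gradient]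

theorem enorm_sq_eq_lintegral {α F : Type*} [MeasurableSpace α] {μ : Measure α}
    [NormedAddCommGroup F] (f : Lp F 2 μ) : ‖f‖ₑ ^ 2 = ∫⁻ x, ‖f x‖ₑ ^ 2 ∂μ := by
  rw [Lp.enorm_def, eLpNorm_eq_lintegral_rpow_enorm_toReal (by norm_num)
    (by norm_num), ← ENNReal.rpow_two, ← ENNReal.rpow_mul]
  norm_num

/-- The Poincaré–Friedrichs inequality. -/
theorem norm_fn_le (hd : 1 ≤ d) (hb : Bornology.IsBounded Ω) (v : H10 Ω) :
    ‖fn v‖ ≤ Metric.diam Ω * ‖grad v‖ := by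
  revert v
  apply H10.induction
  · exact isClosed_le (fnL Ω).continuous.norm (continuous_const.mul (gradL Ω).continuous.norm)
  intro v φ hφ h1 h2
  -- For D strictly above the diameter, x + D e lies outside Ω whenever x is in Ω. Then φ vanishes
  -- at that end of the segment and the line estimate bounds φ(x) itself. Finally D decreases to the
  -- diameter.
  suffices H : ∀ D > Metric.diam Ω, ‖fn v‖ ≤ D * ‖grad v‖ by
    have h3 : Filter.Tendsto (fun D => D * ‖grad v‖) (nhdsWithin (Metric.diam Ω) (Ioi (Metric.diam Ω)))
        (nhds (Metric.diam Ω * ‖grad v‖)) :=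
      (Continuous.tendsto (by fun_prop) _).mono_left nhdsWithin_le_nhds
    exact ge_of_tendsto h3 (by filter_upwards [self_mem_nhdsWithin] with D hD using H D hD)
  intro D hD
  have hD0 : 0 ≤ D := Metric.diam_nonneg.trans hD.le
  let e : Eu d := EuclideanSpace.single ⟨0, hd⟩ 1
  have he : ‖e‖ = 1 := by simp [e]
  have hG : Measurable fun x => ‖fderiv ℝ φ x e‖ₑ ^ 2 :=
    ((hφ.fderiv_apply e).continuous.enorm.measurable).pow_const 2
  have key : ∫⁻ x in Ω, ‖φ x‖ₑ ^ 2 ≤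
      ENNReal.ofReal D ^ 2 * ∫⁻ x in Ω, ‖gradient φ x‖ₑ ^ 2 := by
    calc ∫⁻ x in Ω, ‖φ x‖ₑ ^ 2 ≤ ∫⁻ x, ‖φ x‖ₑ ^ 2 := setLIntegral_le_lintegral _ _
      _ ≤ ∫⁻ x, ENNReal.ofReal D * ∫⁻ t in Ioc 0 D, ‖fderiv ℝ φ (x + t • e) e‖ₑ ^ 2 := by
          refine lintegral_mono fun x => ?_
          by_cases hx : x ∈ Ω
          · have h3 := enorm_sub_sq_le_line hφ.contDiff_one x e hD0
            have h4 : x + D • e ∉ Ω := fun h4 => by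
              have := Metric.dist_le_diam_of_mem hb h4 hx
              rw [dist_eq_norm, add_sub_cancel_left, norm_smul, he, mul_one, Real.norm_eq_abs,
                abs_of_nonneg hD0] at this
              linarith
            rw [hφ.eq_zero_of_notMem h4, zero_sub, enorm_neg] at h3
            exact h3
          · simp [hφ.eq_zero_of_notMem hx]
      _ = ENNReal.ofReal D ^ 2 * ∫⁻ x, ‖fderiv ℝ φ x e‖ₑ ^ 2 := by
          rw [lintegral_const_mul' _ _ ENNReal.ofReal_ne_top, lintegral_lintegral_shift hG e D,
            ← mul_assoc, sq]
      _ ≤ ENNReal.ofReal D ^ 2 * ∫⁻ x, ‖gradient φ x‖ₑ ^ 2 := by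
          gcongr with x
          rw [← ofReal_norm, ← ofReal_norm, norm_gradient]
          refine ENNReal.ofReal_le_ofReal ?_
          simpa [he] using (fderiv ℝ φ x).le_opNorm e
      _ = _ := by
          congr 1
          rw [← setLIntegral_eq_of_support_subset]
          intro x hx
          by_contra hxo
          refine hx ?_
          have : fderiv ℝ φ x = 0 := by
            ext e'; exact (hφ.fderiv_apply e').eq_zero_of_notMem hxo
          simp [gradient, this]
  have : ENNReal.ofReal ‖fn v‖ ^ 2 ≤ ENNReal.ofReal (D * ‖grad v‖) ^ 2 := by
    rw [ENNReal.ofReal_mul hD0, mul_pow, ofReal_norm, ofReal_norm, enorm_sq_eq_lintegral,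
      enorm_sq_eq_lintegral,
      lintegral_congr_ae (g := fun x => ‖φ x‖ₑ ^ 2) (by filter_upwards [h1] with x hx; rw [hx]),
      lintegral_congr_ae (f := fun x => ‖grad v x‖ₑ ^ 2) (g := fun x => ‖gradient φ x‖ₑ ^ 2)
        (by filter_upwards [h2] with x hx; rw [hx])]
    exact key
  rw [ENNReal.pow_le_pow_left_iff two_ne_zero] at this
  exact (ENNReal.ofReal_le_ofReal_iff (by positivity)).1 this

end

section

variable {Ω : Set (Eu d)}

/-! ### Lipschitz functions vanishing outside `Ω` belong to `H¹₀(Ω)` -/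

/-- Weak compactness: by Banach–Alaoglu the sequence has a weak limit along an ultrafilter. As T is
weakly continuous through its adjoint, T maps this limit to y. -/
theorem exists_eq_of_bounded_of_tendsto {E F : Type*} [NormedAddCommGroup E]
    [InnerProductSpace ℝ E] [CompleteSpace E] [NormedAddCommGroup F] [InnerProductSpace ℝ F]
    [CompleteSpace F] (T : E →L[ℝ] F) {x : ℕ → E} {R : ℝ} (hR : ∀ n, ‖x n‖ ≤ R) {y : F}
    (hy : Filter.Tendsto (fun n => T (x n)) Filter.atTop (nhds y)) : ∃ z, T z = y := by
  let J : ℕ → WeakDual ℝ E := fun n => StrongDual.toWeakDual (InnerProductSpace.toDual ℝ E (x n))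
  have hJ : ∀ n, J n ∈ WeakDual.toStrongDual ⁻¹' Metric.closedBall (0 : StrongDual ℝ E) R := by
    intro n; simpa [J] using hR n
  obtain ⟨ℓ, -, hℓ⟩ := (WeakDual.isCompact_closedBall (𝕜 := ℝ) (0 : StrongDual ℝ E) R).ultrafilter_le_nhds
    ((Filter.hyperfilter ℕ).map J)
    (by rw [Ultrafilter.coe_map]; exact Filter.tendsto_principal.2 (Filter.Eventually.of_forall hJ))
  have hu : ((Filter.hyperfilter ℕ : Ultrafilter ℕ) : Filter ℕ) ≤ Filter.atTop := by
    rw [← Nat.cofinite_eq_atTop]; exact Filter.hyperfilter_le_cofinite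
  refine ⟨(InnerProductSpace.toDual ℝ E).symm (WeakDual.toStrongDual ℓ), ?_⟩
  refine ext_inner_right ℝ fun z => ?_
  have h1 : Filter.Tendsto (fun n => J n (T.adjoint z)) (Filter.hyperfilter ℕ)
      (nhds (ℓ (T.adjoint z))) :=
    ((WeakDual.eval_continuous (T.adjoint z)).tendsto ℓ).comp hℓ
  have h2 : Filter.Tendsto (fun n => J n (T.adjoint z)) (Filter.hyperfilter ℕ)
      (nhds (inner ℝ y z)) := by
    have := Filter.Tendsto.inner (𝕜 := ℝ) (hy.mono_left hu) (tendsto_const_nhds (x := z))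
    refine this.congr fun n => ?_
    exact (ContinuousLinearMap.adjoint_inner_right T (x n) z).symm
  rw [← ContinuousLinearMap.adjoint_inner_right T, InnerProductSpace.toDual_symm_apply]
  exact tendsto_nhds_unique h1 h2

/-- Soft thresholding. -/
def shrink (ε s : ℝ) : ℝ := max (s - ε) 0 + min (s + ε) 0

theorem abs_shrink_sub_le {ε : ℝ} (hε : 0 ≤ ε) (s : ℝ) : |shrink ε s - s| ≤ ε := by
  unfold shrink
  rcases max_cases (s - ε) 0 with h | h <;> rcases min_cases (s + ε) 0 with h' | h' <;>
    rw [h.1, h'.1, abs_le] <;> constructor <;> linarith [h.2, h'.2]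

theorem shrink_eq_zero {ε s : ℝ} (h : |s| ≤ ε) : shrink ε s = 0 := by
  rw [abs_le] at h
  unfold shrink
  rw [max_eq_right (by linarith), min_eq_right (by linarith), add_zero]

theorem abs_shrink_sub_shrink_le {ε : ℝ} (hε : 0 ≤ ε) (s t : ℝ) :
    |shrink ε s - shrink ε t| ≤ |s - t| := by
  wlog hst : t ≤ s generalizing s t
  · rw [abs_sub_comm, abs_sub_comm s]; exact this t s (le_of_not_ge hst)
  rw [abs_of_nonneg (sub_nonneg.2 hst)]
  unfold shrink
  rcases max_cases (s - ε) 0 with h1 | h1 <;> rcases min_cases (s + ε) 0 with h2 | h2 <;>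
    rcases max_cases (t - ε) 0 with h3 | h3 <;> rcases min_cases (t + ε) 0 with h4 | h4 <;>
    rw [h1.1, h2.1, h3.1, h4.1, abs_le] <;> constructor <;>
    linarith [h1.2, h2.2, h3.2, h4.2]

/-- Soft thresholding pushes the support into the compact set where |g| ≥ ε, inside Ω, without
increasing the Lipschitz constant. There is then room to mollify, which preserves the Lipschitz
constant too. Each operation moves the values by at most ε. -/
theorem exists_test_near_lipschitz (hΩ : IsOpen Ω) (hb : Bornology.IsBounded Ω) {g : Eu d → ℝ}
    {L : NNReal} (hg : LipschitzWith L g) (h0 : ∀ x ∉ Ω, g x = 0) {ε : ℝ} (hε : 0 < ε) :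
    ∃ φ, IsTestFunction Ω φ ∧ (∀ x, |φ x - g x| ≤ 2 * ε) ∧ ∀ x, ‖fderiv ℝ φ x‖ ≤ L := by
  let G : Eu d → ℝ := fun x => shrink ε (g x)
  have hG : LipschitzWith L G := by
    refine LipschitzWith.of_dist_le_mul fun x y => ?_
    exact (abs_shrink_sub_shrink_le hε.le _ _).trans (hg.dist_le_mul x y)
  let K : Set (Eu d) := {x | ε ≤ |g x|}
  have hKΩ : K ⊆ Ω := fun x hx => by
    by_contra h
    have : ε ≤ |g x| := hx
    rw [h0 x h, abs_zero] at this; linarith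
  have hK : IsCompact K := Metric.isCompact_of_isClosed_isBounded
    (isClosed_le continuous_const hg.continuous.abs) (hb.subset hKΩ)
  have hGK : Function.support G ⊆ K := fun x hx => by
    by_contra h
    exact hx (shrink_eq_zero (le_of_lt (not_le.1 h)))
  have hGc : HasCompactSupport G :=
    HasCompactSupport.of_support_subset_isCompact hK hGK
  obtain ⟨δ, hδ, hδΩ⟩ := hK.exists_cthickening_subset_open hΩ hKΩ
  -- The bound δ keeps the mollified support inside Ω. The other bound limits the change of values
  -- to Lr ≤ ε, and the added 1 covers L = 0.
  let r : ℝ := min δ (ε / (L + 1))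
  have hr : 0 < r := lt_min hδ (by positivity)
  let b : ContDiffBump (0 : Eu d) := ⟨r / 2, r, by positivity, by linarith⟩
  let φ : Eu d → ℝ := convolution (b.normed volume) G (ContinuousLinearMap.lsmul ℝ ℝ) volume
  have hφ1 : ContDiff ℝ ∞ φ :=
    b.hasCompactSupport_normed.contDiff_convolution_left _ b.contDiff_normed
      hG.continuous.locallyIntegrable
  have hsupp : Function.support φ ⊆ Metric.cthickening δ K := by
    refine (support_convolution_subset _).trans ?_
    rw [b.support_normed_eq]
    rintro _ ⟨x, hx, y, hy, rfl⟩
    refine Metric.mem_cthickening_of_dist_le _ y _ _ (hGK hy) ?_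
    have : ‖x‖ < r := by simpa using hx
    simpa [dist_eq_norm] using this.le.trans (min_le_left _ _)
  have hts : tsupport φ ⊆ Metric.cthickening δ K :=
    closure_minimal hsupp Metric.isClosed_cthickening
  have hφ : IsTestFunction Ω φ := ⟨hφ1, HasCompactSupport.of_support_subset_isCompact
    hK.cthickening hsupp, hts.trans hδΩ⟩
  refine ⟨φ, hφ, fun x => ?_, fun x => ?_⟩
  · have h1 : dist (φ x) (G x) ≤ ε := by
      refine b.dist_normed_convolution_le hG.continuous.aestronglyMeasurable fun y hy => ?_
      refine (hG.dist_le_mul y x).trans ?_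
      have h2 : dist y x < r := hy
      have h3 : dist y x ≤ ε / (L + 1) := h2.le.trans (min_le_right _ _)
      have hL : (0 : ℝ) ≤ L := L.2
      calc (L : ℝ) * dist y x ≤ L * (ε / (L + 1)) := by gcongr
        _ = ε * (L / (L + 1)) := by ring
        _ ≤ ε * 1 := by gcongr; rw [div_le_one (by positivity)]; linarith
        _ = ε := mul_one _
    have h2 : |G x - g x| ≤ ε := abs_shrink_sub_le hε.le _
    rw [Real.dist_eq] at h1
    calc |φ x - g x| ≤ |φ x - G x| + |G x - g x| := abs_sub_le _ _ _
      _ ≤ 2 * ε := by linarith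
  · have hint : ∀ x, Integrable fun t => b.normed volume t • G (x - t) := fun x =>
      (b.continuous_normed.smul (hG.continuous.comp (by fun_prop))).integrable_of_hasCompactSupport
        (b.hasCompactSupport_normed.smul_right)
    have hLφ : LipschitzWith L φ := by
      refine LipschitzWith.of_dist_le_mul fun x y => ?_
      have h1 : φ x - φ y = ∫ t, b.normed volume t • (G (x - t) - G (y - t)) := by
        simp_rw [smul_sub]
        rw [integral_sub (hint x) (hint y)]; rfl
      rw [dist_eq_norm, h1]
      calc ‖∫ t, b.normed volume t • (G (x - t) - G (y - t))‖
          ≤ ∫ t, b.normed volume t * (L * dist x y) := by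
            refine norm_integral_le_of_norm_le (b.integrable_normed.mul_const _)
              (Filter.Eventually.of_forall fun t => ?_)
            rw [norm_smul, Real.norm_of_nonneg (b.nonneg_normed t)]
            refine mul_le_mul_of_nonneg_left ?_ (b.nonneg_normed t)
            rw [← dist_eq_norm]
            refine (hG.dist_le_mul _ _).trans (le_of_eq ?_)
            rw [dist_sub_right]
        _ = L * dist x y := by rw [integral_mul_const, b.integral_normed, one_mul]
    exact norm_fderiv_le_of_lipschitz ℝ hLφ

theorem norm_Lp_le_of_bound {F : Type*} [NormedAddCommGroup F] {μ : Measure (Eu d)}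
    [IsFiniteMeasure μ] (f : Lp F 2 μ) {g : Eu d → F} (hfg : f =ᵐ[μ] g) {C : ℝ} (hC : 0 ≤ C)
    (h : ∀ x, ‖g x‖ ≤ C) : ‖f‖ ≤ (measureUnivNNReal μ : ℝ) ^ (1 / 2 : ℝ) * C := by
  have := Lp.norm_le_of_ae_bound (f := f) (p := 2) hC
    (by filter_upwards [hfg] with x hx; rw [hx]; exact h x)
  simpa using this

/-- The smooth approximants converge to g uniformly while their gradients stay bounded by L. They
are bounded in H¹, and a weak limit in H¹₀ has g as its function. -/
theorem exists_H10_of_lipschitz (hΩ : IsOpen Ω) (hb : Bornology.IsBounded Ω) {g : Eu d → ℝ}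
    {L : NNReal} (hg : LipschitzWith L g) (h0 : ∀ x ∉ Ω, g x = 0) :
    ∃ v : H10 Ω, fn v =ᵐ[volume.restrict Ω] g := by
  have : IsFiniteMeasure ((volume : Measure (Eu d)).restrict Ω) :=
    ⟨by simpa using hb.measure_lt_top⟩
  set M : ℝ := (measureUnivNNReal ((volume : Measure (Eu d)).restrict Ω) : ℝ) ^ (1 / 2 : ℝ)
  have hM : 0 ≤ M := by positivity
  choose φ hφ h1 h2 using fun n : ℕ => exists_test_near_lipschitz hΩ hb hg h0
    (ε := 1 / (n + 1 : ℝ)) (by positivity)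
  choose v hv1 hv2 using fun n => exists_H10_of_test (hφ n)
  obtain ⟨B, hB⟩ : ∃ B, ∀ x, |g x| ≤ B := by
    obtain ⟨R, hR⟩ := hb.subset_closedBall 0
    obtain ⟨B, hB⟩ := (isCompact_closedBall (0 : Eu d) R).exists_bound_of_continuousOn
      hg.continuous.continuousOn
    refine ⟨max B 0, fun x => ?_⟩
    by_cases hx : x ∈ Ω
    · exact (hB x (hR hx)).trans (le_max_left _ _)
    · rw [h0 x hx, abs_zero]; exact le_max_right _ _
  have hgm : MemLp g 2 (volume.restrict Ω) :=
    MemLp.of_bound hg.continuous.aestronglyMeasurable B (Filter.Eventually.of_forall hB)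
  have hlim : Filter.Tendsto (fun n => fnL Ω (v n)) Filter.atTop (nhds hgm.toLp) := by
    rw [tendsto_iff_norm_sub_tendsto_zero]
    have hz : Filter.Tendsto (fun n : ℕ => M * (2 * (1 / (n + 1 : ℝ)))) Filter.atTop (nhds 0) := by
      simpa using (tendsto_one_div_add_atTop_nhds_zero_nat.const_mul 2).const_mul M
    refine squeeze_zero (fun n => norm_nonneg _) (fun n => ?_) hz
    refine norm_Lp_le_of_bound _ (g := fun x => φ n x - g x) ?_ (by positivity) (h1 n)
    filter_upwards [Lp.coeFn_sub (fnL Ω (v n)) hgm.toLp, hv1 n, hgm.coeFn_toLp] with x e1 e2 e3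
    rw [e1, Pi.sub_apply, e3, fnL_apply, e2]
  obtain ⟨R, hR⟩ := hlim.norm.bddAbove_range
  have hbd : ∀ n, ‖v n‖ ≤ R + M * L := by
    intro n
    have hfn : ‖fn (v n)‖ ≤ R := hR ⟨n, rfl⟩
    have hgr : ‖grad (v n)‖ ≤ M * L := by
      refine norm_Lp_le_of_bound _ (hv2 n) L.2 fun x => ?_
      rw [norm_gradient]; exact h2 n x
    have hR0 : 0 ≤ R := (norm_nonneg _).trans hfn
    refine le_of_pow_le_pow_left₀ two_ne_zero (by positivity) ?_
    rw [norm_sq_eq]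
    nlinarith [norm_nonneg (fn (v n)), norm_nonneg (grad (v n))]
  obtain ⟨w, hw⟩ := exists_eq_of_bounded_of_tendsto (fnL Ω) hbd hlim
  refine ⟨w, ?_⟩
  rw [fnL_apply] at hw
  rw [hw]; exact hgm.coeFn_toLp

end

section

/-! ### The Poincaré inequality on convex sets -/

theorem lintegral_comp_add_smul {F : Eu d → ℝ≥0∞} (hF : Measurable F) (a : Eu d) {c : ℝ}
    (hc : c ≠ 0) : ∫⁻ x, F (a + c • x) = ENNReal.ofReal |(c ^ d)⁻¹| * ∫⁻ x, F x := by
  have h1 : ∫⁻ x, F (a + c • x) = ∫⁻ y, F (a + y) ∂(Measure.map (c • ·) (volume : Measure (Eu d))) := by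
    rw [lintegral_map (f := fun y => F (a + y)) (hF.comp (measurable_const_add a))
      (measurable_const_smul c)]
  rw [h1, Measure.map_addHaar_smul _ hc, lintegral_smul_measure, lintegral_add_left_eq_self]
  simp

/-- The point x + t(y − x) is an affine function of y with factor t and of x with factor 1 − t. The
change of variables is made in the one with factor at least 1/2, so the Jacobian costs at most 2^d.
-/
theorem lintegral_lintegral_segment_le {S : Set (Eu d)} (hS : MeasurableSet S) (hc : Convex ℝ S)
    {F : Eu d → ℝ≥0∞} (hF : Measurable F) {t : ℝ} (ht0 : 0 ≤ t) (ht1 : t ≤ 1) :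
    ∫⁻ x in S, ∫⁻ y in S, F (x + t • (y - x)) ≤
      ENNReal.ofReal (2 ^ d) * volume S * ∫⁻ x in S, F x := by
  have hmeas : Measurable (S.indicator F) := hF.indicator hS
  have hmem : ∀ x ∈ S, ∀ y ∈ S, x + t • (y - x) ∈ S := fun x hx y hy => by
    have := hc hx hy (sub_nonneg.2 ht1) ht0 (by ring)
    convert this using 1; module
  have hle : ∀ x ∈ S, ∫⁻ y in S, F (x + t • (y - x)) ≤
      ∫⁻ y in S, S.indicator F (x + t • (y - x)) := fun x hx => by
    refine setLIntegral_mono' hS fun y hy => ?_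
    rw [indicator_of_mem (hmem x hx y hy)]
  refine (setLIntegral_mono' hS hle).trans ?_
  have hbound : ∀ c : ℝ, 1 / 2 ≤ c → ∀ a, ∫⁻ x in S, S.indicator F (a + c • x) ≤
      ENNReal.ofReal (2 ^ d) * ∫⁻ x in S, F x := by
    intro c hc a
    refine (setLIntegral_le_lintegral _ _).trans ?_
    rw [lintegral_comp_add_smul hmeas a (by linarith), lintegral_indicator hS]
    gcongr
    rw [abs_of_nonneg (by positivity), ← inv_pow]
    gcongr
    rw [inv_le_comm₀ (by linarith) two_pos]; linarith
  rcases le_total (1 / 2) t with h | h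
  · have : ∀ x ∈ S, ∫⁻ y in S, S.indicator F (x + t • (y - x)) ≤
        ENNReal.ofReal (2 ^ d) * ∫⁻ x in S, F x := fun x _ => by
      refine le_trans (le_of_eq ?_) (hbound t h (x - t • x))
      congr 1; ext y; congr 1; module
    refine (setLIntegral_mono' hS this).trans ?_
    rw [setLIntegral_const]; exact le_of_eq (by ring)
  · rw [lintegral_lintegral_swap (by
      exact (hmeas.comp (by fun_prop)).aemeasurable)]
    have : ∀ y ∈ S, ∫⁻ x in S, S.indicator F (x + t • (y - x)) ≤
        ENNReal.ofReal (2 ^ d) * ∫⁻ x in S, F x := fun y _ => by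
      refine le_trans (le_of_eq ?_) (hbound (1 - t) (by linarith) (t • y))
      congr 1; ext x; congr 1; module
    refine (setLIntegral_mono' hS this).trans ?_
    rw [setLIntegral_const]; exact le_of_eq (by ring)

theorem lintegral_lintegral_sub_sq_le {S : Set (Eu d)} (hS : MeasurableSet S) (hc : Convex ℝ S)
    {h : ℝ} (hh : ∀ x ∈ S, ∀ y ∈ S, ‖x - y‖ ≤ h) {w : Eu d → ℝ} (hw : ContDiff ℝ 1 w) :
    ∫⁻ x in S, ∫⁻ y in S, ‖w y - w x‖ₑ ^ 2 ≤
      ENNReal.ofReal (2 ^ d * h ^ 2) * volume S * ∫⁻ x in S, ‖fderiv ℝ w x‖ₑ ^ 2 := by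
  have hF : Measurable fun x => ‖fderiv ℝ w x‖ₑ ^ 2 :=
    ((hw.continuous_fderiv one_ne_zero).enorm.measurable).pow_const 2
  have h1 : ∀ x ∈ S, ∀ y ∈ S, ‖w y - w x‖ₑ ^ 2 ≤
      ENNReal.ofReal (h ^ 2) * ∫⁻ t in Ioc (0 : ℝ) 1, ‖fderiv ℝ w (x + t • (y - x))‖ₑ ^ 2 := by
    intro x hx y hy
    have h2 := enorm_sub_sq_le_line hw x (y - x) zero_le_one
    rw [one_smul, add_sub_cancel, ENNReal.ofReal_one, one_mul] at h2
    refine h2.trans ?_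
    rw [← lintegral_const_mul' _ _ ENNReal.ofReal_ne_top]
    refine lintegral_mono fun t => ?_
    have hnn : 0 ≤ h := (norm_nonneg _).trans (hh x hx y hy)
    rw [ENNReal.ofReal_pow hnn, ← mul_pow]
    gcongr
    rw [mul_comm]
    refine (ContinuousLinearMap.le_opENorm _ _).trans ?_
    gcongr
    rw [← ofReal_norm]
    exact ENNReal.ofReal_le_ofReal (hh y hy x hx)
  calc ∫⁻ x in S, ∫⁻ y in S, ‖w y - w x‖ₑ ^ 2
      ≤ ∫⁻ x in S, ∫⁻ y in S, ENNReal.ofReal (h ^ 2) *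
          ∫⁻ t in Ioc (0 : ℝ) 1, ‖fderiv ℝ w (x + t • (y - x))‖ₑ ^ 2 :=
        setLIntegral_mono' hS fun x hx => setLIntegral_mono' hS fun y hy => h1 x hx y hy
    _ = ENNReal.ofReal (h ^ 2) * ∫⁻ t in Ioc (0 : ℝ) 1, ∫⁻ x in S, ∫⁻ y in S,
          ‖fderiv ℝ w (x + t • (y - x))‖ₑ ^ 2 := by
        simp_rw [lintegral_const_mul' _ _ ENNReal.ofReal_ne_top]
        congr 1
        have hm : Measurable fun p : (Eu d × ℝ) × Eu d =>
            ‖fderiv ℝ w (p.1.1 + p.1.2 • (p.2 - p.1.1))‖ₑ ^ 2 := hF.comp (by fun_prop)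
        have s1 : ∀ x, ∫⁻ y in S, ∫⁻ t in Ioc (0 : ℝ) 1, ‖fderiv ℝ w (x + t • (y - x))‖ₑ ^ 2 =
            ∫⁻ t in Ioc (0 : ℝ) 1, ∫⁻ y in S, ‖fderiv ℝ w (x + t • (y - x))‖ₑ ^ 2 := fun x =>
          lintegral_lintegral_swap (hF.comp (by fun_prop :
            Measurable fun p : Eu d × ℝ => x + p.2 • (p.1 - x))).aemeasurable
        simp_rw [s1]
        exact lintegral_lintegral_swap
          (hm.lintegral_prod_right' (ν := volume.restrict S)).aemeasurable
    _ ≤ ENNReal.ofReal (h ^ 2) * ∫⁻ t in Ioc (0 : ℝ) 1, ENNReal.ofReal (2 ^ d) * volume S *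
          ∫⁻ x in S, ‖fderiv ℝ w x‖ₑ ^ 2 := by
        refine mul_le_mul_right (setLIntegral_mono' measurableSet_Ioc fun t ht => ?_) _
        exact lintegral_lintegral_segment_le hS hc hF ht.1.le ht.2
    _ = _ := by
        rw [setLIntegral_const, Real.volume_Ioc, sub_zero, ENNReal.ofReal_one, mul_one,
          ENNReal.ofReal_mul (by positivity)]
        ring

/-- `g` is the weak partial derivative of `φ` in the direction `i` on the open set `O`. -/
def HasWeakPartial (O : Set (Eu d)) (i : Fin d) (φ g : Eu d → ℝ) : Prop :=
  ∀ ψ, IsTestFunction O ψ →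
    ∫ x in O, φ x * fderiv ℝ ψ x (EuclideanSpace.single i 1) = - ∫ x in O, g x * ψ x

/-- Mollification of a function on `O` extended by zero. -/
def mollify (b : ContDiffBump (0 : Eu d)) (O : Set (Eu d)) (f : Eu d → ℝ) : Eu d → ℝ :=
  convolution (b.normed volume) (O.indicator f) (ContinuousLinearMap.lsmul ℝ ℝ) volume

theorem mollify_eq (b : ContDiffBump (0 : Eu d)) {O : Set (Eu d)} (hO : MeasurableSet O)
    (f : Eu d → ℝ) (x : Eu d) :
    mollify b O f x = ∫ y in O, f y * b.normed volume (x - y) := by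
  rw [mollify, convolution_eq_swap, ← integral_indicator hO]
  refine integral_congr_ae (Filter.Eventually.of_forall fun y => ?_)
  by_cases hy : y ∈ O <;> simp [hy, mul_comm]

theorem integrable_indicator_of_memLp {O : Set (Eu d)} (hO : MeasurableSet O)
    (hb : Bornology.IsBounded O) {f : Eu d → ℝ} (hf : MemLp f 2 (volume.restrict O)) :
    Integrable (O.indicator f) := by
  have : IsFiniteMeasure ((volume : Measure (Eu d)).restrict O) :=
    ⟨by simpa using hb.measure_lt_top⟩
  exact (integrable_indicator_iff hO).2 (hf.integrable (by norm_num))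

theorem contDiff_mollify (b : ContDiffBump (0 : Eu d)) {O : Set (Eu d)} (hO : MeasurableSet O)
    (hb : Bornology.IsBounded O) {f : Eu d → ℝ} (hf : MemLp f 2 (volume.restrict O)) :
    ContDiff ℝ 1 (mollify b O f) :=
  b.hasCompactSupport_normed.contDiff_convolution_left _ b.contDiff_normed
    (integrable_indicator_of_memLp hO hb hf).locallyIntegrable

/-- The derivative falls on the kernel. Since the ball around x lies in O, the kernel centred at x
is a test function on O, and the weak derivative moves the differentiation back to f. The extension
by zero is therefore not seen. -/
theorem fderiv_mollify (b : ContDiffBump (0 : Eu d)) {O : Set (Eu d)} (hO : MeasurableSet O)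
    (hb : Bornology.IsBounded O) {f g : Eu d → ℝ} (hf : MemLp f 2 (volume.restrict O)) {i : Fin d}
    (hg : HasWeakPartial O i f g) {x : Eu d} (hx : Metric.closedBall x b.rOut ⊆ O) :
    fderiv ℝ (mollify b O f) x (EuclideanSpace.single i 1) = mollify b O g x := by
  let ψ : Eu d → ℝ := fun y => b.normed volume (x - y)
  have hsm : ContDiff ℝ ∞ (b.normed (volume : Measure (Eu d))) := b.contDiff_normed
  have hψ : IsTestFunction O ψ := by
    have hs : Function.support ψ ⊆ Metric.closedBall x b.rOut := by
      intro y hy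
      have : x - y ∈ Function.support (b.normed (volume : Measure (Eu d))) := hy
      rw [b.support_normed_eq, mem_ball_zero_iff] at this
      rw [Metric.mem_closedBall, dist_comm, dist_eq_norm]; exact this.le
    refine ⟨hsm.comp (by fun_prop),
      HasCompactSupport.of_support_subset_isCompact (isCompact_closedBall x b.rOut) hs, ?_⟩
    exact (closure_minimal hs Metric.isClosed_closedBall).trans hx
  have hder : ∀ y e, fderiv ℝ ψ y e = - fderiv ℝ (b.normed (volume : Measure (Eu d))) (x - y) e := by
    intro y e
    have h1 : HasFDerivAt ψ ((fderiv ℝ (b.normed (volume : Measure (Eu d))) (x - y)).comp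
        (-ContinuousLinearMap.id ℝ (Eu d))) y :=
      ((hsm.differentiable (by simp)) (x - y)).hasFDerivAt.comp y ((hasFDerivAt_id y).const_sub x)
    rw [h1.fderiv]; simp
  have h1 := (b.hasCompactSupport_normed (μ := (volume : Measure (Eu d)))).hasFDerivAt_convolution_left
    (ContinuousLinearMap.lsmul ℝ ℝ) (hsm.of_le (by simp))
    (integrable_indicator_of_memLp hO hb hf).locallyIntegrable x
  have h2 : fderiv ℝ (mollify b O f) x = _ := h1.fderiv
  have h3 : (∫ y in O, f y * fderiv ℝ (b.normed (volume : Measure (Eu d))) (x - y)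
      (EuclideanSpace.single i 1)) = ∫ y in O, g y * ψ y := by
    have h3 := hg ψ hψ
    simp_rw [hder, mul_neg] at h3
    rwa [integral_neg, neg_inj] at h3
  have hint := (b.hasCompactSupport_normed.fderiv (𝕜 := ℝ)).convolutionExists_left
    ((ContinuousLinearMap.lsmul ℝ ℝ).precompL (Eu d)) (hsm.continuous_fderiv (by simp))
    (integrable_indicator_of_memLp hO hb hf).locallyIntegrable x
  rw [h2, convolution, ContinuousLinearMap.integral_apply hint, mollify_eq b hO, ← h3,
    ← integral_indicator hO, ← integral_sub_left_eq_self _ volume x]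
  refine integral_congr_ae (Filter.Eventually.of_forall fun y => ?_)
  by_cases hy : y ∈ O <;> simp [hy, ContinuousLinearMap.precompL_apply, mul_comm]

/-- The kernel is a probability density. Cauchy–Schwarz against it gives the pointwise bound, and
Tonelli with translation invariance the integrated one. -/
theorem lintegral_mollify_sq_le (b : ContDiffBump (0 : Eu d)) {O : Set (Eu d)}
    (hO : MeasurableSet O) {f : Eu d → ℝ} (hf : AEStronglyMeasurable f (volume.restrict O)) :
    ∫⁻ x, ‖mollify b O f x‖ₑ ^ 2 ≤ ∫⁻ x in O, ‖f x‖ₑ ^ 2 := by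
  obtain ⟨f', hf', hff'⟩ := (aestronglyMeasurable_indicator_iff hO).2 hf
  let ρ : Eu d → ℝ := b.normed (volume : Measure (Eu d))
  have hρ : Measurable fun t => ‖ρ t‖ₑ := b.continuous_normed.enorm.measurable
  let ν : Measure (Eu d) := (volume : Measure (Eu d)).withDensity fun t => ‖ρ t‖ₑ
  have hν : ν univ = 1 := by
    rw [withDensity_apply _ MeasurableSet.univ, Measure.restrict_univ]
    have : ∀ t, ‖ρ t‖ₑ = ENNReal.ofReal (ρ t) := fun t => by
      rw [← ofReal_norm, Real.norm_of_nonneg (b.nonneg_normed t)]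
    simp_rw [this]
    rw [← ofReal_integral_eq_lintegral_ofReal b.integrable_normed
      (Filter.Eventually.of_forall b.nonneg_normed), b.integral_normed, ENNReal.ofReal_one]
  have hf'm : Measurable fun x => ‖f' x‖ₑ := hf'.measurable.enorm
  have hpt : ∀ x, ‖mollify b O f x‖ₑ ^ 2 ≤ ∫⁻ t, ‖f' (x - t)‖ₑ ^ 2 ∂ν := by
    intro x
    have h1 : mollify b O f x = ∫ t, ρ t • f' (x - t) := by
      refine integral_congr_ae ?_
      have hq : Measure.QuasiMeasurePreserving (fun t : Eu d => x - t) volume volume :=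
        quasiMeasurePreserving_sub_left_of_right_invariant volume x
      filter_upwards [hq.ae hff'] with t ht
      simp only [ContinuousLinearMap.lsmul_apply, ht]; rfl
    have h2 : ‖mollify b O f x‖ₑ ≤ ∫⁻ t, ‖f' (x - t)‖ₑ ∂ν := by
      rw [h1, lintegral_withDensity_eq_lintegral_mul (g := fun t => ‖f' (x - t)‖ₑ) _ hρ
        (hf'm.comp (measurable_const_sub x))]
      refine (enorm_integral_le_lintegral_enorm _).trans (le_of_eq ?_)
      congr 1; ext t; rw [enorm_smul]; rfl
    calc _ ≤ (∫⁻ t, ‖f' (x - t)‖ₑ ∂ν) ^ 2 := by gcongr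
      _ ≤ ν univ * ∫⁻ t, ‖f' (x - t)‖ₑ ^ 2 ∂ν :=
        sq_lintegral_le (hf'm.comp (measurable_const_sub x)).aemeasurable
      _ = _ := by rw [hν, one_mul]
  calc ∫⁻ x, ‖mollify b O f x‖ₑ ^ 2 ≤ ∫⁻ x, ∫⁻ t, ‖f' (x - t)‖ₑ ^ 2 ∂ν := lintegral_mono hpt
    _ = ∫⁻ t, (∫⁻ x, ‖f' x‖ₑ ^ 2) ∂ν := by
        have : SFinite ν := by infer_instance
        rw [lintegral_lintegral_swap]
        · congr 1; ext t
          exact lintegral_sub_right_eq_self (fun x => ‖f' x‖ₑ ^ 2) t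
        · exact ((hf'm.pow_const 2).comp (by fun_prop :
            Measurable fun p : Eu d × Eu d => p.1 - p.2)).aemeasurable
    _ = ∫⁻ x, ‖f' x‖ₑ ^ 2 := by rw [lintegral_const, hν, mul_one]
    _ = ∫⁻ x in O, ‖f x‖ₑ ^ 2 := by
        rw [← lintegral_indicator hO]
        refine lintegral_congr_ae ?_
        filter_upwards [hff'] with x hx
        rw [← hx]
        by_cases hxO : x ∈ O <;> simp [hxO]

theorem enorm_fderiv_sq (w : Eu d → ℝ) (x : Eu d) :
    ‖fderiv ℝ w x‖ₑ ^ 2 = ∑ i, ‖fderiv ℝ w x (EuclideanSpace.single i 1)‖ₑ ^ 2 := by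
  simp_rw [← ofReal_norm, ← ENNReal.ofReal_pow (norm_nonneg _)]
  rw [← ENNReal.ofReal_sum_of_nonneg fun _ _ => by positivity, ← norm_gradient,
    EuclideanSpace.norm_sq_eq]
  simp_rw [gradient_apply]

/-- A point y near x is the convex combination, with weights s and 1 − s, of the dilated point,
which is in O, and of a point close to x₀. This tells at which radius one may mollify on a shrunken
copy of O. -/
theorem closedBall_subset_of_dilation {O : Set (Eu d)} (hc : Convex ℝ O) {x₀ x : Eu d} {r s : ℝ}
    (hr : Metric.ball x₀ r ⊆ O) (hr0 : 0 < r) (hs0 : 0 < s) (hs1 : s < 1)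
    (hx : x₀ + s⁻¹ • (x - x₀) ∈ O) : Metric.closedBall x (r * (1 - s) / 2) ⊆ O := by
  intro y hy
  rw [Metric.mem_closedBall, dist_eq_norm] at hy
  have h1s : 0 < 1 - s := sub_pos.2 hs1
  have hq : x₀ + (1 - s)⁻¹ • (y - x) ∈ O := by
    apply hr
    rw [mem_ball_iff_norm, add_sub_cancel_left, norm_smul, Real.norm_of_nonneg (by positivity)]
    calc (1 - s)⁻¹ * ‖y - x‖ ≤ (1 - s)⁻¹ * (r * (1 - s) / 2) := by gcongr
      _ = r / 2 := by field_simp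
      _ < r := by linarith
  have := hc hx hq hs0.le h1s.le (by ring)
  convert this using 1
  rw [smul_add, smul_add, smul_smul, smul_smul, mul_inv_cancel₀ hs0.ne', mul_inv_cancel₀ h1s.ne']
  module

/-- The Poincaré inequality in double integral form, for functions with weak derivatives. -/
theorem lintegral_sub_sq_le_of_weak {O : Set (Eu d)} (hO : IsOpen O) (hc : Convex ℝ O)
    (hb : Bornology.IsBounded O) (hne : O.Nonempty) {h : ℝ} (hh : ∀ x ∈ O, ∀ y ∈ O, ‖x - y‖ ≤ h)
    {φ : Eu d → ℝ} (hφ : MemLp φ 2 (volume.restrict O)) {g : Fin d → Eu d → ℝ}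
    (hg : ∀ i, MemLp (g i) 2 (volume.restrict O)) (hw : ∀ i, HasWeakPartial O i φ (g i)) :
    ∫⁻ x in O, ∫⁻ y in O, ‖φ y - φ x‖ₑ ^ 2 ≤
      ENNReal.ofReal (2 ^ d * h ^ 2) * volume O * ∑ i, ∫⁻ x in O, ‖g i x‖ₑ ^ 2 := by
  have hOm := hO.measurableSet
  obtain ⟨x₀, hx₀⟩ := hne
  obtain ⟨r, hr0, hr⟩ := Metric.isOpen_iff.1 hO x₀ hx₀
  -- Factors 0 < s n < 1 tending to 1; the second 1 in the denominator excludes s 0 = 0. The sets S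
  -- n are the copies of O shrunk by s n towards x₀, on which mollification at radius r(1 − s n)/2
  -- only sees O.
  let s : ℕ → ℝ := fun n => 1 - 1 / ((n : ℝ) + 1 + 1)
  have hsn : ∀ n : ℕ, 0 < 1 / ((n : ℝ) + 1 + 1) ∧ 1 / ((n : ℝ) + 1 + 1) < 1 := fun n =>
    ⟨by positivity, by rw [div_lt_one (by positivity)]; linarith [(Nat.cast_nonneg n : (0 : ℝ) ≤ n)]⟩
  have hs0 : ∀ n, 0 < s n := fun n => by simp only [s]; linarith [(hsn n).2]
  have hs1 : ∀ n, s n < 1 := fun n => by simp only [s]; linarith [(hsn n).1]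
  have hslim : Filter.Tendsto s Filter.atTop (nhds 1) := by
    have := (tendsto_one_div_add_atTop_nhds_zero_nat (𝕜 := ℝ)).comp (Filter.tendsto_add_atTop_nat 1)
    have := this.const_sub 1
    simpa [s, Function.comp_def] using this
  let S : ℕ → Set (Eu d) := fun n => (fun x => x₀ + (s n)⁻¹ • (x - x₀)) ⁻¹' O
  have hSo : ∀ n, IsOpen (S n) := fun n => hO.preimage (by fun_prop)
  have hSc : ∀ n, Convex ℝ (S n) := fun n => by
    intro x hx y hy a b ha hb hab
    have := hc hx hy ha hb hab
    simp only [S, mem_preimage]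
    convert this using 1
    have : b = 1 - a := by linarith
    subst this; module
  let b : ℕ → ContDiffBump (0 : Eu d) := fun n =>
    ⟨r * (1 - s n) / 2 / 2, r * (1 - s n) / 2, by have := hs1 n; have := sub_pos.2 this; positivity,
      by have := sub_pos.2 (hs1 n); linarith [mul_pos hr0 this]⟩
  have hball : ∀ n, ∀ x ∈ S n, Metric.closedBall x (b n).rOut ⊆ O := fun n x hx =>
    closedBall_subset_of_dilation hc hr hr0 (hs0 n) (hs1 n) hx
  have hSO : ∀ n, S n ⊆ O := fun n x hx =>
    hball n x hx (Metric.mem_closedBall_self (b n).rOut_pos.le)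
  have hSev : ∀ x ∈ O, ∀ᶠ n in Filter.atTop, x ∈ S n := fun x hx => by
    have : Filter.Tendsto (fun n => x₀ + (s n)⁻¹ • (x - x₀)) Filter.atTop
        (nhds (x₀ + (1 : ℝ)⁻¹ • (x - x₀))) :=
      tendsto_const_nhds.add ((hslim.inv₀ one_ne_zero).smul_const _)
    rw [inv_one, one_smul, add_sub_cancel] at this
    exact this (hO.mem_nhds hx)
  let w : ℕ → Eu d → ℝ := fun n => mollify (b n) O φ
  have hwC : ∀ n, ContDiff ℝ 1 (w n) := fun n => contDiff_mollify (b n) hOm hb hφ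
  have hbr : Filter.Tendsto (fun n => (b n).rOut) Filter.atTop (nhds 0) := by
    have : Filter.Tendsto (fun n => r * (1 - s n) / 2) Filter.atTop (nhds (r * (1 - 1) / 2)) :=
      ((hslim.const_sub 1).const_mul r).div_const 2
    simpa using this
  have hae : ∀ᵐ x ∂(volume.restrict O), Filter.Tendsto (fun n => w n x) Filter.atTop (nhds (φ x)) := by
    have := ContDiffBump.ae_convolution_tendsto_right_of_locallyIntegrable (K := 2) hbr
      (Filter.Eventually.of_forall fun n => by
        change r * (1 - s n) / 2 ≤ 2 * (r * (1 - s n) / 2 / 2); linarith)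
      (integrable_indicator_of_memLp hOm hb hφ).locallyIntegrable
    rw [ae_restrict_iff' hOm]
    filter_upwards [this] with x hx hxO
    rwa [indicator_of_mem hxO] at hx
  have hn : ∀ n, ∫⁻ x in S n, ∫⁻ y in S n, ‖w n y - w n x‖ₑ ^ 2 ≤
      ENNReal.ofReal (2 ^ d * h ^ 2) * volume O * ∑ i, ∫⁻ x in O, ‖g i x‖ₑ ^ 2 := by
    intro n
    refine (lintegral_lintegral_sub_sq_le (hSo n).measurableSet (hSc n)
      (fun x hx y hy => hh x (hSO n hx) y (hSO n hy)) (hwC n)).trans ?_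
    have h1 : ∫⁻ x in S n, ‖fderiv ℝ (w n) x‖ₑ ^ 2 ≤ ∑ i, ∫⁻ x in O, ‖g i x‖ₑ ^ 2 := by
      simp_rw [enorm_fderiv_sq]
      rw [lintegral_finsetSum']
      · refine Finset.sum_le_sum fun i _ => ?_
        calc _ = ∫⁻ x in S n, ‖mollify (b n) O (g i) x‖ₑ ^ 2 :=
              setLIntegral_congr_fun (hSo n).measurableSet fun x hx => by
                simp only [w, fderiv_mollify (b n) hOm hb hφ (hw i) (hball n x hx)]
          _ ≤ _ := (setLIntegral_le_lintegral _ _).trans (lintegral_mollify_sq_le (b n) hOm (hg i).1)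
      · intro i _
        exact (((((hwC n).continuous_fderiv one_ne_zero).clm_apply
          continuous_const).enorm.measurable).pow_const 2).aemeasurable
    gcongr
    exact hSO n
  -- The smooth inequality holds on S n × S n with a bound independent of n. These products exhaust
  -- O × O and the mollified functions converge almost everywhere, so Fatou's lemma concludes.
  let F : ℕ → Eu d × Eu d → ℝ≥0∞ := fun n =>
    (S n ×ˢ S n).indicator fun z => ‖w n z.2 - w n z.1‖ₑ ^ 2
  have hGm : ∀ n, Measurable fun z : Eu d × Eu d => ‖w n z.2 - w n z.1‖ₑ ^ 2 := fun n => by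
    have := (hwC n).continuous
    exact ((by fun_prop : Continuous fun z : Eu d × Eu d => w n z.2 - w n z.1).enorm.measurable).pow_const 2
  have hFm : ∀ n, Measurable (F n) := fun n =>
    (hGm n).indicator ((hSo n).measurableSet.prod (hSo n).measurableSet)
  have hFint : ∀ n, ∫⁻ z, F n z ∂((volume.restrict O).prod (volume.restrict O)) ≤
      ∫⁻ x in S n, ∫⁻ y in S n, ‖w n y - w n x‖ₑ ^ 2 := by
    intro n
    rw [Measure.prod_restrict, lintegral_indicator ((hSo n).measurableSet.prod (hSo n).measurableSet),
      Measure.restrict_restrict ((hSo n).measurableSet.prod (hSo n).measurableSet),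
      inter_eq_left.2 (prod_mono (hSO n) (hSO n)), ← Measure.prod_restrict,
      lintegral_prod _ (hGm n).aemeasurable]
  have hlim : ∀ᵐ z ∂((volume.restrict O).prod (volume.restrict O)),
      ‖φ z.2 - φ z.1‖ₑ ^ 2 = Filter.liminf (fun n => F n z) Filter.atTop := by
    have e1 := (Measure.quasiMeasurePreserving_fst (μ := (volume.restrict O : Measure (Eu d)))
      (ν := (volume.restrict O : Measure (Eu d)))).ae (hae.and (ae_restrict_mem hOm))
    have e2 := (Measure.quasiMeasurePreserving_snd (μ := (volume.restrict O : Measure (Eu d)))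
      (ν := (volume.restrict O : Measure (Eu d)))).ae (hae.and (ae_restrict_mem hOm))
    filter_upwards [e1, e2] with z h1 h2
    symm
    apply Filter.Tendsto.liminf_eq
    have h3 : Filter.Tendsto (fun n => ‖w n z.2 - w n z.1‖ₑ ^ 2) Filter.atTop
        (nhds (‖φ z.2 - φ z.1‖ₑ ^ 2)) :=
      ENNReal.Tendsto.pow ((continuous_enorm.tendsto _).comp (h2.1.sub h1.1))
    refine h3.congr' ?_
    filter_upwards [hSev _ h1.2, hSev _ h2.2] with n hn1 hn2
    exact (indicator_of_mem (s := S n ×ˢ S n) (a := z) ⟨hn1, hn2⟩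
      (fun z => ‖w n z.2 - w n z.1‖ₑ ^ 2)).symm
  have hφm : AEStronglyMeasurable φ (volume.restrict O) := hφ.1
  calc ∫⁻ x in O, ∫⁻ y in O, ‖φ y - φ x‖ₑ ^ 2
      = ∫⁻ z, ‖φ z.2 - φ z.1‖ₑ ^ 2 ∂((volume.restrict O).prod (volume.restrict O)) := by
        rw [lintegral_prod]
        exact ((hφm.comp_snd.sub hφm.comp_fst).enorm).pow_const 2
    _ = ∫⁻ z, Filter.liminf (fun n => F n z) Filter.atTop
          ∂((volume.restrict O).prod (volume.restrict O)) := lintegral_congr_ae hlim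
    _ ≤ Filter.liminf (fun n => ∫⁻ z, F n z ∂((volume.restrict O).prod (volume.restrict O)))
          Filter.atTop := lintegral_liminf_le hFm
    _ ≤ _ := Filter.liminf_le_of_le (by isBoundedDefault) fun c hc => by
        obtain ⟨n, hn'⟩ := hc.exists
        exact hn'.trans ((hFint n).trans (hn n))

/-- The deviation from the mean is the mean of the differences. Cauchy–Schwarz reduces it to the
double integral, and the volume cancels. -/
theorem lintegral_sub_average_sq_le {O : Set (Eu d)} (hO : IsOpen O) (hc : Convex ℝ O)
    (hb : Bornology.IsBounded O) (hne : O.Nonempty) {h : ℝ} (hh : ∀ x ∈ O, ∀ y ∈ O, ‖x - y‖ ≤ h)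
    {φ : Eu d → ℝ} (hφ : MemLp φ 2 (volume.restrict O)) {g : Fin d → Eu d → ℝ}
    (hg : ∀ i, MemLp (g i) 2 (volume.restrict O)) (hw : ∀ i, HasWeakPartial O i φ (g i)) :
    ∫⁻ x in O, ‖φ x - ⨍ y in O, φ y‖ₑ ^ 2 ≤
      ENNReal.ofReal (2 ^ d * h ^ 2) * ∑ i, ∫⁻ x in O, ‖g i x‖ₑ ^ 2 := by
  have hv0 : volume O ≠ 0 := (hO.measure_pos _ hne).ne'
  have hvt : volume O ≠ ⊤ := hb.measure_lt_top.ne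
  have : IsFiniteMeasure ((volume : Measure (Eu d)).restrict O) := ⟨by simpa using hvt.lt_top⟩
  have : NeZero ((volume : Measure (Eu d)).restrict O) :=
    ⟨fun h0 => hv0 (by rw [← Measure.restrict_apply_univ, h0]; simp)⟩
  have hφi : Integrable φ (volume.restrict O) := hφ.integrable (by norm_num)
  have hpt : ∀ x, ‖φ x - ⨍ y in O, φ y‖ₑ ^ 2 ≤ (volume O)⁻¹ * ∫⁻ y in O, ‖φ y - φ x‖ₑ ^ 2 := by
    intro x
    have h1 : φ x - ⨍ y in O, φ y = - ⨍ y in O, (φ y - φ x) := by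
      rw [average_eq, average_eq, integral_sub hφi (integrable_const _), integral_const, smul_sub,
        smul_smul, inv_mul_cancel₀, one_smul, neg_sub]
      simpa [Measure.real, ENNReal.toReal_eq_zero_iff] using ⟨hv0, hvt⟩
    rw [h1, enorm_neg, average_eq, enorm_smul, mul_pow]
    have h2 : ‖((volume.restrict O).real (univ : Set (Eu d)))⁻¹‖ₑ = (volume O)⁻¹ := by
      rw [← ofReal_norm, Real.norm_of_nonneg (by positivity), ENNReal.ofReal_inv_of_pos]
      · simp [Measure.real, hvt]
      · simpa [Measure.real] using ENNReal.toReal_pos hv0 hvt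
    have h3 : ‖∫ y in O, (φ y - φ x)‖ₑ ^ 2 ≤ volume O * ∫⁻ y in O, ‖φ y - φ x‖ₑ ^ 2 := by
      calc _ ≤ (∫⁻ y in O, ‖φ y - φ x‖ₑ) ^ 2 := by
            gcongr; exact enorm_integral_le_lintegral_enorm _
        _ ≤ _ := by
            have := sq_lintegral_le (hφ.1.sub aestronglyMeasurable_const).enorm (f := fun y => ‖φ y - φ x‖ₑ)
            simpa using this
    rw [h2]
    calc (volume O)⁻¹ ^ 2 * ‖∫ y in O, (φ y - φ x)‖ₑ ^ 2
        ≤ (volume O)⁻¹ ^ 2 * (volume O * ∫⁻ y in O, ‖φ y - φ x‖ₑ ^ 2) := by gcongr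
      _ = (volume O)⁻¹ * ((volume O)⁻¹ * volume O) * ∫⁻ y in O, ‖φ y - φ x‖ₑ ^ 2 := by ring
      _ = _ := by rw [ENNReal.inv_mul_cancel hv0 hvt, mul_one]
  calc _ ≤ ∫⁻ x in O, (volume O)⁻¹ * ∫⁻ y in O, ‖φ y - φ x‖ₑ ^ 2 := lintegral_mono hpt
    _ = (volume O)⁻¹ * ∫⁻ x in O, ∫⁻ y in O, ‖φ y - φ x‖ₑ ^ 2 :=
        lintegral_const_mul' _ _ (ENNReal.inv_ne_top.2 hv0)
    _ ≤ (volume O)⁻¹ * (ENNReal.ofReal (2 ^ d * h ^ 2) * volume O * ∑ i, ∫⁻ x in O, ‖g i x‖ₑ ^ 2) := by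
        gcongr; exact lintegral_sub_sq_le_of_weak hO hc hb hne hh hφ hg hw
    _ = ((volume O)⁻¹ * volume O) * (ENNReal.ofReal (2 ^ d * h ^ 2) * ∑ i, ∫⁻ x in O, ‖g i x‖ₑ ^ 2) := by
        ring
    _ = _ := by rw [ENNReal.inv_mul_cancel hv0 hvt, one_mul]

end

section

/-! ### Polynomial functions -/

/-- The polynomial function of a polynomial in the coordinates. -/
def ev (p : MvPolynomial (Fin d) ℝ) (x : Eu d) : ℝ := MvPolynomial.eval (fun i => x i) p

theorem ev_add (p q : MvPolynomial (Fin d) ℝ) (x : Eu d) : ev (p + q) x = ev p x + ev q x := by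
  simp [ev]

theorem contDiff_ev (p : MvPolynomial (Fin d) ℝ) {n : WithTop ℕ∞} : ContDiff ℝ n (ev p) := by
  induction p using MvPolynomial.induction_on with
  | C a =>
    have : ev (MvPolynomial.C a : MvPolynomial (Fin d) ℝ) = fun _ => a := by ext; simp [ev]
    rw [this]; exact contDiff_const
  | add p q hp hq =>
    have : ev (p + q) = fun x => ev p x + ev q x := by ext x; exact ev_add p q x
    rw [this]; exact hp.add hq
  | mul_X p i hp =>
    have : ev (p * MvPolynomial.X i) = fun x => ev p x * (EuclideanSpace.proj i : Eu d →L[ℝ] ℝ) x := by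
      ext x; simp [ev]
    rw [this]; exact hp.mul (EuclideanSpace.proj (𝕜 := ℝ) i : Eu d →L[ℝ] ℝ).contDiff

theorem continuous_ev (p : MvPolynomial (Fin d) ℝ) : Continuous (ev p) :=
  (contDiff_ev (n := 0) p).continuous

theorem fderiv_ev (p : MvPolynomial (Fin d) ℝ) (x : Eu d) (i : Fin d) :
    fderiv ℝ (ev p) x (EuclideanSpace.single i 1) = ev (MvPolynomial.pderiv i p) x := by
  have hdiff : ∀ p : MvPolynomial (Fin d) ℝ, DifferentiableAt ℝ (ev p) x := fun p =>
    (contDiff_ev (n := 1) p).differentiable one_ne_zero x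
  induction p using MvPolynomial.induction_on with
  | C a =>
    have : ev (MvPolynomial.C a : MvPolynomial (Fin d) ℝ) = fun _ => a := by ext; simp [ev]
    rw [this]; simp [ev]
  | add p q hp hq =>
    have : ev (p + q) = ev p + ev q := by ext x; exact ev_add p q x
    rw [this, fderiv_add (hdiff p) (hdiff q), map_add, ev_add, ← hp, ← hq]; rfl
  | mul_X p j hp =>
    have h1 : ev (p * MvPolynomial.X j) = ev p * ⇑(EuclideanSpace.proj j : Eu d →L[ℝ] ℝ) := by
      ext x; simp [ev]
    have h2 := (hdiff p).hasFDerivAt.mul (EuclideanSpace.proj (𝕜 := ℝ) j : Eu d →L[ℝ] ℝ).hasFDerivAt (x := x)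
    rw [h1, h2.fderiv]
    simp only [add_apply, smul_apply, hp, smul_eq_mul,
      EuclideanSpace.coe_proj, MvPolynomial.pderiv_mul, MvPolynomial.pderiv_X, ev, map_add, map_mul,
      MvPolynomial.eval_X]
    by_cases hij : i = j
    · subst hij; simp; ring
    · simp [Ne.symm hij]; ring

theorem MemLp.of_continuous {O : Set (Eu d)} (hb : Bornology.IsBounded O)
    {f : Eu d → ℝ} (hf : Continuous f) : MemLp f 2 (volume.restrict O) := by
  have : IsFiniteMeasure ((volume : Measure (Eu d)).restrict O) :=
    ⟨by simpa using hb.measure_lt_top⟩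
  obtain ⟨R, hR⟩ := hb.subset_closedBall 0
  obtain ⟨B, hB⟩ := (isCompact_closedBall (0 : Eu d) R).exists_bound_of_continuousOn hf.continuousOn
  have : ∀ᵐ x ∂((volume : Measure (Eu d)).restrict (Metric.closedBall 0 R)), ‖f x‖ ≤ B :=
    ae_restrict_of_forall_mem Metric.isClosed_closedBall.measurableSet hB
  exact MemLp.of_bound hf.aestronglyMeasurable B (ae_mono (Measure.restrict_mono hR le_rfl) this)

theorem hasWeakPartial_of_contDiff {O : Set (Eu d)} {p : Eu d → ℝ}
    (hp : ContDiff ℝ 1 p) (i : Fin d) :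
    HasWeakPartial O i p fun x => fderiv ℝ p x (EuclideanSpace.single i 1) := by
  intro ψ hψ
  have e1 : ∀ f : Eu d → ℝ, (∀ x ∉ O, f x = 0) → ∫ x in O, f x = ∫ x, f x := fun f hf =>
    setIntegral_eq_integral_of_forall_compl_eq_zero hf
  rw [e1 _ fun x hx => by rw [(hψ.fderiv_apply _).eq_zero_of_notMem hx, mul_zero],
    e1 _ fun x hx => by rw [hψ.eq_zero_of_notMem hx, mul_zero]]
  apply integral_mul_fderiv_eq_neg_fderiv_mul_of_integrable
  · exact (((hp.continuous_fderiv one_ne_zero).clm_apply continuous_const).mul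
      hψ.continuous).integrable_of_hasCompactSupport hψ.2.1.mul_left
  · exact (hp.continuous.mul (hψ.fderiv_apply _).continuous).integrable_of_hasCompactSupport
      (hψ.fderiv_apply _).2.1.mul_left
  · exact (hp.continuous.mul hψ.continuous).integrable_of_hasCompactSupport hψ.2.1.mul_left
  · exact fun x _ => hp.differentiable one_ne_zero x
  · exact fun x _ => hψ.differentiable x

theorem integrable_mul_of_memLp {O : Set (Eu d)} {f g : Eu d → ℝ}
    (hf : MemLp f 2 (volume.restrict O)) (hg : MemLp g 2 (volume.restrict O)) :
    Integrable (fun x => f x * g x) (volume.restrict O) :=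
  hf.integrable_mul hg

theorem HasWeakPartial.sub {O : Set (Eu d)} {i : Fin d} {φ g φ' g' : Eu d → ℝ}
    (h : HasWeakPartial O i φ g) (h' : HasWeakPartial O i φ' g')
    (m1 : MemLp φ 2 (volume.restrict O)) (m2 : MemLp g 2 (volume.restrict O))
    (m3 : MemLp φ' 2 (volume.restrict O)) (m4 : MemLp g' 2 (volume.restrict O)) :
    HasWeakPartial O i (fun x => φ x - φ' x) (fun x => g x - g' x) := by
  intro ψ hψ
  have a1 := hψ.memLp (volume.restrict O) 2
  have a2 := (hψ.fderiv_apply (EuclideanSpace.single i 1)).memLp (volume.restrict O) 2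
  simp_rw [sub_mul]
  rw [integral_sub (integrable_mul_of_memLp m1 a2) (integrable_mul_of_memLp m3 a2),
    integral_sub (integrable_mul_of_memLp m2 a1) (integrable_mul_of_memLp m4 a1), h ψ hψ, h' ψ hψ]
  ring

theorem HasWeakPartial.congr {O : Set (Eu d)} {i : Fin d} {φ g φ' g' : Eu d → ℝ}
    (h : HasWeakPartial O i φ g) (h1 : φ =ᵐ[volume.restrict O] φ')
    (h2 : g =ᵐ[volume.restrict O] g') : HasWeakPartial O i φ' g' := by
  intro ψ hψ
  have e1 := integral_congr_ae (h1.mul (ae_eq_refl (fun x => fderiv ℝ ψ x (EuclideanSpace.single i 1))))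
  have e2 := integral_congr_ae (h2.mul (ae_eq_refl ψ))
  exact e1.symm.trans ((h ψ hψ).trans (congrArg Neg.neg e2))

theorem ae_eq_of_forall_test {O : Set (Eu d)} (hO : IsOpen O) {f g : Eu d → ℝ}
    (hf : MemLp f 2 (volume.restrict O)) (hg : MemLp g 2 (volume.restrict O))
    (h : ∀ ψ, IsTestFunction O ψ → ∫ x in O, f x * ψ x = ∫ x in O, g x * ψ x) :
    f =ᵐ[volume.restrict O] g := by
  have hli : LocallyIntegrableOn (fun x => f x - g x) O volume := by
    have := locallyIntegrableOn_of_L2 hO (hf.sub hg).toLp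
    intro x hx
    obtain ⟨s, hs, hsi⟩ := this x hx
    refine ⟨s ∩ O, Filter.inter_mem hs self_mem_nhdsWithin, (hsi.mono_set inter_subset_left).congr ?_⟩
    have e1 := (hf.sub hg).coeFn_toLp
    exact ae_mono (Measure.restrict_mono inter_subset_right le_rfl) e1
  have := hO.ae_eq_zero_of_integral_contDiff_smul_eq_zero hli fun ψ h1 h2 h3 => by
    have hψ : IsTestFunction O ψ := ⟨h1, h2, h3⟩
    have a1 := hψ.memLp (volume.restrict O) 2
    rw [← setIntegral_eq_integral_of_forall_compl_eq_zero (s := O)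
      fun x hx => by rw [hψ.eq_zero_of_notMem hx, zero_smul]]
    have h4 : ∀ x, ψ x • (f x - g x) = f x * ψ x - g x * ψ x := fun x => by
      rw [smul_eq_mul]; ring
    simp_rw [h4]
    rw [integral_sub (integrable_mul_of_memLp hf a1) (integrable_mul_of_memLp hg a1), h ψ hψ, sub_self]
  rw [Filter.EventuallyEq, ae_restrict_iff' hO.measurableSet]
  filter_upwards [this] with x hx hxO
  exact sub_eq_zero.1 (hx hxO)

theorem HasWeakPartial.unique {O : Set (Eu d)} (hO : IsOpen O) {i : Fin d} {φ g g' : Eu d → ℝ}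
    (h : HasWeakPartial O i φ g) (h' : HasWeakPartial O i φ g')
    (m : MemLp g 2 (volume.restrict O)) (m' : MemLp g' 2 (volume.restrict O)) :
    g =ᵐ[volume.restrict O] g' :=
  ae_eq_of_forall_test hO m m' fun ψ hψ => by
    have := (h ψ hψ).symm.trans (h' ψ hψ); linarith

/-! ### Iterated partial derivatives of polynomials by multi-indices -/

/-- The iterated partial derivative of multi-order `a`. -/
def polyDeriv (a : Fin d →₀ ℕ) : MvPolynomial (Fin d) ℝ →ₗ[ℝ] MvPolynomial (Fin d) ℝ :=
  (MvPolynomial.basisMonomials (Fin d) ℝ).constr ℝ fun b =>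
    MvPolynomial.monomial (b - a) (∏ i, ((b i).descFactorial (a i) : ℝ))

theorem polyDeriv_monomial (a b : Fin d →₀ ℕ) (c : ℝ) : polyDeriv a (MvPolynomial.monomial b c) =
    MvPolynomial.monomial (b - a) (c * ∏ i, ((b i).descFactorial (a i) : ℝ)) := by
  have h1 : MvPolynomial.monomial b c = c • MvPolynomial.basisMonomials (Fin d) ℝ b := by
    simp [MvPolynomial.smul_monomial]
  rw [h1, map_smul, polyDeriv, Module.Basis.constr_basis, MvPolynomial.smul_monomial, smul_eq_mul]

theorem polyDeriv_zero (p : MvPolynomial (Fin d) ℝ) : polyDeriv 0 p = p := by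
  induction p using MvPolynomial.induction_on' with
  | monomial b c => rw [polyDeriv_monomial]; simp
  | add p q hp hq => rw [map_add, hp, hq]

theorem pderiv_polyDeriv (i : Fin d) (a : Fin d →₀ ℕ) (p : MvPolynomial (Fin d) ℝ) :
    MvPolynomial.pderiv i (polyDeriv a p) = polyDeriv (a + Finsupp.single i 1) p := by
  induction p using MvPolynomial.induction_on' with
  | add p q hp hq => rw [map_add, map_add, map_add, hp, hq]
  | monomial b c =>
    rw [polyDeriv_monomial, polyDeriv_monomial, MvPolynomial.pderiv_monomial, tsub_tsub, mul_assoc]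
    congr 2
    rw [← Finset.mul_prod_erase _ _ (Finset.mem_univ i), ← Finset.mul_prod_erase Finset.univ
      (fun j => ((b j).descFactorial ((a + Finsupp.single i 1 : Fin d →₀ ℕ) j) : ℝ)) (Finset.mem_univ i)]
    have h1 : ∏ j ∈ Finset.univ.erase i, ((b j).descFactorial ((a + Finsupp.single i 1 : Fin d →₀ ℕ) j) : ℝ) =
        ∏ j ∈ Finset.univ.erase i, ((b j).descFactorial (a j) : ℝ) :=
      Finset.prod_congr rfl fun j hj => by
        simp [(Finset.ne_of_mem_erase hj).symm]
    rw [h1]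
    simp [Nat.descFactorial_succ]
    ring

theorem polyDeriv_single (i : Fin d) (p : MvPolynomial (Fin d) ℝ) :
    polyDeriv (Finsupp.single i 1) p = MvPolynomial.pderiv i p := by
  conv_rhs => rw [← polyDeriv_zero p]
  rw [pderiv_polyDeriv, zero_add]

/-- The multi-indices of order `m`. -/
def multi (d m : ℕ) : Finset (Fin d →₀ ℕ) := Finset.finsuppAntidiag Finset.univ m

theorem mem_multi {m : ℕ} {a : Fin d →₀ ℕ} : a ∈ multi d m ↔ a.degree = m := by
  simp [multi, Finsupp.degree_eq_sum]

/-- A homogeneous polynomial with prescribed derivatives of top order. -/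
theorem exists_polyDeriv_eq (m : ℕ) (c : (Fin d →₀ ℕ) → ℝ) :
    ∃ p : MvPolynomial (Fin d) ℝ, p.totalDegree ≤ m ∧
      ∀ a ∈ multi d m, polyDeriv a p = MvPolynomial.C (c a) := by
  -- The derivative of order b of the monomial x^b is b!. Any other multi-index of the same order
  -- exceeds b in some coordinate, so the corresponding derivative annihilates x^b.
  refine ⟨∑ b ∈ multi d m, MvPolynomial.monomial b (c b / ∏ i, ((b i).factorial : ℝ)), ?_, ?_⟩
  · refine (MvPolynomial.totalDegree_finsetSum_le fun b hb => ?_)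
    refine (MvPolynomial.totalDegree_monomial_le _ _).trans ?_
    rw [mem_multi] at hb
    exact hb.le
  · intro a ha
    rw [map_sum, Finset.sum_eq_single a]
    · rw [polyDeriv_monomial, tsub_self]
      have : (∏ i, ((a i).factorial : ℝ)) ≠ 0 :=
        Finset.prod_ne_zero_iff.2 fun i _ => by positivity
      simp_rw [Nat.descFactorial_self]
      rw [div_mul_cancel₀ _ this, MvPolynomial.C_apply]
    · intro b hb hba
      obtain ⟨i, hi⟩ : ∃ i, b i < a i := by
        by_contra! hcon
        refine hba (Finsupp.ext fun i => ?_)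
        rw [mem_multi, Finsupp.degree_eq_sum] at ha hb
        have := (Finset.sum_eq_sum_iff_of_le (s := Finset.univ) fun i _ => hcon i).1 (ha.trans hb.symm)
        exact (this i (Finset.mem_univ i)).symm
      have h0 : ((b i).descFactorial (a i) : ℝ) = 0 := by rw [Nat.descFactorial_of_lt hi, Nat.cast_zero]
      have hz : ∏ i, ((b i).descFactorial (a i) : ℝ) = 0 := Finset.prod_eq_zero (Finset.mem_univ i) h0
      rw [polyDeriv_monomial, hz, mul_zero, map_zero]
    · intro h; exact absurd ha h

/-! ### The Bramble–Hilbert lemma on convex sets -/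

/-- A family of weak derivatives up to order `m` in `L²(O)`, indexed by multi-indices. -/
structure WeakJet (O : Set (Eu d)) (m : ℕ) (G : (Fin d →₀ ℕ) → Eu d → ℝ) : Prop where
  memLp : ∀ a, a.degree ≤ m → MemLp (G a) 2 (volume.restrict O)
  partial_ : ∀ a, a.degree < m → ∀ i, HasWeakPartial O i (G a) (G (a + Finsupp.single i 1))

theorem WeakJet.mono {O : Set (Eu d)} {m n : ℕ} {G : (Fin d →₀ ℕ) → Eu d → ℝ} (h : WeakJet O n G)
    (hmn : m ≤ n) : WeakJet O m G :=
  ⟨fun a ha => h.memLp a (ha.trans hmn), fun a ha i => h.partial_ a (ha.trans_le hmn) i⟩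

theorem WeakJet.sub_poly {O : Set (Eu d)} (hb : Bornology.IsBounded O) {m : ℕ}
    {G : (Fin d →₀ ℕ) → Eu d → ℝ} (h : WeakJet O m G) (p : MvPolynomial (Fin d) ℝ) :
    WeakJet O m fun a x => G a x - ev (polyDeriv a p) x := by
  have hm : ∀ a, MemLp (ev (polyDeriv a p)) 2 (volume.restrict O) := fun a =>
    MemLp.of_continuous hb (continuous_ev _)
  have hdeg : ∀ (a : Fin d →₀ ℕ) i, (a + Finsupp.single i 1).degree = a.degree + 1 := by simp
  refine ⟨fun a ha => (h.memLp a ha).sub (hm a), fun a ha i => ?_⟩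
  have := hasWeakPartial_of_contDiff (O := O) (contDiff_ev (polyDeriv a p)) i
  simp_rw [fderiv_ev, pderiv_polyDeriv] at this
  exact (h.partial_ a ha i).sub this (h.memLp a ha.le) (h.memLp _ (by rw [hdeg]; exact ha)) (hm _) (hm _)

/-- Induction on the order. One subtracts a homogeneous polynomial whose top derivatives are the
averages of the top entries of the jet in question. Poincaré then bounds these entries by those one
order higher, and the induction hypothesis applies to the rest. Each application of Poincaré costs a
factor 2^d d h²; the bound on the first derivatives uses one application fewer. Averages make this
work on any bounded convex open set, with explicit constants and without compactness. -/
theorem bramble_hilbert {O : Set (Eu d)} (hO : IsOpen O) (hc : Convex ℝ O)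
    (hb : Bornology.IsBounded O) (hne : O.Nonempty) {h : ℝ} (hh : ∀ x ∈ O, ∀ y ∈ O, ‖x - y‖ ≤ h)
    (m : ℕ) : ∀ G, WeakJet O (m + 1) G → ∃ p : MvPolynomial (Fin d) ℝ, p.totalDegree ≤ m ∧
      (∫⁻ x in O, ‖G 0 x - ev p x‖ₑ ^ 2 ≤ ENNReal.ofReal (2 ^ d * d * h ^ 2) ^ (m + 1) *
        ∑ a ∈ multi d (m + 1), ∫⁻ x in O, ‖G a x‖ₑ ^ 2) ∧
      ∀ i, ∫⁻ x in O, ‖G (Finsupp.single i 1) x - ev (MvPolynomial.pderiv i p) x‖ₑ ^ 2 ≤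
        ENNReal.ofReal (2 ^ d * d * h ^ 2) ^ m *
          ∑ a ∈ multi d (m + 1), ∫⁻ x in O, ‖G a x‖ₑ ^ 2 := by
  have hdeg : ∀ (a : Fin d →₀ ℕ) i, (a + Finsupp.single i 1).degree = a.degree + 1 := by simp
  have key : ∀ m G, WeakJet O (m + 1) G → ∀ c : (Fin d →₀ ℕ) → ℝ,
      (∀ a, c a = ⨍ x in O, G a x) →
      ∑ a ∈ multi d m, ∫⁻ x in O, ‖G a x - c a‖ₑ ^ 2 ≤ ENNReal.ofReal (2 ^ d * d * h ^ 2) *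
        ∑ a ∈ multi d (m + 1), ∫⁻ x in O, ‖G a x‖ₑ ^ 2 := by
    intro m G hG c hcm
    have h1 : ∀ a ∈ multi d m, ∫⁻ x in O, ‖G a x - c a‖ₑ ^ 2 ≤ ENNReal.ofReal (2 ^ d * h ^ 2) *
        ∑ i, ∫⁻ x in O, ‖G (a + Finsupp.single i 1) x‖ₑ ^ 2 := by
      intro a ha
      rw [mem_multi] at ha
      rw [hcm]
      exact lintegral_sub_average_sq_le hO hc hb hne hh (hG.memLp a (by omega))
        (fun i => hG.memLp _ (by rw [hdeg]; omega)) (fun i => hG.partial_ a (by omega) i)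
    refine (Finset.sum_le_sum h1).trans ?_
    rw [← Finset.mul_sum, Finset.sum_comm]
    -- For a fixed direction i the shift a ↦ a + eᵢ is injective, so each direction contributes at
    -- most the full sum over the next order. The d directions give the factor d.
    have h2 : ∀ i ∈ (Finset.univ : Finset (Fin d)),
        ∑ a ∈ multi d m, ∫⁻ x in O, ‖G (a + Finsupp.single i 1) x‖ₑ ^ 2 ≤
        ∑ a ∈ multi d (m + 1), ∫⁻ x in O, ‖G a x‖ₑ ^ 2 := by
      intro i _
      rw [← Finset.sum_image (g := fun a => a + Finsupp.single i 1)
        (f := fun a => ∫⁻ x in O, ‖G a x‖ₑ ^ 2) (by intro a _ b _ hab; exact add_right_cancel hab)]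
      refine Finset.sum_le_sum_of_subset fun a ha => ?_
      obtain ⟨b, hb', rfl⟩ := Finset.mem_image.1 ha
      rw [mem_multi] at hb' ⊢
      rw [hdeg, hb']
    refine (mul_le_mul_right (Finset.sum_le_sum h2) _).trans (le_of_eq ?_)
    rw [Finset.sum_const, Finset.card_univ, Fintype.card_fin, nsmul_eq_mul, ← mul_assoc,
      ← ENNReal.ofReal_natCast, ← ENNReal.ofReal_mul (by positivity)]
    congr 2; ring
  induction m with
  | zero =>
    intro G hG
    refine ⟨MvPolynomial.C (⨍ x in O, G 0 x), by simp, ?_, ?_⟩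
    · have := key 0 G hG _ fun a => rfl
      have h0 : multi d 0 = {0} := by ext a; simp [mem_multi, Finsupp.degree_eq_zero_iff]
      rw [h0, Finset.sum_singleton] at this
      simpa [ev] using this
    · intro i
      simp only [MvPolynomial.pderiv_C, ev, map_zero, sub_zero, pow_zero, one_mul]
      exact Finset.single_le_sum (f := fun a => ∫⁻ x in O, ‖G a x‖ₑ ^ 2) (fun _ _ => zero_le)
        (by simp [mem_multi] : Finsupp.single i 1 ∈ multi d (0 + 1))
  | succ m ih =>
    intro G hG
    obtain ⟨p, hp, hpd⟩ := exists_polyDeriv_eq (m + 1) fun a => ⨍ x in O, G a x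
    obtain ⟨q, hq, hq0, hq1⟩ := ih _ ((hG.mono (Nat.le_succ _)).sub_poly hb p)
    have hS : ∑ a ∈ multi d (m + 1), ∫⁻ x in O, ‖G a x - ev (polyDeriv a p) x‖ₑ ^ 2 ≤
        ENNReal.ofReal (2 ^ d * d * h ^ 2) *
          ∑ a ∈ multi d (m + 1 + 1), ∫⁻ x in O, ‖G a x‖ₑ ^ 2 := by
      refine le_trans (le_of_eq (Finset.sum_congr rfl fun a ha => ?_)) (key (m + 1) G hG _ fun a => rfl)
      rw [hpd a ha]; simp [ev]
    refine ⟨p + q, (MvPolynomial.totalDegree_add _ _).trans (max_le hp (hq.trans (Nat.le_succ _))), ?_, ?_⟩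
    · rw [pow_succ _ (m + 1), mul_assoc]
      refine le_trans (le_of_eq ?_) (hq0.trans (mul_le_mul_right hS _))
      simp_rw [polyDeriv_zero, ev_add, sub_sub]
    · intro i
      rw [pow_succ _ m, mul_assoc]
      refine le_trans (le_of_eq ?_) ((hq1 i).trans (mul_le_mul_right hS _))
      simp_rw [polyDeriv_single, map_add, ev_add, sub_sub]

end

section

/-! ### From weak derivatives of `Fin`-indexed order to jets -/

/-- Iterated partial derivatives along a list of directions. -/
def listDeriv (l : List (Fin d)) (ψ : Eu d → ℝ) : Eu d → ℝ :=
  l.foldr (fun i χ x => fderiv ℝ χ x (EuclideanSpace.single i 1)) ψ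

theorem contDiff_listDeriv (l : List (Fin d)) {ψ : Eu d → ℝ} (h : ContDiff ℝ ∞ ψ) :
    ContDiff ℝ ∞ (listDeriv l ψ) := by
  induction l with
  | nil => exact h
  | cons i l ih =>
    have h1 : ContDiff ℝ ∞ fun x => fderiv ℝ (listDeriv l ψ) x (EuclideanSpace.single i 1) :=
      (ih.fderiv_right (m := ∞) (by simp)).clm_apply contDiff_const
    exact h1

theorem fderiv_fderiv_comm {χ : Eu d → ℝ} (h : ContDiff ℝ ∞ χ) (e e' x : Eu d) :
    fderiv ℝ (fun y => fderiv ℝ χ y e) x e' = fderiv ℝ (fun y => fderiv ℝ χ y e') x e := by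
  have hd : DifferentiableAt ℝ (fderiv ℝ χ) x :=
    ((h.fderiv_right (m := ∞) (by simp)).differentiable (by simp)) x
  have h1 : ∀ a b : Eu d, fderiv ℝ (fun y => fderiv ℝ χ y a) x b = fderiv ℝ (fderiv ℝ χ) x b a := by
    intro a b
    have := hd.hasFDerivAt.clm_apply (hasFDerivAt_const a x)
    rw [this.fderiv]; simp
  rw [h1, h1]
  have hs : IsSymmSndFDerivAt ℝ χ x := (h.contDiffAt).isSymmSndFDerivAt
    (by simpa using WithTop.coe_le_coe.2 (le_top : (2 : ℕ∞) ≤ ⊤))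
  exact hs e' e

/-- Symmetry of second derivatives, applied to the adjacent transpositions that generate
permutations. -/
theorem listDeriv_perm {l l' : List (Fin d)} (hl : l.Perm l') {ψ : Eu d → ℝ} (h : ContDiff ℝ ∞ ψ) :
    listDeriv l ψ = listDeriv l' ψ := by
  induction hl with
  | nil => rfl
  | cons i _ ih =>
    change (fun x => fderiv ℝ (listDeriv _ ψ) x _) = fun x => fderiv ℝ (listDeriv _ ψ) x _
    rw [ih]
  | swap i j l =>
    ext x
    exact fderiv_fderiv_comm (contDiff_listDeriv l h) _ _ x
  | trans _ _ ih1 ih2 => rw [ih1, ih2]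

theorem listDeriv_concat (l : List (Fin d)) (i : Fin d) (ψ : Eu d → ℝ) :
    listDeriv (l ++ [i]) ψ = listDeriv l fun x => fderiv ℝ ψ x (EuclideanSpace.single i 1) := by
  simp [listDeriv, List.foldr_append]

theorem iteratedFDeriv_eq_listDeriv {ψ : Eu d → ℝ} (h : ContDiff ℝ ∞ ψ) {r : ℕ} (j : Fin r → Fin d)
    (x : Eu d) : iteratedFDeriv ℝ r ψ x (fun i => EuclideanSpace.single (j i) 1) =
      listDeriv (List.ofFn j) ψ x := by
  induction r generalizing x with
  | zero => simp [listDeriv]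
  | succ r ih =>
    rw [DifferentiableAt.iteratedFDeriv_succ_apply_left'
      ((h.differentiable_iteratedFDeriv (by exact_mod_cast WithTop.coe_lt_top _)) x)]
    have h2 : (fun y => iteratedFDeriv ℝ r ψ y (Fin.tail fun i => EuclideanSpace.single (j i) (1 : ℝ)))
        = listDeriv (List.ofFn fun i => j i.succ) ψ := by
      ext y; exact ih (fun i => j i.succ) y
    rw [h2, List.ofFn_succ]; rfl

/-- `g` is the weak derivative of `φ` along the list `l`. -/
def HasListDeriv (O : Set (Eu d)) (l : List (Fin d)) (φ g : Eu d → ℝ) : Prop :=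
  ∀ ψ, IsTestFunction O ψ → ∫ x in O, φ x * listDeriv l ψ x = (-1) ^ l.length * ∫ x in O, g x * ψ x

theorem hasWeakDeriv_iff {O : Set (Eu d)} {r : ℕ} {j : Fin r → Fin d} {φ g : Eu d → ℝ} :
    HasWeakDeriv O j φ g ↔ HasListDeriv O (List.ofFn j) φ g := by
  unfold HasWeakDeriv HasListDeriv
  refine forall₂_congr fun ψ hψ => ?_
  simp_rw [iteratedFDeriv_eq_listDeriv hψ.1 j, List.length_ofFn]

theorem HasWeakDeriv.unique {O : Set (Eu d)} (hO : IsOpen O) {r : ℕ} {j : Fin r → Fin d}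
    {φ : Eu d → ℝ} {g g' : L2 O} (h : HasWeakDeriv O j φ g) (h' : HasWeakDeriv O j φ g') : g = g' := by
  refine Lp.ext (ae_eq_of_forall_test hO (Lp.memLp g) (Lp.memLp g') fun ψ hψ => ?_)
  have := (h ψ hψ).symm.trans (h' ψ hψ)
  exact mul_left_cancel₀ (pow_ne_zero _ (by norm_num)) this

/-- A list of directions with a given multi-index. -/
def multiList (a : Fin d →₀ ℕ) : List (Fin d) := (Finsupp.toMultiset a).toList

theorem length_multiList (a : Fin d →₀ ℕ) : (multiList a).length = a.degree := by
  simp [multiList, Finsupp.card_toMultiset, Finsupp.degree_apply, Finsupp.sum]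

theorem multiList_add_single (a : Fin d →₀ ℕ) (i : Fin d) :
    (multiList (a + Finsupp.single i 1)).Perm (multiList a ++ [i]) := by
  rw [← Multiset.coe_eq_coe]
  simp [multiList, ← Multiset.coe_add]

/-- The definition of the Sobolev space provides each weak derivative of φ separately. Testing
against ∂ᵢψ shows that they fit together, the order of differentiation being immaterial on test
functions. The entry of order zero is chosen to be φ itself. -/
theorem exists_jet {O : Set (Eu d)} {m : ℕ} {φ : Eu d → ℝ}
    (hm : MemSobolev O m φ) (hφ : MemLp φ 2 (volume.restrict O)) :
    ∃ G : (Fin d →₀ ℕ) → L2 O, WeakJet O m (fun a => G a) ∧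
      (∀ a, a.degree ≤ m → HasListDeriv O (multiList a) φ (G a)) ∧
      G 0 =ᵐ[volume.restrict O] φ := by
  have hex : ∀ a : Fin d →₀ ℕ, ∃ g : L2 O, (a = 0 → g = hφ.toLp) ∧
      (a.degree ≤ m → HasListDeriv O (multiList a) φ g) := by
    intro a
    by_cases ha0 : a = 0
    · refine ⟨hφ.toLp, fun _ => rfl, fun _ ψ _ => ?_⟩
      subst ha0
      have : multiList (0 : Fin d →₀ ℕ) = [] := by simp [multiList]
      rw [this]
      simp only [listDeriv, List.foldr_nil, List.length_nil, pow_zero, one_mul]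
      refine integral_congr_ae ?_
      filter_upwards [hφ.coeFn_toLp] with x hx
      rw [hx]
    · by_cases ha : a.degree ≤ m
      · obtain ⟨g, hg⟩ := hm (multiList a).length (by rw [length_multiList]; exact ha) (multiList a).get
        rw [hasWeakDeriv_iff, List.ofFn_get] at hg
        exact ⟨g, fun h => absurd h ha0, fun _ => hg⟩
      · exact ⟨0, fun h => absurd h ha0, fun h => absurd h ha⟩
  choose G hG0 hG using hex
  refine ⟨G, ⟨fun a _ => Lp.memLp _, fun a ha i ψ hψ => ?_⟩, hG, ?_⟩
  · have hdeg : (a + Finsupp.single i 1).degree = a.degree + 1 := by simp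
    have h1 := hG a ha.le _ (hψ.fderiv_apply (EuclideanSpace.single i 1))
    have h2 := hG (a + Finsupp.single i 1) (by rw [hdeg]; exact ha) ψ hψ
    rw [← listDeriv_concat, ← listDeriv_perm (multiList_add_single a i) hψ.1, h2, length_multiList,
      length_multiList, hdeg, pow_succ, mul_assoc] at h1
    have := mul_left_cancel₀ (pow_ne_zero a.degree (by norm_num : (-1 : ℝ) ≠ 0)) h1
    rw [← this]; ring
  · rw [hG0 0 rfl]; exact hφ.coeFn_toLp

theorem sum_le_sum_of_injective {α β : Type*} [Fintype β] {s : Finset α} (J : s → β)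
    (hJ : Function.Injective J) (f : α → ℝ≥0∞) (T : β → ℝ≥0∞) (h : ∀ a : s, f a ≤ T (J a)) :
    ∑ a ∈ s, f a ≤ ∑ b, T b := by
  classical
  rw [← Finset.sum_attach]
  calc _ ≤ ∑ a ∈ s.attach, T (J a) := Finset.sum_le_sum fun a _ => h a
    _ = ∑ b ∈ s.attach.image J, T b := (Finset.sum_image fun a _ b _ h => hJ h).symm
    _ ≤ _ := Finset.sum_le_sum_of_subset (Finset.subset_univ _)

/-- The seminorm sums over ordered tuples of directions, the jet over multi-indices. Choosing one
ordering for each multi-index is injective, and uniqueness of weak derivatives identifies the terms.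
-/
theorem sum_jet_le_seminorm {O : Set (Eu d)} (hO : IsOpen O) {m : ℕ} {φ : Eu d → ℝ}
    (hm : MemSobolev O m φ) {G : (Fin d →₀ ℕ) → L2 O}
    (hG : ∀ a, a.degree ≤ m → HasListDeriv O (multiList a) φ (G a)) :
    ∑ a ∈ multi d m, ∫⁻ x in O, ‖G a x‖ₑ ^ 2 ≤ sobolevSeminormSq O m φ := by
  rw [sobolevSeminormSq, if_pos hm]
  have hlist : ∀ l : List (Fin d), l.length = m → ∃ j : Fin m → Fin d, List.ofFn j = l := by
    rintro l rfl; exact ⟨l.get, List.ofFn_get l⟩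
  choose J hJ using fun a : multi d m => hlist (multiList a.1)
    (by rw [length_multiList, mem_multi.1 a.2])
  have hinj : Function.Injective J := fun a b hab => by
    have h1 : multiList a.1 = multiList b.1 := by rw [← hJ, ← hJ, hab]
    have h2 := congrArg (fun l : List (Fin d) => (l : Multiset (Fin d))) h1
    simp only [multiList, Multiset.coe_toList] at h2
    exact Subtype.ext (by simpa using congrArg Multiset.toFinsupp h2)
  refine sum_le_sum_of_injective J hinj _ _ fun a => le_iInf₂ fun g hg => ?_
  have h1 : HasWeakDeriv O (J a) φ (G a.1) := by
    rw [hasWeakDeriv_iff, hJ]; exact hG a.1 (mem_multi.1 a.2).le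
  rw [← enorm_sq_eq_lintegral, h1.unique hO hg]

variable {Ω : Set (Eu d)}

theorem enorm_sq_eq_sum (x : Eu d) : ‖x‖ₑ ^ 2 = ∑ i, ‖x i‖ₑ ^ 2 := by
  simp_rw [← ofReal_norm, ← ENNReal.ofReal_pow (norm_nonneg _)]
  rw [← ENNReal.ofReal_sum_of_nonneg fun _ _ => by positivity, EuclideanSpace.norm_sq_eq]

theorem hasWeakPartial_grad {O : Set (Eu d)} (hΩ : IsOpen Ω) (hOΩ : O ⊆ Ω) (v : H10 Ω)
    (i : Fin d) : HasWeakPartial O i (fn v) (fun x => grad v x i) := by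
  intro ψ hψ
  have h := integral_fn_mul_fderiv v (hψ.mono (subset_univ _)) (EuclideanSpace.single i 1)
  rw [setIntegral_eq_of_subset_of_forall_sdiff_eq_zero hΩ.measurableSet hOΩ fun x hx => by
      rw [(hψ.fderiv_apply _).eq_zero_of_notMem hx.2, mul_zero],
    setIntegral_eq_of_subset_of_forall_sdiff_eq_zero hΩ.measurableSet hOΩ fun x hx => by
      rw [hψ.eq_zero_of_notMem hx.2, zero_smul, inner_zero_left]] at h
  rw [h]
  simp [real_inner_smul_left, EuclideanSpace.inner_single_left, mul_comm]

theorem memLp_grad_apply {O : Set (Eu d)} (hOΩ : O ⊆ Ω) (v : H10 Ω) (i : Fin d) :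
    MemLp (fun x => grad v x i) 2 (volume.restrict O) :=
  ((EuclideanSpace.proj (𝕜 := ℝ) i).comp_memLp' ((Lp.memLp (grad v)).mono_measure
    (Measure.restrict_mono hOΩ le_rfl)))

/-- Local polynomial approximation of `v` on a convex open subset. -/
theorem exists_local_poly (hΩ : IsOpen Ω) {O : Set (Eu d)} (hO : IsOpen O) (hc : Convex ℝ O)
    (hb : Bornology.IsBounded O) (hne : O.Nonempty) (hOΩ : O ⊆ Ω) {h : ℝ}
    (hh : ∀ x ∈ O, ∀ y ∈ O, ‖x - y‖ ≤ h) (k : ℕ) (v : H10 Ω) (hm : MemSobolev O (k + 1) (fn v)) :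
    ∃ p : MvPolynomial (Fin d) ℝ, p.totalDegree ≤ k ∧
      ∫⁻ x in O, ‖fn v x - ev p x‖ₑ ^ 2 ≤ ENNReal.ofReal (2 ^ d * d * h ^ 2) ^ (k + 1) *
        sobolevSeminormSq O (k + 1) (fn v) ∧
      ∫⁻ x in O, ‖grad v x - gradient (ev p) x‖ₑ ^ 2 ≤ d * ENNReal.ofReal (2 ^ d * d * h ^ 2) ^ k *
          sobolevSeminormSq O (k + 1) (fn v) := by
  have hmem : MemLp (fn v) 2 (volume.restrict O) :=
    (Lp.memLp (fn v)).mono_measure (Measure.restrict_mono hOΩ le_rfl)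
  obtain ⟨G, hG, hGl, hG0⟩ := exists_jet hm hmem
  obtain ⟨p, hp, hp0, hp1⟩ := bramble_hilbert hO hc hb hne hh k _ hG
  have hS := sum_jet_le_seminorm hO hm hGl
  refine ⟨p, hp, ?_, ?_⟩
  · refine le_trans (le_of_eq ?_) (hp0.trans (mul_le_mul_right hS _))
    refine lintegral_congr_ae ?_
    filter_upwards [hG0] with x hx
    rw [hx]
  · have hgr : ∀ i, (fun x => grad v x i) =ᵐ[volume.restrict O] G (Finsupp.single i 1) := fun i => by
      have h1 := hG.partial_ 0 (by simp) i
      rw [zero_add] at h1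
      exact (hasWeakPartial_grad hΩ hOΩ v i).unique hO (h1.congr hG0 (ae_eq_refl _))
        (memLp_grad_apply hOΩ v i) (Lp.memLp _)
    have h2 : ∀ᵐ x ∂(volume.restrict O), ‖grad v x - gradient (ev p) x‖ₑ ^ 2 =
        ∑ i, ‖G (Finsupp.single i 1) x - ev (MvPolynomial.pderiv i p) x‖ₑ ^ 2 := by
      filter_upwards [ae_all_iff.2 hgr] with x hx
      rw [enorm_sq_eq_sum]
      refine Finset.sum_congr rfl fun i _ => ?_
      rw [PiLp.sub_apply, gradient_apply, fderiv_ev, hx i]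
    rw [lintegral_congr_ae h2, lintegral_finsetSum']
    · refine (Finset.sum_le_sum fun i _ => hp1 i).trans ?_
      rw [Finset.sum_const, Finset.card_univ, Fintype.card_fin, nsmul_eq_mul]
      exact (mul_le_mul_right (mul_le_mul_right hS _) _).trans (le_of_eq (mul_assoc _ _ _).symm)
    · intro i _
      exact ((((Lp.aestronglyMeasurable _).sub (continuous_ev _).aestronglyMeasurable)).enorm).pow_const 2

end

section

/-! ### Barycentric coordinates on a simplex -/

/-- An ordered affine basis of `ℝᵈ`: the vertices of a nondegenerate simplex. -/
abbrev Bary (d : ℕ) := AffineBasis (Fin (d + 1)) ℝ (Eu d)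

/-- The closed simplex spanned by an affine basis. -/
def simplex (b : Bary d) : Set (Eu d) := convexHull ℝ (range b)

theorem mem_simplex {b : Bary d} {x : Eu d} : x ∈ simplex b ↔ ∀ i, 0 ≤ b.coord i x := by
  rw [simplex, b.convexHull_eq_nonneg_coord]; rfl

theorem coord_le_one {b : Bary d} {x : Eu d} (hx : x ∈ simplex b) (i : Fin (d + 1)) :
    b.coord i x ≤ 1 := by
  rw [← b.sum_coord_apply_eq_one x]
  exact Finset.single_le_sum (fun j _ => mem_simplex.1 hx j) (Finset.mem_univ i)

theorem isCompact_simplex (b : Bary d) : IsCompact (simplex b) := (finite_range b).isCompact_convexHull _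

theorem convex_simplex (b : Bary d) : Convex ℝ (simplex b) := convex_convexHull ℝ _

theorem measurableSet_simplex (b : Bary d) : MeasurableSet (simplex b) :=
  (isCompact_simplex b).isClosed.measurableSet

theorem interior_simplex (b : Bary d) : interior (simplex b) = {x | ∀ i, 0 < b.coord i x} :=
  b.interior_convexHull

theorem interior_simplex_nonempty (b : Bary d) : (interior (simplex b)).Nonempty := by
  rw [simplex, interior_convexHull_nonempty_iff_affineSpan_eq_top]; exact b.tot

theorem volume_simplex_ne_top (b : Bary d) : volume (simplex b) ≠ ⊤ :=
  (isCompact_simplex b).measure_lt_top.ne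

theorem volume_simplex_ne_zero (b : Bary d) : volume (simplex b) ≠ 0 :=
  ((isOpen_interior.measure_pos volume (interior_simplex_nonempty b)).trans_le
    (measure_mono interior_subset)).ne'

theorem restrict_interior_simplex (b : Bary d) :
    (volume : Measure (Eu d)).restrict (interior (simplex b)) = volume.restrict (simplex b) := by
  refine Measure.restrict_congr_set ?_
  refine (ae_eq_set.2 ⟨?_, ?_⟩)
  · rw [sdiff_eq_empty.2 interior_subset]; simp
  · refine measure_mono_null ?_ ((convex_simplex b).addHaar_frontier volume)
    exact fun x hx => ⟨subset_closure hx.1, hx.2⟩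

/-- The differential of a barycentric coordinate. -/
def dcoord (b : Bary d) (i : Fin (d + 1)) : Eu d →L[ℝ] ℝ :=
  LinearMap.toContinuousLinearMap (b.coord i).linear

theorem coord_sub (b : Bary d) (i : Fin (d + 1)) (x y : Eu d) :
    b.coord i x - b.coord i y = dcoord b i (x - y) :=
  ((b.coord i).linearMap_vsub x y).symm

theorem hasFDerivAt_coord (b : Bary d) (i : Fin (d + 1)) (x : Eu d) :
    HasFDerivAt (b.coord i) (dcoord b i) x := by
  have : (b.coord i : Eu d → ℝ) = fun y => dcoord b i y + b.coord i 0 := by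
    ext y
    have := coord_sub b i y 0
    rw [sub_zero] at this
    linarith
  rw [this]
  exact (dcoord b i).hasFDerivAt.add_const _

theorem continuous_coord (b : Bary d) (i : Fin (d + 1)) : Continuous (b.coord i) :=
  continuous_iff_continuousAt.2 fun x => (hasFDerivAt_coord b i x).continuousAt

theorem contDiff_coord (b : Bary d) (i : Fin (d + 1)) {n : WithTop ℕ∞} : ContDiff ℝ n (b.coord i) := by
  have : (b.coord i : Eu d → ℝ) = fun y => dcoord b i y + b.coord i 0 := by
    ext y
    have := coord_sub b i y 0
    rw [sub_zero] at this
    linarith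
  rw [this]
  exact (dcoord b i).contDiff.add contDiff_const

/-- A barycentric coordinate takes values in [0, 1] on the simplex, so it varies by at most 1 over
any displacement of length r from the centre of the ball. -/
theorem norm_dcoord_le {b : Bary d} {c : Eu d} {r : ℝ} (hr : 0 < r)
    (hs : Metric.closedBall c r ⊆ simplex b) (i : Fin (d + 1)) : ‖dcoord b i‖ ≤ 1 / r := by
  refine ContinuousLinearMap.opNorm_le_bound _ (by positivity) fun e => ?_
  rcases eq_or_ne e 0 with rfl | he
  · simp
  have hn : 0 < ‖e‖ := norm_pos_iff.2 he
  set e' := (r / ‖e‖) • e with he'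
  have hne : ‖e'‖ = r := by rw [he', norm_smul, Real.norm_of_nonneg (by positivity)]; field_simp
  have h0 : c ∈ simplex b := hs (Metric.mem_closedBall_self hr.le)
  have h1 : c + e' ∈ simplex b := hs (by simp [hne])
  have h2 := coord_sub b i (c + e') c
  rw [add_sub_cancel_left, he', map_smul, smul_eq_mul] at h2
  have h3 : |b.coord i (c + e') - b.coord i c| ≤ 1 := by
    rw [abs_le]
    constructor <;>
      linarith [mem_simplex.1 h0 i, mem_simplex.1 h1 i, coord_le_one h0 i, coord_le_one h1 i]
  rw [h2, abs_mul, abs_of_pos (by positivity : 0 < r / ‖e‖)] at h3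
  rw [Real.norm_eq_abs]
  rw [div_mul_eq_mul_div, div_le_one hn] at h3
  rw [div_mul_eq_mul_div, one_mul, le_div_iff₀ hr]
  linarith

/-- The affine map between simplices. -/
def baryMap (b₀ b : Bary d) (y : Eu d) : Eu d := ∑ i, b₀.coord i y • b i

theorem coord_sum_smul (b : Bary d) {w : Fin (d + 1) → ℝ} (hw : ∑ i, w i = 1) (i : Fin (d + 1)) :
    b.coord i (∑ j, w j • b j) = w i := by
  rw [← Finset.affineCombination_eq_linear_combination _ _ _ hw]
  exact b.coord_apply_combination_of_mem (Finset.mem_univ i) hw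

theorem coord_baryMap (b₀ b : Bary d) (i : Fin (d + 1)) (y : Eu d) :
    b.coord i (baryMap b₀ b y) = b₀.coord i y :=
  coord_sum_smul b (b₀.sum_coord_apply_eq_one y) i

theorem baryMap_baryMap (b₀ b : Bary d) (y : Eu d) : baryMap b b₀ (baryMap b₀ b y) = y := by
  rw [baryMap]
  simp_rw [coord_baryMap]
  exact b₀.linear_combination_coord_eq_self y

theorem baryMap_image (b₀ b : Bary d) : baryMap b₀ b '' simplex b₀ = simplex b := by
  ext x
  constructor
  · rintro ⟨y, hy, rfl⟩
    exact mem_simplex.2 fun i => by rw [coord_baryMap]; exact mem_simplex.1 hy i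
  · intro hx
    exact ⟨baryMap b b₀ x, mem_simplex.2 fun i => by rw [coord_baryMap]; exact mem_simplex.1 hx i,
      baryMap_baryMap _ _ _⟩

/-- Affine change of variables between simplices. -/
theorem lintegral_simplex_comp (b₀ b : Bary d) (f : Eu d → ℝ≥0∞) :
    volume (simplex b₀) * ∫⁻ x in simplex b, f x =
      volume (simplex b) * ∫⁻ y in simplex b₀, f (baryMap b₀ b y) := by
  obtain ⟨L, hL⟩ : ∃ L : Eu d →L[ℝ] Eu d, ∀ y, HasFDerivAt (baryMap b₀ b) L y := by
    refine ⟨∑ i, (dcoord b₀ i).smulRight (b i), fun y => ?_⟩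
    exact HasFDerivAt.fun_sum fun i _ => (hasFDerivAt_coord b₀ i y).smul_const (b i)
  have key : ∀ f : Eu d → ℝ≥0∞, ∫⁻ x in simplex b, f x =
      ENNReal.ofReal |L.det| * ∫⁻ y in simplex b₀, f (baryMap b₀ b y) := by
    intro f
    rw [← baryMap_image b₀ b, lintegral_image_eq_lintegral_abs_det_fderiv_mul volume
      (measurableSet_simplex b₀) (fun y _ => (hL y).hasFDerivWithinAt)
      (fun y _ y' _ h => by rw [← baryMap_baryMap b₀ b y, h, baryMap_baryMap]),
      lintegral_const_mul' _ _ ENNReal.ofReal_ne_top]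
  -- The constant function 1 identifies the determinant with the ratio of the volumes.
  have h1 := key fun _ => 1
  simp only [lintegral_const, one_mul, Measure.restrict_apply MeasurableSet.univ, univ_inter] at h1
  rw [key f, h1]
  ring

/-! ### Polynomials in barycentric coordinates -/

/-- Evaluation of a polynomial in the barycentric coordinates. -/
def bev (b : Bary d) (Q : MvPolynomial (Fin (d + 1)) ℝ) (x : Eu d) : ℝ :=
  MvPolynomial.eval (fun i => b.coord i x) Q

theorem contDiff_bev (b : Bary d) (Q : MvPolynomial (Fin (d + 1)) ℝ) {n : WithTop ℕ∞} :
    ContDiff ℝ n (bev b Q) := by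
  induction Q using MvPolynomial.induction_on with
  | C a =>
    have : bev b (MvPolynomial.C a) = fun _ => a := by ext; simp [bev]
    rw [this]; exact contDiff_const
  | add p q hp hq =>
    have : bev b (p + q) = fun x => bev b p x + bev b q x := by ext; simp [bev]
    rw [this]; exact hp.add hq
  | mul_X p i hp =>
    have : bev b (p * MvPolynomial.X i) = fun x => bev b p x * b.coord i x := by ext; simp [bev]
    rw [this]; exact hp.mul (contDiff_coord b i)

theorem hasFDerivAt_bev (b : Bary d) (Q : MvPolynomial (Fin (d + 1)) ℝ) (x : Eu d) :
    HasFDerivAt (bev b Q) (∑ i, bev b (MvPolynomial.pderiv i Q) x • dcoord b i) x := by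
  induction Q using MvPolynomial.induction_on with
  | C a =>
    have : bev b (MvPolynomial.C a) = fun _ => a := by ext; simp [bev]
    rw [this]
    convert hasFDerivAt_const a x using 1
    simp [bev]
  | add p q hp hq =>
    have : bev b (p + q) = fun x => bev b p x + bev b q x := by ext; simp [bev]
    rw [this]
    refine (hp.add hq).congr_fderiv ?_
    rw [← Finset.sum_add_distrib]
    exact Finset.sum_congr rfl fun i _ => by simp [bev, add_smul]
  | mul_X p j hp =>
    have : bev b (p * MvPolynomial.X j) = fun x => bev b p x * b.coord j x := by ext; simp [bev]
    rw [this]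
    refine (hp.mul (hasFDerivAt_coord b j x)).congr_fderiv ?_
    rw [Finset.smul_sum]
    classical
    have h1 : ∀ i, bev b (MvPolynomial.pderiv i (p * MvPolynomial.X j)) x =
        (if i = j then bev b p x else 0) + b.coord j x * bev b (MvPolynomial.pderiv i p) x := by
      intro i
      rw [Derivation.leibniz, MvPolynomial.pderiv_X]
      by_cases h : i = j
      · subst h; simp [bev]
      · simp [bev, h, Ne.symm h]
    simp_rw [h1, add_smul, Finset.sum_add_distrib, mul_smul]
    congr 1
    rw [Finset.sum_eq_single j] <;> simp +contextual

theorem bev_eq_sum (b : Bary d) {k : ℕ} {Q : MvPolynomial (Fin (d + 1)) ℝ} (hQ : Q.IsHomogeneous k)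
    (x : Eu d) : bev b Q x = ∑ α ∈ Finset.univ.finsuppAntidiag k,
      Q.coeff α * bev b (MvPolynomial.monomial α 1) x := by
  have hsub : Q.support ⊆ Finset.univ.finsuppAntidiag k := by
    intro α hα
    rw [Finset.mem_finsuppAntidiag]
    refine ⟨?_, Finset.subset_univ _⟩
    have := hQ.degree_eq_sum_deg_support hα
    rw [this]
    exact (Finset.sum_subset (Finset.subset_univ _) (fun i _ hi => by simpa using hi)).symm
  conv_lhs => rw [Q.as_sum]
  rw [bev, map_sum]
  refine (Finset.sum_subset hsub fun α _ hα => by simp [MvPolynomial.notMem_support_iff.1 hα]).trans ?_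
  refine Finset.sum_congr rfl fun α _ => ?_
  rw [bev, MvPolynomial.eval_monomial, MvPolynomial.eval_monomial, one_mul]

/-- Every point of the open positive orthant is a positive multiple of the coordinates of an
interior point. By homogeneity Q vanishes on the orthant, which is large enough to force Q = 0. -/
theorem eq_zero_of_bev_eq_zero (b : Bary d) {k : ℕ} {Q : MvPolynomial (Fin (d + 1)) ℝ}
    (hQ : Q.IsHomogeneous k) (h : ∀ x ∈ interior (simplex b), bev b Q x = 0) : Q = 0 := by
  refine MvPolynomial.funext_set (fun _ => Ioi (0 : ℝ)) (fun _ => Ioi_infinite 0) fun y hy => ?_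
  have hy' : ∀ i, 0 < y i := fun i => hy i (mem_univ i)
  have hs : 0 < ∑ i, y i := Finset.sum_pos (fun i _ => hy' i) Finset.univ_nonempty
  set s := ∑ i, y i with hsd
  have hw : ∑ i, y i / s = 1 := by rw [← Finset.sum_div, div_self hs.ne']
  have h1 := h (∑ i, (y i / s) • b i) (by
    rw [interior_simplex]
    exact fun i => by rw [coord_sum_smul b hw]; exact div_pos (hy' i) hs)
  rw [bev] at h1
  simp_rw [coord_sum_smul b hw] at h1
  have h2 : MvPolynomial.eval y Q = s ^ k * MvPolynomial.eval (fun i => y i / s) Q := by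
    rw [MvPolynomial.eval_eq, MvPolynomial.eval_eq, Finset.mul_sum]
    refine Finset.sum_congr rfl fun α hα => ?_
    rw [hQ.degree_eq_sum_deg_support hα, ← Finset.prod_pow_eq_pow_sum, mul_left_comm,
      ← Finset.prod_mul_distrib]
    congr 1
    refine Finset.prod_congr rfl fun i _ => ?_
    rw [← mul_pow, mul_div_cancel₀ _ hs.ne']
  rw [h2, h1]; simp

/-- The coefficients of a homogeneous polynomial in barycentric coordinates are controlled
by its mean square over the simplex. -/
theorem exists_coeff_bound (d k : ℕ) : ∃ C : ℝ≥0∞, C ≠ ⊤ ∧ ∀ (b : Bary d)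
    (Q : MvPolynomial (Fin (d + 1)) ℝ), Q.IsHomogeneous k → ∀ α,
      ‖Q.coeff α‖ₑ ^ 2 * volume (simplex b) ≤ C * ∫⁻ x in simplex b, ‖bev b Q x‖ₑ ^ 2 := by
  classical
  obtain ⟨b₀⟩ : Nonempty (Bary d) := by
    obtain ⟨b⟩ := AffineBasis.exists_affineBasis_of_finiteDimensional (k := ℝ) (P := Eu d)
      (ι := Fin (d + 1)) (by simp)
    exact ⟨b⟩
  set A := (Finset.univ : Finset (Fin (d + 1))).finsuppAntidiag k with hA
  have hLp : ∀ α : A, MemLp (bev b₀ (MvPolynomial.monomial α.1 1)) 2 (volume.restrict (simplex b₀)) :=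
    fun α => MemLp.of_continuous (isCompact_simplex b₀).isBounded (contDiff_bev (n := 0) _ _).continuous
  set T : (A → ℝ) →ₗ[ℝ] L2 (simplex b₀) := Fintype.linearCombination ℝ fun α => (hLp α).toLp _ with hT
  have hTc : ∀ c : A → ℝ, T c =ᵐ[volume.restrict (simplex b₀)]
      bev b₀ (∑ α : A, MvPolynomial.monomial α.1 (c α)) := by
    intro c
    have h1 : ∀ s : Finset A, (∑ α ∈ s, c α • (hLp α).toLp _ : L2 (simplex b₀))
        =ᵐ[volume.restrict (simplex b₀)] bev b₀ (∑ α ∈ s, MvPolynomial.monomial α.1 (c α)) := by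
      intro s
      induction s using Finset.induction_on with
      | empty =>
        filter_upwards [Lp.coeFn_zero ℝ 2 (volume.restrict (simplex b₀))] with x hx
        simpa [bev] using hx
      | insert α s hα ih =>
        rw [Finset.sum_insert hα, Finset.sum_insert hα]
        filter_upwards [ih, Lp.coeFn_add (c α • (hLp α).toLp _)
          (∑ α ∈ s, c α • (hLp α).toLp _ : L2 (simplex b₀)), Lp.coeFn_smul (c α) ((hLp α).toLp _),
          (hLp α).coeFn_toLp] with x h1 h2 h3 h4
        rw [h2, Pi.add_apply, h1, h3, Pi.smul_apply, h4]
        simp [bev, MvPolynomial.eval_monomial]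
    exact h1 Finset.univ
  have hhom : ∀ c : A → ℝ, (∑ α : A, MvPolynomial.monomial α.1 (c α)).IsHomogeneous k := by
    refine fun c => MvPolynomial.IsHomogeneous.sum _ _ _ fun α _ =>
      MvPolynomial.isHomogeneous_monomial _ ?_
    have := (Finset.mem_finsuppAntidiag.1 α.2).1
    rw [← this, Finsupp.degree]
    exact Finset.sum_subset (Finset.subset_univ _) (fun i _ hi => by simpa using hi)
  have hker : LinearMap.ker T = ⊥ := by
    rw [LinearMap.ker_eq_bot']
    intro c hc
    have h1 : bev b₀ (∑ α : A, MvPolynomial.monomial α.1 (c α)) =ᵐ[volume.restrict (interior (simplex b₀))] 0 := by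
      rw [restrict_interior_simplex]
      refine (hTc c).symm.trans ?_
      rw [hc]; exact Lp.coeFn_zero ℝ 2 _
    have h2 := Measure.eqOn_open_of_ae_eq h1 isOpen_interior
      (contDiff_bev (n := 0) _ _).continuous.continuousOn continuousOn_const
    have h3 := eq_zero_of_bev_eq_zero b₀ (hhom c) h2
    ext α
    have h4 := congrArg (MvPolynomial.coeff α.1) h3
    rw [MvPolynomial.coeff_sum, MvPolynomial.coeff_zero, Finset.sum_eq_single α] at h4
    · simpa using h4
    · intro β _ hβ
      rw [MvPolynomial.coeff_monomial, if_neg fun h => hβ (Subtype.ext h)]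
    · simp
  clear_value T
  -- On the reference simplex b₀ the map from coefficients to L² is injective on a
  -- finite-dimensional space, hence bounded below.
  obtain ⟨K, -, hK⟩ := T.exists_antilipschitzWith hker
  refine ⟨(K : ℝ≥0∞) ^ 2 * volume (simplex b₀),
    ENNReal.mul_ne_top (by simp) (volume_simplex_ne_top _), fun b Q hQ α => ?_⟩
  by_cases hα : α ∈ A
  · set c : A → ℝ := fun β => Q.coeff β.1
    have hcb : ∀ x, bev b₀ (∑ β : A, MvPolynomial.monomial β.1 (c β)) x = bev b₀ Q x := by
      intro x
      rw [bev_eq_sum b₀ hQ, bev, map_sum]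
      refine Eq.trans ?_ (Finset.sum_coe_sort A fun α =>
        Q.coeff α * bev b₀ (MvPolynomial.monomial α 1) x)
      refine Finset.sum_congr rfl fun β _ => ?_
      rw [bev, MvPolynomial.eval_monomial, MvPolynomial.eval_monomial, one_mul]
    have h1 : ‖Q.coeff α‖ₑ ≤ K * ‖T c‖ₑ := by
      have h2 : ‖c‖ ≤ K * ‖T c‖ := by
        have := hK.le_mul_dist c 0
        simpa using this
      have h3 := (norm_le_pi_norm c ⟨α, hα⟩).trans h2
      rw [← ofReal_norm, ← ofReal_norm]
      refine (ENNReal.ofReal_le_ofReal h3).trans ?_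
      rw [ENNReal.ofReal_mul K.coe_nonneg, ENNReal.ofReal_coe_nnreal]
    have h0 : ‖T c‖ₑ ^ 2 = ∫⁻ x in simplex b₀, ‖bev b₀ Q x‖ₑ ^ 2 := by
      refine (enorm_sq_eq_lintegral (T c)).trans ?_
      refine lintegral_congr_ae ?_
      filter_upwards [hTc c] with x hx
      rw [hx, hcb]
    have h4 : ‖Q.coeff α‖ₑ ^ 2 ≤ (K : ℝ≥0∞) ^ 2 * ∫⁻ x in simplex b₀, ‖bev b₀ Q x‖ₑ ^ 2 := by
      rw [← h0, ← mul_pow]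
      exact pow_le_pow_left' h1 2
    -- The coefficients do not depend on the simplex, and the mean square of Q is invariant under
    -- affine maps. So the constant for b₀ serves every simplex.
    have h5 := lintegral_simplex_comp b b₀ fun x => ‖bev b₀ Q x‖ₑ ^ 2
    have h6 : ∀ y, bev b₀ Q (baryMap b b₀ y) = bev b Q y := fun y => by
      rw [bev, bev]; simp_rw [coord_baryMap]
    simp_rw [h6] at h5
    refine (mul_le_mul_left h4 _).trans (le_of_eq ?_)
    rw [mul_assoc, mul_comm (lintegral _ _), h5, mul_assoc]
  · have : Q.coeff α = 0 := by
      refine hQ.coeff_eq_zero fun h => hα ?_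
      rw [hA, Finset.mem_finsuppAntidiag]
      refine ⟨?_, Finset.subset_univ _⟩
      rw [← h, Finsupp.degree]
      exact (Finset.sum_subset (Finset.subset_univ _) (fun i _ hi => by simpa using hi)).symm
    simp [this]

end

section

/-! ### Inverse estimate -/

theorem mem_finsuppAntidiag_univ {ι : Type*} [Fintype ι] [DecidableEq ι] {k : ℕ} {α : ι →₀ ℕ} :
    α ∈ (Finset.univ : Finset ι).finsuppAntidiag k ↔ α.degree = k := by
  rw [Finset.mem_finsuppAntidiag, Finsupp.degree]
  rw [← Finset.sum_subset (Finset.subset_univ α.support) (fun i _ hi => by simpa using hi)]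
  simp only [Finset.subset_univ, and_true]
  rfl

theorem norm_gradient_le {f : Eu d → ℝ} {x : Eu d} {f' : Eu d →L[ℝ] ℝ} (h : HasFDerivAt f f' x) :
    ‖gradient f x‖ = ‖f'‖ := by
  rw [norm_gradient, h.fderiv]

/-- The number of monomials of degree `k` in `d + 1` variables. -/
def numMon (d k : ℕ) : ℕ := ((Finset.univ : Finset (Fin (d + 1))).finsuppAntidiag k).card

theorem abs_bev_pderiv_le {b : Bary d} {k : ℕ} {Q : MvPolynomial (Fin (d + 1)) ℝ}
    (hQ : Q.IsHomogeneous k) {M : ℝ} (hM : ∀ α, |Q.coeff α| ≤ M) {x : Eu d} (hx : x ∈ simplex b)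
    (i : Fin (d + 1)) : |bev b (MvPolynomial.pderiv i Q) x| ≤ numMon d k * (M * k) := by
  have hM0 : 0 ≤ M := (abs_nonneg _).trans (hM 0)
  rw [numMon, ← nsmul_eq_mul]
  have h1 : Q = ∑ α ∈ (Finset.univ : Finset (Fin (d + 1))).finsuppAntidiag k,
      MvPolynomial.monomial α (Q.coeff α) := by
    conv_lhs => rw [Q.as_sum]
    refine Finset.sum_subset (fun α hα => ?_) fun α _ hα => by
      simp [MvPolynomial.notMem_support_iff.1 hα]
    exact mem_finsuppAntidiag_univ.2 (by
      by_contra h; exact MvPolynomial.mem_support_iff.1 hα (hQ.coeff_eq_zero h))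
  rw [h1, map_sum, bev, map_sum, ← Finset.sum_const]
  refine (Finset.abs_sum_le_sum_abs _ _).trans (Finset.sum_le_sum fun α hα => ?_)
  rw [MvPolynomial.pderiv_monomial, MvPolynomial.eval_monomial, abs_mul, abs_mul, Finsupp.prod]
  have h2 : |∏ j ∈ (α - Finsupp.single i 1 : Fin (d + 1) →₀ ℕ).support, b.coord j x ^ ((α - Finsupp.single i 1 : Fin (d + 1) →₀ ℕ) j)| ≤ 1 := by
    rw [Finset.abs_prod]
    refine Finset.prod_le_one (fun _ _ => abs_nonneg _) fun j _ => ?_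
    rw [abs_of_nonneg (pow_nonneg (mem_simplex.1 hx j) _)]
    exact pow_le_one₀ (mem_simplex.1 hx j) (coord_le_one hx j)
  have h3 : |(α i : ℝ)| ≤ k := by
    rw [Nat.abs_cast, ← mem_finsuppAntidiag_univ.1 hα]
    exact_mod_cast Finsupp.le_degree i α
  calc _ ≤ M * k * 1 := by
        gcongr
        exact hM _
    _ = _ := mul_one _

theorem norm_gradient_bev_le {b : Bary d} {k : ℕ} {Q : MvPolynomial (Fin (d + 1)) ℝ}
    (hQ : Q.IsHomogeneous k) {M : ℝ} (hM : ∀ α, |Q.coeff α| ≤ M) {x : Eu d} (hx : x ∈ simplex b)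
    {c : Eu d} {r : ℝ} (hr : 0 < r) (hs : Metric.closedBall c r ⊆ simplex b) :
    ‖gradient (bev b Q) x‖ ≤ (d + 1) * (numMon d k * k) * M / r := by
  rw [norm_gradient_le (hasFDerivAt_bev b Q x)]
  have hM0 : 0 ≤ M := (abs_nonneg _).trans (hM 0)
  have h1 : ∀ i, ‖bev b (MvPolynomial.pderiv i Q) x • dcoord b i‖ ≤ numMon d k * (M * k) * (1 / r) := by
    intro i
    rw [norm_smul, Real.norm_eq_abs]
    exact mul_le_mul (abs_bev_pderiv_le hQ hM hx i) (norm_dcoord_le hr hs i) (norm_nonneg _)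
      (by positivity)
  refine (norm_sum_le_of_le _ fun i _ => h1 i).trans (le_of_eq ?_)
  rw [Finset.sum_const, Finset.card_univ, Fintype.card_fin, nsmul_eq_mul]
  push_cast
  ring

theorem enorm_sq_eq_ofReal {F : Type*} [NormedAddCommGroup F] (a : F) :
    ‖a‖ₑ ^ 2 = ENNReal.ofReal (‖a‖ ^ 2) := by
  rw [ENNReal.ofReal_pow (norm_nonneg _), ofReal_norm]

/-- A common bound for the coefficients of a homogeneous polynomial, attained by one of them. -/
theorem exists_coeff_max {σ : Type*} (Q : MvPolynomial σ ℝ) :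
    ∃ β, ∀ α, |Q.coeff α| ≤ |Q.coeff β| := by
  rcases Q.support.eq_empty_or_nonempty with h | h
  · refine ⟨0, fun α => ?_⟩
    rw [MvPolynomial.support_eq_empty] at h; simp [h]
  · obtain ⟨β, -, hβ⟩ := Q.support.exists_max_image (fun α => |Q.coeff α|) h
    refine ⟨β, fun α => ?_⟩
    by_cases hα : α ∈ Q.support
    · exact hβ α hα
    · simp [MvPolynomial.notMem_support_iff.1 hα]

/-- The gradient is at most the largest coefficient times C/r, because coordinates are between 0 and
1 and have slope at most 1/r. The largest coefficient is bounded by the mean square, and the volumes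
cancel. -/
theorem exists_inverse_estimate (d k : ℕ) : ∃ C : ℝ≥0∞, C ≠ ⊤ ∧ ∀ (b : Bary d)
    (Q : MvPolynomial (Fin (d + 1)) ℝ), Q.IsHomogeneous k → ∀ (c : Eu d) (r : ℝ), 0 < r →
      Metric.closedBall c r ⊆ simplex b →
      ENNReal.ofReal (r ^ 2) * ∫⁻ x in simplex b, ‖gradient (bev b Q) x‖ₑ ^ 2 ≤
        C * ∫⁻ x in simplex b, ‖bev b Q x‖ₑ ^ 2 := by
  obtain ⟨C, hC, h⟩ := exists_coeff_bound d k
  set A : ℝ := (d + 1) * (numMon d k * k) with hA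
  refine ⟨ENNReal.ofReal (A ^ 2) * C, ENNReal.mul_ne_top ENNReal.ofReal_ne_top hC,
    fun b Q hQ c r hr hs => ?_⟩
  obtain ⟨β, hβ⟩ := exists_coeff_max Q
  rw [← lintegral_const_mul' _ _ ENNReal.ofReal_ne_top]
  have h1 : ∀ x ∈ simplex b, ENNReal.ofReal (r ^ 2) * ‖gradient (bev b Q) x‖ₑ ^ 2 ≤
      ENNReal.ofReal (A ^ 2) * ‖Q.coeff β‖ₑ ^ 2 := by
    intro x hx
    have h2 := norm_gradient_bev_le hQ hβ hx hr hs
    rw [← hA, le_div_iff₀ hr] at h2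
    rw [enorm_sq_eq_ofReal, enorm_sq_eq_ofReal, ← ENNReal.ofReal_mul (sq_nonneg _),
      ← ENNReal.ofReal_mul (sq_nonneg _), ← mul_pow, ← mul_pow, mul_comm, Real.norm_eq_abs (Q.coeff β)]
    exact ENNReal.ofReal_le_ofReal (pow_le_pow_left₀ (by positivity) h2 2)
  refine (setLIntegral_mono' (measurableSet_simplex b) h1).trans ?_
  rw [setLIntegral_const, mul_assoc, mul_assoc]
  exact mul_le_mul_right (h b Q hQ β) _

/-! ### Homogenization -/

/-- Setting variables to zero is evaluation at an extension by zero. It is used to restrict a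
polynomial in all vertices to one cell, and one in the vertices of a cell to a facet. -/
theorem eval_killCompl {σ τ : Type*} {f : σ → τ} (hf : Function.Injective f) (y : σ → ℝ)
    (p : MvPolynomial τ ℝ) :
    MvPolynomial.eval y (MvPolynomial.killCompl hf p) =
      MvPolynomial.eval (Function.extend f y 0) p := by
  induction p using MvPolynomial.induction_on with
  | C a => simp
  | add p q hp hq => simp [hp, hq]
  | mul_X p i hp =>
    rw [map_mul, map_mul, hp, map_mul]
    congr 1
    rw [MvPolynomial.killCompl, MvPolynomial.aeval_X, MvPolynomial.eval_X]
    split_ifs with h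
    · obtain ⟨j, rfl⟩ := h
      rw [MvPolynomial.eval_X, hf.extend_apply, Equiv.ofInjective_symm_apply]
    · rw [map_zero, Function.extend_apply' _ _ _ h]; rfl

open Classical in
theorem isHomogeneous_killCompl {σ τ : Type*} {f : σ → τ} (hf : Function.Injective f) {k : ℕ}
    {p : MvPolynomial τ ℝ} (hp : p.IsHomogeneous k) :
    (MvPolynomial.killCompl hf p).IsHomogeneous k := by
  have := hp.aeval (S := ℝ) (n := 1) (fun i => if h : i ∈ Set.range f then
    MvPolynomial.X <| (Equiv.ofInjective f hf).symm ⟨i, h⟩ else 0) (fun i => by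
      split_ifs with h
      · exact MvPolynomial.isHomogeneous_X _ _
      · exact MvPolynomial.isHomogeneous_zero _ _ _)
  rw [one_mul] at this
  convert this using 2
  unfold MvPolynomial.killCompl
  congr!

/-- The homogeneous polynomial of degree `k` in the barycentric coordinates with respect to `s`
which represents the polynomial `P` of degree at most `k`. -/
def homogenize (s : Finset (Eu d)) (k : ℕ) (P : MvPolynomial (Fin d) ℝ) : MvPolynomial (Eu d) ℝ :=
  ∑ m ∈ P.support, MvPolynomial.C (P.coeff m) *
    ((∏ i, (∑ v ∈ s, MvPolynomial.C (v i) * MvPolynomial.X v) ^ m i) *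
      (∑ v ∈ s, MvPolynomial.X v) ^ (k - m.degree))

theorem isHomogeneous_homogenize (s : Finset (Eu d)) {k : ℕ} {P : MvPolynomial (Fin d) ℝ}
    (hP : P.totalDegree ≤ k) : (homogenize s k P).IsHomogeneous k := by
  refine MvPolynomial.IsHomogeneous.sum _ _ _ fun m hm => ?_
  have hmk : m.degree ≤ k := (MvPolynomial.le_totalDegree hm).trans hP
  have h1 : (∏ i, (∑ v ∈ s, MvPolynomial.C (v i) * MvPolynomial.X v) ^ m i :
      MvPolynomial (Eu d) ℝ).IsHomogeneous m.degree := by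
    have := MvPolynomial.IsHomogeneous.prod Finset.univ
      (fun i => (∑ v ∈ s, MvPolynomial.C (v i) * MvPolynomial.X v : MvPolynomial (Eu d) ℝ) ^ m i)
      (fun i => 1 * m i) (fun i _ => (MvPolynomial.IsHomogeneous.sum _ _ _ fun v _ =>
        MvPolynomial.isHomogeneous_C_mul_X _ _).pow _)
    convert this using 1
    simp only [one_mul]
    exact Finset.sum_subset (Finset.subset_univ _) (fun i _ hi => by simpa using hi)
  have h2 : ((∑ v ∈ s, MvPolynomial.X v : MvPolynomial (Eu d) ℝ) ^ (k - m.degree)).IsHomogeneous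
      (1 * (k - m.degree)) :=
    (MvPolynomial.IsHomogeneous.sum _ _ _ fun v _ => MvPolynomial.isHomogeneous_X _ _).pow _
  have h3 := (h1.mul h2).C_mul (P.coeff m)
  convert h3 using 1
  omega

theorem eval_homogenize {s : Finset (Eu d)} {k : ℕ} {P : MvPolynomial (Fin d) ℝ} {w : Eu d → ℝ}
    {x : Eu d} (h1 : ∑ v ∈ s, w v = 1) (hx : ∑ v ∈ s, w v • v = x) :
    MvPolynomial.eval w (homogenize s k P) = ev P x := by
  rw [homogenize, ev, MvPolynomial.eval_eq' (fun i => x i), map_sum]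
  refine Finset.sum_congr rfl fun m _ => ?_
  have h2 : ∀ i, ∑ v ∈ s, v i * w v = x i := fun i => by
    rw [← hx]
    simp [mul_comm]
  simp [map_sum, map_prod, h1, h2]

/-! ### Facets -/

/-- The affine projection of a simplex onto its facet opposite to vertex `0`
which moves vertex `0` to vertex `1`. -/
def facetProj (b : Bary (d + 1)) (x : Eu (d + 1)) : Eu (d + 1) := x + b.coord 0 x • (b 1 - b 0)

theorem coord_add_smul (b : Bary (d + 1)) (x : Eu (d + 1)) (t : ℝ) (i : Fin (d + 2)) :
    b.coord i (x + t • (b 1 - b 0)) =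
      b.coord i x + t * ((if i = 1 then 1 else 0) - (if i = 0 then 1 else 0)) := by
  have h1 := coord_sub b i (x + t • (b 1 - b 0)) x
  rw [add_sub_cancel_left, map_smul, ← coord_sub, b.coord_apply, b.coord_apply, smul_eq_mul] at h1
  linarith

theorem coord_facetProj (b : Bary (d + 1)) (x : Eu (d + 1)) :
    (fun i => b.coord i (facetProj b x)) =
      Fin.cons 0 (fun i : Fin (d + 1) => b.coord i.succ x + if i = 0 then b.coord 0 x else 0) := by
  ext i
  rw [facetProj, coord_add_smul]
  refine Fin.cases ?_ (fun j => ?_) i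
  · simp
  · simp only [Fin.cons_succ, Fin.succ_ne_zero, if_false, sub_zero]
    congr 1
    by_cases h : j = 0
    · subst h; simp
    · have : j.succ ≠ 1 := fun h' => h (Fin.succ_injective _ (by simpa using h'))
      simp [h, this]

theorem facetProj_mem {b : Bary (d + 1)} {x : Eu (d + 1)} (hx : x ∈ simplex b) :
    facetProj b x ∈ convexHull ℝ (range fun i : Fin (d + 1) => b i.succ) := by
  have h1 : facetProj b x = ∑ i : Fin (d + 1), (b.coord i.succ (facetProj b x)) • b i.succ := by
    have := b.linear_combination_coord_eq_self (facetProj b x)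
    rw [Fin.sum_univ_succ] at this
    have h0 := congrFun (coord_facetProj b x) 0
    simp only [Fin.cons_zero] at h0
    rw [h0, zero_smul, zero_add] at this
    exact this.symm
  have h2 : ∀ i : Fin (d + 1), 0 ≤ b.coord i.succ (facetProj b x) := fun i => by
    have := congrFun (coord_facetProj b x) i.succ
    simp only [Fin.cons_succ] at this
    rw [this]
    have := mem_simplex.1 hx 0
    have := mem_simplex.1 hx i.succ
    split_ifs <;> linarith
  have h3 : ∑ i : Fin (d + 1), b.coord i.succ (facetProj b x) = 1 := by
    have := b.sum_coord_apply_eq_one (facetProj b x)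
    rw [Fin.sum_univ_succ] at this
    have h0 := congrFun (coord_facetProj b x) 0
    simp only [Fin.cons_zero] at h0
    rwa [h0, zero_add] at this
  rw [h1]
  exact (convex_convexHull ℝ _).sum_mem (fun i _ => h2 i) h3
    fun i _ => subset_convexHull ℝ _ (mem_range_self i)

/-- A trace inequality in volume form: instead of a surface integral, the values at the projections
of the points of the simplex are integrated over the simplex. The segment from x to its projection
is a piece of length at most one, in units of the edge b 1 − b 0, and stays in the simplex. The line
estimate and translation invariance then give the bound. -/
theorem lintegral_trace_le (b : Bary (d + 1)) {g : Eu (d + 1) → ℝ} (hg : ContDiff ℝ 1 g) {h : ℝ}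
    (hh : ‖b 1 - b 0‖ ≤ h) :
    ∫⁻ x in simplex b, ‖g (facetProj b x)‖ₑ ^ 2 ≤ 2 * ((∫⁻ x in simplex b, ‖g x‖ₑ ^ 2) +
      ENNReal.ofReal (h ^ 2) * ∫⁻ x in simplex b, ‖gradient g x‖ₑ ^ 2) := by
  set e := b 1 - b 0 with he
  -- Extended by zero, the directional derivative can be integrated over all shifts without regard
  -- to the shape of the simplex.
  set G : Eu (d + 1) → ℝ≥0∞ := (simplex b).indicator fun x => ‖fderiv ℝ g x e‖ₑ ^ 2 with hG
  have hGm : Measurable G := by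
    refine Measurable.indicator ?_ (measurableSet_simplex b)
    exact (((hg.continuous_fderiv one_ne_zero).clm_apply continuous_const).enorm.measurable.pow_const 2)
  have h1 : ∀ x ∈ simplex b, ‖g (facetProj b x)‖ₑ ^ 2 ≤
      2 * ‖g x‖ₑ ^ 2 + 2 * ∫⁻ t in Ioc (0 : ℝ) 1, G (x + t • e) := by
    intro x hx
    have hl0 := mem_simplex.1 hx 0
    have hl1 := coord_le_one hx 0
    have h2 := enorm_sub_sq_le_line hg x e hl0
    have h3 : ‖g (facetProj b x) - g x‖ₑ ^ 2 ≤ ∫⁻ t in Ioc (0 : ℝ) 1, G (x + t • e) := by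
      refine h2.trans ?_
      calc _ ≤ 1 * ∫⁻ t in Ioc 0 (b.coord 0 x), ‖fderiv ℝ g (x + t • e) e‖ₑ ^ 2 := by
            gcongr
            exact ENNReal.ofReal_le_one.2 hl1
        _ = ∫⁻ t in Ioc 0 (b.coord 0 x), G (x + t • e) := by
            rw [one_mul]
            refine setLIntegral_congr_fun measurableSet_Ioc fun t ht => ?_
            have : x + t • e ∈ simplex b := by
              refine mem_simplex.2 fun i => ?_
              rw [he, coord_add_smul]
              have := mem_simplex.1 hx i
              have h01 : (0 : Fin (d + 2)) ≠ 1 := by simp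
              by_cases hi : i = 0
              · subst hi; simp only [if_neg h01, if_true]; linarith [ht.2]
              · simp only [if_neg hi]; split_ifs <;> linarith [ht.1]
            simp only [hG, indicator_of_mem this]
        _ ≤ _ := lintegral_mono_set (Ioc_subset_Ioc_right hl1)
    have h4 : ‖g (facetProj b x)‖ₑ ^ 2 ≤ 2 * ‖g x‖ₑ ^ 2 + 2 * ‖g (facetProj b x) - g x‖ₑ ^ 2 := by
      rw [enorm_sq_eq_ofReal, enorm_sq_eq_ofReal, enorm_sq_eq_ofReal,
        show (2 : ℝ≥0∞) = ENNReal.ofReal 2 by simp, ← ENNReal.ofReal_mul (by norm_num),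
        ← ENNReal.ofReal_mul (by norm_num), ← ENNReal.ofReal_add (by positivity) (by positivity)]
      refine ENNReal.ofReal_le_ofReal ?_
      simp only [Real.norm_eq_abs, sq_abs]
      nlinarith [sq_nonneg (g (facetProj b x) - 2 * g x)]
    exact h4.trans (by gcongr)
  refine (setLIntegral_mono' (measurableSet_simplex b) h1).trans ?_
  have hgm : Measurable fun x => ‖g x‖ₑ ^ 2 := hg.continuous.enorm.measurable.pow_const 2
  rw [lintegral_add_left (hgm.const_mul 2), lintegral_const_mul' _ _ (by simp),
    lintegral_const_mul' _ _ (by simp), ← mul_add]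
  gcongr
  refine (setLIntegral_le_lintegral _ _).trans ?_
  rw [lintegral_lintegral_shift hGm e 1, ENNReal.ofReal_one, one_mul, hG,
    lintegral_indicator (measurableSet_simplex b), ← lintegral_const_mul' _ _ ENNReal.ofReal_ne_top]
  refine lintegral_mono fun x => ?_
  rw [enorm_sq_eq_ofReal, enorm_sq_eq_ofReal, ← ENNReal.ofReal_mul (sq_nonneg _), ← mul_pow, norm_gradient]
  refine ENNReal.ofReal_le_ofReal (pow_le_pow_left₀ (norm_nonneg _) ?_ 2)
  rw [mul_comm]
  exact (ContinuousLinearMap.le_opNorm _ _).trans (by gcongr)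

/-- The coefficients attached to a facet are controlled by the trace on this facet. -/
theorem exists_facet_coeff_bound (d k : ℕ) : ∃ C : ℝ≥0∞, C ≠ ⊤ ∧ ∀ (b : Bary (d + 1))
    (Q : MvPolynomial (Fin (d + 2)) ℝ), Q.IsHomogeneous k → ∀ β : Fin (d + 1) →₀ ℕ,
      ‖Q.coeff (β.mapDomain Fin.succ)‖ₑ ^ 2 * volume (simplex b) ≤
        C * ∫⁻ x in simplex b, ‖bev b Q (facetProj b x)‖ₑ ^ 2 := by
  obtain ⟨C, hC, h⟩ := exists_coeff_bound (d + 1) k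
  refine ⟨C, hC, fun b Q hQ β => ?_⟩
  have hs : Function.Injective (Fin.succ : Fin (d + 1) → Fin (d + 2)) := Fin.succ_injective _
  -- F expresses the facet coordinates of the projected point by the coordinates of x. Thus Q
  -- composed with the projection is again homogeneous of degree k. Dropping variable 0 undoes the
  -- substitution, so the coefficients on the facet are those of Q and the mean square bound applies
  -- to them.
  set F : Fin (d + 1) → MvPolynomial (Fin (d + 2)) ℝ :=
    fun i => MvPolynomial.X i.succ + if i = 0 then MvPolynomial.X 0 else 0 with hF
  set R := MvPolynomial.killCompl hs Q with hR
  have hRh : R.IsHomogeneous k := isHomogeneous_killCompl hs hQ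
  have h1 : (MvPolynomial.aeval F R).IsHomogeneous k := by
    have := hRh.aeval (S := ℝ) (n := 1) F (fun i => by
      refine (MvPolynomial.isHomogeneous_X _ _).add ?_
      split_ifs
      · exact MvPolynomial.isHomogeneous_X _ _
      · exact MvPolynomial.isHomogeneous_zero _ _ _)
    rwa [one_mul] at this
  have h2 : MvPolynomial.killCompl hs (MvPolynomial.aeval F R) = R := by
    have : (MvPolynomial.killCompl hs).comp (MvPolynomial.aeval F) = AlgHom.id ℝ _ := by
      refine MvPolynomial.algHom_ext fun i => ?_
      rw [AlgHom.comp_apply, MvPolynomial.aeval_X, hF]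
      dsimp only
      rw [map_add, ← MvPolynomial.rename_X Fin.succ, MvPolynomial.killCompl_rename_app]
      have h0 : MvPolynomial.killCompl hs (MvPolynomial.X 0 : MvPolynomial (Fin (d + 2)) ℝ) = 0 := by
        rw [MvPolynomial.killCompl, MvPolynomial.aeval_X, dif_neg]
        rintro ⟨j, hj⟩; exact Fin.succ_ne_zero j hj
      split_ifs <;> simp [h0]
    exact AlgHom.congr_fun this R
  have h3 := h b _ h1 (β.mapDomain Fin.succ)
  rw [← MvPolynomial.coeff_killCompl hs, h2, hR, MvPolynomial.coeff_killCompl hs] at h3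
  refine h3.trans (le_of_eq ?_)
  congr 1
  refine lintegral_congr fun x => ?_
  congr 2
  rw [bev, bev, coord_facetProj, ← MvPolynomial.coe_aeval_eq_eval]
  have h4 : ∀ y : Fin (d + 1) → ℝ, Function.extend Fin.succ y 0 = (Fin.cons 0 y : Fin (d + 2) → ℝ) := by
    intro y; ext i
    refine Fin.cases ?_ (fun j => ?_) i
    · rw [Function.extend_apply' _ _ _ (by rintro ⟨j, hj⟩; exact Fin.succ_ne_zero j hj)]; rfl
    · rw [hs.extend_apply, Fin.cons_succ]
  rw [← h4, ← eval_killCompl hs]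
  change MvPolynomial.aeval _ (MvPolynomial.aeval F R) = _
  rw [← AlgHom.comp_apply, MvPolynomial.comp_aeval, ← MvPolynomial.coe_aeval_eq_eval]
  change _ = MvPolynomial.aeval _ R
  congr 2
  ext i
  simp only [hF, map_add, MvPolynomial.aeval_X]
  split_ifs <;> simp

end

section

/-! ### Geometry of the mesh cells -/

/-- Near a boundary point x the set is strictly above a graph. Moving from x in the direction −e
gives points strictly below the graph, which are not in the closure. So Ω has no slits, and the
interiors of the cells lie in Ω. -/
theorem IsLipschitzDomain.interior_closure {Ω : Set (Eu d)} (hΩ : IsOpen Ω) (h : IsLipschitzDomain Ω) :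
    interior (closure Ω) = Ω := by
  refine Subset.antisymm (fun x hx => ?_) (interior_maximal subset_closure hΩ)
  by_contra hxΩ
  have hfr : x ∈ frontier Ω := ⟨interior_subset hx, by rwa [hΩ.interior_eq]⟩
  obtain ⟨e, he, K, φ, hφ, r, hr, hloc⟩ := h x hfr
  have hx0 : ¬ φ (x - inner ℝ e x • e) < inner ℝ e x :=
    fun h' => hxΩ ((hloc x (Metric.mem_ball_self hr)).2 h')
  have hc : Continuous fun t : ℝ => x - t • e := by fun_prop
  have h1 : ∀ᶠ t in nhds (0 : ℝ), x - t • e ∈ interior (closure Ω) ∩ Metric.ball x r :=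
    hc.continuousAt.eventually ((isOpen_interior.inter Metric.isOpen_ball).mem_nhds
      (by simpa using ⟨hx, hr⟩))
  obtain ⟨t, ht, ht0⟩ := ((h1.filter_mono nhdsWithin_le_nhds).and
    (self_mem_nhdsWithin : Ioi (0 : ℝ) ∈ nhdsWithin 0 (Ioi 0))).exists
  have hcl : x - t • e ∈ closure (Ω ∩ Metric.ball x r) := by
    have := Metric.isOpen_ball.inter_closure (s := Metric.ball x r) (t := Ω)
      ⟨ht.2, interior_subset ht.1⟩
    rwa [inter_comm]
  have hsub : Ω ∩ Metric.ball x r ⊆ {y | φ (y - inner ℝ e y • e) ≤ inner ℝ e y} :=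
    fun y hy => ((hloc y hy.2).1 hy.1).le
  have hclosed : IsClosed {y | φ (y - inner ℝ e y • e) ≤ inner ℝ e y} :=
    isClosed_le (hφ.continuous.comp (by fun_prop)) (by fun_prop)
  have h2 := closure_minimal hsub hclosed hcl
  have h3 : inner ℝ e (x - t • e) = inner ℝ e x - t := by
    rw [inner_sub_right, inner_smul_right, real_inner_self_eq_norm_sq, he]; ring
  have h4 : x - t • e - (inner ℝ e x - t) • e = x - inner ℝ e x • e := by
    rw [sub_smul]; abel
  simp only [mem_ofPred_eq] at h2
  rw [h3, h4] at h2
  have : 0 < t := ht0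
  linarith [not_lt.1 hx0]

/-- An ordering of the vertices of a simplex. -/
theorem exists_bary {f : Fin (d + 1) → Eu d} (hf : AffineIndependent ℝ f) : ∃ b : Bary d, ⇑b = f :=
  ⟨⟨f, hf, hf.affineSpan_eq_top_iff_card_eq_finrank_add_one.2 (by simp)⟩, rfl⟩

theorem affineIndependent_of_range {s : Finset (Eu d)} (hs : AffineIndependent ℝ ((↑) : s → Eu d))
    {f : Fin (d + 1) → Eu d} (hf : Function.Injective f) (hr : ∀ i, f i ∈ s) :
    AffineIndependent ℝ f := by
  have := hs.comp_embedding ⟨fun i => ⟨f i, hr i⟩, fun i j h => hf (by simpa using h)⟩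
  exact this

variable {Ω : Set (Eu d)}

/-- The closed cell with vertex set `s`. -/
abbrev hull (s : Finset (Eu d)) : Set (Eu d) := convexHull ℝ (s : Set (Eu d))

theorem simplex_eq_hull {b : Bary d} {s : Finset (Eu d)} (h : range b = s) : simplex b = hull s := by
  rw [simplex, h]

theorem Mesh.exists_enum (T : Mesh Ω) {s : Finset (Eu d)} (hs : s ∈ T.cells) {v : Eu d} (hv : v ∈ s) :
    ∃ b : Bary d, range b = s ∧ b 0 = v := by
  have e : Fin (d + 1) ≃ s := (Finset.equivFinOfCardEq (T.card_eq s hs)).symm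
  set e' := (Equiv.swap 0 (e.symm ⟨v, hv⟩)).trans e
  obtain ⟨b, hb⟩ := exists_bary (affineIndependent_of_range (T.indep s hs)
    (f := fun i => (e' i : Eu d)) (Subtype.val_injective.comp e'.injective) (fun i => (e' i).2))
  refine ⟨b, ?_, by rw [hb]; simp [e']⟩
  rw [hb]
  ext x
  constructor
  · rintro ⟨i, rfl⟩; exact (e' i).2
  · intro hx; exact ⟨e'.symm ⟨x, hx⟩, by simp⟩

theorem Mesh.nonempty_of_mem (T : Mesh Ω) {s : Finset (Eu d)} (hs : s ∈ T.cells) : s.Nonempty :=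
  Finset.card_pos.1 (by rw [T.card_eq s hs]; omega)

theorem Mesh.exists_enum' (T : Mesh Ω) {s : Finset (Eu d)} (hs : s ∈ T.cells) :
    ∃ b : Bary d, range b = s := by
  obtain ⟨v, hv⟩ := T.nonempty_of_mem hs
  obtain ⟨b, hb, -⟩ := T.exists_enum hs hv
  exact ⟨b, hb⟩

theorem Mesh.isCompact_hull (s : Finset (Eu d)) : IsCompact (hull s) :=
  s.finite_toSet.isCompact_convexHull _

theorem Mesh.hull_subset (T : Mesh Ω) {s : Finset (Eu d)} (hs : s ∈ T.cells) :
    hull s ⊆ closure Ω := by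
  rw [← T.cover]; exact subset_biUnion_of_mem (u := fun s : Finset (Eu d) => hull s) hs

theorem Mesh.interior_hull_subset (hΩ : IsOpen Ω) (hL : IsLipschitzDomain Ω) (T : Mesh Ω)
    {s : Finset (Eu d)} (hs : s ∈ T.cells) : interior (hull s) ⊆ Ω := by
  rw [← hL.interior_closure hΩ]
  exact interior_mono (T.hull_subset hs)

theorem Mesh.interior_hull_nonempty (T : Mesh Ω) {s : Finset (Eu d)} (hs : s ∈ T.cells) :
    (interior (hull s)).Nonempty := by
  obtain ⟨b, hb⟩ := T.exists_enum' hs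
  rw [← simplex_eq_hull hb]
  exact interior_simplex_nonempty b

theorem interior_hull_eq_empty {m : Finset (Eu d)} (hm : m.card ≤ d) : interior (hull m) = ∅ := by
  by_contra h
  rw [← ne_eq, ← nonempty_iff_ne_empty, interior_convexHull_nonempty_iff_affineSpan_eq_top] at h
  have h1 := finrank_vectorSpan_image_finset_le ℝ (fun x : Eu d => x) m (n := m.card - 1)
  rcases m.eq_empty_or_nonempty with rfl | hne
  · simp at h
  have h2 := h1 (by have := hne.card_pos; omega)
  rw [Finset.image_id'] at h2
  have h3 : vectorSpan ℝ (m : Set (Eu d)) = ⊤ := by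
    rw [← direction_affineSpan, h, AffineSubspace.direction_top]
  rw [h3, finrank_top, finrank_euclideanSpace_fin] at h2
  have := hne.card_pos
  omega

/-- If they meet, the interiors of the two cells meet in a nonempty open set. For distinct cells
conformity puts it in the hull of at most d points, which has empty interior. -/
theorem Mesh.eq_of_interior_inter (T : Mesh Ω) {s t : Finset (Eu d)} (hs : s ∈ T.cells)
    (ht : t ∈ T.cells) (h : (interior (hull s) ∩ hull t).Nonempty) : s = t := by
  classical
  obtain ⟨x, hxs, hxt⟩ := h
  by_contra hne
  have hx : x ∈ closure (interior (hull t)) := by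
    rw [(convex_convexHull ℝ _).closure_interior_eq_closure_of_nonempty_interior
      (T.interior_hull_nonempty ht)]
    exact subset_closure hxt
  obtain ⟨y, hy1, hy2⟩ := mem_closure_iff.1 hx _ isOpen_interior hxs
  have hcard : (s ∩ t).card ≤ d := by
    have h1 : s ∩ t ⊂ s := by
      refine Finset.ssubset_iff_subset_ne.2 ⟨Finset.inter_subset_left, fun h => hne ?_⟩
      refine Finset.eq_of_subset_of_card_le (Finset.inter_eq_left.1 h) ?_
      rw [T.card_eq s hs, T.card_eq t ht]
    have := Finset.card_lt_card h1
    rw [T.card_eq s hs] at this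
    omega
  have h2 : y ∈ interior (hull (s ∩ t)) := by
    refine interior_maximal (fun z hz => ?_) (isOpen_interior.inter isOpen_interior) ⟨hy1, hy2⟩
    have := T.conforming s hs t ht ⟨interior_subset hz.1, interior_subset hz.2⟩
    rwa [hull, Finset.coe_inter]
  rw [interior_hull_eq_empty hcard] at h2
  exact h2

theorem Mesh.restrict_interior (T : Mesh Ω) {s : Finset (Eu d)} (hs : s ∈ T.cells) :
    (volume : Measure (Eu d)).restrict (interior (hull s)) = volume.restrict (hull s) := by
  obtain ⟨b, hb⟩ := T.exists_enum' hs
  rw [← simplex_eq_hull hb]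
  exact restrict_interior_simplex b

/-- The interiors are disjoint and fill Ω up to the frontiers of convex sets, which are null. -/
theorem Mesh.lintegral_eq_sum (hΩ : IsOpen Ω) (hL : IsLipschitzDomain Ω) (T : Mesh Ω)
    (F : Eu d → ℝ≥0∞) : ∫⁻ x in Ω, F x = ∑ s ∈ T.cells, ∫⁻ x in hull s, F x := by
  have h1 : ∫⁻ x in ⋃ s ∈ T.cells, interior (hull s), F x = ∑ s ∈ T.cells, ∫⁻ x in interior (hull s), F x := by
    refine lintegral_biUnion_finset (fun s hs t ht hst => ?_) (fun s _ => isOpen_interior.measurableSet) F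
    refine Set.disjoint_iff_inter_eq_empty.2 ?_
    by_contra h
    obtain ⟨x, hx⟩ := nonempty_iff_ne_empty.2 h
    exact hst (T.eq_of_interior_inter hs ht ⟨x, hx.1, interior_subset hx.2⟩)
  have h2 : (volume : Measure (Eu d)).restrict Ω = volume.restrict (⋃ s ∈ T.cells, interior (hull s)) := by
    refine Measure.restrict_congr_set (ae_eq_set.2 ⟨?_, ?_⟩)
    · refine measure_mono_null (t := ⋃ s ∈ T.cells, frontier (hull s)) (fun x hx => ?_) ?_
      · have h3 : x ∈ ⋃ s ∈ T.cells, hull s := by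
          have := T.cover; rw [this]; exact subset_closure hx.1
        obtain ⟨s, hs, hxs⟩ := mem_iUnion₂.1 h3
        refine mem_iUnion₂.2 ⟨s, hs, subset_closure hxs, fun h => hx.2 (mem_iUnion₂.2 ⟨s, hs, h⟩)⟩
      · exact (measure_biUnion_null_iff T.cells.countable_toSet).2
          fun s _ => (convex_convexHull ℝ _).addHaar_frontier volume
    · rw [Set.sdiff_eq_empty.2]
      · simp
      · exact iUnion₂_subset fun s hs => T.interior_hull_subset hΩ hL hs
  rw [h2, h1]
  exact Finset.sum_congr rfl fun s hs => by rw [T.restrict_interior hs]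

/-- The polynomial `P` in the barycentric coordinates of an ordered cell. -/
def cellPoly (b : Bary d) (s : Finset (Eu d)) (k : ℕ) (P : MvPolynomial (Fin d) ℝ) :
    MvPolynomial (Fin (d + 1)) ℝ := MvPolynomial.killCompl b.ind.injective (homogenize s k P)

theorem isHomogeneous_cellPoly (b : Bary d) (s : Finset (Eu d)) {k : ℕ} {P : MvPolynomial (Fin d) ℝ}
    (hP : P.totalDegree ≤ k) : (cellPoly b s k P).IsHomogeneous k :=
  isHomogeneous_killCompl _ (isHomogeneous_homogenize s hP)

theorem sum_enum {b : Bary d} {s : Finset (Eu d)} (h : range b = s) {M : Type*} [AddCommMonoid M]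
    (f : Eu d → M) : ∑ v ∈ s, f v = ∑ i, f (b i) := by
  classical
  have : s = Finset.univ.image b := by
    ext v
    rw [← Finset.mem_coe, ← h]; simp
  rw [this, Finset.sum_image fun i _ j _ hij => b.ind.injective hij]

theorem bev_cellPoly {b : Bary d} {s : Finset (Eu d)} (h : range b = s) (k : ℕ)
    (P : MvPolynomial (Fin d) ℝ) : bev b (cellPoly b s k P) = ev P := by
  ext x
  rw [bev, cellPoly, eval_killCompl]
  refine eval_homogenize ?_ ?_
  · rw [sum_enum h]
    simp_rw [b.ind.injective.extend_apply]
    exact b.sum_coord_apply_eq_one x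
  · rw [sum_enum h]
    simp_rw [b.ind.injective.extend_apply]
    exact b.linear_combination_coord_eq_self x

/-- The diameter of a cell. -/
abbrev hdiam (s : Finset (Eu d)) : ℝ := Metric.diam (hull s)

theorem Mesh.minSize_le (T : Mesh Ω) {s : Finset (Eu d)} (hs : s ∈ T.cells) : T.minSize ≤ hdiam s :=
  ciInf_le (f := fun s : T.cells => hdiam s.1) (finite_range _).bddBelow ⟨s, hs⟩

theorem Mesh.le_size (T : Mesh Ω) {s : Finset (Eu d)} (hs : s ∈ T.cells) : hdiam s ≤ T.size :=
  le_ciSup (f := fun s : T.cells => hdiam s.1) (finite_range _).bddAbove ⟨s, hs⟩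

theorem grad_ae_of_feSpace (hΩ : IsOpen Ω) (hL : IsLipschitzDomain Ω) (T : Mesh Ω)
    {v : H10 Ω} {g : Eu d → ℝ} (hv : fn v =ᵐ[volume.restrict Ω] g) {s : Finset (Eu d)}
    (hs : s ∈ T.cells) {G : Eu d → ℝ} (hG : ContDiff ℝ 1 G) (hgG : ∀ x ∈ hull s, g x = G x) :
    (fn v =ᵐ[volume.restrict (hull s)] G) ∧
      grad v =ᵐ[volume.restrict (hull s)] fun x => gradient G x := by
  have hsub := T.interior_hull_subset hΩ hL hs
  have h1 : fn v =ᵐ[volume.restrict (interior (hull s))] G := by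
    filter_upwards [ae_restrict_of_ae_restrict_of_subset hsub hv,
      ae_restrict_mem isOpen_interior.measurableSet] with x hx hxs
    rw [hx, hgG x (interior_subset hxs)]
  have h2 := grad_ae_eq_gradient hΩ isOpen_interior hsub hG v h1
  rw [T.restrict_interior hs] at h1 h2
  exact ⟨h1, h2⟩

/-- The inverse estimate on each cell, summed over the mesh. -/
theorem stable_of_cfl (d k : ℕ) (Ω : Set (Eu d)) (hΩ : IsOpen Ω) (hL : IsLipschitzDomain Ω)
    {σ μ₀ : ℝ} (hσ : 0 < σ) (hμ₁ : μ₀ < 1) :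
    ∃ c : ℝ, 0 < c ∧ ∀ T : Mesh Ω, T.IsShapeRegular σ →
      ∀ τ : ℝ, 0 < τ → τ ≤ c * T.minSize → T.IsStableStep k μ₀ τ := by
  obtain ⟨C, hC, hinv⟩ := exists_inverse_estimate d k
  set A : ℝ := C.toReal + 1 with hA
  have hA0 : 0 < A := by positivity
  have hCA : C ≤ ENNReal.ofReal A := by
    rw [← ENNReal.ofReal_toReal hC]
    exact ENNReal.ofReal_le_ofReal (by linarith)
  -- As h_min ≤ diam s ≤ σ r, this c gives τ² ≤ (1 − μ₀) r²/A on every cell, so the inverse constant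
  -- A cancels. The 1 added to C in A makes it positive.
  refine ⟨Real.sqrt ((1 - μ₀) / A) / σ, by
    have : 0 < (1 - μ₀) / A := div_pos (by linarith) hA0
    positivity, fun T hT τ hτ hτc v hv => ?_⟩
  obtain ⟨g, -, -, hgp, hvg⟩ := hv
  have key : ENNReal.ofReal (τ ^ 2) * ‖grad v‖ₑ ^ 2 ≤ ENNReal.ofReal (1 - μ₀) * ‖fn v‖ₑ ^ 2 := by
    rw [enorm_sq_eq_lintegral (grad v), enorm_sq_eq_lintegral (fn v),
      T.lintegral_eq_sum hΩ hL, T.lintegral_eq_sum hΩ hL, Finset.mul_sum, Finset.mul_sum]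
    refine Finset.sum_le_sum fun s hs => ?_
    obtain ⟨p, hp, hpe⟩ := hgp s hs
    obtain ⟨b, hb⟩ := T.exists_enum' hs
    obtain ⟨c, r, hr, hcr, hdr⟩ := hT s hs
    obtain ⟨h1, h2⟩ := grad_ae_of_feSpace hΩ hL T hvg hs (contDiff_ev p) hpe
    have h3 := hinv b _ (isHomogeneous_cellPoly b s hp) c r hr (by rwa [simplex_eq_hull hb])
    rw [bev_cellPoly hb, simplex_eq_hull hb] at h3
    rw [lintegral_congr_ae (g := fun x => ‖gradient (ev p) x‖ₑ ^ 2)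
        (by filter_upwards [h2] with x hx; rw [hx]),
      lintegral_congr_ae (f := fun x => ‖fn v x‖ₑ ^ 2) (g := fun x => ‖ev p x‖ₑ ^ 2)
        (by filter_upwards [h1] with x hx; rw [hx])]
    have h4 : τ ≤ Real.sqrt ((1 - μ₀) / A) * r := by
      refine hτc.trans ?_
      have := (T.minSize_le hs).trans hdr
      rw [div_mul_eq_mul_div, div_le_iff₀ hσ, mul_assoc]
      exact mul_le_mul_of_nonneg_left (by linarith) (Real.sqrt_nonneg _)
    have h5 : τ ^ 2 ≤ (1 - μ₀) / A * r ^ 2 := by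
      refine (pow_le_pow_left₀ hτ.le h4 2).trans (le_of_eq ?_)
      rw [mul_pow, Real.sq_sqrt (div_nonneg (by linarith) hA0.le)]
    have hq : 0 ≤ (1 - μ₀) / A := div_nonneg (by linarith) hA0.le
    calc _ ≤ ENNReal.ofReal ((1 - μ₀) / A * r ^ 2) * ∫⁻ x in hull s, ‖gradient (ev p) x‖ₑ ^ 2 := by
          gcongr
      _ = ENNReal.ofReal ((1 - μ₀) / A) * (ENNReal.ofReal (r ^ 2) *
            ∫⁻ x in hull s, ‖gradient (ev p) x‖ₑ ^ 2) := by
          rw [ENNReal.ofReal_mul hq, mul_assoc]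
      _ ≤ ENNReal.ofReal ((1 - μ₀) / A) * (ENNReal.ofReal A * ∫⁻ x in hull s, ‖ev p x‖ₑ ^ 2) := by
          exact mul_le_mul_right (h3.trans (mul_le_mul_left hCA _)) _
      _ = _ := by
          rw [← mul_assoc, ← ENNReal.ofReal_mul hq, div_mul_cancel₀ _ hA0.ne']
  rw [enorm_sq_eq_ofReal, enorm_sq_eq_ofReal, ← ENNReal.ofReal_mul (sq_nonneg _),
    ← ENNReal.ofReal_mul (by linarith),
    ENNReal.ofReal_le_ofReal_iff (mul_nonneg (by linarith) (sq_nonneg _))] at key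
  rw [mForm, real_inner_self_eq_norm_sq, real_inner_self_eq_norm_sq]
  constructor
  · linarith
  · have := mul_nonneg (sq_nonneg τ) (sq_nonneg ‖grad v‖)
    linarith

end

section

/-! ### Jumps of the local polynomials across facets -/

theorem facetProj_eq_sum (b : Bary (d + 1)) (x : Eu (d + 1)) : facetProj b x =
    ∑ i : Fin (d + 1), (b.coord i.succ x + if i = 0 then b.coord 0 x else 0) • b i.succ := by
  have := b.linear_combination_coord_eq_self (facetProj b x)
  rw [Fin.sum_univ_succ] at this
  have h0 := congrFun (coord_facetProj b x)
  rw [h0 0, Fin.cons_zero, zero_smul, zero_add] at this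
  rw [← this]
  exact Finset.sum_congr rfl fun i _ => by rw [h0 i.succ, Fin.cons_succ]

/-- The projected point depends only on the barycentric coordinates of x and on the vertices of the
facet. So the affine map between two cells with a common facet is compatible with the two
projections, and traces from both sides can be compared at the same points. -/
theorem facetProj_baryMap {b b' : Bary (d + 1)} (h : ∀ i : Fin (d + 1), b' i.succ = b i.succ)
    (x : Eu (d + 1)) : facetProj b' (baryMap b b' x) = facetProj b x := by
  rw [facetProj_eq_sum, facetProj_eq_sum]
  simp_rw [coord_baryMap, h]

theorem enorm_sub_sq_le {F : Type*} [NormedAddCommGroup F] (a b : F) :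
    ‖a - b‖ₑ ^ 2 ≤ 2 * ‖a‖ₑ ^ 2 + 2 * ‖b‖ₑ ^ 2 := by
  rw [enorm_sq_eq_ofReal, enorm_sq_eq_ofReal, enorm_sq_eq_ofReal,
    show (2 : ℝ≥0∞) = ENNReal.ofReal 2 by simp, ← ENNReal.ofReal_mul (by norm_num),
    ← ENNReal.ofReal_mul (by norm_num), ← ENNReal.ofReal_add (by positivity) (by positivity)]
  refine ENNReal.ofReal_le_ofReal ?_
  have := norm_sub_le a b
  nlinarith [sq_nonneg (‖a‖ - ‖b‖), norm_nonneg (a - b), norm_nonneg a, norm_nonneg b]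

theorem enorm_add_sq_le {F : Type*} [NormedAddCommGroup F] (a b : F) :
    ‖a + b‖ₑ ^ 2 ≤ 2 * ‖a‖ₑ ^ 2 + 2 * ‖b‖ₑ ^ 2 := by
  have := enorm_sub_sq_le a (-b)
  rwa [sub_neg_eq_add, enorm_neg] at this

/-- The scaled squared `H¹` error on a simplex. -/
def smoothErr (b : Bary d) (h : ℝ) (φ p : Eu d → ℝ) : ℝ≥0∞ :=
  (∫⁻ x in simplex b, ‖φ x - p x‖ₑ ^ 2) +
    ENNReal.ofReal (h ^ 2) * ∫⁻ x in simplex b, ‖gradient φ x - gradient p x‖ₑ ^ 2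

theorem gradient_sub {f g : Eu d → ℝ} (hf : ContDiff ℝ 1 f) (hg : ContDiff ℝ 1 g) (x : Eu d) :
    gradient (fun y => f y - g y) x = gradient f x - gradient g x := by
  have h1 := (hf.differentiable one_ne_zero x).hasFDerivAt.sub
    (hg.differentiable one_ne_zero x).hasFDerivAt
  have h2 : fderiv ℝ (fun y => f y - g y) x = fderiv ℝ f x - fderiv ℝ g x := h1.fderiv
  rw [gradient, gradient, gradient, h2, map_sub]

theorem lintegral_trace_sub_le (b : Bary (d + 1)) {φ p : Eu (d + 1) → ℝ} (hφ : ContDiff ℝ 1 φ)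
    (hp : ContDiff ℝ 1 p) {h : ℝ} (hh : ‖b 1 - b 0‖ ≤ h) :
    ∫⁻ x in simplex b, ‖φ (facetProj b x) - p (facetProj b x)‖ₑ ^ 2 ≤ 2 * smoothErr b h φ p := by
  refine (lintegral_trace_le b (hφ.sub hp) hh).trans (le_of_eq ?_)
  rw [smoothErr]
  simp_rw [← gradient_sub hφ hp]

/-- The facet coefficients of Q − Q' are bounded by its trace. On the facet Q and Q' are compared
with the same values of φ, which leaves the traces of φ − Q and φ − Q', one from each simplex. -/
theorem exists_facet_jump_bound (d k : ℕ) : ∃ C : ℝ≥0∞, C ≠ ⊤ ∧ ∀ (b b' : Bary (d + 1)),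
    (∀ i : Fin (d + 1), b' i.succ = b i.succ) → ∀ (h h' : ℝ), ‖b 1 - b 0‖ ≤ h → ‖b' 1 - b' 0‖ ≤ h' →
    ∀ (Q Q' : MvPolynomial (Fin (d + 2)) ℝ), Q.IsHomogeneous k → Q'.IsHomogeneous k →
    ∀ φ : Eu (d + 1) → ℝ, ContDiff ℝ 1 φ → ∀ β : Fin (d + 1) →₀ ℕ,
      ‖Q.coeff (β.mapDomain Fin.succ) - Q'.coeff (β.mapDomain Fin.succ)‖ₑ ^ 2 ≤
        C * (smoothErr b h φ (bev b Q) / volume (simplex b) +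
          smoothErr b' h' φ (bev b' Q') / volume (simplex b')) := by
  obtain ⟨C, hC, hcoef⟩ := exists_facet_coeff_bound d k
  refine ⟨C * 4, ENNReal.mul_ne_top hC (by simp), fun b b' hbb h h' hh hh' Q Q' hQ hQ' φ hφ β => ?_⟩
  have h1 := hcoef b (Q - Q') (hQ.sub hQ') β
  rw [MvPolynomial.coeff_sub] at h1
  have hcoord : ∀ x, (fun i => b.coord i (facetProj b x)) = fun i => b'.coord i (facetProj b x) := by
    intro x
    rw [← facetProj_baryMap hbb x, coord_facetProj, facetProj_baryMap hbb x, coord_facetProj]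
    simp_rw [coord_baryMap]
  have h2 : ∀ x, ‖bev b (Q - Q') (facetProj b x)‖ₑ ^ 2 ≤
      2 * ‖φ (facetProj b' (baryMap b b' x)) - bev b' Q' (facetProj b' (baryMap b b' x))‖ₑ ^ 2 +
      2 * ‖φ (facetProj b x) - bev b Q (facetProj b x)‖ₑ ^ 2 := by
    intro x
    rw [facetProj_baryMap hbb]
    refine le_trans (le_of_eq ?_) (enorm_sub_sq_le _ _)
    congr 2
    have h3 : bev b' Q' (facetProj b x) = bev b Q' (facetProj b x) := by
      rw [bev, bev, hcoord]
    rw [h3]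
    simp only [bev, map_sub]
    ring
  have hV := volume_simplex_ne_zero b
  have hV' := volume_simplex_ne_zero b'
  have hT := volume_simplex_ne_top b
  have hT' := volume_simplex_ne_top b'
  have h4 := lintegral_simplex_comp b b' fun y =>
    ‖φ (facetProj b' y) - bev b' Q' (facetProj b' y)‖ₑ ^ 2
  have h5 := lintegral_trace_sub_le b' hφ (contDiff_bev b' Q') hh'
  have h6 := lintegral_trace_sub_le b hφ (contDiff_bev b Q) hh
  have hcont : Continuous fun x => φ (facetProj b x) - bev b Q (facetProj b x) := by
    have : Continuous (facetProj b) := by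
      unfold facetProj
      exact continuous_id.add ((continuous_coord b 0).smul continuous_const)
    exact (hφ.continuous.comp this).sub ((contDiff_bev (n := 0) b Q).continuous.comp this)
  have h7 : ∫⁻ x in simplex b, ‖bev b (Q - Q') (facetProj b x)‖ₑ ^ 2 ≤
      volume (simplex b) * (4 * (smoothErr b h φ (bev b Q) / volume (simplex b) +
          smoothErr b' h' φ (bev b' Q') / volume (simplex b'))) := by
    refine (lintegral_mono h2).trans ?_
    rw [lintegral_add_right _ ((hcont.enorm.measurable.pow_const 2).const_mul 2),
      lintegral_const_mul' _ _ (by simp), lintegral_const_mul' _ _ (by simp)]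
    have h8 : ∫⁻ x in simplex b, ‖φ (facetProj b' (baryMap b b' x)) -
        bev b' Q' (facetProj b' (baryMap b b' x))‖ₑ ^ 2 ≤
        volume (simplex b) * (2 * smoothErr b' h' φ (bev b' Q')) / volume (simplex b') := by
      rw [ENNReal.le_div_iff_mul_le (Or.inl hV') (Or.inl hT'), mul_comm, ← h4]
      exact mul_le_mul_right h5 _
    have h9 : volume (simplex b) * (smoothErr b h φ (bev b Q) / volume (simplex b)) =
        smoothErr b h φ (bev b Q) := ENNReal.mul_div_cancel hV hT
    calc _ ≤ 2 * (volume (simplex b) * (2 * smoothErr b' h' φ (bev b' Q')) / volume (simplex b')) +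
          2 * (2 * smoothErr b h φ (bev b Q)) := by gcongr
      _ = 4 * (volume (simplex b) * (smoothErr b' h' φ (bev b' Q') / volume (simplex b'))) +
          4 * (volume (simplex b) * (smoothErr b h φ (bev b Q) / volume (simplex b))) := by
        rw [h9]
        simp only [div_eq_mul_inv]
        ring
      _ = _ := by ring
  have h10 := h1.trans (mul_le_mul_right h7 C)
  rw [mul_comm, show ∀ V X : ℝ≥0∞, C * (V * X) = V * (C * X) by intros; ring] at h10
  rw [mul_assoc]
  exact (ENNReal.mul_le_mul_iff_right hV hT).1 h10

/-- The one-sided version: where φ vanishes on the facet, the trace of Q is that of the error. -/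
theorem exists_facet_zero_bound (d k : ℕ) : ∃ C : ℝ≥0∞, C ≠ ⊤ ∧ ∀ (b : Bary (d + 1)) (h : ℝ),
    ‖b 1 - b 0‖ ≤ h → ∀ (Q : MvPolynomial (Fin (d + 2)) ℝ), Q.IsHomogeneous k →
    ∀ φ : Eu (d + 1) → ℝ, ContDiff ℝ 1 φ →
      (∀ x ∈ convexHull ℝ (range fun i : Fin (d + 1) => b i.succ), φ x = 0) →
      ∀ β : Fin (d + 1) →₀ ℕ, ‖Q.coeff (β.mapDomain Fin.succ)‖ₑ ^ 2 ≤
        C * (smoothErr b h φ (bev b Q) / volume (simplex b)) := by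
  obtain ⟨C, hC, hcoef⟩ := exists_facet_coeff_bound d k
  refine ⟨C * 2, ENNReal.mul_ne_top hC (by simp), fun b h hh Q hQ φ hφ h0 β => ?_⟩
  have h1 := hcoef b Q hQ β
  have hV := volume_simplex_ne_zero b
  have hT := volume_simplex_ne_top b
  rw [← mul_div_assoc, ENNReal.le_div_iff_mul_le (Or.inl hV) (Or.inl hT), mul_assoc]
  refine h1.trans (mul_le_mul_right ?_ _)
  refine le_trans (le_of_eq ?_) (lintegral_trace_sub_le b hφ (contDiff_bev b Q) hh)
  refine setLIntegral_congr_fun (measurableSet_simplex b) fun x hx => ?_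
  rw [h0 _ (facetProj_mem hx), zero_sub, enorm_neg]

variable {Ω : Set (Eu d)}

/-- The scaled squared `H¹` distance on a cell between `v` and the polynomial `P`. -/
def locErr (s : Finset (Eu d)) (v : H10 Ω) (P : MvPolynomial (Fin d) ℝ) : ℝ≥0∞ :=
  (∫⁻ x in hull s, ‖fn v x - ev P x‖ₑ ^ 2) +
    ENNReal.ofReal (hdiam s ^ 2) * ∫⁻ x in hull s, ‖grad v x - gradient (ev P) x‖ₑ ^ 2

theorem fn_sub_ae (w v : H10 Ω) :
    fn (w - v) =ᵐ[volume.restrict Ω] fun x => fn w x - fn v x := by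
  have h : fn (w - v) = fn w - fn v := map_sub (fnL Ω) w v
  rw [h]
  exact Lp.coeFn_sub _ _

theorem grad_sub_ae (w v : H10 Ω) :
    grad (w - v) =ᵐ[volume.restrict Ω] fun x => grad w x - grad v x := by
  have h : grad (w - v) = grad w - grad v := map_sub (gradL Ω) w v
  rw [h]
  exact Lp.coeFn_sub _ _

theorem enorm_fn_sq_le (u : H10 Ω) : ‖fn u‖ₑ ^ 2 ≤ ‖u‖ₑ ^ 2 := by
  refine (enorm_sq_eq_ofReal (fn u)).trans_le (le_trans ?_ (enorm_sq_eq_ofReal u).symm.le)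
  exact ENNReal.ofReal_le_ofReal ((le_add_of_nonneg_right (sq_nonneg _)).trans (norm_sq_eq u).symm.le)

theorem enorm_grad_sq_le (u : H10 Ω) : ‖grad u‖ₑ ^ 2 ≤ ‖u‖ₑ ^ 2 := by
  refine (enorm_sq_eq_ofReal (grad u)).trans_le (le_trans ?_ (enorm_sq_eq_ofReal u).symm.le)
  exact ENNReal.ofReal_le_ofReal ((le_add_of_nonneg_left (sq_nonneg _)).trans (norm_sq_eq u).symm.le)

theorem lintegral_sq_add_le {α F : Type*} [MeasurableSpace α] {μ ν : Measure α}
    [NormedAddCommGroup F] (hle : ν ≤ μ) (f : Lp F 2 μ) {a b : α → F}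
    (h : ∀ᵐ x ∂ν, a x = b x + f x) :
    ∫⁻ x, ‖a x‖ₑ ^ 2 ∂ν ≤ 2 * (∫⁻ x, ‖b x‖ₑ ^ 2 ∂ν) + 2 * ‖f‖ₑ ^ 2 := by
  have h1 : ∫⁻ x, ‖a x‖ₑ ^ 2 ∂ν ≤ ∫⁻ x, (2 * ‖b x‖ₑ ^ 2 + 2 * ‖f x‖ₑ ^ 2) ∂ν := by
    refine lintegral_mono_ae ?_
    filter_upwards [h] with x hx
    rw [hx]
    exact enorm_add_sq_le _ _
  refine h1.trans ?_
  rw [lintegral_add_right', lintegral_const_mul' _ _ (by simp), lintegral_const_mul' _ _ (by simp),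
    enorm_sq_eq_lintegral f]
  · exact add_le_add_right (mul_le_mul_right (lintegral_mono' hle le_rfl) _) _
  · exact (((Lp.aestronglyMeasurable f).mono_measure hle).enorm.pow_const 2).const_mul _

theorem Mesh.restrict_hull_le (hΩ : IsOpen Ω) (hL : IsLipschitzDomain Ω) (T : Mesh Ω)
    {s : Finset (Eu d)} (hs : s ∈ T.cells) :
    (volume : Measure (Eu d)).restrict (hull s) ≤ volume.restrict Ω := by
  rw [← T.restrict_interior hs]
  exact Measure.restrict_mono (T.interior_hull_subset hΩ hL hs) le_rfl

/-- Replacing v by a nearby smooth w costs a multiple of ‖w − v‖². The factor may depend on the cell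
since it disappears in the limit. -/
theorem smoothErr_le (hΩ : IsOpen Ω) (hL : IsLipschitzDomain Ω) (T : Mesh Ω) {s : Finset (Eu d)}
    (hs : s ∈ T.cells) {b : Bary d} (hb : range b = s) (v w : H10 Ω) {φ : Eu d → ℝ}
    (h1 : fn w =ᵐ[volume.restrict Ω] φ)
    (h2 : grad w =ᵐ[volume.restrict Ω] fun x => gradient φ x) (P : MvPolynomial (Fin d) ℝ) :
    smoothErr b (hdiam s) φ (ev P) ≤ 2 * locErr s v P +
      2 * (1 + ENNReal.ofReal (hdiam s ^ 2)) * ‖w - v‖ₑ ^ 2 := by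
  have hle := T.restrict_hull_le hΩ hL hs
  have i1 := lintegral_sq_add_le hle (fn (w - v)) (a := fun x => φ x - ev P x)
    (b := fun x => fn v x - ev P x) (by
      filter_upwards [ae_mono hle h1, ae_mono hle (fn_sub_ae w v)] with x hx h3
      rw [h3, ← hx]; ring)
  have i2 := lintegral_sq_add_le hle (grad (w - v)) (a := fun x => gradient φ x - gradient (ev P) x)
    (b := fun x => grad v x - gradient (ev P) x) (by
      filter_upwards [ae_mono hle h2, ae_mono hle (grad_sub_ae w v)] with x hx h3
      rw [h3, ← hx]; abel)
  have e1 := enorm_fn_sq_le (w - v)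
  have e2 := enorm_grad_sq_le (w - v)
  replace i1 := i1.trans (add_le_add_right (mul_le_mul_right e1 2) _)
  replace i2 := i2.trans (add_le_add_right (mul_le_mul_right e2 2) _)
  rw [smoothErr, locErr, simplex_eq_hull hb]
  refine (add_le_add i1 (mul_le_mul_right i2 _)).trans (le_of_eq ?_)
  generalize ‖w - v‖ₑ ^ 2 = W
  ring

/-- By density w tends to v. This extends the trace arguments from test functions to H¹₀ without
defining traces there; C only has to be finite, not uniform. -/
theorem le_of_forall_test {v : H10 Ω} {A B C : ℝ≥0∞} (hC : C ≠ ⊤)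
    (h : ∀ (w : H10 Ω) (φ : Eu d → ℝ), IsTestFunction Ω φ → fn w =ᵐ[volume.restrict Ω] φ →
      (grad w =ᵐ[volume.restrict Ω] fun x => gradient φ x) → A ≤ B + C * ‖w - v‖ₑ ^ 2) : A ≤ B := by
  set S : Set (H10 Ω) := {w | ∃ φ : Eu d → ℝ, IsTestFunction Ω φ ∧ fn w =ᵐ[volume.restrict Ω] φ ∧
    grad w =ᵐ[volume.restrict Ω] fun x => gradient φ x} with hS
  have hd : v ∈ closure S := H10.induction (p := fun v => v ∈ closure S) isClosed_closure
    (fun w φ h1 h2 h3 => subset_closure ⟨φ, h1, h2, h3⟩) v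
  have hcl : IsClosed {w : H10 Ω | A ≤ B + C * ‖w - v‖ₑ ^ 2} := by
    refine isClosed_le continuous_const (continuous_const.add ?_)
    refine (ENNReal.continuous_const_mul hC).comp ?_
    exact (ENNReal.continuous_pow 2).comp (continuous_id.sub continuous_const).enorm
  have h0 : S ⊆ {w : H10 Ω | A ≤ B + C * ‖w - v‖ₑ ^ 2} := by
    rintro w ⟨φ, h1, h2, h3⟩
    exact h w φ h1 h2 h3
  have h4 : A ≤ B + C * ‖v - v‖ₑ ^ 2 := closure_minimal h0 hcl hd
  rwa [show ‖v - v‖ₑ = 0 from enorm_eq_zero.2 (sub_self v), zero_pow two_ne_zero, mul_zero, add_zero] at h4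

end

section

/-! ### Jump estimates on the mesh -/

variable {Ω : Set (Eu d)}

/-- The coefficients of the local polynomial `P` on the cell `s`, indexed globally. -/
def cellCoeff (s : Finset (Eu d)) (k : ℕ) (P : MvPolynomial (Fin d) ℝ) (α : Eu d →₀ ℕ) : ℝ :=
  (homogenize s k P).coeff α

theorem coeff_cellPoly (b : Bary d) (s : Finset (Eu d)) (k : ℕ) (P : MvPolynomial (Fin d) ℝ)
    (β : Fin (d + 1) →₀ ℕ) : (cellPoly b s k P).coeff β = cellCoeff s k P (β.mapDomain b) :=
  MvPolynomial.coeff_killCompl _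

theorem norm_sub_le_hdiam {b : Bary d} {s : Finset (Eu d)} (hb : range b = s) (i j : Fin (d + 1)) :
    ‖b i - b j‖ ≤ hdiam s := by
  rw [← dist_eq_norm]
  have h : ∀ i, b i ∈ hull s := fun i => subset_convexHull ℝ _ (hb ▸ mem_range_self i)
  exact Metric.dist_le_diam_of_mem (Mesh.isCompact_hull s).isBounded (h i) (h j)

theorem volume_hull_ne (T : Mesh Ω) {s : Finset (Eu d)} (hs : s ∈ T.cells) :
    volume (hull s) ≠ 0 ∧ volume (hull s) ≠ ⊤ := by
  obtain ⟨b, hb⟩ := T.exists_enum' hs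
  rw [← simplex_eq_hull hb]
  exact ⟨volume_simplex_ne_zero b, volume_simplex_ne_top b⟩

/-- One exponent β on the facet labels serves every simplex that lists the facet in the same order,
which allows the coefficients from both sides to be compared. -/
theorem exists_comap_facet [DecidableEq (Eu (d + 1))] {b : Bary (d + 1)} {s : Finset (Eu (d + 1))} (hb : range b = s)
    {α : Eu (d + 1) →₀ ℕ} (hα : α.support ⊆ s.erase (b 0)) :
    ∃ β : Fin (d + 1) →₀ ℕ, ∀ b' : Bary (d + 1), (∀ i : Fin (d + 1), b' i.succ = b i.succ) →
      (β.mapDomain Fin.succ).mapDomain b' = α := by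
  have hinj : Function.Injective fun i : Fin (d + 1) => b i.succ :=
    b.ind.injective.comp (Fin.succ_injective _)
  refine ⟨α.comapDomain (fun i : Fin (d + 1) => b i.succ) hinj.injOn, fun b' hb' => ?_⟩
  rw [← Finsupp.mapDomain_comp]
  have : (b' ∘ Fin.succ : Fin (d + 1) → Eu (d + 1)) = fun i => b i.succ := funext hb'
  rw [this]
  refine Finsupp.mapDomain_comapDomain _ hinj _ fun v hv => ?_
  have h1 := Finset.mem_erase.1 (hα hv)
  have h2 : v ∈ range b := by rw [hb]; exact h1.2
  obtain ⟨i, rfl⟩ := h2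
  have hi : i ≠ 0 := fun h => h1.1 (by rw [h])
  obtain ⟨j, rfl⟩ := Fin.exists_succ_eq.2 hi
  exact ⟨j, rfl⟩

theorem exists_enum_pair [DecidableEq (Eu (d + 1))] {Ω : Set (Eu (d + 1))} (T : Mesh Ω) {s t : Finset (Eu (d + 1))}
    (hs : s ∈ T.cells) (ht : t ∈ T.cells) {v w : Eu (d + 1)} (hv : v ∈ s) (hw : w ∈ t)
    (h : s.erase v = t.erase w) : ∃ b b' : Bary (d + 1), range b = s ∧ range b' = t ∧ b 0 = v ∧
      ∀ i : Fin (d + 1), b' i.succ = b i.succ := by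
  obtain ⟨b, hb, hb0⟩ := T.exists_enum hs hv
  have h1 : ∀ i : Fin (d + 1), b i.succ ∈ t.erase w := by
    intro i
    rw [← h, Finset.mem_erase]
    refine ⟨fun h' => ?_, by rw [← Finset.mem_coe, ← hb]; exact mem_range_self _⟩
    rw [← hb0] at h'
    exact Fin.succ_ne_zero i (b.ind.injective h')
  set f : Fin (d + 2) → Eu (d + 1) := Fin.cons w fun i => b i.succ with hf
  have hfi : Function.Injective f := by
    refine Fin.cons_injective_iff.2 ⟨?_, b.ind.injective.comp (Fin.succ_injective _)⟩
    rintro ⟨i, hi⟩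
    exact (Finset.mem_erase.1 (h1 i)).1 hi
  have hft : ∀ i, f i ∈ t := by
    intro i
    refine Fin.cases ?_ (fun j => ?_) i
    · simpa [hf] using hw
    · simpa [hf] using Finset.mem_of_mem_erase (h1 j)
  obtain ⟨b', hb'⟩ := exists_bary (affineIndependent_of_range (T.indep t ht) hfi hft)
  refine ⟨b, b', hb, ?_, hb0, fun i => by rw [hb']; simp [hf]⟩
  rw [hb']
  have h2 : Finset.univ.image f = t := by
    refine Finset.eq_of_subset_of_card_le (fun x hx => ?_) ?_
    · obtain ⟨i, -, rfl⟩ := Finset.mem_image.1 hx; exact hft i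
    · rw [Finset.card_image_of_injective _ hfi, T.card_eq t ht]; simp
  rw [← h2]; simp

-- The jump estimate for a test function, carried over to u by density. The local errors are divided
-- by the volumes because coefficients behave like mean values.
open Classical in
theorem exists_mesh_jump_bound (d k : ℕ) : ∃ C : ℝ≥0∞, C ≠ ⊤ ∧ ∀ (Ω : Set (Eu (d + 1))), IsOpen Ω →
    IsLipschitzDomain Ω → ∀ (T : Mesh Ω), ∀ s ∈ T.cells, ∀ t ∈ T.cells, ∀ v ∈ s, ∀ w ∈ t,
    s.erase v = t.erase w → ∀ (u : H10 Ω) (P P' : MvPolynomial (Fin (d + 1)) ℝ),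
      P.totalDegree ≤ k → P'.totalDegree ≤ k → ∀ α : Eu (d + 1) →₀ ℕ, α.support ⊆ s.erase v →
      ‖cellCoeff s k P α - cellCoeff t k P' α‖ₑ ^ 2 ≤
        C * (locErr s u P / volume (hull s) + locErr t u P' / volume (hull t)) := by
  obtain ⟨C, hC, hjump⟩ := exists_facet_jump_bound d k
  refine ⟨C * 2, ENNReal.mul_ne_top hC (by simp), fun Ω hΩ hL T s hs t ht v hv w hw hst u P P' hP hP' α hα => ?_⟩
  obtain ⟨b, b', hb, hb', hb0, hbb⟩ := exists_enum_pair T hs ht hv hw hst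
  obtain ⟨β, hβ⟩ := exists_comap_facet hb (hb0 ▸ hα)
  obtain ⟨hVs, hTs⟩ := volume_hull_ne T hs
  obtain ⟨hVt, hTt⟩ := volume_hull_ne T ht
  refine le_of_forall_test (v := u)
    (C := C * ((2 * (1 + ENNReal.ofReal (hdiam s ^ 2))) / volume (hull s) +
      (2 * (1 + ENNReal.ofReal (hdiam t ^ 2))) / volume (hull t))) ?_ ?_
  · refine ENNReal.mul_ne_top hC (ENNReal.add_ne_top.2 ⟨ENNReal.div_ne_top ?_ hVs, ENNReal.div_ne_top ?_ hVt⟩) <;>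
    exact ENNReal.mul_ne_top (by simp) (by simp)
  · intro y φ hφ h1 h2
    have h3 := hjump b b' hbb (hdiam s) (hdiam t) (norm_sub_le_hdiam hb 1 0) (norm_sub_le_hdiam hb' 1 0)
      (cellPoly b s k P) (cellPoly b' t k P') (isHomogeneous_cellPoly b s hP)
      (isHomogeneous_cellPoly b' t hP') φ hφ.contDiff_one β
    rw [coeff_cellPoly, coeff_cellPoly, hβ b fun _ => rfl, hβ b' hbb, bev_cellPoly hb, bev_cellPoly hb',
      simplex_eq_hull hb, simplex_eq_hull hb'] at h3
    refine h3.trans ?_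
    have h4 := smoothErr_le hΩ hL T hs hb u y h1 h2 P
    have h5 := smoothErr_le hΩ hL T ht hb' u y h1 h2 P'
    generalize ‖y - u‖ₑ ^ 2 = W at h4 h5 ⊢
    refine (mul_le_mul_right (add_le_add (ENNReal.div_le_div_right h4 _)
      (ENNReal.div_le_div_right h5 _)) C).trans (le_of_eq ?_)
    simp only [div_eq_mul_inv]
    ring

-- Test functions vanish outside Ω, hence on such a facet. The one-sided bound passes to u by
-- density.
open Classical in
theorem exists_mesh_zero_bound (d k : ℕ) : ∃ C : ℝ≥0∞, C ≠ ⊤ ∧ ∀ (Ω : Set (Eu (d + 1))), IsOpen Ω →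
    IsLipschitzDomain Ω → ∀ (T : Mesh Ω), ∀ s ∈ T.cells, ∀ v ∈ s, hull (s.erase v) ∩ Ω = ∅ →
    ∀ (u : H10 Ω) (P : MvPolynomial (Fin (d + 1)) ℝ),
      P.totalDegree ≤ k → ∀ α : Eu (d + 1) →₀ ℕ, α.support ⊆ s.erase v →
      ‖cellCoeff s k P α‖ₑ ^ 2 ≤ C * (locErr s u P / volume (hull s)) := by
  obtain ⟨C, hC, hjump⟩ := exists_facet_zero_bound d k
  refine ⟨C * 2, ENNReal.mul_ne_top hC (by simp), fun Ω hΩ hL T s hs v hv hsΩ u P hP α hα => ?_⟩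
  obtain ⟨b, hb, hb0⟩ := T.exists_enum hs hv
  obtain ⟨β, hβ⟩ := exists_comap_facet hb (hb0 ▸ hα)
  obtain ⟨hVs, hTs⟩ := volume_hull_ne T hs
  refine le_of_forall_test (v := u)
    (C := C * ((2 * (1 + ENNReal.ofReal (hdiam s ^ 2))) / volume (hull s))) ?_ ?_
  · exact ENNReal.mul_ne_top hC (ENNReal.div_ne_top (ENNReal.mul_ne_top (by simp) (by simp)) hVs)
  · intro y φ hφ h1 h2
    have h3 := hjump b (hdiam s) (norm_sub_le_hdiam hb 1 0) (cellPoly b s k P)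
      (isHomogeneous_cellPoly b s hP) φ hφ.contDiff_one (fun x hx => by
        refine hφ.eq_zero_of_notMem fun hxΩ => ?_
        have : x ∈ hull (s.erase v) ∩ Ω := ⟨convexHull_mono ?_ hx, hxΩ⟩
        · rw [hsΩ] at this; exact this
        · rintro _ ⟨i, rfl⟩
          rw [Finset.mem_coe, Finset.mem_erase]
          refine ⟨fun h' => ?_, by rw [← Finset.mem_coe, ← hb]; exact mem_range_self _⟩
          simp only [← hb0] at h'
          exact Fin.succ_ne_zero i (b.ind.injective h')) β
    rw [coeff_cellPoly, hβ b fun _ => rfl, bev_cellPoly hb, simplex_eq_hull hb] at h3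
    refine h3.trans ?_
    have h4 := smoothErr_le hΩ hL T hs hb u y h1 h2 P
    generalize ‖y - u‖ₑ ^ 2 = W at h4 ⊢
    refine (mul_le_mul_right (ENNReal.div_le_div_right h4 _) C).trans (le_of_eq ?_)
    simp only [div_eq_mul_inv]
    ring

end

section

/-! ### Barycentric coordinates indexed by the vertices -/

/-- `s` is the vertex set of a nondegenerate simplex. -/
def IsCell (s : Finset (Eu d)) : Prop := ∃ b : Bary d, range b = s

open Classical in
/-- The barycentric coordinate of `x` in the simplex `s` attached to `v` (zero if `v ∉ s`). -/
def bc (s : Finset (Eu d)) (v x : Eu d) : ℝ :=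
  if h : IsCell s then Function.extend h.choose (fun i => h.choose.coord i x) 0 v else 0

theorem bc_of_notMem {s : Finset (Eu d)} {v : Eu d} (hv : v ∉ s) (x : Eu d) : bc s v x = 0 := by
  rw [bc]
  split_ifs with h
  · rw [Function.extend_apply']
    · rfl
    · rintro ⟨i, rfl⟩
      exact hv (h.choose_spec.subset ⟨i, rfl⟩)
  · rfl

/-- The enumeration chosen in the definition is irrelevant, because the affine weights of a point on
affinely independent vertices are unique. -/
theorem bc_eq_coord {b : Bary d} {s : Finset (Eu d)} (hb : range b = s) (i : Fin (d + 1)) (x : Eu d) :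
    bc s (b i) x = b.coord i x := by
  have h : IsCell s := ⟨b, hb⟩
  rw [bc, dif_pos h]
  set b' := h.choose with hb'
  have hr : range b' = s := h.choose_spec
  have hmem : ∀ i, ∃ j, b' j = b i := fun i => by
    have : b i ∈ range b' := by rw [hr, ← hb]; exact mem_range_self _
    exact this
  choose e he using hmem
  rw [← he i, b'.ind.injective.extend_apply]
  have hei : Function.Injective e := fun i j hij => b.ind.injective (by rw [← he i, ← he j, hij])
  have heb : Function.Bijective e := Finite.injective_iff_bijective.1 hei
  have h1 : ∑ j, b.coord j x • b' (e j) = x := by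
    simp_rw [he]; exact b.linear_combination_coord_eq_self x
  set E := Equiv.ofBijective e heb
  have h2 : ∑ j, b.coord (E.symm j) x • b' j = x := by
    refine Eq.trans ?_ h1
    rw [← E.sum_comp]
    refine Finset.sum_congr rfl fun j _ => ?_
    rw [E.symm_apply_apply]; rfl
  have h3 : ∑ j, b.coord (E.symm j) x = 1 := by
    rw [← b.sum_coord_apply_eq_one x, ← E.sum_comp]
    exact Finset.sum_congr rfl fun j _ => by rw [E.symm_apply_apply]
  have h4 := coord_sum_smul b' h3 (e i)
  rw [h2] at h4
  rw [h4]
  congr 1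
  exact congrArg _ (E.symm_apply_apply i)

theorem IsCell.sum_bc {s : Finset (Eu d)} (hs : IsCell s) (x : Eu d) : ∑ v ∈ s, bc s v x = 1 := by
  obtain ⟨b, hb⟩ := hs
  rw [sum_enum hb]
  simp_rw [bc_eq_coord hb]
  exact b.sum_coord_apply_eq_one x

theorem IsCell.sum_bc_smul {s : Finset (Eu d)} (hs : IsCell s) (x : Eu d) :
    ∑ v ∈ s, bc s v x • v = x := by
  obtain ⟨b, hb⟩ := hs
  rw [sum_enum hb]
  simp_rw [bc_eq_coord hb]
  exact b.linear_combination_coord_eq_self x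

theorem IsCell.exists_eq {b : Bary d} {s : Finset (Eu d)} (hb : range b = s) {v : Eu d} (hv : v ∈ s) :
    ∃ i, b i = v := by
  have : v ∈ range b := by rw [hb]; exact hv
  exact this

theorem IsCell.bc_unique {s : Finset (Eu d)} (hs : IsCell s) {w : Eu d → ℝ} {x : Eu d}
    (h1 : ∑ v ∈ s, w v = 1) (h2 : ∑ v ∈ s, w v • v = x) {v : Eu d} (hv : v ∈ s) : bc s v x = w v := by
  obtain ⟨b, hb⟩ := hs
  obtain ⟨i, rfl⟩ := IsCell.exists_eq hb hv
  rw [bc_eq_coord hb]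
  rw [sum_enum hb] at h1 h2
  rw [← h2]
  exact coord_sum_smul b h1 i

theorem IsCell.mem_hull {s : Finset (Eu d)} (hs : IsCell s) {x : Eu d} :
    x ∈ hull s ↔ ∀ v ∈ s, 0 ≤ bc s v x := by
  obtain ⟨b, hb⟩ := hs
  rw [← simplex_eq_hull hb, mem_simplex]
  constructor
  · intro h v hv
    obtain ⟨i, rfl⟩ := IsCell.exists_eq hb hv
    rw [bc_eq_coord hb]; exact h i
  · intro h i
    rw [← bc_eq_coord hb]
    exact h _ (by rw [← Finset.mem_coe, ← hb]; exact mem_range_self i)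

theorem IsCell.mem_interior_hull {s : Finset (Eu d)} (hs : IsCell s) {x : Eu d} :
    x ∈ interior (hull s) ↔ ∀ v ∈ s, 0 < bc s v x := by
  obtain ⟨b, hb⟩ := hs
  rw [← simplex_eq_hull hb, interior_simplex]
  constructor
  · intro h v hv
    obtain ⟨i, rfl⟩ := IsCell.exists_eq hb hv
    rw [bc_eq_coord hb]; exact h i
  · intro h i
    rw [← bc_eq_coord hb]
    exact h _ (by rw [← Finset.mem_coe, ← hb]; exact mem_range_self i)

theorem bc_nonneg {s : Finset (Eu d)} (hs : IsCell s) {x : Eu d} (hx : x ∈ hull s) (v : Eu d) :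
    0 ≤ bc s v x := by
  by_cases hv : v ∈ s
  · exact hs.mem_hull.1 hx v hv
  · exact (bc_of_notMem hv x).ge

theorem IsCell.contDiff_bc {s : Finset (Eu d)} (hs : IsCell s) (v : Eu d) {n : WithTop ℕ∞} :
    ContDiff ℝ n (bc s v) := by
  by_cases hv : v ∈ s
  · obtain ⟨b, hb⟩ := hs
    obtain ⟨i, rfl⟩ := IsCell.exists_eq hb hv
    have : bc s (b i) = b.coord i := funext fun x => bc_eq_coord hb i x
    rw [this]; exact contDiff_coord b i
  · have : bc s v = fun _ => 0 := funext fun x => bc_of_notMem hv x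
    rw [this]; exact contDiff_const

theorem IsCell.continuous_bc {s : Finset (Eu d)} (hs : IsCell s) (v : Eu d) : Continuous (bc s v) :=
  (hs.contDiff_bc (n := 0) v).continuous

theorem IsCell.bc_comb {s : Finset (Eu d)} (hs : IsCell s) {v : Eu d} (x y : Eu d) (t : ℝ) :
    bc s v (x + t • (y - x)) = bc s v x + t * (bc s v y - bc s v x) := by
  by_cases hv : v ∈ s
  · obtain ⟨b, hb⟩ := hs
    obtain ⟨i, rfl⟩ := IsCell.exists_eq hb hv
    simp_rw [bc_eq_coord hb]
    have h1 := coord_sub b i (x + t • (y - x)) x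
    rw [add_sub_cancel_left, map_smul, ← coord_sub, smul_eq_mul] at h1
    linarith
  · simp [bc_of_notMem hv]

theorem IsCell.bc_self {s : Finset (Eu d)} (hs : IsCell s) {v : Eu d} (hv : v ∈ s) : bc s v v = 1 := by
  obtain ⟨b, hb⟩ := hs
  obtain ⟨i, rfl⟩ := IsCell.exists_eq hb hv
  rw [bc_eq_coord hb, b.coord_apply_eq]

theorem IsCell.bc_vertex_ne {s : Finset (Eu d)} (hs : IsCell s) {v w : Eu d} (hw : w ∈ s) (h : v ≠ w) :
    bc s v w = 0 := by
  by_cases hv : v ∈ s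
  · obtain ⟨b, hb⟩ := hs
    obtain ⟨i, rfl⟩ := IsCell.exists_eq hb hv
    obtain ⟨j, rfl⟩ := IsCell.exists_eq hb hw
    rw [bc_eq_coord hb, b.coord_apply_ne fun hij => h (by rw [hij])]
  · exact bc_of_notMem hv w

variable {Ω : Set (Eu d)}

theorem Mesh.isCell (T : Mesh Ω) {s : Finset (Eu d)} (hs : s ∈ T.cells) : IsCell s := T.exists_enum' hs

theorem bc_eq_of_mem_hull {s m : Finset (Eu d)} (hs : IsCell s) (hm : m ⊆ s) {w : Eu d → ℝ}
    {x : Eu d} (h1 : ∑ v ∈ m, w v = 1) (h2 : ∑ v ∈ m, w v • v = x) :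
    (∀ v ∈ m, bc s v x = w v) ∧ ∀ v ∉ m, bc s v x = 0 := by
  classical
  have e1 : ∑ v ∈ s, (if v ∈ m then w v else 0) = 1 := by
    rw [← h1, Finset.sum_ite_mem, Finset.inter_eq_right.2 hm]
  have e2 : ∑ v ∈ s, (if v ∈ m then w v else 0) • v = x := by
    rw [← h2]
    simp_rw [ite_smul, zero_smul]
    rw [Finset.sum_ite_mem, Finset.inter_eq_right.2 hm]
  constructor
  · intro v hv
    rw [hs.bc_unique e1 e2 (hm hv), if_pos hv]
  · intro v hv
    by_cases hvs : v ∈ s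
    · rw [hs.bc_unique e1 e2 hvs, if_neg hv]
    · exact bc_of_notMem hvs x

/-- By conformity x lies in the hull of the common vertices. On both cells its coordinates are the
weights there, extended by zero. This makes polynomials in vertex coordinates with mesh-wide
coefficients continuous across cells. -/
theorem Mesh.bc_agree (T : Mesh Ω) {s t : Finset (Eu d)} (hs : s ∈ T.cells) (ht : t ∈ T.cells)
    {x : Eu d} (hxs : x ∈ hull s) (hxt : x ∈ hull t) (v : Eu d) : bc s v x = bc t v x := by
  classical
  have hx := T.conforming s hs t ht ⟨hxs, hxt⟩
  rw [← Finset.coe_inter, Finset.mem_convexHull'] at hx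
  obtain ⟨w, -, h1, h2⟩ := hx
  obtain ⟨a1, a2⟩ := bc_eq_of_mem_hull (T.isCell hs) Finset.inter_subset_left h1 h2
  obtain ⟨b1, b2⟩ := bc_eq_of_mem_hull (T.isCell ht) Finset.inter_subset_right h1 h2
  by_cases hv : v ∈ s ∩ t
  · rw [a1 v hv, b1 v hv]
  · rw [a2 v hv, b2 v hv]

theorem Mesh.mem_of_bc_pos (T : Mesh Ω) {s t : Finset (Eu d)} (hs : s ∈ T.cells) (ht : t ∈ T.cells)
    {x : Eu d} (hxs : x ∈ hull s) (hxt : x ∈ hull t) {v : Eu d} (h : 0 < bc s v x) : v ∈ t := by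
  by_contra hv
  rw [T.bc_agree hs ht hxs hxt, bc_of_notMem hv] at h
  exact lt_irrefl _ h

/-- The relative interior of the simplex with vertex set `m`. -/
def relint (m : Finset (Eu d)) : Set (Eu d) :=
  {x | ∃ w : Eu d → ℝ, (∀ v ∈ m, 0 < w v) ∧ ∑ v ∈ m, w v = 1 ∧ ∑ v ∈ m, w v • v = x}

theorem relint_nonempty {m : Finset (Eu d)} (hm : m.Nonempty) : (relint m).Nonempty := by
  have : (0 : ℝ) < m.card := by exact_mod_cast hm.card_pos
  refine ⟨_, fun _ => (m.card : ℝ)⁻¹, fun _ _ => by positivity, ?_, rfl⟩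
  rw [Finset.sum_const, nsmul_eq_mul, mul_inv_cancel₀ this.ne']

theorem mem_relint_iff {s m : Finset (Eu d)} (hs : IsCell s) (hm : m ⊆ s) {x : Eu d} :
    x ∈ relint m ↔ (∀ v ∈ m, 0 < bc s v x) ∧ ∀ v ∉ m, bc s v x = 0 := by
  constructor
  · rintro ⟨w, hw, h1, h2⟩
    obtain ⟨a1, a2⟩ := bc_eq_of_mem_hull hs hm h1 h2
    exact ⟨fun v hv => by rw [a1 v hv]; exact hw v hv, a2⟩
  · rintro ⟨a1, a2⟩
    refine ⟨fun v => bc s v x, a1, ?_, ?_⟩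
    · rw [← hs.sum_bc x]
      exact Finset.sum_subset hm fun v _ hv => a2 v hv
    · conv_rhs => rw [← hs.sum_bc_smul x]
      exact Finset.sum_subset hm fun v _ hv => by simp only [a2 v hv, zero_smul]

theorem relint_subset_hull {s m : Finset (Eu d)} (hs : IsCell s) (hm : m ⊆ s) : relint m ⊆ hull s := by
  intro x hx
  obtain ⟨h1, h2⟩ := (mem_relint_iff hs hm).1 hx
  refine hs.mem_hull.2 fun v _ => ?_
  by_cases hv : v ∈ m
  · exact (h1 v hv).le
  · exact (h2 v hv).ge

theorem Mesh.subset_of_relint_mem (T : Mesh Ω) {s t m : Finset (Eu d)} (hs : s ∈ T.cells)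
    (ht : t ∈ T.cells) (hm : m ⊆ s) {x : Eu d} (hx : x ∈ relint m) (hxt : x ∈ hull t) : m ⊆ t :=
  fun v hv => T.mem_of_bc_pos hs ht (relint_subset_hull (T.isCell hs) hm hx) hxt
    (((mem_relint_iff (T.isCell hs) hm).1 hx).1 v hv)

/-! ### Facets and stars -/

/-- The facets of `s` opposite to `v` and of `t` opposite to `w` are the same. -/
def SharesFacet (s t : Finset (Eu d)) (v w : Eu d) : Prop :=
  v ∈ s ∧ w ∈ t ∧ s ≠ t ∧ (s : Set (Eu d)) \ {v} = (t : Set (Eu d)) \ {w}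

theorem affineSpan_ne_top_of_card_le {m : Finset (Eu d)} (hm : m.card ≤ d) :
    affineSpan ℝ (m : Set (Eu d)) ≠ ⊤ := by
  intro h
  have := interior_convexHull_nonempty_iff_affineSpan_eq_top.2 h
  rw [interior_hull_eq_empty hm] at this
  exact Set.not_nonempty_empty this

open Classical in
/-- A facet which meets `Ω` is shared by two cells. -/
theorem Mesh.exists_sharesFacet (T : Mesh Ω) (hΩ : IsOpen Ω) {s : Finset (Eu d)} (hs : s ∈ T.cells)
    {v : Eu d} (hv : v ∈ s) {x : Eu d} (hx : x ∈ relint (s.erase v)) (hxΩ : x ∈ Ω) :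
    ∃ t ∈ T.cells, ∃ w, SharesFacet s t v w := by
  have hc := T.isCell hs
  obtain ⟨h1, h2⟩ := (mem_relint_iff hc (s.erase_subset v)).1 hx
  have hx0 : bc s v x = 0 := h2 v (Finset.notMem_erase v s)
  set c : ℝ → Eu d := fun ε => x + ε • (v - x) with hcdef
  have hcc : Continuous c := by fun_prop
  have hc0 : c 0 = x := by simp [hcdef]
  -- Points x + ε(v − x) with small ε < 0 are still in Ω but outside s, since their coordinate at v
  -- is negative. So x is a limit of points of the other cells, whose finite union is closed.
  have hcl : x ∈ closure (⋃ t ∈ T.cells.erase s, hull t) := by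
    rw [mem_closure_iff_nhds]
    intro U hU
    have h3 : ∀ᶠ ε in nhds (0 : ℝ), c ε ∈ U ∩ Ω :=
      hcc.continuousAt.eventually (by rw [hc0]; exact Filter.inter_mem hU (hΩ.mem_nhds hxΩ))
    obtain ⟨ε, hε, hε0⟩ := ((h3.filter_mono nhdsWithin_le_nhds).and
      (self_mem_nhdsWithin : Iio (0 : ℝ) ∈ nhdsWithin 0 (Iio 0))).exists
    refine ⟨c ε, hε.1, ?_⟩
    have h4 : c ε ∈ ⋃ t ∈ T.cells, hull t := by
      have := T.cover; rw [this]; exact subset_closure hε.2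
    obtain ⟨t, ht, hct⟩ := mem_iUnion₂.1 h4
    refine mem_iUnion₂.2 ⟨t, Finset.mem_erase.2 ⟨?_, ht⟩, hct⟩
    rintro rfl
    have := hc.mem_hull.1 hct v hv
    rw [hcdef, hc.bc_comb, hx0, hc.bc_self hv] at this
    have h5 : ε < 0 := hε0
    linarith
  rw [IsClosed.closure_eq] at hcl
  · obtain ⟨t, ht, hxt⟩ := mem_iUnion₂.1 hcl
    have ht' := (Finset.mem_erase.1 ht).2
    have hne := (Finset.mem_erase.1 ht).1
    have hsub := T.subset_of_relint_mem hs ht' (s.erase_subset v) hx hxt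
    have hcard : (s.erase v).card + 1 = t.card := by
      rw [Finset.card_erase_of_mem hv, T.card_eq s hs, T.card_eq t ht']; omega
    obtain ⟨w, hw⟩ := (Finset.exists_eq_insert_iff (s := s.erase v) (t := t)).2 ⟨hsub, hcard⟩
    refine ⟨t, ht', w, hv, ?_, hne.symm, ?_⟩
    · rw [← hw.2]; exact Finset.mem_insert_self _ _
    · rw [← hw.2, Finset.coe_insert, Set.insert_sdiff_of_mem _ (mem_singleton w), ← Finset.coe_erase,
        Set.sdiff_singleton_eq_self]
      exact fun h => hw.1 (Finset.mem_coe.1 h)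
  · exact isClosed_biUnion_finset fun t _ => (Mesh.isCompact_hull t).isClosed

theorem SharesFacet.mem_iff {s t : Finset (Eu d)} {v w : Eu d} (h : SharesFacet s t v w) {u : Eu d} :
    (u ∈ s ∧ u ≠ v) ↔ (u ∈ t ∧ u ≠ w) := by
  have := Set.ext_iff.1 h.2.2.2 u
  simpa using this

theorem SharesFacet.symm {s t : Finset (Eu d)} {v w : Eu d} (h : SharesFacet s t v w) :
    SharesFacet t s w v := ⟨h.2.1, h.1, h.2.2.1.symm, h.2.2.2.symm⟩

/-- Two cells which share a facet cover a neighbourhood of each point in the interior of the facet. -/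
theorem Mesh.union_mem_nhds (T : Mesh Ω) {s t : Finset (Eu d)} (hs : s ∈ T.cells) (ht : t ∈ T.cells)
    {v w : Eu d} (h : SharesFacet s t v w) {x : Eu d} (hx0 : bc s v x = 0)
    (hx : ∀ u ∈ s, u ≠ v → 0 < bc s u x) : hull s ∪ hull t ∈ nhds x := by
  have hcs := T.isCell hs
  have hct := T.isCell ht
  have hxs : x ∈ hull s := hcs.mem_hull.2 fun u hu => by
    by_cases huv : u = v
    · rw [huv, hx0]
    · exact (hx u hu huv).le
  classical
  have hxr : x ∈ relint (s.erase v) := (mem_relint_iff hcs (s.erase_subset v)).2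
    ⟨fun u hu => hx u (Finset.mem_of_mem_erase hu) (Finset.ne_of_mem_erase hu), fun u hu => by
      by_cases huv : u = v
      · rw [huv, hx0]
      · exact bc_of_notMem (fun h' => hu (Finset.mem_erase.2 ⟨huv, h'⟩)) x⟩
  have hsub : s.erase v ⊆ t := fun u hu =>
    (h.mem_iff.1 ⟨Finset.mem_of_mem_erase hu, Finset.ne_of_mem_erase hu⟩).1
  have hxt : x ∈ hull t := relint_subset_hull hct hsub hxr
  have hbt : ∀ u, bc t u x = bc s u x := fun u => T.bc_agree ht hs hxt hxs u
  have hxw : bc t w x = 0 := by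
    rw [hbt]
    by_cases hws : w ∈ s
    · by_cases hwv : w = v
      · rw [hwv, hx0]
      · exact absurd rfl (h.mem_iff.1 ⟨hws, hwv⟩).2
    · exact bc_of_notMem hws x
  -- the two coordinates transversal to the facet are proportional, with a nonpositive factor
  have hprop : ∀ y, bc t w y = bc s v y * bc t w v := by
    intro y
    obtain ⟨b, hb⟩ := hct
    obtain ⟨i, hi⟩ := IsCell.exists_eq hb h.2.1
    have hlin : ∀ z, bc t w z = dcoord b i z + b.coord i 0 := by
      intro z
      have := coord_sub b i z 0
      rw [sub_zero] at this
      rw [← hi, bc_eq_coord hb]; linarith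
    have e1 : bc t w y = ∑ u ∈ s, bc s u y * bc t w u := by
      conv_lhs => rw [hlin, ← hcs.sum_bc_smul y, map_sum]
      have : b.coord i 0 = ∑ u ∈ s, bc s u y * b.coord i 0 := by
        rw [← Finset.sum_mul, hcs.sum_bc, one_mul]
      rw [this, ← Finset.sum_add_distrib]
      refine Finset.sum_congr rfl fun u _ => ?_
      rw [hlin u, map_smul, smul_eq_mul]; ring
    rw [e1, Finset.sum_eq_single v]
    · intro u hu huv
      have := h.mem_iff.1 ⟨hu, huv⟩
      rw [(show IsCell t from ⟨b, hb⟩).bc_vertex_ne this.1 this.2.symm, mul_zero]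
    · exact fun h' => absurd h.1 h'
  have hev : ∀ᶠ y in nhds x, ∀ u ∈ s.erase v, 0 < bc s u y ∧ 0 < bc t u y := by
    rw [Filter.eventually_all_finset]
    intro u hu
    have h3 := hx u (Finset.mem_of_mem_erase hu) (Finset.ne_of_mem_erase hu)
    exact ((hcs.continuous_bc u).continuousAt.eventually (lt_mem_nhds h3)).and
      ((hct.continuous_bc u).continuousAt.eventually (lt_mem_nhds (by rw [hbt]; exact h3)))
  have hin : ∀ y, (∀ u ∈ s.erase v, 0 < bc s u y ∧ 0 < bc t u y) → 0 ≤ bc t w y → y ∈ hull t := by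
    intro y hy hyw
    refine hct.mem_hull.2 fun u hu => ?_
    by_cases huw : u = w
    · rw [huw]; exact hyw
    · have := h.mem_iff.2 ⟨hu, huw⟩
      exact (hy u (Finset.mem_erase.2 ⟨this.2, this.1⟩)).2.le
  -- If v and w were on the same side of the facet, points slightly moved from x towards v would be
  -- interior to s and lie in t, so s and t would coincide.
  have hneg : bc t w v ≤ 0 := by
    by_contra hpos
    push Not at hpos
    set c : ℝ → Eu d := fun ε => x + ε • (v - x) with hcdef
    have hcc : Continuous c := by fun_prop
    have hc0 : c 0 = x := by simp [hcdef]
    have h3 : ∀ᶠ ε in nhds (0 : ℝ), ∀ u ∈ s.erase v, 0 < bc s u (c ε) ∧ 0 < bc t u (c ε) :=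
      hcc.continuousAt.eventually (by rw [hc0]; exact hev)
    obtain ⟨ε, hε, hε0⟩ := ((h3.filter_mono nhdsWithin_le_nhds).and
      (self_mem_nhdsWithin : Ioi (0 : ℝ) ∈ nhdsWithin 0 (Ioi 0))).exists
    have hε0' : 0 < ε := hε0
    have h4 : bc s v (c ε) = ε := by rw [hcdef, hcs.bc_comb, hx0, hcs.bc_self h.1]; ring
    refine h.2.2.1 (T.eq_of_interior_inter hs ht ⟨c ε, ?_, ?_⟩)
    · refine hcs.mem_interior_hull.2 fun u hu => ?_
      by_cases huv : u = v
      · rw [huv, h4]; exact hε0'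
      · exact (hε u (Finset.mem_erase.2 ⟨huv, hu⟩)).1
    · refine hin _ hε ?_
      rw [hprop, h4]; positivity
  filter_upwards [hev] with y hy
  by_cases h0 : 0 ≤ bc s v y
  · left
    refine hcs.mem_hull.2 fun u hu => ?_
    by_cases huv : u = v
    · rw [huv]; exact h0
    · exact (hy u (Finset.mem_erase.2 ⟨huv, hu⟩)).1.le
  · right
    refine hin y hy ?_
    rw [hprop]
    exact mul_nonneg_of_nonpos_of_nonpos (not_le.1 h0).le hneg

end

section

/-! ### Connectedness of stars -/

variable {Ω : Set (Eu d)}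

theorem volume_affineSpan_eq_zero {m : Finset (Eu d)} (hm : m.card ≤ d) :
    volume (affineSpan ℝ (m : Set (Eu d)) : Set (Eu d)) = 0 :=
  Measure.addHaar_affineSubspace _ _ (affineSpan_ne_top_of_card_le hm)

theorem mem_affineSpan_of_relint {m : Finset (Eu d)} {x : Eu d} {w : Eu d → ℝ}
    (h1 : ∑ v ∈ m, w v = 1) (h2 : ∑ v ∈ m, w v • v = x) : x ∈ affineSpan ℝ (m : Set (Eu d)) := by
  have h3 := affineCombination_mem_affineSpan (k := ℝ) (s := (Finset.univ : Finset m))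
    (w := fun i => w i) ((Finset.sum_coe_sort m w).trans h1) (fun i : m => (i : Eu d))
  rw [Finset.affineCombination_eq_linear_combination _ _ _ ((Finset.sum_coe_sort m w).trans h1),
    Finset.sum_coe_sort m fun v => w v • v, h2] at h3
  convert h3 using 2
  ext v; simp

open Classical in
/-- A family of cells around a common face all of whose facets containing this face are shared
within the family covers a neighbourhood of each point of the relative interior of the face. -/
theorem Mesh.iUnion_mem_nhds (T : Mesh Ω) {m : Finset (Eu d)} {C : Finset (Finset (Eu d))}
    (hne : C.Nonempty) (hC : C ⊆ T.cells) (hm : ∀ s ∈ C, m ⊆ s)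
    (hsh : ∀ s ∈ C, ∀ v ∈ s, v ∉ m → ∃ t ∈ C, ∃ w, SharesFacet s t v w) {z : Eu d}
    (hz : z ∈ relint m) : ⋃ s ∈ C, hull s ∈ nhds z := by
  set A := ⋃ s ∈ C, hull s with hA
  have hAc : IsClosed A := isClosed_biUnion_finset fun t _ => (Mesh.isCompact_hull t).isClosed
  have hcell : ∀ s ∈ C, IsCell s := fun s hs => T.isCell (hC hs)
  have hev : ∀ᶠ y in nhds z, ∀ s ∈ C, ∀ v ∈ m, 0 < bc s v y := by
    rw [Filter.eventually_all_finset]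
    intro s hs
    rw [Filter.eventually_all_finset]
    intro v hv
    exact ((hcell s hs).continuous_bc v).continuousAt.eventually
      (lt_mem_nhds (((mem_relint_iff (hcell s hs) (hm s hs)).1 hz).1 v hv))
  obtain ⟨ε, hε, hball⟩ := Metric.eventually_nhds_iff_ball.1 hev
  obtain ⟨s₀, hs₀⟩ := hne
  obtain ⟨p, hpb, hpi⟩ : (Metric.ball z ε ∩ interior (hull s₀)).Nonempty := by
    have : z ∈ closure (interior (hull s₀)) := by
      rw [(convex_convexHull ℝ _).closure_interior_eq_closure_of_nonempty_interior
        (T.interior_hull_nonempty (hC hs₀))]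
      exact subset_closure (relint_subset_hull (hcell _ hs₀) (hm _ hs₀) hz)
    exact mem_closure_iff.1 this _ Metric.isOpen_ball (Metric.mem_ball_self hε)
  -- N is the union of the affine spans of p and the faces of codimension two. Each is spanned by d
  -- points, so N is null and its complement dense; the remaining q are reached because A is closed.
  set N : Set (Eu d) := ⋃ s ∈ C, ⋃ v ∈ s, ⋃ v' ∈ s.erase v,
    (affineSpan ℝ ((insert p ((s.erase v).erase v') : Finset (Eu d)) : Set (Eu d)) : Set (Eu d)) with hN
  have hN0 : volume N = 0 := by
    refine (measure_biUnion_null_iff C.countable_toSet).2 fun s hs =>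
      (measure_biUnion_null_iff s.countable_toSet).2 fun v hv =>
      (measure_biUnion_null_iff (s.erase v).countable_toSet).2 fun v' hv' => ?_
    refine volume_affineSpan_eq_zero ?_
    refine (Finset.card_insert_le _ _).trans ?_
    have h1 := Finset.card_erase_of_mem hv
    have h2 := Finset.card_erase_of_mem hv'
    have h3 : 0 < (s.erase v).card := Finset.card_pos.2 ⟨v', hv'⟩
    rw [T.card_eq s (hC hs)] at h1
    omega
  -- Continuous induction along the segment from p to q. Avoiding N, it meets the frontiers of cells
  -- only in the relative interiors of facets. There the two cells sharing the facet, both in the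
  -- family, cover a neighbourhood, so the segment cannot leave the union.
  have key : ∀ q ∈ Metric.ball z ε, q ∉ N → q ∈ A := by
    intro q hq hqN
    set c : ℝ → Eu d := fun t => p + t • (q - p) with hc
    have hcc : Continuous c := by fun_prop
    have hcb : ∀ t ∈ Icc (0 : ℝ) 1, c t ∈ Metric.ball z ε := by
      intro t ht
      have : c t = (1 - t) • p + t • q := by rw [hc]; simp only; rw [smul_sub, sub_smul, one_smul]; abel
      rw [this]
      exact convex_ball z ε hpb hq (by linarith [ht.2]) ht.1 (by ring)
    have hsub : Icc (0 : ℝ) 1 ⊆ c ⁻¹' A := by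
      refine IsClosed.Icc_subset_of_forall_mem_nhdsWithin ((hAc.preimage hcc).inter isClosed_Icc) ?_ ?_
      · change c 0 ∈ A
        rw [hc]; simp only [zero_smul, add_zero]
        exact mem_iUnion₂.2 ⟨s₀, hs₀, interior_subset hpi⟩
      · rintro t ⟨htA, ht⟩
        refine mem_nhdsWithin_of_mem_nhds (hcc.continuousAt.preimage_mem_nhds ?_)
        have htb := hcb t ⟨ht.1, ht.2.le⟩
        obtain ⟨s, hs, hts⟩ := mem_iUnion₂.1 htA
        have hsc := hcell s hs
        have hnn := hsc.mem_hull.1 hts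
        by_cases hpos : ∀ v ∈ s, 0 < bc s v (c t)
        · exact Filter.mem_of_superset (mem_interior_iff_mem_nhds.1 (hsc.mem_interior_hull.2 hpos))
            (subset_biUnion_of_mem (u := fun s : Finset (Eu d) => hull s) hs)
        push Not at hpos
        obtain ⟨v, hv, hv0⟩ := hpos
        replace hv0 : bc s v (c t) = 0 := le_antisymm hv0 (hnn v hv)
        have hvm : v ∉ m := fun h => by
          have := hball (c t) htb s hs v h
          rw [hv0] at this; exact lt_irrefl _ this
        obtain ⟨s', hs', w, hw⟩ := hsh s hs v hv hvm
        by_cases hpos' : ∀ u ∈ s, u ≠ v → 0 < bc s u (c t)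
        · refine Filter.mem_of_superset (T.union_mem_nhds (hC hs) (hC hs') hw hv0 hpos') ?_
          exact union_subset (subset_biUnion_of_mem (u := fun s : Finset (Eu d) => hull s) hs)
            (subset_biUnion_of_mem (u := fun s : Finset (Eu d) => hull s) hs')
        exfalso
        push Not at hpos'
        obtain ⟨v', hv', hvv, hv0'⟩ := hpos'
        replace hv0' : bc s v' (c t) = 0 := le_antisymm hv0' (hnn v' hv')
        -- At t = 0 the point is p, interior to a cell, so no coordinate vanishes. For t > 0 the
        -- point is on a face of codimension two, and q on the line through it and p would be in N.
        rcases eq_or_lt_of_le ht.1 with h0 | h0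
        · have hcp : c t = p := by rw [hc, ← h0]; simp
          rw [hcp] at hts hv0
          have := T.eq_of_interior_inter (hC hs₀) (hC hs) ⟨p, hpi, hts⟩
          rw [this] at hpi
          have := hsc.mem_interior_hull.1 hpi v hv
          rw [hv0] at this; exact lt_irrefl _ this
        · refine hqN (mem_iUnion₂.2 ⟨s, hs, mem_iUnion₂.2 ⟨v, hv, mem_iUnion₂.2 ⟨v',
            Finset.mem_erase.2 ⟨hvv, hv'⟩, ?_⟩⟩⟩)
          set E := affineSpan ℝ ((insert p ((s.erase v).erase v') : Finset (Eu d)) : Set (Eu d))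
          have e1 : c t ∈ E := by
            have h1 : ∑ u ∈ (s.erase v).erase v', bc s u (c t) = 1 := by
              rw [Finset.sum_erase (s.erase v) (f := fun u => bc s u (c t)) hv0',
                Finset.sum_erase s (f := fun u => bc s u (c t)) hv0]
              exact hsc.sum_bc (c t)
            have h2 : ∑ u ∈ (s.erase v).erase v', bc s u (c t) • u = c t := by
              rw [Finset.sum_erase (s.erase v) (f := fun u => bc s u (c t) • u)
                  (show bc s v' (c t) • v' = 0 by rw [hv0', zero_smul]),
                Finset.sum_erase s (f := fun u => bc s u (c t) • u)
                  (show bc s v (c t) • v = 0 by rw [hv0, zero_smul])]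
              exact hsc.sum_bc_smul (c t)
            exact affineSpan_mono ℝ (by simp) (mem_affineSpan_of_relint h1 h2)
          have e2 : p ∈ E := subset_affineSpan ℝ _ (by simp)
          have e3 : q = AffineMap.lineMap p (c t) (1 / t) := by
            rw [AffineMap.lineMap_apply_module', hc]
            simp only [add_sub_cancel_left, smul_smul]
            rw [one_div_mul_cancel h0.ne', one_smul]; abel
          rw [e3]
          exact AffineMap.lineMap_mem _ e2 e1
    have := hsub (right_mem_Icc.2 zero_le_one)
    simpa [hc] using this
  refine Filter.mem_of_superset (Metric.ball_mem_nhds z hε) fun q hq => ?_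
  have hd : Dense Nᶜ := by
    have : ∀ᵐ x ∂(volume : Measure (Eu d)), x ∈ Nᶜ := measure_eq_zero_iff_ae_notMem.1 hN0
    exact Measure.dense_of_ae this
  rw [← hAc.closure_eq]
  refine mem_closure_iff.2 fun U hU hqU => ?_
  obtain ⟨y, hy, hyN⟩ := hd.inter_open_nonempty (U ∩ Metric.ball z ε) (hU.inter Metric.isOpen_ball) ⟨q, hqU, hq⟩
  exact ⟨y, hy.1, key y hy.2 hyN⟩

open Classical in
/-- The cells which contain the face `m`. -/
def Mesh.star (T : Mesh Ω) (m : Finset (Eu d)) : Finset (Finset (Eu d)) := T.cells.filter (m ⊆ ·)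

theorem Mesh.mem_star {T : Mesh Ω} {m s : Finset (Eu d)} : s ∈ T.star m ↔ s ∈ T.cells ∧ m ⊆ s := by
  classical
  exact Finset.mem_filter

/-- Facet adjacency of the cells in a star. -/
def Mesh.starGraph (T : Mesh Ω) (m : Finset (Eu d)) : SimpleGraph (T.star m) where
  Adj s t := ∃ v w, SharesFacet s.1 t.1 v w
  symm := ⟨fun _ _ ⟨v, w, h⟩ => ⟨w, v, h.symm⟩⟩
  loopless := ⟨fun _ ⟨_, _, h⟩ => h.2.2.1 rfl⟩

/-- The face `m` is interior: every larger face of the mesh has its relative interior in `Ω`. -/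
def Mesh.IsInteriorFace (T : Mesh Ω) (m : Finset (Eu d)) : Prop :=
  ∀ M, m ⊆ M → (∃ s ∈ T.cells, M ⊆ s) → relint M ⊆ Ω

theorem SharesFacet.notMem {s t m : Finset (Eu d)} {v w : Eu d} (h : SharesFacet s t v w)
    (hs : m ⊆ s) (ht : m ⊆ t) : v ∉ m := by
  intro hv
  have hvw : v = w := by
    by_contra hne
    exact (h.mem_iff.2 ⟨ht hv, hne⟩).2 rfl
  refine h.2.2.1 (Finset.ext fun u => ?_)
  by_cases huv : u = v
  · rw [huv]; exact ⟨fun _ => ht hv, fun _ => hs hv⟩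
  · have := h.mem_iff (u := u)
    rw [← hvw] at this
    simpa [huv] using this

theorem SharesFacet.subset_of {s t m : Finset (Eu d)} {v w : Eu d} (h : SharesFacet s t v w)
    (hs : m ⊆ s) (hv : v ∉ m) : m ⊆ t := fun _ hu =>
  (h.mem_iff.1 ⟨hs hu, fun h' => hv (h' ▸ hu)⟩).1

open Classical in
/-- The cells of the star of `m` reachable from a given one. -/
def Mesh.component (T : Mesh Ω) (m : Finset (Eu d)) (s : T.star m) : Finset (Finset (Eu d)) :=
  (Finset.univ.filter fun t => (T.starGraph m).Reachable s t).image Subtype.val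

theorem Mesh.mem_component {T : Mesh Ω} {m : Finset (Eu d)} {s : T.star m} {t : Finset (Eu d)} :
    t ∈ T.component m s ↔ ∃ h : t ∈ T.star m, (T.starGraph m).Reachable s ⟨t, h⟩ := by
  classical
  simp [Mesh.component]

theorem Mesh.component_closed {T : Mesh Ω} {m : Finset (Eu d)} {s : T.star m} {t t' : Finset (Eu d)}
    (ht : t ∈ T.component m s) (ht' : t' ∈ T.cells) {v w : Eu d} (h : SharesFacet t t' v w)
    (hv : v ∉ m) : t' ∈ T.component m s := by
  obtain ⟨h1, h2⟩ := Mesh.mem_component.1 ht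
  have h3 : t' ∈ T.star m := Mesh.mem_star.2 ⟨ht', h.subset_of (Mesh.mem_star.1 h1).2 hv⟩
  refine Mesh.mem_component.2 ⟨h3, h2.trans (SimpleGraph.Adj.reachable ?_)⟩
  exact ⟨v, w, h⟩

/-- The interior of t accumulates at z, so it meets some cell of the family, which must be t. -/
theorem Mesh.mem_of_iUnion_mem_nhds (T : Mesh Ω) {C : Finset (Finset (Eu d))} (hC : C ⊆ T.cells)
    {z : Eu d} (h : ⋃ s ∈ C, hull s ∈ nhds z) {t : Finset (Eu d)} (ht : t ∈ T.cells) (hz : z ∈ hull t) :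
    t ∈ C := by
  have h1 : z ∈ closure (interior (hull t)) := by
    rw [(convex_convexHull ℝ _).closure_interior_eq_closure_of_nonempty_interior
      (T.interior_hull_nonempty ht)]
    exact subset_closure hz
  obtain ⟨y, hy1, hy2⟩ := mem_closure_iff_nhds.1 h1 _ h
  obtain ⟨s, hs, hys⟩ := mem_iUnion₂.1 hy1
  rw [T.eq_of_interior_inter ht (hC hs) ⟨y, hy2, hys⟩]
  exact hs

theorem Mesh.component_subset {T : Mesh Ω} {m : Finset (Eu d)} {s : T.star m} :
    T.component m s ⊆ T.star m := fun _ ht => (Mesh.mem_component.1 ht).1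

theorem Mesh.star_subset {T : Mesh Ω} {m : Finset (Eu d)} : T.star m ⊆ T.cells :=
  fun _ hs => (Mesh.mem_star.1 hs).1

theorem Mesh.self_mem_component {T : Mesh Ω} {m : Finset (Eu d)} (s : T.star m) :
    s.1 ∈ T.component m s := Mesh.mem_component.2 ⟨s.2, SimpleGraph.Reachable.refl _⟩

/-- The star of an interior face is connected through facets. -/
theorem Mesh.reachable_of_interior (T : Mesh Ω) (hΩ : IsOpen Ω) {m : Finset (Eu d)} (hmne : m.Nonempty)
    (hm : T.IsInteriorFace m) (s t : T.star m) : (T.starGraph m).Reachable s t := by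
  classical
  obtain ⟨z, hz⟩ := relint_nonempty hmne
  have ht := Mesh.mem_star.1 t.2
  -- All facets containing m meet Ω, so each is shared, and the component is closed under passing to
  -- the neighbour. It thus covers a neighbourhood of z, which leaves no room for cells of the star
  -- outside it.
  have h1 : ⋃ s' ∈ T.component m s, hull s' ∈ nhds z := by
    refine T.iUnion_mem_nhds ⟨_, Mesh.self_mem_component s⟩ (Mesh.component_subset.trans Mesh.star_subset)
      (fun s' hs' => (Mesh.mem_star.1 (Mesh.component_subset hs')).2) (fun s' hs' v hv hvm => ?_) hz
    obtain ⟨hs1, hs2⟩ := Mesh.mem_star.1 (Mesh.component_subset hs')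
    have hsub : m ⊆ s'.erase v := Finset.subset_erase.2 ⟨hs2, hvm⟩
    obtain ⟨x, hx⟩ := relint_nonempty (hmne.mono hsub)
    obtain ⟨t', ht', w, hw⟩ := T.exists_sharesFacet hΩ hs1 hv hx
      (hm _ hsub ⟨s', hs1, s'.erase_subset v⟩ hx)
    exact ⟨t', Mesh.component_closed hs' ht' hw hvm, w, hw⟩
  have h2 := T.mem_of_iUnion_mem_nhds (Mesh.component_subset.trans Mesh.star_subset) h1 ht.1
    (relint_subset_hull (T.isCell ht.1) ht.2 hz)
  exact (Mesh.mem_component.1 h2).2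

open Classical in
/-- In the star of a boundary face, each cell is connected to one with a facet outside `Ω`. -/
theorem Mesh.exists_boundary_facet (T : Mesh Ω) (hΩ : IsOpen Ω) (hL : IsLipschitzDomain Ω)
    {m : Finset (Eu d)} (hmne : m.Nonempty) (hm : ¬ T.IsInteriorFace m) (s : T.star m) :
    ∃ t : T.star m, (T.starGraph m).Reachable s t ∧ ∃ v ∈ t.1, v ∉ m ∧
      (∀ t' ∈ T.cells, ∀ w, ¬ SharesFacet t.1 t' v w) ∧ hull (t.1.erase v) ∩ Ω = ∅ := by
  by_contra hcon
  push Not at hcon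
  -- Under the contrary assumption each facet containing m of each cell of the component is shared:
  -- an unshared one would meet Ω, even in its relative interior, and therefore be shared.
  have hsh : ∀ s' ∈ T.component m s, ∀ v ∈ s', v ∉ m →
      ∃ t ∈ T.component m s, ∃ w, SharesFacet s' t v w := by
    intro s' hs' v hv hvm
    obtain ⟨h1, h2⟩ := Mesh.mem_component.1 hs'
    obtain ⟨hs1, hs2⟩ := Mesh.mem_star.1 h1
    by_contra hno
    push Not at hno
    have hno' : ∀ t' ∈ T.cells, ∀ w, ¬ SharesFacet s' t' v w := fun t' ht' w hw =>
      hno t' (Mesh.component_closed hs' ht' hw hvm) w hw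
    obtain ⟨y, hy, hyΩ⟩ := hcon ⟨s', h1⟩ h2 v hv hvm hno'
    have hsub : m ⊆ s'.erase v := Finset.subset_erase.2 ⟨hs2, hvm⟩
    obtain ⟨x, hx⟩ := relint_nonempty (hmne.mono hsub)
    -- points on the segment from `y` to `x` are in the relative interior
    set c : ℝ → Eu d := fun ε => y + ε • (x - y) with hcdef
    have hcc : Continuous c := by fun_prop
    have h3 : ∀ᶠ ε in nhds (0 : ℝ), c ε ∈ Ω ∧ ε < 1 :=
      (hcc.continuousAt.eventually (by
        rw [show c 0 = y by simp [hcdef]]; exact hΩ.mem_nhds hyΩ)).and (gt_mem_nhds one_pos)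
    obtain ⟨ε, hε, hε0⟩ := ((h3.filter_mono nhdsWithin_le_nhds).and
      (self_mem_nhdsWithin : Ioi (0 : ℝ) ∈ nhdsWithin 0 (Ioi 0))).exists
    have hε0' : 0 < ε := hε0
    have hcε : c ε ∈ relint (s'.erase v) := by
      obtain ⟨w, hw0, hw1, hw2⟩ := Finset.mem_convexHull'.1 hy
      obtain ⟨w', hw0', hw1', hw2'⟩ := hx
      refine ⟨fun u => (1 - ε) * w u + ε * w' u, fun u hu => ?_, ?_, ?_⟩
      · have := mul_nonneg (sub_nonneg.2 hε.2.le) (hw0 u hu)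
        have := mul_pos hε0' (hw0' u hu)
        linarith
      · rw [Finset.sum_add_distrib, ← Finset.mul_sum, ← Finset.mul_sum, hw1, hw1']; ring
      · simp_rw [add_smul, mul_smul]
        rw [Finset.sum_add_distrib, ← Finset.smul_sum, ← Finset.smul_sum, hw2, hw2', hcdef]
        simp only
        rw [sub_smul, one_smul, smul_sub]; abel
    obtain ⟨t', ht', w, hw⟩ := T.exists_sharesFacet hΩ hs1 hv hcε hε.1
    exact hno' t' ht' w hw
  have hCc : T.component m s ⊆ T.cells := Mesh.component_subset.trans Mesh.star_subset
  obtain ⟨z, hz⟩ := relint_nonempty hmne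
  have h1 := T.iUnion_mem_nhds ⟨_, Mesh.self_mem_component s⟩ hCc
    (fun s' hs' => (Mesh.mem_star.1 (Mesh.component_subset hs')).2) hsh hz
  refine hm fun M hmM ⟨t, ht, hMt⟩ z' hz' => ?_
  have htC := T.mem_of_iUnion_mem_nhds hCc h1 ht
    (relint_subset_hull (T.isCell ht) (hmM.trans hMt) hz)
  -- The covering argument applies equally around every larger face M. So its relative interior
  -- consists of interior points of the closure of Ω, that is, points of Ω, and m would be an
  -- interior face.
  have h2 := T.iUnion_mem_nhds (m := M) (C := (T.component m s).filter (M ⊆ ·))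
    ⟨t, Finset.mem_filter.2 ⟨htC, hMt⟩⟩ ((Finset.filter_subset _ _).trans hCc)
    (fun s' hs' => (Finset.mem_filter.1 hs').2) (fun s' hs' v hv hvM => by
      obtain ⟨h3, h4⟩ := Finset.mem_filter.1 hs'
      obtain ⟨t', ht', w, hw⟩ := hsh s' h3 v hv fun h => hvM (hmM h)
      exact ⟨t', Finset.mem_filter.2 ⟨ht', hw.subset_of h4 hvM⟩, w, hw⟩) hz'
  rw [← hL.interior_closure hΩ, mem_interior_iff_mem_nhds]
  refine Filter.mem_of_superset h2 (iUnion₂_subset fun s' hs' => T.hull_subset (hCc (Finset.mem_filter.1 hs').1))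

end

section

/-! ### Shape regularity -/

variable {Ω : Set (Eu d)}

theorem norm_sub_le_of_mem {s : Finset (Eu d)} {x y : Eu d} (hx : x ∈ hull s) (hy : y ∈ hull s) :
    ‖x - y‖ ≤ hdiam s := by
  rw [← dist_eq_norm]
  exact Metric.dist_le_diam_of_mem (Mesh.isCompact_hull s).isBounded hx hy

theorem vertex_mem_hull {s : Finset (Eu d)} {v : Eu d} (hv : v ∈ s) : v ∈ hull s :=
  subset_convexHull ℝ _ hv

/-- The edges of a shape-regular cell are not too short. -/
theorem IsCell.le_edge {s : Finset (Eu d)} (hs : IsCell s) {c : Eu d} {r : ℝ} (hr : 0 < r)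
    (hcr : Metric.closedBall c r ⊆ hull s) {v w : Eu d} (hv : v ∈ s) (hw : w ∈ s) (hvw : v ≠ w) :
    r ≤ ‖v - w‖ := by
  obtain ⟨b, hb⟩ := hs
  obtain ⟨i, rfl⟩ := IsCell.exists_eq hb hv
  obtain ⟨j, rfl⟩ := IsCell.exists_eq hb hw
  have h1 := norm_dcoord_le hr (by rwa [simplex_eq_hull hb]) i
  have h2 := coord_sub b i (b i) (b j)
  rw [b.coord_apply_eq, b.coord_apply_ne fun h => hvw (by rw [h]), sub_zero] at h2
  have h3 := (dcoord b i).le_opNorm (b i - b j)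
  rw [← h2, norm_one] at h3
  have h4 : 1 ≤ 1 / r * ‖b i - b j‖ := h3.trans (by gcongr)
  rwa [div_mul_eq_mul_div, one_mul, le_div_iff₀ hr, one_mul] at h4

theorem Mesh.hdiam_pos (T : Mesh Ω) (hd : 1 ≤ d) {s : Finset (Eu d)} (hs : s ∈ T.cells) :
    0 < hdiam s := by
  obtain ⟨v, hv, w, hw, hvw⟩ := Finset.one_lt_card.1 (show 1 < s.card by rw [T.card_eq s hs]; omega)
  exact (norm_pos_iff.2 (sub_ne_zero.2 hvw)).trans_le
    (norm_sub_le_of_mem (vertex_mem_hull hv) (vertex_mem_hull hw))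

theorem Mesh.one_le_of_shape (T : Mesh Ω) (hd : 1 ≤ d) {σ : ℝ} (hT : T.IsShapeRegular σ)
    {s : Finset (Eu d)} (hs : s ∈ T.cells) : 1 ≤ σ := by
  obtain ⟨c, r, hr, hcr, hdr⟩ := hT s hs
  obtain ⟨v, hv, w, hw, hvw⟩ := Finset.one_lt_card.1 (show 1 < s.card by rw [T.card_eq s hs]; omega)
  have h1 := (T.isCell hs).le_edge hr hcr hv hw hvw
  have h2 := norm_sub_le_of_mem (vertex_mem_hull hv) (vertex_mem_hull hw)
  by_contra h
  push Not at h
  nlinarith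

theorem Mesh.hdiam_le_of_edge (T : Mesh Ω) {σ : ℝ} (hσ : 0 ≤ σ) (hT : T.IsShapeRegular σ)
    {s t : Finset (Eu d)} (hs : s ∈ T.cells) {v w : Eu d} (hv : v ∈ s) (hw : w ∈ s)
    (hvt : v ∈ t) (hwt : w ∈ t) (hvw : v ≠ w) : hdiam s ≤ σ * hdiam t := by
  obtain ⟨c, r, hr, hcr, hdr⟩ := hT s hs
  have h1 := (T.isCell hs).le_edge hr hcr hv hw hvw
  have h2 := norm_sub_le_of_mem (vertex_mem_hull hvt) (vertex_mem_hull hwt)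
  exact hdr.trans (mul_le_mul_of_nonneg_left (h1.trans h2) hσ)

/-- Neighbouring cells have comparable diameters, in dimension at least two. -/
theorem Mesh.hdiam_le_of_sharesFacet (T : Mesh Ω) (hd : 2 ≤ d) {σ : ℝ} (hσ : 0 ≤ σ)
    (hT : T.IsShapeRegular σ) {s t : Finset (Eu d)} (hs : s ∈ T.cells) {v w : Eu d}
    (h : SharesFacet s t v w) : hdiam s ≤ σ * hdiam t := by
  classical
  have hcard : 1 < (s.erase v).card := by
    rw [Finset.card_erase_of_mem h.1, T.card_eq s hs]; omega
  obtain ⟨a, ha, b, hb, hab⟩ := Finset.one_lt_card.1 hcard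
  rw [Finset.mem_erase] at ha hb
  exact T.hdiam_le_of_edge hσ hT hs ha.2 hb.2 (h.mem_iff.1 ⟨ha.2, ha.1⟩).1 (h.mem_iff.1 ⟨hb.2, hb.1⟩).1 hab

theorem volume_hull_le {s : Finset (Eu d)} (hs : s.Nonempty) :
    volume (hull s) ≤ ENNReal.ofReal (hdiam s ^ d) * volume (Metric.ball (0 : Eu d) 1) := by
  obtain ⟨v, hv⟩ := hs
  have h1 : hull s ⊆ Metric.closedBall v (hdiam s) := fun x hx => by
    rw [Metric.mem_closedBall, dist_eq_norm]
    exact norm_sub_le_of_mem hx (vertex_mem_hull hv)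
  refine (measure_mono h1).trans (le_of_eq ?_)
  rw [Measure.addHaar_closedBall _ _ Metric.diam_nonneg, finrank_euclideanSpace_fin]

theorem Mesh.le_volume_hull (T : Mesh Ω) {σ : ℝ} (hσ : 0 < σ)
    (hT : T.IsShapeRegular σ) {s : Finset (Eu d)} (hs : s ∈ T.cells) :
    ENNReal.ofReal ((hdiam s / σ) ^ d) * volume (Metric.ball (0 : Eu d) 1) ≤ volume (hull s) := by
  obtain ⟨c, r, hr, hcr, hdr⟩ := hT s hs
  have h1 : Metric.closedBall c (hdiam s / σ) ⊆ hull s :=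
    (Metric.closedBall_subset_closedBall (by rw [div_le_iff₀ hσ]; linarith)).trans hcr
  refine le_trans (le_of_eq ?_) (measure_mono h1)
  rw [Measure.addHaar_closedBall _ _ (div_nonneg Metric.diam_nonneg hσ.le), finrank_euclideanSpace_fin]

/-- Comparison of the scaling factors of two cells of comparable size. -/
theorem Mesh.scaling_le (T : Mesh Ω) (hd : 1 ≤ d) {σ : ℝ} (hT : T.IsShapeRegular σ)
    {s t : Finset (Eu d)} (hs : s ∈ T.cells) (ht : t ∈ T.cells) {L : ℝ} (hL : 1 ≤ L)
    (h1 : hdiam t ≤ L * hdiam s) (h2 : d = 1 ∨ hdiam s ≤ L * hdiam t) :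
    volume (hull s) * ENNReal.ofReal (hdiam t ^ 2) ≤
      ENNReal.ofReal (σ ^ d * L ^ (d + 2)) * (ENNReal.ofReal (hdiam s ^ 2) * volume (hull t)) := by
  have hσ : 0 < σ := one_pos.trans_le (T.one_le_of_shape hd hT hs)
  have hps := T.hdiam_pos hd hs
  have hpt := T.hdiam_pos hd ht
  set a := hdiam s
  set b := hdiam t
  set B₁ := volume (Metric.ball (0 : Eu d) 1)
  have key : a ^ d * b ^ 2 ≤ σ ^ d * L ^ (d + 2) * (a ^ 2 * (b / σ) ^ d) := by
    have e1 : σ ^ d * L ^ (d + 2) * (a ^ 2 * (b / σ) ^ d) = L ^ (d + 2) * (a ^ 2 * b ^ d) := by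
      rw [div_pow]; field_simp
    rw [e1]
    rcases h2 with h2 | h2
    -- In dimension one the volume is comparable to the diameter, so the inequality reduces to b ≤ C
    -- a and only the first comparison of sizes is required.
    · have hL3 : L ≤ L ^ (d + 2) := le_self_pow₀ hL (by omega)
      calc a ^ d * b ^ 2 = a * b * b := by rw [h2]; ring
        _ ≤ a * b * (L * a) := by gcongr
        _ = L * (a ^ 2 * b) := by ring
        _ ≤ L ^ (d + 2) * (a ^ 2 * b) := by gcongr
        _ = _ := by rw [h2]; ring
    · calc a ^ d * b ^ 2 ≤ (L * b) ^ d * (L * a) ^ 2 := by gcongr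
        _ = _ := by ring
  calc volume (hull s) * ENNReal.ofReal (b ^ 2)
      ≤ ENNReal.ofReal (a ^ d) * B₁ * ENNReal.ofReal (b ^ 2) := by
        gcongr; exact volume_hull_le (T.nonempty_of_mem hs)
    _ = ENNReal.ofReal (a ^ d * b ^ 2) * B₁ := by rw [ENNReal.ofReal_mul (by positivity)]; ring
    _ ≤ ENNReal.ofReal (σ ^ d * L ^ (d + 2) * (a ^ 2 * (b / σ) ^ d)) * B₁ := by gcongr
    _ = ENNReal.ofReal (σ ^ d * L ^ (d + 2)) * (ENNReal.ofReal (a ^ 2) *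
          (ENNReal.ofReal ((b / σ) ^ d) * B₁)) := by
        rw [ENNReal.ofReal_mul (by positivity), ENNReal.ofReal_mul (p := a ^ 2) (by positivity)]; ring
    _ ≤ _ := by gcongr; exact T.le_volume_hull hσ hT ht

/-- The number of cells around a face is bounded. -/
theorem Mesh.card_star_le (T : Mesh Ω) (hd : 1 ≤ d) {σ : ℝ} (hT : T.IsShapeRegular σ)
    {m : Finset (Eu d)} (hm : m.Nonempty) : ((T.star m).card : ℝ) ≤ max 1 (σ ^ d) := by
  rcases (T.star m).eq_empty_or_nonempty with he | hne
  · rw [he]; simp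
  refine le_max_of_le_right ?_
  obtain ⟨v, hv⟩ := hm
  obtain ⟨s₀, hs₀, hmin⟩ := (T.star m).exists_min_image hdiam hne
  set ε := hdiam s₀
  have hε : 0 < ε := T.hdiam_pos hd (Mesh.star_subset hs₀)
  have hσ : 0 < σ := one_pos.trans_le (T.one_le_of_shape hd hT (Mesh.star_subset hs₀))
  -- Each cell is shrunk towards the common vertex v to the diameter ε of the smallest one. The copy
  -- contains a ball of radius ε/σ, stays in the cell and within distance ε of v. These balls are
  -- disjoint, so comparing volumes bounds their number by σ^d.
  have hball : ∀ s ∈ T.star m, ∃ c, Metric.ball c (ε / σ) ⊆ hull s ∩ Metric.closedBall v ε := by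
    intro s hs
    obtain ⟨hsc, hms⟩ := Mesh.mem_star.1 hs
    obtain ⟨c, r, hr, hcr, hdr⟩ := hT s hsc
    have hps := T.hdiam_pos hd hsc
    set l := ε / hdiam s with hl
    have hl0 : 0 < l := div_pos hε hps
    have hl1 : l ≤ 1 := (div_le_one hps).2 (hmin s hs)
    refine ⟨v + l • (c - v), fun x hx => ?_⟩
    set y := v + l⁻¹ • (x - v) with hy
    have hxy : x = (1 - l) • v + l • y := by
      rw [hy, smul_add, smul_smul, mul_inv_cancel₀ hl0.ne', one_smul, sub_smul, one_smul]; abel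
    have hyc : y ∈ hull s := by
      refine hcr ?_
      rw [Metric.mem_closedBall, dist_eq_norm]
      have h1 : y - c = l⁻¹ • (x - (v + l • (c - v))) := by
        rw [hy, ← sub_sub, smul_sub l⁻¹ (x - v), smul_smul, inv_mul_cancel₀ hl0.ne', one_smul]; abel
      rw [h1, norm_smul, Real.norm_of_nonneg (by positivity), inv_mul_le_iff₀ hl0, ← dist_eq_norm]
      refine (Metric.mem_ball.1 hx).le.trans ?_
      rw [hl, div_mul_eq_mul_div, div_le_div_iff₀ hσ hps]
      nlinarith
    have hvs := vertex_mem_hull (hms hv)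
    refine ⟨?_, ?_⟩
    · rw [hxy]
      exact convex_convexHull ℝ _ hvs hyc (by linarith) hl0.le (by ring)
    · rw [Metric.mem_closedBall, dist_eq_norm]
      have h2 : x - v = l • (y - v) := by
        rw [hy, add_sub_cancel_left, smul_smul, mul_inv_cancel₀ hl0.ne', one_smul]
      rw [h2, norm_smul, Real.norm_of_nonneg hl0.le]
      calc l * ‖y - v‖ ≤ l * hdiam s := by gcongr; exact norm_sub_le_of_mem hyc hvs
        _ = ε := div_mul_cancel₀ _ hps.ne'
  choose! c hc using hball
  have hdisj : (T.star m : Set (Finset (Eu d))).PairwiseDisjoint fun s => Metric.ball (c s) (ε / σ) := by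
    intro s hs t ht hst
    refine Set.disjoint_iff_inter_eq_empty.2 ?_
    by_contra h
    obtain ⟨x, hxs, hxt⟩ := nonempty_iff_ne_empty.2 h
    refine hst (T.eq_of_interior_inter (Mesh.star_subset hs) (Mesh.star_subset ht)
      ⟨x, interior_maximal (fun y hy => (hc s hs hy).1) Metric.isOpen_ball hxs, (hc t ht hxt).1⟩)
  have hmeas := measure_biUnion_finset (μ := volume) hdisj fun s _ => Metric.isOpen_ball.measurableSet
  have hle : volume (⋃ s ∈ T.star m, Metric.ball (c s) (ε / σ)) ≤ volume (Metric.closedBall v ε) :=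
    measure_mono (iUnion₂_subset fun s hs x hx => (hc s hs hx).2)
  rw [hmeas, Measure.addHaar_closedBall _ _ hε.le] at hle
  rw [Finset.sum_congr rfl fun s _ => Measure.addHaar_ball_of_pos volume (c s) (div_pos hε hσ),
    Finset.sum_const, nsmul_eq_mul, finrank_euclideanSpace_fin, ← mul_assoc,
    ENNReal.mul_le_mul_iff_left (Metric.measure_ball_pos volume _ one_pos).ne'
      Metric.isBounded_ball.measure_lt_top.ne, ← ENNReal.ofReal_natCast,
    ← ENNReal.ofReal_mul (by positivity), ENNReal.ofReal_le_ofReal_iff (by positivity), div_pow,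
    ← mul_div_assoc, div_le_iff₀ (by positivity), mul_comm] at hle
  exact le_of_mul_le_mul_left hle (by positivity)

/-! ### Propagation along walks -/

/-- A path without repeated vertices has fewer steps than there are vertices, and the differences
telescope. -/
theorem enorm_sub_le_of_reachable {V : Type*} [Fintype V] (G : SimpleGraph V) (f : V → ℝ) {J : ℝ≥0∞}
    (hJ : ∀ a b, G.Adj a b → ‖f a - f b‖ₑ ≤ J) {a b : V} (h : G.Reachable a b) :
    ‖f a - f b‖ₑ ≤ Fintype.card V * J := by
  classical
  have h1 : ∀ {a b : V} (p : G.Walk a b), ‖f a - f b‖ₑ ≤ p.length * J := by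
    intro a b p
    induction p with
    | nil => simp
    | @cons a c b hac p ih =>
      rw [SimpleGraph.Walk.length_cons, show f a - f b = (f a - f c) + (f c - f b) by ring]
      refine (enorm_add_le _ _).trans ((add_le_add (hJ _ _ hac) ih).trans (le_of_eq ?_))
      push_cast; ring
  obtain ⟨p⟩ := h
  refine (h1 p.toPath.1).trans (mul_le_mul_left ?_ _)
  exact_mod_cast p.toPath.2.length_lt.le

/-- The cells of a connected star have comparable diameters, in dimension at least two. -/
theorem Mesh.hdiam_le_of_reachable (T : Mesh Ω) (hd : 2 ≤ d) {σ : ℝ} (hT : T.IsShapeRegular σ)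
    {m : Finset (Eu d)} {s t : T.star m} {N : ℕ} (hN : (T.star m).card ≤ N)
    (h : (T.starGraph m).Reachable s t) : hdiam s.1 ≤ σ ^ N * hdiam t.1 := by
  have hpos : ∀ s : T.star m, 0 < hdiam s.1 := fun s => T.hdiam_pos (by omega) (Mesh.star_subset s.2)
  have hσ : 1 ≤ σ := T.one_le_of_shape (by omega) hT (Mesh.star_subset s.2)
  have hlog : 0 ≤ Real.log σ := Real.log_nonneg hσ
  -- Neighbours have diameters within a factor σ. Logarithms make this an additive bound to which
  -- the path lemma applies.
  have hstep : ∀ a b : T.star m, (T.starGraph m).Adj a b →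
      Real.log (hdiam a.1) - Real.log (hdiam b.1) ≤ Real.log σ := by
    rintro a b ⟨v, w, hvw⟩
    have h1 := T.hdiam_le_of_sharesFacet hd (by linarith) hT (Mesh.star_subset a.2) hvw
    have h2 := Real.log_le_log (hpos a) h1
    rw [Real.log_mul (by positivity) (hpos b).ne'] at h2
    linarith
  have h1 := enorm_sub_le_of_reachable (T.starGraph m) (fun s => Real.log (hdiam s.1))
    (J := ENNReal.ofReal (Real.log σ)) (fun a b hab => by
      rw [← ofReal_norm, Real.norm_eq_abs]
      refine ENNReal.ofReal_le_ofReal (abs_sub_le_iff.2 ⟨hstep a b hab, hstep b a hab.symm⟩)) h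
  rw [← ofReal_norm, Real.norm_eq_abs, Fintype.card_coe, ← ENNReal.ofReal_natCast,
    ← ENNReal.ofReal_mul (by positivity), ENNReal.ofReal_le_ofReal_iff (by positivity)] at h1
  have h2 : Real.log (hdiam s.1) ≤ Real.log (σ ^ N * hdiam t.1) := by
    rw [Real.log_mul (by positivity) (hpos t).ne', Real.log_pow]
    have h3 := (abs_le.1 h1).2
    have h4 : ((T.star m).card : ℝ) * Real.log σ ≤ N * Real.log σ := by gcongr
    linarith
  exact (Real.log_le_log_iff (hpos s) (mul_pos (by positivity) (hpos t))).1 h2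

end

section

/-! ### Degrees of freedom of the quasi-interpolant -/

variable {Ω : Set (Eu d)}

open Classical in
/-- A smallest cell around the face `m`. -/
def Mesh.refCell (T : Mesh Ω) (m : Finset (Eu d)) : Finset (Eu d) :=
  if h : (T.star m).Nonempty then ((T.star m).exists_min_image hdiam h).choose else ∅

theorem Mesh.refCell_spec (T : Mesh Ω) {m s : Finset (Eu d)} (hs : s ∈ T.star m) :
    T.refCell m ∈ T.star m ∧ hdiam (T.refCell m) ≤ hdiam s := by
  have h : (T.star m).Nonempty := ⟨s, hs⟩
  have := ((T.star m).exists_min_image hdiam h).choose_spec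
  rw [Mesh.refCell, dif_pos h]
  exact ⟨this.1, this.2 s hs⟩

open Classical in
/-- The degree of freedom of the quasi-interpolant attached to the exponent `α`. -/
def Mesh.dof (T : Mesh Ω) (k : ℕ) (P : Finset (Eu d) → MvPolynomial (Fin d) ℝ) (α : Eu d →₀ ℕ) : ℝ :=
  if T.IsInteriorFace α.support then
    cellCoeff (T.refCell α.support) k (P (T.refCell α.support)) α else 0

theorem le_rpow_half {x y : ℝ≥0∞} (h : x ^ 2 ≤ y) : x ≤ y ^ (1 / 2 : ℝ) := by
  have h1 := ENNReal.rpow_le_rpow h (by norm_num : (0 : ℝ) ≤ 1 / 2)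
  rw [← ENNReal.rpow_two, ← ENNReal.rpow_mul] at h1
  norm_num at h1 ⊢
  exact h1

theorem rpow_half_sq (y : ℝ≥0∞) : (y ^ (1 / 2 : ℝ)) ^ 2 = y := by
  rw [← ENNReal.rpow_two, ← ENNReal.rpow_mul]; norm_num

theorem mul_div_le_of_mul_le {X Y Z W E : ℝ≥0∞} (hY : Y ≠ 0) (hY' : Y ≠ ⊤) (hW : W ≠ 0) (hW' : W ≠ ⊤)
    (h : X * Y ≤ Z * W) : E / W * X ≤ Z * (E / Y) := by
  have h1 : X / W ≤ Z / Y := by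
    rw [ENNReal.div_le_iff hW hW']
    calc X ≤ Z * W / Y := (ENNReal.le_div_iff_mul_le (Or.inl hY) (Or.inl hY')).2 h
      _ = Z / Y * W := by simp only [div_eq_mul_inv]; ring
  calc E / W * X = E * (X / W) := by simp only [div_eq_mul_inv]; ring
    _ ≤ E * (Z / Y) := by gcongr
    _ = _ := by simp only [div_eq_mul_inv]; ring

/-- Only jumps inside the component of a matter: f is replaced by zero elsewhere, which creates no
new jump along an edge. -/
theorem enorm_sub_le_of_reachable' {V : Type*} [Fintype V] (G : SimpleGraph V) (f : V → ℝ) {J : ℝ≥0∞}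
    {a b : V} (hJ : ∀ c c', G.Reachable a c → G.Reachable a c' → G.Adj c c' → ‖f c - f c'‖ₑ ≤ J)
    (h : G.Reachable a b) : ‖f a - f b‖ₑ ≤ Fintype.card V * J := by
  classical
  have h1 := enorm_sub_le_of_reachable G (fun c => if G.Reachable a c then f c else 0) (J := J)
    (fun c c' hcc => by
      by_cases hc : G.Reachable a c
      · have hc' := hc.trans hcc.reachable
        simp only [hc, hc', if_true]; exact hJ c c' hc hc' hcc
      · have hc' : ¬ G.Reachable a c' := fun h' => hc (h'.trans hcc.symm.reachable)
        simp [hc, hc']) h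
  simpa [h] using h1

/-- On the line a nonempty face that is not a whole cell is a vertex. Two cells containing it share
it as a facet, so no chain of cells is needed. -/
theorem Mesh.sharesFacet_of_one {Ω : Set (Eu 1)} (T : Mesh Ω) {m s t : Finset (Eu 1)} (hm : m.Nonempty)
    (hs : s ∈ T.star m) (ht : t ∈ T.star m) (hst : s ≠ t) {v : Eu 1} (hv : v ∈ s) (hvm : v ∉ m) :
    ∃ w, w ∉ m ∧ SharesFacet s t v w := by
  classical
  obtain ⟨a, ha⟩ := hm
  obtain ⟨hs1, hs2⟩ := Mesh.mem_star.1 hs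
  obtain ⟨ht1, ht2⟩ := Mesh.mem_star.1 ht
  have hcs : (s.erase v).card = 1 := by rw [Finset.card_erase_of_mem hv, T.card_eq s hs1]
  have hct : (t.erase a).card = 1 := by rw [Finset.card_erase_of_mem (ht2 ha), T.card_eq t ht1]
  obtain ⟨a', ha'⟩ := Finset.card_eq_one.1 hcs
  obtain ⟨w, hw⟩ := Finset.card_eq_one.1 hct
  have hsa : s.erase v = {a} := by
    have : a ∈ s.erase v := Finset.mem_erase.2 ⟨fun h => hvm (h ▸ ha), hs2 ha⟩
    rw [ha'] at this ⊢
    rw [Finset.mem_singleton.1 this]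
  have hwt : w ∈ t ∧ w ≠ a := by
    have : w ∈ t.erase a := by rw [hw]; exact Finset.mem_singleton_self w
    exact ⟨Finset.mem_of_mem_erase this, Finset.ne_of_mem_erase this⟩
  have hta : t.erase w = {a} := by
    have h1 : (t.erase w).card = 1 := by rw [Finset.card_erase_of_mem hwt.1, T.card_eq t ht1]
    obtain ⟨a'', ha''⟩ := Finset.card_eq_one.1 h1
    have : a ∈ t.erase w := Finset.mem_erase.2 ⟨hwt.2.symm, ht2 ha⟩
    rw [ha''] at this ⊢
    rw [Finset.mem_singleton.1 this]
  have hsub : m ⊆ {a} := by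
    rw [← hsa]; exact Finset.subset_erase.2 ⟨hs2, hvm⟩
  refine ⟨w, fun h => hwt.2 (Finset.mem_singleton.1 (hsub h)), hv, hwt.1, hst, ?_⟩
  rw [← Finset.coe_erase, ← Finset.coe_erase, hsa, hta]

theorem SharesFacet.erase_eq [DecidableEq (Eu d)] {s t : Finset (Eu d)} {v w : Eu d}
    (h : SharesFacet s t v w) : s.erase v = t.erase w := by
  have := h.2.2.2
  rw [← Finset.coe_erase, ← Finset.coe_erase] at this
  exact Finset.coe_injective this

-- A chain of facet-adjacent cells leads from s to the reference cell if the face is interior, and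
-- otherwise to a cell with a facet outside Ω, where the coefficient itself is small. The jumps
-- along the chain are bounded by the local errors. Comparability of sizes turns the factor |s|/|t|
-- into diam(s)²/diam(t)².
set_option maxHeartbeats 1000000 in
theorem exists_dof_bound (d k : ℕ) (σ : ℝ) : ∃ A : ℝ≥0∞, A ≠ ⊤ ∧ ∀ (Ω : Set (Eu (d + 1))), IsOpen Ω →
    IsLipschitzDomain Ω → ∀ (T : Mesh Ω), T.IsShapeRegular σ → ∀ (u : H10 Ω)
    (P : Finset (Eu (d + 1)) → MvPolynomial (Fin (d + 1)) ℝ),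
    (∀ s ∈ T.cells, (P s).totalDegree ≤ k) → ∀ α : Eu (d + 1) →₀ ℕ, α.support.Nonempty →
    ∀ s ∈ T.star α.support, ‖cellCoeff s k (P s) α - T.dof k P α‖ₑ ^ 2 * volume (hull s) ≤
      A * (ENNReal.ofReal (hdiam s ^ 2) * ∑ t ∈ T.star α.support,
        locErr t u (P t) / ENNReal.ofReal (hdiam t ^ 2)) := by
  classical
  obtain ⟨C, hC, hjump⟩ := exists_mesh_jump_bound d k
  obtain ⟨C₀, hC₀, hzero⟩ := exists_mesh_zero_bound d k
  -- N bounds the number of cells around the face, hence the length of a chain; L bounds the ratio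
  -- of diameters along it. The constant B is a sum large enough for each of the cases below.
  set N : ℕ := ⌈max 1 (σ ^ (d + 1))⌉₊ with hN
  set L : ℝ := max 1 (σ ^ N) with hL
  set B : ℝ≥0∞ := C + C₀ + 2 * ((N : ℝ≥0∞) ^ 2 * (C * 2)) + 2 * C₀ with hB
  have hBt : B ≠ ⊤ := by
    simp only [hB]
    finiteness
  refine ⟨B * ENNReal.ofReal (σ ^ (d + 1) * L ^ (d + 1 + 2)), ENNReal.mul_ne_top hBt ENNReal.ofReal_ne_top,
    fun Ω hΩ hLip T hT u P hP α hα s hs => ?_⟩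
  set m := α.support with hm
  have hs1 := (Mesh.mem_star.1 hs).1
  have hs2 := (Mesh.mem_star.1 hs).2
  set w : Finset (Eu (d + 1)) → ℝ≥0∞ := fun t => locErr t u (P t) / volume (hull t) with hw
  have hcard : (T.star m).card ≤ N := by
    have := (T.card_star_le (by omega) hT hα).trans (Nat.le_ceil _)
    exact_mod_cast this
  have hnotsub : ∀ {t : Finset (Eu (d + 1))} {v : Eu (d + 1)}, t ∈ T.star m → v ∉ m →
      α.support ⊆ t.erase v := fun ht hv => Finset.subset_erase.2 ⟨(Mesh.mem_star.1 ht).2, hv⟩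
  have hstep : ∀ t ∈ T.star m, ∀ t' ∈ T.star m, ∀ v v', SharesFacet t t' v v' →
      ‖cellCoeff t k (P t) α - cellCoeff t' k (P t') α‖ₑ ^ 2 ≤ C * (w t + w t') := by
    intro t ht t' ht' v v' hvv
    have h1 := Mesh.mem_star.1 ht
    have h2 := Mesh.mem_star.1 ht'
    exact hjump Ω hΩ hLip T t h1.1 t' h2.1 v hvv.1 v' hvv.2.1 hvv.erase_eq u _ _ (hP t h1.1) (hP t' h2.1) α
      (hnotsub ht (hvv.notMem h1.2 h2.2))
  have hbd : ∀ t : T.star m, ∀ v ∈ t.1, v ∉ m → hull (t.1.erase v) ∩ Ω = ∅ →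
      ‖cellCoeff t.1 k (P t.1) α‖ₑ ^ 2 ≤ C₀ * w t.1 := fun t v hv hvm hvΩ =>
    hzero Ω hΩ hLip T t.1 (Mesh.star_subset t.2) v hv hvΩ u _ (hP _ (Mesh.star_subset t.2)) α
      (hnotsub t.2 hvm)
  have hL1 : 1 ≤ L := le_max_left _ _
  have claim : ∃ R ⊆ T.star m, (∀ t ∈ R, hdiam t ≤ L * hdiam s ∧ (d + 1 = 1 ∨ hdiam s ≤ L * hdiam t)) ∧
      ‖cellCoeff s k (P s) α - T.dof k P α‖ₑ ^ 2 ≤ B * ∑ t ∈ R, w t := by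
    have hself : hdiam s ≤ L * hdiam s := le_mul_of_one_le_left Metric.diam_nonneg hL1
    by_cases hd : d + 1 = 1
    -- On the line neighbouring intervals may have very different lengths. It suffices that the
    -- reference cell is not longer than s, which is why the smallest cell was chosen. In the
    -- boundary case s is the only cell around the vertex.
    · obtain rfl : d = 0 := by omega
      by_cases hint : T.IsInteriorFace m
      · obtain ⟨hK, hKs⟩ := T.refCell_spec hs
        rw [Mesh.dof, if_pos hint]
        by_cases hsK : s = T.refCell m
        · refine ⟨∅, by simp, by simp, ?_⟩
          rw [← hm, ← hsK]; simp
        · refine ⟨{s, T.refCell m}, ?_, ?_, ?_⟩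
          · intro t ht
            rcases Finset.mem_insert.1 ht with rfl | ht
            · exact hs
            · rw [Finset.mem_singleton.1 ht]; exact hK
          · intro t ht
            refine ⟨?_, Or.inl rfl⟩
            rcases Finset.mem_insert.1 ht with rfl | ht
            · exact hself
            · rw [Finset.mem_singleton.1 ht]; exact hKs.trans hself
          · have hex : ∃ v ∈ s, v ∉ m := by
              by_contra hcon
              push Not at hcon
              have hle := (Mesh.mem_star.1 hK).2
              refine hsK (Finset.eq_of_subset_of_card_le (fun v hv => hle (hcon v hv)) ?_)
              rw [T.card_eq _ (Mesh.mem_star.1 hK).1, T.card_eq s hs1]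
            obtain ⟨v, hv, hvm⟩ := hex
            obtain ⟨v', -, hvv⟩ := T.sharesFacet_of_one hα hs hK hsK hv hvm
            rw [Finset.sum_pair hsK]
            refine (hstep s hs _ hK v v' hvv).trans (mul_le_mul_left ?_ _)
            rw [hB, add_assoc, add_assoc]; exact le_self_add
      · obtain ⟨t, -, v, hv, hvm, hno, hvΩ⟩ := T.exists_boundary_facet hΩ hLip hα hint ⟨s, hs⟩
        have hts : t.1 = s := by
          by_contra hne
          obtain ⟨w, -, hw⟩ := T.sharesFacet_of_one hα t.2 hs hne hv hvm
          exact hno s hs1 w hw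
        refine ⟨{s}, by simpa using hs, fun t' ht' => ?_, ?_⟩
        · rw [Finset.mem_singleton.1 ht']; exact ⟨hself, Or.inl rfl⟩
        · rw [Mesh.dof, if_neg hint, sub_zero, Finset.sum_singleton]
          have := hbd t v hv hvm hvΩ
          rw [hts] at this
          refine this.trans (mul_le_mul_left ?_ _)
          rw [hB, add_comm C C₀, add_assoc, add_assoc]; exact le_self_add
    · have hd2 : 2 ≤ d + 1 := by omega
      set S : T.star m := ⟨s, hs⟩ with hS
      set R := T.component m S with hR
      set W := ∑ t ∈ R, w t with hW
      have hle : ∀ t ∈ R, w t ≤ W := fun t ht => Finset.single_le_sum (fun _ _ => zero_le) ht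
      have hchain : ∀ t : T.star m, (T.starGraph m).Reachable S t →
          ‖cellCoeff s k (P s) α - cellCoeff t.1 k (P t.1) α‖ₑ ^ 2 ≤ (N : ℝ≥0∞) ^ 2 * (C * 2) * W := by
        intro t ht
        have h1 := enorm_sub_le_of_reachable' (T.starGraph m) (fun t => cellCoeff t.1 k (P t.1) α)
          (J := (C * 2 * W) ^ (1 / 2 : ℝ)) (a := S) (fun c c' hc hc' ⟨v, v', hvv⟩ => by
            refine le_rpow_half ((hstep c.1 c.2 c'.1 c'.2 v v' hvv).trans ?_)
            have h2 := hle c.1 (Mesh.mem_component.2 ⟨c.2, hc⟩)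
            have h3 := hle c'.1 (Mesh.mem_component.2 ⟨c'.2, hc'⟩)
            calc C * (w c.1 + w c'.1) ≤ C * (W + W) := by gcongr
              _ = C * 2 * W := by ring) ht
        have h4 := pow_le_pow_left' h1 2
        rw [mul_pow, rpow_half_sq] at h4
        refine h4.trans ?_
        rw [Fintype.card_coe, mul_assoc ((N : ℝ≥0∞) ^ 2)]
        gcongr
      have hRstar : R ⊆ T.star m := Mesh.component_subset
      refine ⟨R, hRstar, fun t ht => ?_, ?_⟩
      · obtain ⟨ht1, ht2⟩ := Mesh.mem_component.1 ht
        have h1 := T.hdiam_le_of_reachable hd2 hT hcard ht2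
        have h2 := T.hdiam_le_of_reachable hd2 hT hcard ht2.symm
        have h3 : σ ^ N ≤ L := le_max_right _ _
        exact ⟨h2.trans (mul_le_mul_of_nonneg_right h3 Metric.diam_nonneg),
          Or.inr (h1.trans (mul_le_mul_of_nonneg_right h3 Metric.diam_nonneg))⟩
      · by_cases hint : T.IsInteriorFace m
        · obtain ⟨hK, -⟩ := T.refCell_spec hs
          rw [Mesh.dof, if_pos hint]
          refine (hchain ⟨_, hK⟩ (T.reachable_of_interior hΩ hα hint _ _)).trans (mul_le_mul_left ?_ _)
          calc (N : ℝ≥0∞) ^ 2 * (C * 2) ≤ 2 * ((N : ℝ≥0∞) ^ 2 * (C * 2)) :=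
                le_mul_of_one_le_left zero_le (by norm_num)
            _ ≤ B := by rw [hB, add_comm (C + C₀), add_assoc]; exact le_self_add
        · rw [Mesh.dof, if_neg hint, sub_zero]
          obtain ⟨t, htr, v, hv, hvm, -, hvΩ⟩ := T.exists_boundary_facet hΩ hLip hα hint S
          have h1 := hchain t htr
          have h2 := (hbd t v hv hvm hvΩ).trans
            (mul_le_mul_right (hle t.1 (Mesh.mem_component.2 ⟨t.2, htr⟩)) C₀)
          have h3 := enorm_add_sq_le (cellCoeff s k (P s) α - cellCoeff t.1 k (P t.1) α)
            (cellCoeff t.1 k (P t.1) α)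
          rw [sub_add_cancel] at h3
          refine h3.trans ?_
          calc _ ≤ 2 * ((N : ℝ≥0∞) ^ 2 * (C * 2) * W) + 2 * (C₀ * W) := by gcongr
            _ = (2 * ((N : ℝ≥0∞) ^ 2 * (C * 2)) + 2 * C₀) * W := by ring
            _ ≤ B * W := by
              refine mul_le_mul_left ?_ _
              rw [hB, add_assoc (C + C₀)]; exact le_add_self
  obtain ⟨R, hR, hRh, hle⟩ := claim
  obtain ⟨hVs, hVs'⟩ := volume_hull_ne T hs1
  refine (mul_le_mul_left hle _).trans ?_
  rw [mul_assoc, mul_assoc, Finset.sum_mul]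
  refine mul_le_mul_right ?_ B
  rw [← mul_assoc, Finset.mul_sum]
  refine (Finset.sum_le_sum fun t ht => ?_).trans
    (Finset.sum_le_sum_of_subset (f := fun t => ENNReal.ofReal (σ ^ (d + 1) * L ^ (d + 1 + 2)) *
      ENNReal.ofReal (hdiam s ^ 2) * (locErr t u (P t) / ENNReal.ofReal (hdiam t ^ 2))) hR)
  have ht1 := Mesh.star_subset (hR ht)
  obtain ⟨hVt, hVt'⟩ := volume_hull_ne T ht1
  have hpt := T.hdiam_pos (by omega) ht1
  refine mul_div_le_of_mul_le (ENNReal.ofReal_pos.2 (by positivity)).ne' ENNReal.ofReal_ne_top hVt hVt' ?_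
  have := T.scaling_le (by omega) hT hs1 ht1 hL1 (hRh t ht).1 (hRh t ht).2
  rwa [← mul_assoc] at this

end

section

/-! ### The quasi-interpolant -/

theorem totalDegree_aeval_le {σ τ : Type*} {k : ℕ} {Q : MvPolynomial σ ℝ} (hQ : Q.totalDegree ≤ k)
    {F : σ → MvPolynomial τ ℝ} (hF : ∀ i, (F i).totalDegree ≤ 1) :
    (MvPolynomial.aeval F Q).totalDegree ≤ k := by
  classical
  rw [MvPolynomial.aeval_def, MvPolynomial.eval₂_eq]
  refine (MvPolynomial.totalDegree_finsetSum _ _).trans (Finset.sup_le fun α hα => ?_)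
  refine (MvPolynomial.totalDegree_mul _ _).trans ?_
  have h1 : (algebraMap ℝ (MvPolynomial τ ℝ) (Q.coeff α)).totalDegree = 0 :=
    MvPolynomial.totalDegree_C _
  rw [h1, zero_add]
  refine (MvPolynomial.totalDegree_finsetProd _ _).trans (le_trans (Finset.sum_le_sum fun i _ => ?_)
    ((MvPolynomial.le_totalDegree hα).trans hQ))
  exact (MvPolynomial.totalDegree_pow _ _).trans (by nlinarith [hF i])

/-- A homogeneous polynomial of degree `k` in the barycentric coordinates is a polynomial of degree
at most `k`. -/
theorem exists_ev_eq_bev (b : Bary d) {k : ℕ} {Q : MvPolynomial (Fin (d + 1)) ℝ}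
    (hQ : Q.IsHomogeneous k) : ∃ p : MvPolynomial (Fin d) ℝ, p.totalDegree ≤ k ∧ ev p = bev b Q := by
  set F : Fin (d + 1) → MvPolynomial (Fin d) ℝ := fun i =>
    (∑ j, MvPolynomial.C (dcoord b i (EuclideanSpace.single j 1)) * MvPolynomial.X j) +
      MvPolynomial.C (b.coord i 0) with hF
  refine ⟨MvPolynomial.aeval F Q, totalDegree_aeval_le hQ.totalDegree_le fun i => ?_, ?_⟩
  · refine (MvPolynomial.totalDegree_add _ _).trans (max_le ?_ (by simp))
    refine (MvPolynomial.totalDegree_finsetSum _ _).trans (Finset.sup_le fun j _ => ?_)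
    refine (MvPolynomial.totalDegree_mul _ _).trans ?_
    rw [MvPolynomial.totalDegree_C, MvPolynomial.totalDegree_X]
  · ext x
    rw [ev, bev, ← MvPolynomial.coe_aeval_eq_eval]
    change MvPolynomial.aeval _ (MvPolynomial.aeval F Q) = _
    rw [← AlgHom.comp_apply, MvPolynomial.comp_aeval, ← MvPolynomial.coe_aeval_eq_eval]
    change _ = MvPolynomial.aeval _ Q
    congr 2
    ext i
    have h1 := coord_sub b i x 0
    rw [sub_zero] at h1
    have h2 : dcoord b i x = ∑ j, dcoord b i (EuclideanSpace.single j 1) * x j := by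
      have h3 : x = ∑ j, x j • EuclideanSpace.single j (1 : ℝ) := by
        ext l
        simp [Finset.sum_apply, Pi.single_apply]
      conv_lhs => rw [h3, map_sum]
      exact Finset.sum_congr rfl fun j _ => by rw [map_smul, smul_eq_mul, mul_comm]
    simp only [hF, map_add, map_sum, map_mul, MvPolynomial.aeval_X, MvPolynomial.aeval_C]
    rw [show b.coord i x = dcoord b i x + b.coord i 0 by linarith, h2]
    rfl

/-- The bound is only assumed between each centre and nearby points, with a uniform constant.
Continuous induction along a segment adds it up. -/
theorem lipschitzWith_of_local {E : Type*} [NormedAddCommGroup E] [NormedSpace ℝ E] {g : E → ℝ}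
    {K : NNReal} (h : ∀ x, ∀ᶠ y in nhds x, |g y - g x| ≤ K * ‖y - x‖) : LipschitzWith K g := by
  have hg : Continuous g := by
    refine continuous_iff_continuousAt.2 fun x => ?_
    refine tendsto_iff_norm_sub_tendsto_zero.2 ?_
    refine squeeze_zero' (Filter.Eventually.of_forall fun _ => norm_nonneg _) (h x) ?_
    have : Filter.Tendsto (fun y => (K : ℝ) * ‖y - x‖) (nhds x) (nhds (K * ‖x - x‖)) :=
      (by fun_prop : Continuous fun y => (K : ℝ) * ‖y - x‖).tendsto x
    simpa using this
  refine LipschitzWith.of_dist_le_mul fun y x => ?_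
  rw [Real.dist_eq, dist_eq_norm]
  set c : ℝ → E := fun t => x + t • (y - x) with hc
  have hcc : Continuous c := by fun_prop
  have hsub : ∀ s t, c s - c t = (s - t) • (y - x) := fun s t => by
    rw [hc]; simp only; rw [sub_smul]; abel
  have key : Icc (0 : ℝ) 1 ⊆ {t | |g (c t) - g x| ≤ K * (t * ‖y - x‖)} := by
    refine IsClosed.Icc_subset_of_forall_mem_nhdsWithin ?_ ?_ ?_
    · exact (isClosed_le ((hg.comp hcc).sub continuous_const).abs (by fun_prop)).inter isClosed_Icc
    · simp [hc]
    · rintro t ⟨ht, -⟩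
      have h1 := (hcc.tendsto t).eventually (h (c t))
      filter_upwards [h1.filter_mono nhdsWithin_le_nhds, self_mem_nhdsWithin] with s hs hst
      have h2 : t < s := hst
      rw [hsub, norm_smul, Real.norm_of_nonneg (by linarith)] at hs
      have h3 : |g (c t) - g x| ≤ K * (t * ‖y - x‖) := ht
      change |g (c s) - g x| ≤ K * (s * ‖y - x‖)
      calc |g (c s) - g x| = |(g (c s) - g (c t)) + (g (c t) - g x)| := by ring_nf
        _ ≤ |g (c s) - g (c t)| + |g (c t) - g x| := abs_add_le _ _
        _ ≤ K * ((s - t) * ‖y - x‖) + K * (t * ‖y - x‖) := add_le_add hs h3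
        _ = _ := by ring
  have := key (right_mem_Icc.2 zero_le_one)
  simpa [hc] using this

variable {Ω : Set (Eu d)}

open Classical in
/-- The quasi-interpolant as a polynomial in the hat functions of the vertices. -/
def Mesh.quasiPoly (T : Mesh Ω) (k : ℕ) (P : Finset (Eu d) → MvPolynomial (Fin d) ℝ) :
    MvPolynomial (Eu d) ℝ :=
  ∑ α ∈ (T.cells.biUnion id).finsuppAntidiag k, MvPolynomial.monomial α (T.dof k P α)

theorem degree_of_mem_finsuppAntidiag {ι : Type*} [DecidableEq ι] {s : Finset ι} {k : ℕ} {α : ι →₀ ℕ} :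
    α ∈ s.finsuppAntidiag k ↔ α.degree = k ∧ α.support ⊆ s := by
  rw [Finset.mem_finsuppAntidiag]
  constructor
  · rintro ⟨h1, h2⟩
    refine ⟨?_, h2⟩
    rw [← h1]
    exact Finset.sum_subset h2 (fun i _ hi => by simpa using hi)
  · rintro ⟨h1, h2⟩
    refine ⟨?_, h2⟩
    rw [← h1]
    exact (Finset.sum_subset h2 (fun i _ hi => by simpa using hi)).symm

theorem Mesh.isHomogeneous_quasiPoly (T : Mesh Ω) (k : ℕ)
    (P : Finset (Eu d) → MvPolynomial (Fin d) ℝ) : (T.quasiPoly k P).IsHomogeneous k := by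
  classical
  refine MvPolynomial.IsHomogeneous.sum _ _ _ fun α hα => MvPolynomial.isHomogeneous_monomial _ ?_
  exact (degree_of_mem_finsuppAntidiag.1 hα).1

theorem Mesh.coeff_quasiPoly (T : Mesh Ω) {k : ℕ} (P : Finset (Eu d) → MvPolynomial (Fin d) ℝ)
    {α : Eu d →₀ ℕ} (h1 : α.degree = k) {s : Finset (Eu d)} (hs : s ∈ T.cells) (h2 : α.support ⊆ s) :
    (T.quasiPoly k P).coeff α = T.dof k P α := by
  classical
  rw [Mesh.quasiPoly, MvPolynomial.coeff_sum, Finset.sum_eq_single α]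
  · simp
  · intro β _ hβ
    rw [MvPolynomial.coeff_monomial, if_neg hβ]
  · intro h
    refine absurd (degree_of_mem_finsuppAntidiag.2 ⟨h1, h2.trans ?_⟩) h
    exact Finset.subset_biUnion_of_mem id hs

/-- The quasi-interpolant on a cell. -/
def Mesh.quasiCell (T : Mesh Ω) (k : ℕ) (P : Finset (Eu d) → MvPolynomial (Fin d) ℝ)
    (s : Finset (Eu d)) (x : Eu d) : ℝ := MvPolynomial.eval (fun v => bc s v x) (T.quasiPoly k P)

open Classical in
/-- The quasi-interpolant, extended by zero. -/
def Mesh.quasi (T : Mesh Ω) (k : ℕ) (P : Finset (Eu d) → MvPolynomial (Fin d) ℝ) (x : Eu d) : ℝ :=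
  if h : ∃ s ∈ T.cells, x ∈ hull s then T.quasiCell k P h.choose x else 0

theorem Mesh.quasi_eq (T : Mesh Ω) (k : ℕ) (P : Finset (Eu d) → MvPolynomial (Fin d) ℝ)
    {s : Finset (Eu d)} (hs : s ∈ T.cells) {x : Eu d} (hx : x ∈ hull s) :
    T.quasi k P x = T.quasiCell k P s x := by
  have h : ∃ s ∈ T.cells, x ∈ hull s := ⟨s, hs, hx⟩
  rw [Mesh.quasi, dif_pos h, Mesh.quasiCell, Mesh.quasiCell]
  have : (fun v => bc h.choose v x) = fun v => bc s v x :=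
    funext fun v => T.bc_agree h.choose_spec.1 hs h.choose_spec.2 hx v
  rw [this]

theorem Mesh.mem_closure_iff (T : Mesh Ω) {x : Eu d} : x ∈ closure Ω ↔ ∃ s ∈ T.cells, x ∈ hull s := by
  rw [← T.cover]; simp

/-- A point of a cell outside Ω lies in the relative interior of the face M of its positive
coordinates. A monomial that does not vanish there has its support in M. Then its support is not an
interior face, so its coefficient was set to zero. -/
theorem Mesh.quasi_eq_zero (T : Mesh Ω) (k : ℕ) (P : Finset (Eu d) → MvPolynomial (Fin d) ℝ)
    {x : Eu d} (hx : x ∉ Ω) : T.quasi k P x = 0 := by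
  classical
  by_cases h : ∃ s ∈ T.cells, x ∈ hull s
  swap
  · rw [Mesh.quasi, dif_neg h]
  obtain ⟨s, hs, hxs⟩ := h
  rw [T.quasi_eq k P hs hxs, Mesh.quasiCell, Mesh.quasiPoly, map_sum]
  refine Finset.sum_eq_zero fun α _ => ?_
  rw [MvPolynomial.eval_monomial]
  by_cases hpos : ∀ v ∈ α.support, 0 < bc s v x
  · have hc := T.isCell hs
    set M := s.filter fun v => 0 < bc s v x with hM
    have hMs : M ⊆ s := Finset.filter_subset _ _
    have hxM : x ∈ relint M := (mem_relint_iff hc hMs).2 ⟨fun v hv => (Finset.mem_filter.1 hv).2, fun v hv => by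
      by_cases hvs : v ∈ s
      · refine le_antisymm (not_lt.1 fun h => hv (Finset.mem_filter.2 ⟨hvs, h⟩)) (hc.mem_hull.1 hxs v hvs)
      · exact bc_of_notMem hvs x⟩
    have hsub : α.support ⊆ M := fun v hv => by
      refine Finset.mem_filter.2 ⟨?_, hpos v hv⟩
      by_contra hvs
      have := hpos v hv
      rw [bc_of_notMem hvs] at this
      exact lt_irrefl _ this
    rw [Mesh.dof, if_neg, zero_mul]
    exact fun hint => hx (hint M hsub ⟨s, hs, hMs⟩ hxM)
  · push Not at hpos
    obtain ⟨v, hv, hv0⟩ := hpos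
    have : bc s v x = 0 := le_antisymm hv0 (bc_nonneg (T.isCell hs) hxs v)
    rw [Finsupp.prod, Finset.prod_eq_zero hv, mul_zero]
    rw [this, zero_pow (Finsupp.mem_support_iff.1 hv)]

/-- The quasi-interpolant on an ordered cell. -/
theorem Mesh.quasiCell_eq_bev (T : Mesh Ω) (k : ℕ) (P : Finset (Eu d) → MvPolynomial (Fin d) ℝ)
    {s : Finset (Eu d)} {b : Bary d} (hb : range b = s) :
    T.quasiCell k P s = bev b (MvPolynomial.killCompl b.ind.injective (T.quasiPoly k P)) := by
  ext x
  rw [bev, eval_killCompl, Mesh.quasiCell]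
  congr 2
  ext v
  by_cases hv : v ∈ s
  · obtain ⟨i, rfl⟩ := IsCell.exists_eq hb hv
    rw [bc_eq_coord hb, b.ind.injective.extend_apply]
  · rw [bc_of_notMem hv, Function.extend_apply']
    · rfl
    · rintro ⟨i, rfl⟩
      exact hv (Finset.mem_coe.1 (hb.subset ⟨i, rfl⟩))

/-- The function is smooth on each compact cell. Every cell containing a point y close to x also
contains x, so the two values are compared on one cell; if y is in no cell, both values are zero. -/
theorem Mesh.exists_lipschitz_quasi (T : Mesh Ω) (hΩ : IsOpen Ω) (k : ℕ)
    (P : Finset (Eu d) → MvPolynomial (Fin d) ℝ) : ∃ K, LipschitzWith K (T.quasi k P) := by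
  have h1 : ∀ s ∈ T.cells, ∃ K : NNReal, LipschitzOnWith K (T.quasiCell k P s) (hull s) := by
    intro s hs
    obtain ⟨b, hb⟩ := T.exists_enum' hs
    rw [T.quasiCell_eq_bev k P hb]
    have := (contDiff_bev (n := 1) b (MvPolynomial.killCompl b.ind.injective (T.quasiPoly k P)))
    exact this.locallyLipschitz.locallyLipschitzOn.exists_lipschitzOnWith_of_compact (Mesh.isCompact_hull s)
  choose! K hK using h1
  refine ⟨T.cells.sup K, lipschitzWith_of_local fun x => ?_⟩
  have hev : ∀ᶠ y in nhds x, ∀ s ∈ T.cells, y ∈ hull s → x ∈ hull s := by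
    rw [Filter.eventually_all_finset]
    intro s _
    by_cases hx : x ∈ hull s
    · exact Filter.Eventually.of_forall fun _ _ => hx
    · filter_upwards [(Mesh.isCompact_hull s).isClosed.isOpen_compl.mem_nhds hx] with y hy hys
      exact absurd hys hy
  have hev2 : ∀ᶠ y in nhds x, x ∈ Ω → y ∈ Ω := by
    by_cases hx : x ∈ Ω
    · filter_upwards [hΩ.mem_nhds hx] with y hy _ using hy
    · exact Filter.Eventually.of_forall fun _ h => absurd h hx
  filter_upwards [hev, hev2] with y hy hy2
  by_cases hyc : ∃ s ∈ T.cells, y ∈ hull s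
  · obtain ⟨s, hs, hys⟩ := hyc
    have hxs := hy s hs hys
    rw [T.quasi_eq k P hs hys, T.quasi_eq k P hs hxs]
    have h2 := (hK s hs).dist_le_mul y hys x hxs
    rw [Real.dist_eq, dist_eq_norm] at h2
    refine h2.trans (mul_le_mul_of_nonneg_right ?_ (norm_nonneg _))
    exact_mod_cast Finset.le_sup hs
  · have hyΩ : y ∉ Ω := fun h => hyc (T.mem_closure_iff.1 (subset_closure h))
    rw [T.quasi_eq_zero k P hyΩ, T.quasi_eq_zero k P fun h => hyΩ (hy2 h), sub_zero, abs_zero]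
    positivity

/-- The quasi-interpolant belongs to the finite element space. -/
theorem Mesh.exists_quasi_mem (T : Mesh Ω) (hΩ : IsOpen Ω) (hb : Bornology.IsBounded Ω) (k : ℕ)
    (P : Finset (Eu d) → MvPolynomial (Fin d) ℝ) :
    ∃ w ∈ T.feSpace k, fn w =ᵐ[volume.restrict Ω] T.quasi k P := by
  obtain ⟨K, hK⟩ := T.exists_lipschitz_quasi hΩ k P
  obtain ⟨w, hw⟩ := exists_H10_of_lipschitz hΩ hb hK fun x hx => T.quasi_eq_zero k P hx
  refine ⟨w, ⟨T.quasi k P, hK.continuous.continuousOn, fun x hx => ?_, fun s hs => ?_, hw⟩, hw⟩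
  · refine T.quasi_eq_zero k P fun hxΩ => ?_
    rw [frontier, hΩ.interior_eq] at hx
    exact hx.2 hxΩ
  · obtain ⟨b, hb⟩ := T.exists_enum' hs
    obtain ⟨p, hp, hpe⟩ := exists_ev_eq_bev b (isHomogeneous_killCompl b.ind.injective
      (T.isHomogeneous_quasiPoly k P))
    refine ⟨p, hp, fun x hx => ?_⟩
    rw [T.quasi_eq k P hs hx, T.quasiCell_eq_bev k P hb, ← hpe]
    rfl

end

section

/-! ### The approximation theorem -/

variable {Ω : Set (Eu d)}

/-- Interchanging the sums, a cell t is counted at each of its d + 1 vertices, once for each cell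
around that vertex. -/
theorem Mesh.sum_neighbours_le (T : Mesh Ω) (hd : 1 ≤ d) {σ : ℝ} (hT : T.IsShapeRegular σ)
    (e : Finset (Eu d) → ℝ≥0∞) :
    ∑ s ∈ T.cells, ∑ v ∈ s, ∑ t ∈ T.star {v}, e t ≤
      ENNReal.ofReal (max 1 (σ ^ d)) * (((d + 1 : ℕ) : ℝ≥0∞) * ∑ t ∈ T.cells, e t) := by
  classical
  set V := T.cells.biUnion id with hV
  have hswap : ∀ g : Finset (Eu d) → Eu d → ℝ≥0∞,
      ∑ s ∈ T.cells, ∑ v ∈ s, g s v = ∑ v ∈ V, ∑ s ∈ T.star {v}, g s v := fun g => by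
    refine Finset.sum_comm' fun s v => ?_
    rw [Mesh.mem_star, Finset.singleton_subset_iff]
    refine ⟨fun h => ⟨h, Finset.mem_biUnion.2 ⟨s, h⟩⟩, fun h => h.1⟩
  rw [hswap]
  have h1 : ∑ t ∈ T.cells, ((d + 1 : ℕ) : ℝ≥0∞) * e t = ∑ v ∈ V, ∑ t ∈ T.star {v}, e t := by
    rw [← hswap fun t _ => e t]
    refine Finset.sum_congr rfl fun t ht => ?_
    rw [Finset.sum_const, T.card_eq t ht, nsmul_eq_mul]
  rw [Finset.mul_sum, h1, Finset.mul_sum]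
  refine Finset.sum_le_sum fun v _ => ?_
  rw [Finset.sum_const, nsmul_eq_mul]
  refine mul_le_mul_left ?_ _
  rw [← ENNReal.ofReal_natCast]
  exact ENNReal.ofReal_le_ofReal (T.card_star_le hd hT (Finset.singleton_nonempty v))

/-- On each cell the gradient of the quasi-interpolant is close to that of the local polynomial. -/
theorem exists_gradient_quasi_bound (d k : ℕ) (hk : 1 ≤ k) (σ : ℝ) : ∃ A : ℝ≥0∞, A ≠ ⊤ ∧
    ∀ (Ω : Set (Eu (d + 1))), IsOpen Ω → IsLipschitzDomain Ω → ∀ (T : Mesh Ω), T.IsShapeRegular σ →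
    ∀ (u : H10 Ω) (P : Finset (Eu (d + 1)) → MvPolynomial (Fin (d + 1)) ℝ),
    (∀ s ∈ T.cells, (P s).totalDegree ≤ k) → ∀ s ∈ T.cells, ∃ c : ℝ≥0∞,
    (∀ x ∈ hull s, ‖gradient (ev (P s)) x - gradient (T.quasiCell k P s) x‖ₑ ^ 2 ≤ c) ∧
    c * volume (hull s) ≤ A * ∑ v ∈ s, ∑ t ∈ T.star {v},
        locErr t u (P t) / ENNReal.ofReal (hdiam t ^ 2) := by
  obtain ⟨A, hA, hdof⟩ := exists_dof_bound d k σ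
  set G : ℝ := ((d + 1 : ℕ) + 1) * (numMon (d + 1) k * k) * σ with hG
  refine ⟨ENNReal.ofReal (G ^ 2) * A, ENNReal.mul_ne_top ENNReal.ofReal_ne_top hA,
    fun Ω hΩ hL T hT u P hP s hs => ?_⟩
  obtain ⟨b, hb⟩ := T.exists_enum' hs
  obtain ⟨z, r, hr, hcr, hdr⟩ := hT s hs
  have hσ : 1 ≤ σ := T.one_le_of_shape (by omega) hT hs
  have hh := T.hdiam_pos (by omega) hs
  set h := hdiam s with hhd
  set Q := MvPolynomial.killCompl b.ind.injective (T.quasiPoly k P) with hQ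
  set D := cellPoly b s k (P s) - Q with hD
  have hDh : D.IsHomogeneous k := (isHomogeneous_cellPoly b s (hP s hs)).sub
    (isHomogeneous_killCompl _ (T.isHomogeneous_quasiPoly k P))
  obtain ⟨β, hβ⟩ := exists_coeff_max D
  set M := |D.coeff β| with hM
  have hgrad : ∀ x ∈ hull s,
      ‖gradient (ev (P s)) x - gradient (T.quasiCell k P s) x‖ ≤ G * M / h := by
    intro x hx
    rw [← bev_cellPoly hb k (P s), T.quasiCell_eq_bev k P hb, ← gradient_sub (contDiff_bev b _) (contDiff_bev b _)]
    have h1 : (fun x => bev b (cellPoly b s k (P s)) x - bev b Q x) = bev b D := by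
      ext y; simp [bev, hD]
    rw [h1]
    rw [← simplex_eq_hull hb] at hx
    have hcr : Metric.closedBall z r ⊆ simplex b := by rw [simplex_eq_hull hb]; exact hcr
    refine (norm_gradient_bev_le hDh hβ hx hr hcr).trans ?_
    rw [div_le_div_iff₀ hr hh]
    have h2 : (0 : ℝ) ≤ ((d + 1 : ℕ) + 1) * (numMon (d + 1) k * k) * M := by positivity
    have h3 : h ≤ σ * r := hdr
    calc _ ≤ ((d + 1 : ℕ) + 1) * (numMon (d + 1) k * k) * M * (σ * r) :=
          mul_le_mul_of_nonneg_left h3 h2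
      _ = _ := by rw [hG]; ring
  refine ⟨ENNReal.ofReal ((G / h) ^ 2) * ‖D.coeff β‖ₑ ^ 2, fun x hx => ?_, ?_⟩
  · rw [enorm_sq_eq_ofReal, enorm_sq_eq_ofReal, ← ENNReal.ofReal_mul (by positivity), Real.norm_eq_abs (D.coeff β)]
    refine ENNReal.ofReal_le_ofReal ((pow_le_pow_left₀ (norm_nonneg _) (hgrad x hx) 2).trans_eq ?_)
    rw [← hM]; ring
  -- A largest coefficient may sit at an exponent of the wrong degree, but it is then zero and there
  -- is nothing to prove.
  · by_cases hβk : β.degree = k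
    swap
    · have h0 : D.coeff β = 0 := by
        by_contra h
        refine hβk ?_
        have := hDh h
        exact (DFunLike.congr_fun (Finsupp.degree_eq_weight_one (R := ℕ)) β).trans this
      rw [h0]; simp
    set α : Eu (d + 1) →₀ ℕ := β.mapDomain b with hα
    have hαk : α.degree = k := by rw [hα, Finsupp.degree_mapDomain]; exact hβk
    have hαs : α.support ⊆ s := by
      classical
      refine (Finsupp.mapDomain_support).trans fun v hv => ?_
      obtain ⟨i, -, rfl⟩ := Finset.mem_image.1 hv
      exact Finset.mem_coe.1 (hb.subset ⟨i, rfl⟩)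
    -- Here k ≥ 1 enters: every exponent involves a vertex, so the cells around its support are all
    -- neighbours of s.
    have hαn : α.support.Nonempty := by
      rw [Finsupp.support_nonempty_iff]
      rintro h0
      rw [h0] at hαk
      simp at hαk
      omega
    have hc : D.coeff β = cellCoeff s k (P s) α - T.dof k P α := by
      rw [hD, MvPolynomial.coeff_sub, coeff_cellPoly, hQ, MvPolynomial.coeff_killCompl,
        T.coeff_quasiPoly P hαk hs hαs]
    obtain ⟨v, hv⟩ := hαn
    have h1 := hdof Ω hΩ hL T hT u P hP α ⟨v, hv⟩ s (Mesh.mem_star.2 ⟨hs, hαs⟩)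
    rw [← hc] at h1
    rw [mul_assoc]
    refine (mul_le_mul_right h1 _).trans ?_
    have h2 : ∑ t ∈ T.star α.support, locErr t u (P t) / ENNReal.ofReal (hdiam t ^ 2) ≤
        ∑ v ∈ s, ∑ t ∈ T.star {v}, locErr t u (P t) / ENNReal.ofReal (hdiam t ^ 2) := by
      refine le_trans (Finset.sum_le_sum_of_subset ?_) (Finset.single_le_sum
        (f := fun v => ∑ t ∈ T.star {v}, locErr t u (P t) / ENNReal.ofReal (hdiam t ^ 2))
        (fun _ _ => zero_le) (hαs hv))
      intro t ht
      rw [Mesh.mem_star] at ht ⊢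
      exact ⟨ht.1, Finset.singleton_subset_iff.2 (ht.2 hv)⟩
    refine (mul_le_mul_right (mul_le_mul_right (mul_le_mul_right h2 _) _) _).trans_eq ?_
    generalize (∑ v ∈ s, ∑ t ∈ T.star {v}, locErr t u (P t) / ENNReal.ofReal (hdiam t ^ 2)) = X
    rw [show G ^ 2 = (G / h) ^ 2 * h ^ 2 by field_simp, ENNReal.ofReal_mul (sq_nonneg _)]
    ring

/-- Local approximation on the cells by polynomials, in scaled norms. -/
theorem exists_cell_poly (d k : ℕ) : ∃ B : ℝ≥0∞, B ≠ ⊤ ∧ ∀ (Ω : Set (Eu (d + 1))), IsOpen Ω →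
    IsLipschitzDomain Ω → ∀ (T : Mesh Ω) (u : H10 Ω) (s : Finset (Eu (d + 1))), s ∈ T.cells →
    MemSobolev (interior (hull s)) (k + 1) (fn u) →
    ∃ p : MvPolynomial (Fin (d + 1)) ℝ, p.totalDegree ≤ k ∧
      locErr s u p / ENNReal.ofReal (hdiam s ^ 2) ≤ B * (ENNReal.ofReal (T.size ^ (2 * k)) *
        sobolevSeminormSq (interior (hull s)) (k + 1) (fn u)) ∧
      ∫⁻ x in hull s, ‖grad u x - gradient (ev p) x‖ₑ ^ 2 ≤ B * (ENNReal.ofReal (T.size ^ (2 * k)) *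
        sobolevSeminormSq (interior (hull s)) (k + 1) (fn u)) := by
  obtain ⟨a, ha0, ha⟩ : ∃ a : ℝ, 0 ≤ a ∧ (2 : ℝ) ^ (d + 1) * (d + 1 : ℕ) = a :=
    ⟨_, by positivity, rfl⟩
  refine ⟨ENNReal.ofReal a ^ (k + 1) + (d + 1 : ℕ) * ENNReal.ofReal a ^ k, by finiteness,
    fun Ω hΩ hL T u s hs hm => ?_⟩
  have hh := T.hdiam_pos (by omega) hs
  obtain ⟨p, hp, h0, h1⟩ := exists_local_poly hΩ isOpen_interior (convex_convexHull ℝ _).interior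
    ((Mesh.isCompact_hull s).isBounded.subset interior_subset) (T.interior_hull_nonempty hs)
    (T.interior_hull_subset hΩ hL hs) (h := hdiam s)
    (fun x hx y hy => norm_sub_le_of_mem (interior_subset hx) (interior_subset hy)) k u hm
  rw [T.restrict_interior hs] at h0 h1
  have hle : ENNReal.ofReal (hdiam s ^ (2 * k)) ≤ ENNReal.ofReal (T.size ^ (2 * k)) :=
    ENNReal.ofReal_le_ofReal (pow_le_pow_left₀ hh.le (T.le_size hs) _)
  have he : ∀ n : ℕ, ENNReal.ofReal (2 ^ (d + 1) * (d + 1 : ℕ) * hdiam s ^ 2) ^ n =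
      ENNReal.ofReal a ^ n * ENNReal.ofReal (hdiam s ^ (2 * n)) := fun n => by
    rw [ha, ← ENNReal.ofReal_pow (by positivity), ← ENNReal.ofReal_pow ha0,
      ← ENNReal.ofReal_mul (by positivity)]
    congr 1
    rw [mul_pow, ← pow_mul]
  rw [he] at h0 h1
  generalize sobolevSeminormSq (interior (hull s)) (k + 1) (fn u) = S at h0 h1 ⊢
  generalize ENNReal.ofReal (T.size ^ (2 * k)) = H at hle ⊢
  have h1' : ∫⁻ x in hull s, ‖grad u x - gradient (ev p) x‖ₑ ^ 2 ≤
      (d + 1 : ℕ) * ENNReal.ofReal a ^ k * (H * S) := by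
    refine h1.trans ?_
    calc _ = ((d + 1 : ℕ) : ℝ≥0∞) * ENNReal.ofReal a ^ k *
          (ENNReal.ofReal (hdiam s ^ (2 * k)) * S) := by ring
      _ ≤ _ := mul_le_mul_right (mul_le_mul_left hle _) _
  refine ⟨p, hp, ENNReal.div_le_of_le_mul' ?_, h1'.trans (mul_le_mul_left le_add_self _)⟩
  rw [locErr, add_mul, mul_add]
  refine add_le_add (h0.trans ?_) (mul_le_mul_right h1' _)
  rw [show 2 * (k + 1) = 2 * k + 2 by ring, pow_add (hdiam s), ENNReal.ofReal_mul (by positivity)]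
  calc _ = ENNReal.ofReal (hdiam s ^ 2) * (ENNReal.ofReal a ^ (k + 1) *
        (ENNReal.ofReal (hdiam s ^ (2 * k)) * S)) := by ring
    _ ≤ _ := mul_le_mul_right (mul_le_mul_right (mul_le_mul_left hle _) _) _

/-- The error in the gradient on a cell. -/
theorem Mesh.lintegral_grad_sub_le {Ω : Set (Eu d)} (hΩ : IsOpen Ω) (hL : IsLipschitzDomain Ω)
    (T : Mesh Ω) (u w : H10 Ω) {k : ℕ} {P : Finset (Eu d) → MvPolynomial (Fin d) ℝ}
    (hwq : fn w =ᵐ[volume.restrict Ω] T.quasi k P) {s : Finset (Eu d)} (hs : s ∈ T.cells)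
    {c : ℝ≥0∞} (hc : ∀ x ∈ hull s,
      ‖gradient (ev (P s)) x - gradient (T.quasiCell k P s) x‖ₑ ^ 2 ≤ c) :
    ∫⁻ x in hull s, ‖grad (u - w) x‖ₑ ^ 2 ≤
      2 * (∫⁻ x in hull s, ‖grad u x - gradient (ev (P s)) x‖ₑ ^ 2) + 2 * (c * volume (hull s)) := by
  obtain ⟨b, hbs⟩ := T.exists_enum' hs
  have hG := (grad_ae_of_feSpace hΩ hL T hwq hs (G := T.quasiCell k P s)
    (by rw [T.quasiCell_eq_bev k P hbs]; exact contDiff_bev b _)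
    (fun x hx => T.quasi_eq k P hs hx)).2
  have hsub := ae_mono (T.restrict_hull_le hΩ hL hs) (grad_sub_ae u w)
  have h1 : ∫⁻ x in hull s, ‖grad (u - w) x‖ₑ ^ 2 ≤
      ∫⁻ x in hull s, (2 * ‖grad u x - gradient (ev (P s)) x‖ₑ ^ 2 + 2 * c) := by
    refine lintegral_mono_ae ?_
    filter_upwards [hG, hsub, ae_restrict_mem (Mesh.isCompact_hull s).measurableSet] with x h1 h2 h3
    rw [h2, h1, ← sub_add_sub_cancel (grad u x) (gradient (ev (P s)) x)]
    exact (enorm_add_sq_le _ _).trans (add_le_add_right (mul_le_mul_right (hc x h3) _) _)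
  refine h1.trans_eq ?_
  rw [lintegral_add_right _ measurable_const, lintegral_const_mul' _ _ (by simp), setLIntegral_const,
    mul_assoc 2 c]

/-- The global error of a quasi-interpolant in terms of local errors. -/
theorem Mesh.enorm_grad_sub_quasi_le {Ω : Set (Eu d)} (hd : 1 ≤ d) (hΩ : IsOpen Ω)
    (hL : IsLipschitzDomain Ω) (T : Mesh Ω) {σ : ℝ} (hT : T.IsShapeRegular σ) (u w : H10 Ω) {k : ℕ}
    {P : Finset (Eu d) → MvPolynomial (Fin d) ℝ}
    (hwq : fn w =ᵐ[volume.restrict Ω] T.quasi k P) {A B : ℝ≥0∞} {S : Finset (Eu d) → ℝ≥0∞}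
    (hA : ∀ s ∈ T.cells, ∃ c : ℝ≥0∞,
      (∀ x ∈ hull s, ‖gradient (ev (P s)) x - gradient (T.quasiCell k P s) x‖ₑ ^ 2 ≤ c) ∧
      c * volume (hull s) ≤ A * ∑ v ∈ s, ∑ t ∈ T.star {v},
        locErr t u (P t) / ENNReal.ofReal (hdiam t ^ 2))
    (h0 : ∀ s ∈ T.cells, locErr s u (P s) / ENNReal.ofReal (hdiam s ^ 2) ≤ B * S s)
    (h1 : ∀ s ∈ T.cells, ∫⁻ x in hull s, ‖grad u x - gradient (ev (P s)) x‖ₑ ^ 2 ≤ B * S s) :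
    ‖grad u - grad w‖ₑ ^ 2 ≤ (2 * B + 2 * A * (ENNReal.ofReal (max 1 (σ ^ d)) *
      ((d + 1 : ℕ) : ℝ≥0∞)) * B) * ∑ s ∈ T.cells, S s := by
  have hcell : ∀ s ∈ T.cells, ∫⁻ x in hull s, ‖grad (u - w) x‖ₑ ^ 2 ≤
      2 * (B * S s) + 2 * (A * ∑ v ∈ s, ∑ t ∈ T.star {v},
        locErr t u (P t) / ENNReal.ofReal (hdiam t ^ 2)) := by
    intro s hs
    obtain ⟨c, hc, hcA⟩ := hA s hs
    refine (Mesh.lintegral_grad_sub_le hΩ hL T u w hwq hs hc).trans ?_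
    exact add_le_add (mul_le_mul_right (h1 s hs) _) (mul_le_mul_right hcA _)
  rw [show grad u - grad w = grad (u - w) from (map_sub (gradL Ω) u w).symm, enorm_sq_eq_lintegral,
    T.lintegral_eq_sum hΩ hL]
  refine (Finset.sum_le_sum hcell).trans ?_
  have h2 := (T.sum_neighbours_le hd hT fun t =>
    locErr t u (P t) / ENNReal.ofReal (hdiam t ^ 2)).trans
    (mul_le_mul_right (mul_le_mul_right (Finset.sum_le_sum h0) _) _)
  rw [← Finset.mul_sum, ← mul_assoc] at h2
  rw [Finset.sum_add_distrib, ← Finset.mul_sum, ← Finset.mul_sum, ← Finset.mul_sum, ← Finset.mul_sum]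
  refine (add_le_add_right (mul_le_mul_right (mul_le_mul_right h2 _) _) _).trans_eq ?_
  generalize ∑ s ∈ T.cells, S s = X
  ring

theorem Mesh.exists_approx_of_bounds {Ω : Set (Eu d)} (hd : 1 ≤ d) (hΩ : IsOpen Ω)
    (hb : Bornology.IsBounded Ω) (hL : IsLipschitzDomain Ω) (T : Mesh Ω) {σ : ℝ}
    (hT : T.IsShapeRegular σ) (u : H10 Ω) {k : ℕ} {A B : ℝ≥0∞}
    (hA : ∀ P : Finset (Eu d) → MvPolynomial (Fin d) ℝ, (∀ s ∈ T.cells, (P s).totalDegree ≤ k) →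
      ∀ s ∈ T.cells, ∃ c : ℝ≥0∞,
      (∀ x ∈ hull s, ‖gradient (ev (P s)) x - gradient (T.quasiCell k P s) x‖ₑ ^ 2 ≤ c) ∧
      c * volume (hull s) ≤ A * ∑ v ∈ s, ∑ t ∈ T.star {v},
        locErr t u (P t) / ENNReal.ofReal (hdiam t ^ 2))
    (hB : ∀ s ∈ T.cells, MemSobolev (interior (hull s)) (k + 1) (fn u) →
      ∃ p : MvPolynomial (Fin d) ℝ, p.totalDegree ≤ k ∧
      locErr s u p / ENNReal.ofReal (hdiam s ^ 2) ≤ B * (ENNReal.ofReal (T.size ^ (2 * k)) *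
        sobolevSeminormSq (interior (hull s)) (k + 1) (fn u)) ∧
      ∫⁻ x in hull s, ‖grad u x - gradient (ev p) x‖ₑ ^ 2 ≤ B * (ENNReal.ofReal (T.size ^ (2 * k)) *
        sobolevSeminormSq (interior (hull s)) (k + 1) (fn u))) :
    ∃ w ∈ T.feSpace k, ‖grad u - grad w‖ₑ ^ 2 ≤ (2 * B + 2 * A * (ENNReal.ofReal (max 1 (σ ^ d)) *
      ((d + 1 : ℕ) : ℝ≥0∞)) * B + 1) * (ENNReal.ofReal (T.size ^ (2 * k)) *
        T.brokenSeminorm (k + 1) (fn u) ^ 2) := by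
  have hsq : T.brokenSeminorm (k + 1) (fn u) ^ 2 =
      ∑ s ∈ T.cells, sobolevSeminormSq (interior (hull s)) (k + 1) (fn u) := rpow_half_sq _
  rw [hsq]
  by_cases hm : ∀ s ∈ T.cells, MemSobolev (interior (hull s)) (k + 1) (fn u)
  · replace hB := fun s (hs : s ∈ T.cells) => hB s hs (hm s hs)
    choose! P hP h0 h1 using hB
    obtain ⟨w, hw, hwq⟩ := T.exists_quasi_mem hΩ hb k P
    refine ⟨w, hw, (T.enorm_grad_sub_quasi_le hd hΩ hL hT u w hwq (hA P hP) h0 h1).trans ?_⟩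
    rw [← Finset.mul_sum]
    exact mul_le_mul_left le_self_add _
  · push Not at hm
    obtain ⟨s, hs, hms⟩ := hm
    have htop : ∑ s ∈ T.cells, sobolevSeminormSq (interior (hull s)) (k + 1) (fn u) = ⊤ := by
      refine ENNReal.sum_eq_top.2 ⟨s, hs, ?_⟩
      rw [sobolevSeminormSq, if_neg hms]
    have hpos : 0 < T.size := (T.hdiam_pos hd hs).trans_le (T.le_size hs)
    refine ⟨0, zero_mem _, ?_⟩
    -- If v is not piecewise in the Sobolev space, the right side is infinite and w = 0 will do. For
    -- the product to be infinite the mesh size must be positive and the constant nonzero; the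
    -- latter is ensured by the summand 1.
    rw [htop, ENNReal.mul_top (by simpa using pow_pos hpos _), ENNReal.mul_top (by simp)]
    exact le_top

/-- Approximation in the gradient norm by finite element functions, for functions that are only
piecewise smooth. -/
theorem exists_approx (d k : ℕ) (hk : 1 ≤ k) (σ : ℝ) : ∃ C : ℝ≥0∞, C ≠ ⊤ ∧
    ∀ (Ω : Set (Eu (d + 1))), IsOpen Ω → Bornology.IsBounded Ω → IsLipschitzDomain Ω →
    ∀ (T : Mesh Ω), T.IsShapeRegular σ → ∀ u : H10 Ω, ∃ w ∈ T.feSpace k,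
      ‖grad u - grad w‖ₑ ^ 2 ≤ C * (ENNReal.ofReal (T.size ^ (2 * k)) *
        T.brokenSeminorm (k + 1) (fn u) ^ 2) := by
  refine (exists_gradient_quasi_bound d k hk σ).elim fun A hA => (exists_cell_poly d k).elim fun B hB =>
    ⟨_, ?_, fun Ω hΩ hb hL T hT u => T.exists_approx_of_bounds (by omega) hΩ hb hL hT u
      (hA.2 Ω hΩ hL T hT u) (hB.2 Ω hΩ hL T u)⟩
  have := hA.1
  have := hB.1
  finiteness

end

section

/-! ### Primitives and Taylor expansions -/

section Primitive

variable {E F : Type*} [NormedAddCommGroup E] [NormedSpace ℝ E] [NormedAddCommGroup F] [NormedSpace ℝ F]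

/-- `x` is a primitive of `y` on the real line. -/
def IsPrimitive (x y : ℝ → E) : Prop :=
  ∀ a b, IntervalIntegrable y volume a b ∧ x b - x a = ∫ s in a..b, y s

theorem IsPrimitive.continuous {x y : ℝ → E} (h : IsPrimitive x y) : Continuous x := by
  have h1 : x = fun b => x 0 + ∫ s in (0 : ℝ)..b, y s := by
    ext b
    rw [← (h 0 b).2]; abel
  rw [h1]
  exact continuous_const.add (intervalIntegral.continuous_primitive (fun a b => (h a b).1) 0)

theorem IsPrimitive.clm [CompleteSpace E] [CompleteSpace F] {x y : ℝ → E} (h : IsPrimitive x y) (L : E →L[ℝ] F) :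
    IsPrimitive (fun t => L (x t)) (fun t => L (y t)) := fun a b => by
  have h1 := (h a b).1
  refine ⟨⟨L.integrable_comp h1.1, L.integrable_comp h1.2⟩, ?_⟩
  rw [← map_sub, (h a b).2, L.intervalIntegral_comp_comm h1]

theorem IsPrimitive.aestronglyMeasurable {x y : ℝ → E} (h : IsPrimitive x y) :
    AEStronglyMeasurable y volume := by
  have h1 : (volume : Measure ℝ) = volume.restrict (⋃ n : ℕ, Ioc (-(n : ℝ)) n) := by
    rw [eq_univ_of_forall (s := ⋃ n : ℕ, Ioc (-(n : ℝ)) n) fun x => ?_, Measure.restrict_univ]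
    obtain ⟨n, hn⟩ := exists_nat_gt |x|
    exact mem_iUnion.2 ⟨n, (abs_lt.1 hn).1, (abs_lt.1 hn).2.le⟩
  rw [h1]
  exact AEStronglyMeasurable.iUnion fun n => (h _ _).1.1.aestronglyMeasurable

theorem enorm_intervalIntegral_le {y : ℝ → E} {a b s t : ℝ} (hs : s ∈ Icc a b) (ht : t ∈ Icc a b) :
    ‖∫ σ in t..s, y σ‖ₑ ≤ ∫⁻ σ in Icc a b, ‖y σ‖ₑ := by
  have hsub : uIoc t s ⊆ Icc a b :=
    uIoc_subset_uIcc.trans (uIcc_subset_Icc ht hs)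
  rw [← ofReal_norm, intervalIntegral.norm_intervalIntegral_eq, ofReal_norm]
  exact (enorm_integral_le_lintegral_enorm _).trans (lintegral_mono_set hsub)

theorem integral_taylor_term [CompleteSpace E] (v : E) (s t : ℝ) (l : ℕ) :
    ∫ σ in t..s, ((σ - t) ^ l / (l.factorial : ℝ)) • v = ((s - t) ^ (l + 1) / ((l + 1).factorial : ℝ)) • v := by
  rw [intervalIntegral.integral_smul_const, intervalIntegral.integral_div,
    intervalIntegral.integral_comp_sub_right (fun σ => σ ^ l), integral_pow]
  congr 1
  rw [Nat.factorial_succ]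
  push_cast
  simp
  field_simp

/-- The expansion of the first derivative is integrated. The remainder is crude, with the full
interval length and no factorial, and needs only an integrable top derivative. -/
theorem taylor_bound [CompleteSpace E] (m : ℕ) : ∀ {D : ℕ → ℝ → E},
    (∀ r ≤ m, IsPrimitive (D r) (D (r + 1))) → ∀ {a b s t : ℝ}, s ∈ Icc a b → t ∈ Icc a b →
    ‖D 0 s - ∑ l ∈ Finset.range (m + 1), ((s - t) ^ l / (l.factorial : ℝ)) • D l t‖ₑ ≤
      ENNReal.ofReal ((b - a) ^ m) * ∫⁻ σ in Icc a b, ‖D (m + 1) σ‖ₑ := by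
  induction m with
  | zero =>
    intro D h a b s t hs ht
    simp only [zero_add, Finset.range_one, Finset.sum_singleton, pow_zero, Nat.factorial_zero,
      Nat.cast_one, div_one, one_smul, ENNReal.ofReal_one, one_mul]
    rw [(h 0 le_rfl t s).2]
    exact enorm_intervalIntegral_le hs ht
  | succ m ih =>
    intro D h a b s t hs ht
    have hab : a ≤ b := hs.1.trans hs.2
    have ih' := fun {σ} (hσ : σ ∈ Icc a b) => ih (D := fun r => D (r + 1))
      (fun r hr => h (r + 1) (by omega)) hσ ht
    have hint : ∀ l ∈ Finset.range (m + 1), IntervalIntegrable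
        (fun σ => ((σ - t) ^ l / (l.factorial : ℝ)) • D (l + 1) t) volume t s := fun l _ =>
      Continuous.intervalIntegrable (by fun_prop) _ _
    have h1 : D 0 s - ∑ l ∈ Finset.range (m + 1 + 1), ((s - t) ^ l / (l.factorial : ℝ)) • D l t =
        ∫ σ in t..s, (D 1 σ - ∑ l ∈ Finset.range (m + 1),
          ((σ - t) ^ l / (l.factorial : ℝ)) • D (l + 1) t) := by
      rw [intervalIntegral.integral_sub (h 0 (by omega) t s).1
        (Continuous.intervalIntegrable (by fun_prop) _ _), ← (h 0 (by omega) t s).2,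
        intervalIntegral.integral_finsetSum hint, Finset.sum_range_succ']
      simp_rw [integral_taylor_term]
      simp only [pow_zero, Nat.factorial_zero, Nat.cast_one, div_one, one_smul]
      abel
    rw [h1]
    refine (enorm_intervalIntegral_le hs ht).trans ((setLIntegral_mono' measurableSet_Icc
      fun σ hσ => ih' hσ).trans_eq ?_)
    rw [setLIntegral_const, Real.volume_Icc, pow_succ, ENNReal.ofReal_mul (pow_nonneg (by linarith) _)]
    ring

/-- Linear combinations of point values, expanded at another point. -/
theorem enorm_sum_sub_taylor_le [CompleteSpace E] (m : ℕ) {D : ℕ → ℝ → E}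
    (h : ∀ r ≤ m, IsPrimitive (D r) (D (r + 1))) {a b t : ℝ} (ht : t ∈ Icc a b) {ι : Type*}
    (S : Finset ι) (c : ι → ℝ) (x : ι → ℝ) (hx : ∀ i ∈ S, x i ∈ Icc a b) {M : ℝ} (hc : ∀ i ∈ S, |c i| ≤ M) :
    ‖∑ i ∈ S, c i • D 0 (x i) - ∑ l ∈ Finset.range (m + 1),
        ((∑ i ∈ S, c i * (x i - t) ^ l) / (l.factorial : ℝ)) • D l t‖ₑ ≤
      S.card * ENNReal.ofReal M * ENNReal.ofReal ((b - a) ^ m) * ∫⁻ σ in Icc a b, ‖D (m + 1) σ‖ₑ := by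
  have h1 : ∑ i ∈ S, c i • D 0 (x i) - ∑ l ∈ Finset.range (m + 1),
        ((∑ i ∈ S, c i * (x i - t) ^ l) / (l.factorial : ℝ)) • D l t =
      ∑ i ∈ S, c i • (D 0 (x i) - ∑ l ∈ Finset.range (m + 1),
        ((x i - t) ^ l / (l.factorial : ℝ)) • D l t) := by
    simp_rw [smul_sub, Finset.sum_sub_distrib, Finset.smul_sum, smul_smul]
    rw [Finset.sum_comm]
    congr 1
    refine Finset.sum_congr rfl fun l _ => ?_
    rw [← Finset.sum_smul, Finset.sum_div]
    simp_rw [mul_div_assoc]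
  rw [h1]
  refine (enorm_sum_le _ _).trans ?_
  rw [mul_assoc, mul_assoc, ← nsmul_eq_mul]
  refine Finset.sum_le_card_nsmul _ _ _ fun i hi => ?_
  rw [enorm_smul]
  refine mul_le_mul' ?_ (taylor_bound m h (hx i hi) ht)
  rw [← ofReal_norm]
  exact ENNReal.ofReal_le_ofReal (hc i hi)

end Primitive

/-! ### Damped averages -/

/-- The weight `e^{-2ρt}`. -/
def damp (ρ t : ℝ) : ℝ≥0∞ := ENNReal.ofReal (Real.exp (-2 * ρ * t))

theorem continuous_damp (ρ : ℝ) : Continuous (damp ρ) := by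
  exact ENNReal.continuous_ofReal.comp (by fun_prop)

theorem damp_shift_le {ρ s : ℝ} {N : ℝ} (h : ρ * s ≤ N) (t : ℝ) :
    damp ρ t ≤ ENNReal.ofReal (Real.exp (2 * N)) * damp ρ (t + s) := by
  rw [damp, damp, ← ENNReal.ofReal_mul (Real.exp_pos _).le, ← Real.exp_add]
  exact ENNReal.ofReal_le_ofReal (Real.exp_le_exp.2 (by nlinarith))

/-- Local averages are bounded in damped norms. -/
theorem lintegral_average_le {φ : ℝ → ℝ≥0∞} (hφ : AEMeasurable φ) {ρ τ : ℝ} (hρ : 0 < ρ) (hτ : 0 < τ)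
    (hρτ : ρ * τ ≤ 1) :
    ∫⁻ t, (∫⁻ s in Icc (t - 3 * τ) (t + 3 * τ), φ s) * damp ρ t ≤
      ENNReal.ofReal (6 * τ * Real.exp 6) * ∫⁻ t, φ t * damp ρ t := by
  obtain ⟨ψ, hψ, hψφ⟩ := hφ
  have h1 : ∀ t, ∫⁻ s in Icc (t - 3 * τ) (t + 3 * τ), φ s = ∫⁻ s in Icc (-(3 * τ)) (3 * τ), ψ (s + t) := by
    intro t
    rw [lintegral_congr_ae (ae_restrict_of_ae hψφ), ← lintegral_indicator measurableSet_Icc,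
      ← lintegral_add_right_eq_self _ t, ← lintegral_indicator measurableSet_Icc]
    refine lintegral_congr fun s => ?_
    by_cases hs : s ∈ Icc (-(3 * τ)) (3 * τ)
    · rw [indicator_of_mem hs, indicator_of_mem (by constructor <;> linarith [hs.1, hs.2])]
    · rw [indicator_of_notMem hs, indicator_of_notMem]
      exact fun h => hs ⟨by linarith [h.1], by linarith [h.2]⟩
  have h2 : ∫⁻ t, φ t * damp ρ t = ∫⁻ t, ψ t * damp ρ t := by
    refine lintegral_congr_ae ?_
    filter_upwards [hψφ] with t ht
    rw [ht]
  have hm : Measurable fun t => ψ t * damp ρ t := hψ.mul (continuous_damp ρ).measurable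
  rw [h2]
  calc ∫⁻ t, (∫⁻ s in Icc (t - 3 * τ) (t + 3 * τ), φ s) * damp ρ t
      ≤ ∫⁻ t, ∫⁻ s in Icc (-(3 * τ)) (3 * τ), ENNReal.ofReal (Real.exp 6) * (ψ (s + t) * damp ρ (s + t)) := by
        refine lintegral_mono fun t => ?_
        simp only
        rw [h1, mul_comm, ← lintegral_const_mul' _ _ (show damp ρ t ≠ ⊤ from ENNReal.ofReal_ne_top)]
        refine setLIntegral_mono' measurableSet_Icc fun s hs => ?_
        -- Across half the window, of length 3τ, the weight changes by at most e^{6ρτ} ≤ e⁶. The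
        -- other factor 6τ is the length of the window.
        have h3 : damp ρ t ≤ ENNReal.ofReal (Real.exp (2 * 3)) * damp ρ (t + s) :=
          damp_shift_le (by nlinarith [hs.2]) t
        norm_num at h3
        rw [add_comm s t]
        calc damp ρ t * ψ (t + s) ≤ (ENNReal.ofReal (Real.exp 6) * damp ρ (t + s)) * ψ (t + s) :=
              mul_le_mul_left h3 _
          _ = _ := by ring
    _ = ∫⁻ s in Icc (-(3 * τ)) (3 * τ), ∫⁻ t, ENNReal.ofReal (Real.exp 6) * (ψ (s + t) * damp ρ (s + t)) := by
        refine lintegral_lintegral_swap ?_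
        exact ((hm.comp (measurable_snd.add measurable_fst)).const_mul _).aemeasurable
    _ = ∫⁻ s in Icc (-(3 * τ)) (3 * τ), ENNReal.ofReal (Real.exp 6) * ∫⁻ t, ψ t * damp ρ t := by
        refine lintegral_congr fun s => ?_
        rw [lintegral_const_mul' _ _ ENNReal.ofReal_ne_top,
          lintegral_add_left_eq_self (fun t => ψ t * damp ρ t)]
    _ = _ := by
        rw [setLIntegral_const, Real.volume_Icc, mul_comm, ← mul_assoc, ← ENNReal.ofReal_mul (by linarith)]
        congr 2; ring

theorem lintegral_mul_sq_le {α : Type*} [MeasurableSpace α] {μ : Measure α} {f g : α → ℝ≥0∞}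
    (hf : AEMeasurable f μ) (hg : AEMeasurable g μ) :
    (∫⁻ x, f x * g x ∂μ) ^ 2 ≤ (∫⁻ x, f x ^ 2 ∂μ) * ∫⁻ x, g x ^ 2 ∂μ := by
  have h := ENNReal.lintegral_mul_le_Lp_mul_Lq μ (p := 2) (q := 2)
    (Real.holderConjugate_iff.mpr ⟨by norm_num, by norm_num⟩) hf hg
  simp only [Pi.mul_apply, ENNReal.rpow_two] at h
  refine (pow_le_pow_left₀ (zero_le) h 2).trans_eq ?_
  rw [mul_pow, rpow_half_sq, rpow_half_sq]

/-- A damped Hardy inequality. -/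
theorem lintegral_primitive_sq_le {g : ℝ → ℝ≥0∞} (hg : Measurable g) {ρ : ℝ} (hρ : 0 < ρ) :
    ∫⁻ t in Ioi (0 : ℝ), (∫⁻ s in Ioc 0 t, g s) ^ 2 * damp ρ t ≤
      ENNReal.ofReal (ρ⁻¹ ^ 2) * ∫⁻ t in Ioi (0 : ℝ), g t ^ 2 * damp ρ t := by
  -- The weight is w² with w(t) = e^{−ρt}. Cauchy–Schwarz with weights w⁻¹ and w, and then Tonelli,
  -- each cost one integral of an exponential and thus a factor ρ⁻¹.
  set w : ℝ → ℝ≥0∞ := damp (ρ / 2) with hw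
  have hwm : Measurable w := (continuous_damp _).measurable
  have hww : ∀ t, damp ρ t = w t * w t := fun t => by
    rw [hw, damp, damp, ← ENNReal.ofReal_mul (Real.exp_pos _).le, ← Real.exp_add]
    congr 2; ring
  have hw0 : ∀ t, w t ≠ 0 := fun t => by
    rw [hw, damp]; exact (ENNReal.ofReal_pos.2 (Real.exp_pos _)).ne'
  have hwt : ∀ t, w t ≠ ⊤ := fun t => ENNReal.ofReal_ne_top
  have hint : ∀ s, ∫⁻ t in Ioi s, w t = ENNReal.ofReal ρ⁻¹ * w s := by
    intro s
    have h1 : ∀ t, w t = ENNReal.ofReal (Real.exp (-ρ * t)) := fun t => by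
      rw [hw, damp]; congr 2; ring
    simp_rw [h1]
    rw [← ofReal_integral_eq_lintegral_ofReal (integrableOn_exp_mul_Ioi (by linarith) s)
      (Filter.Eventually.of_forall fun _ => (Real.exp_pos _).le), integral_exp_mul_Ioi (by linarith),
      ← ENNReal.ofReal_mul (by positivity)]
    congr 1; field_simp
  have hinv : ∀ t, ∫⁻ s in Ioc 0 t, (w s)⁻¹ ≤ ENNReal.ofReal ρ⁻¹ * (w t)⁻¹ := by
    intro t
    have h1 : ∀ t, (w t)⁻¹ = ENNReal.ofReal (Real.exp (ρ * t)) := fun t => by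
      rw [hw, damp, ← ENNReal.ofReal_inv_of_pos (Real.exp_pos _), ← Real.exp_neg]; congr 2; ring
    simp_rw [h1]
    have h2 : IntegrableOn (fun s => Real.exp (ρ * s)) (Iic t) := integrableOn_exp_mul_Iic hρ t
    refine (lintegral_mono_set Ioc_subset_Iic_self).trans ?_
    rw [← ofReal_integral_eq_lintegral_ofReal h2
      (Filter.Eventually.of_forall fun _ => (Real.exp_pos _).le), integral_exp_mul_Iic hρ,
      ← ENNReal.ofReal_mul (by positivity)]
    refine ENNReal.ofReal_le_ofReal (le_of_eq ?_)
    field_simp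
  have hcs : ∀ t, (∫⁻ s in Ioc 0 t, g s) ^ 2 ≤
      (ENNReal.ofReal ρ⁻¹ * (w t)⁻¹) * ∫⁻ s in Ioc 0 t, g s ^ 2 * w s := by
    intro t
    set v : ℝ → ℝ≥0∞ := damp (ρ / 4) with hv
    have hvm : Measurable v := (continuous_damp _).measurable
    have hvv : ∀ t, w t = v t ^ 2 := fun t => by
      rw [hw, hv, damp, damp, sq, ← ENNReal.ofReal_mul (Real.exp_pos _).le, ← Real.exp_add]
      congr 2; ring
    have hv0 : ∀ t, v t ≠ 0 := fun t => (ENNReal.ofReal_pos.2 (Real.exp_pos _)).ne'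
    have hvt : ∀ t, v t ≠ ⊤ := fun t => ENNReal.ofReal_ne_top
    have h1 := lintegral_mul_sq_le (μ := volume.restrict (Ioc 0 t)) (f := fun s => (v s)⁻¹)
      (g := fun s => v s * g s) hvm.inv.aemeasurable (hvm.mul hg).aemeasurable
    have h2 : ∀ s, (v s)⁻¹ * (v s * g s) = g s := fun s => by
      rw [← mul_assoc, ENNReal.inv_mul_cancel (hv0 s) (hvt s), one_mul]
    simp_rw [h2, mul_pow, ← ENNReal.inv_pow, ← hvv] at h1
    refine h1.trans ((mul_le_mul_left (hinv t) _).trans_eq ?_)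
    exact congrArg _ (lintegral_congr fun s => mul_comm _ _)
  set F : ℝ → ℝ≥0∞ := fun s => g s ^ 2 * w s with hF
  have hFm : Measurable F := (hg.pow_const 2).mul hwm
  calc ∫⁻ t in Ioi (0 : ℝ), (∫⁻ s in Ioc 0 t, g s) ^ 2 * damp ρ t
      ≤ ∫⁻ t in Ioi (0 : ℝ), ∫⁻ s in Ioi (0 : ℝ), ENNReal.ofReal ρ⁻¹ * w t * (Iic t).indicator F s := by
        refine lintegral_mono fun t => ?_
        simp only
        rw [lintegral_const_mul' _ _ (ENNReal.mul_ne_top ENNReal.ofReal_ne_top (hwt t)),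
          lintegral_indicator measurableSet_Iic, Measure.restrict_restrict measurableSet_Iic, inter_comm,
          Ioi_inter_Iic]
        refine (mul_le_mul_left (hcs t) _).trans_eq ?_
        rw [hww]
        calc _ = ENNReal.ofReal ρ⁻¹ * ((w t)⁻¹ * w t) * w t * ∫⁻ s in Ioc 0 t, F s := by ring
          _ = _ := by rw [ENNReal.inv_mul_cancel (hw0 t) (hwt t), mul_one]
    _ = ∫⁻ s in Ioi (0 : ℝ), ∫⁻ t in Ioi (0 : ℝ), ENNReal.ofReal ρ⁻¹ * w t * (Iic t).indicator F s := by
        refine lintegral_lintegral_swap (Measurable.aemeasurable ?_)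
        refine Measurable.mul ((hwm.comp measurable_fst).const_mul _) ?_
        exact Measurable.indicator (s := {p : ℝ × ℝ | p.2 ≤ p.1}) (hFm.comp measurable_snd)
          (measurableSet_le measurable_snd measurable_fst)
    _ ≤ ∫⁻ s in Ioi (0 : ℝ), ENNReal.ofReal (ρ⁻¹ ^ 2) * (g s ^ 2 * damp ρ s) := by
        refine lintegral_mono fun s => ?_
        have h1 : ∀ t, ENNReal.ofReal ρ⁻¹ * w t * (Iic t).indicator F s =
            (Ici s).indicator (fun t => ENNReal.ofReal ρ⁻¹ * F s * w t) t := fun t => by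
          by_cases h : s ≤ t
          · rw [indicator_of_mem (mem_Iic.2 h), indicator_of_mem (mem_Ici.2 h)]; ring
          · rw [indicator_of_notMem (by simpa using h), indicator_of_notMem (by simpa using h), mul_zero]
        simp_rw [h1]
        refine (lintegral_mono' Measure.restrict_le_self le_rfl).trans ?_
        rw [lintegral_indicator measurableSet_Ici, setLIntegral_congr Ioi_ae_eq_Ici.symm,
          lintegral_const_mul _ hwm, hint, hF, hww, ENNReal.ofReal_pow (by positivity)]
        refine le_of_eq ?_
        ring
    _ = _ := lintegral_const_mul' _ _ ENNReal.ofReal_ne_top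

end

section

/-! ### The Ritz projection and the discrete energy estimate in Hilbert spaces -/

section Hilbert

variable {V H G : Type*} [NormedAddCommGroup V] [InnerProductSpace ℝ V]
  [NormedAddCommGroup H] [InnerProductSpace ℝ H] [NormedAddCommGroup G] [InnerProductSpace ℝ G]

/-- Lax–Milgram on the closed subspace K, where the form (N·, N·) is coercive because N is bounded
below. -/
theorem exists_ritz [CompleteSpace V] [CompleteSpace G] (N : V →L[ℝ] G) {β : ℝ} (hβ : 0 < β)
    (hN : ∀ v, β * ‖v‖ ≤ ‖N v‖) (K : Submodule ℝ V) (hK : IsClosed (K : Set V)) :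
    ∃ P : V →L[ℝ] V, (∀ v, P v ∈ K) ∧ ∀ v, ∀ w ∈ K, inner ℝ (N (v - P v)) (N w) = 0 := by
  have : CompleteSpace K := hK.completeSpace_coe
  set NK : K →L[ℝ] G := N.comp K.subtypeL with hNK
  set B : K →L[ℝ] K →L[ℝ] ℝ := (innerSL ℝ).bilinearComp NK NK with hB
  have hB' : ∀ v w : K, B v w = inner ℝ (N v) (N w) := fun v w => rfl
  have hco : IsCoercive B := by
    refine ⟨β ^ 2, by positivity, fun v => ?_⟩
    rw [hB', real_inner_self_eq_norm_sq]
    calc β ^ 2 * ‖v‖ * ‖v‖ = (β * ‖(v : V)‖) ^ 2 := by rw [Submodule.coe_norm]; ring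
      _ ≤ _ := pow_le_pow_left₀ (by positivity) (hN v) 2
  set S := hco.continuousLinearEquivOfBilin with hS
  have hS' : ∀ v w : K, inner ℝ (S v) w = inner ℝ (N v) (N w) := fun v w =>
    hco.continuousLinearEquivOfBilin_apply v w
  refine ⟨K.subtypeL.comp ((S.symm : K →L[ℝ] K).comp (NK.adjoint.comp N)), fun v => Subtype.mem _,
    fun v w hw => ?_⟩
  have h1 := hS' (S.symm (NK.adjoint (N v))) ⟨w, hw⟩
  rw [ContinuousLinearEquiv.apply_symm_apply, ContinuousLinearMap.adjoint_inner_left] at h1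
  rw [map_sub, inner_sub_left, sub_eq_zero]
  exact h1

theorem norm_sub_ritz_le {N : V →L[ℝ] G} {K : Submodule ℝ V} {P : V →L[ℝ] V} (hPK : ∀ v, P v ∈ K)
    (hP : ∀ v, ∀ w ∈ K, inner ℝ (N (v - P v)) (N w) = 0) (v : V) {w : V} (hw : w ∈ K) :
    ‖N (v - P v)‖ ≤ ‖N v - N w‖ := by
  have h1 := hP v (P v - w) (sub_mem (hPK v) hw)
  have h2 : N v - N w = N (v - P v) + N (P v - w) := by simp
  rw [h2]
  have h3 := norm_add_sq_real (N (v - P v)) (N (P v - w))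
  rw [h1] at h3
  exact (abs_le_of_sq_le_sq' (by nlinarith [sq_nonneg ‖N (P v - w)‖]) (norm_nonneg _)).2

/-- By polarization (Nv, Nw) is half of ‖Nv‖² + ‖Nw‖² − ‖N(v − w)‖². The stability condition bounds
the negative term by half of the kinetic part, and half of every positive term survives. -/
theorem energy_lower (i : V →L[ℝ] H) (N : V →L[ℝ] G) {τ : ℝ} (hτ : 0 < τ) {v w : V}
    (h : τ ^ 2 * ‖N (v - w)‖ ^ 2 ≤ ‖i (v - w)‖ ^ 2) {E : ℝ}
    (hE : E = ‖i (v - w)‖ ^ 2 / τ ^ 2 + inner ℝ (N v) (N w)) :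
    0 ≤ E ∧ ‖i (v - w)‖ ≤ 2 * τ * √E ∧ ‖N v‖ ≤ 2 * √E := by
  have h1 := norm_sub_sq_real (N v) (N w)
  have h2 := norm_add_sq_real (N v) (N w)
  rw [← map_sub] at h1
  obtain ⟨y, hy⟩ : ∃ y, y = ‖i (v - w)‖ ^ 2 / τ ^ 2 := ⟨_, rfl⟩
  have hy' : ‖i (v - w)‖ ^ 2 = τ ^ 2 * y := by rw [hy]; field_simp
  rw [← hy] at hE
  have h3 : ‖N (v - w)‖ ^ 2 ≤ y := by
    rw [hy'] at h
    exact le_of_mul_le_mul_left h (by positivity)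
  have hy0 : 0 ≤ y := (sq_nonneg _).trans h3
  have h4 := sq_nonneg ‖N v + N w‖
  have h5 := sq_nonneg ‖N v‖
  have h6 := sq_nonneg ‖N w‖
  have hE0 : 0 ≤ E := by linarith
  refine ⟨hE0, ?_, ?_⟩
  · refine abs_le_of_sq_le_sq' ?_ (by positivity) |>.2
    rw [hy', mul_pow, mul_pow, Real.sq_sqrt hE0]
    nlinarith [sq_nonneg τ, mul_nonneg (sq_nonneg τ) (show 0 ≤ 4 * E - y by linarith)]
  · refine abs_le_of_sq_le_sq' ?_ (by positivity) |>.2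
    rw [mul_pow, Real.sq_sqrt hE0]
    linarith

/-- Factoring a² − b² cancels a + b. In this way the square root of the energy grows only additively
from one step to the next. -/
theorem le_add_of_sq_sub_le {a b c : ℝ} (hb : 0 ≤ b) (hc : 0 ≤ c)
    (h : a ^ 2 - b ^ 2 ≤ c * (a + b)) : a ≤ b + c := by
  by_contra hlt
  push Not at hlt
  nlinarith

/-- Stability of the leapfrog scheme in the energy norm. -/
theorem leapfrog_stable (i : V →L[ℝ] H) (N : V →L[ℝ] G) (K : Submodule ℝ V) {τ : ℝ} (hτ : 0 < τ)
    (hst : ∀ v ∈ K, τ ^ 2 * ‖N v‖ ^ 2 ≤ ‖i v‖ ^ 2) {e : ℤ → V} (he : ∀ n, e n ∈ K)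
    (he0 : ∀ n ≤ 0, e n = 0) {g : ℤ → H}
    (hstep : ∀ n, ∀ v ∈ K, 1 / τ ^ 2 * inner ℝ (i (e (n + 1) - (2 : ℝ) • e n + e (n - 1))) (i v)
      + inner ℝ (N (e n)) (N v) = inner ℝ (g n) (i v)) (n : ℕ) :
    (∀ m : ℤ, m ≤ n + 1 → ‖N (e m)‖ ≤ 4 * ∑ l ∈ Finset.range (n + 1), τ * ‖g l‖) ∧
    ∀ m : ℤ, m ≤ n → ‖i (e (m + 1) - e m)‖ ≤ τ * (4 * ∑ l ∈ Finset.range (n + 1), τ * ‖g l‖) := by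
  set E : ℤ → ℝ := fun n => ‖i (e (n + 1) - e n)‖ ^ 2 / τ ^ 2 + inner ℝ (N (e (n + 1))) (N (e n)) with hE
  have hlow := fun n : ℤ => energy_lower i N hτ (hst _ (sub_mem (he (n + 1)) (he n))) (E := E n) rfl
  have hstepE : ∀ n : ℤ, √(E n) ≤ √(E (n - 1)) + 2 * (τ * ‖g n‖) := by
    intro n
    refine le_add_of_sq_sub_le (Real.sqrt_nonneg _) (by positivity) ?_
    rw [Real.sq_sqrt (hlow n).1, Real.sq_sqrt (hlow (n - 1)).1]
    -- With this test function the second difference yields the change of the kinetic part, and (N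
    -- eⁿ, N eⁿ⁺¹) − (N eⁿ, N eⁿ⁻¹) the change of the potential part.
    have h1 := hstep n (e (n + 1) - e (n - 1)) (sub_mem (he _) (he _))
    have h2 : E n - E (n - 1) = inner ℝ (g n) (i (e (n + 1) - e (n - 1))) := by
      rw [← h1, hE]
      simp only [sub_add_cancel, map_add, map_sub, map_smul]
      have h3 : ∀ x y z : H, ‖x - y‖ ^ 2 - ‖y - z‖ ^ 2 = inner ℝ (x - (2 : ℝ) • y + z) (x - z) := by
        intro x y z
        rw [show x - (2 : ℝ) • y + z = (x - y) - (y - z) by rw [two_smul]; abel,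
          show x - z = (x - y) + (y - z) by abel]
        generalize x - y = p, y - z = q
        rw [inner_add_right, inner_sub_left, inner_sub_left, real_inner_self_eq_norm_sq,
          real_inner_self_eq_norm_sq, real_inner_comm p q]
        ring
      rw [← h3, inner_sub_right, real_inner_comm (N (e n)) (N (e (n + 1)))]
      ring
    rw [h2]
    refine (real_inner_le_norm _ _).trans ?_
    have h4 : ‖i (e (n + 1) - e (n - 1))‖ ≤ 2 * τ * √(E n) + 2 * τ * √(E (n - 1)) := by
      rw [show e (n + 1) - e (n - 1) = (e (n + 1) - e n) + (e n - e (n - 1)) by abel, map_add]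
      refine (norm_add_le _ _).trans (add_le_add (hlow n).2.1 ?_)
      have := (hlow (n - 1)).2.1
      rwa [sub_add_cancel] at this
    refine (mul_le_mul_of_nonneg_left h4 (norm_nonneg _)).trans_eq (by ring)
  have hsum : ∀ n : ℕ, √(E n) ≤ 2 * ∑ l ∈ Finset.range (n + 1), τ * ‖g l‖ := by
    intro n
    induction n with
    | zero =>
      have h1 := hstepE 0
      have h2 : E (0 - 1) = 0 := by simp [hE, he0]
      rw [h2, Real.sqrt_zero, zero_add] at h1
      simpa using h1
    | succ n ih =>
      have h1 := hstepE (n + 1 : ℕ)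
      rw [show ((n + 1 : ℕ) : ℤ) - 1 = n by push_cast; ring] at h1
      rw [Finset.sum_range_succ, mul_add]
      linarith
  have hmono : ∀ {m n : ℕ}, m ≤ n → √(E m) ≤ 2 * ∑ l ∈ Finset.range (n + 1), τ * ‖g l‖ := fun hmn =>
    (hsum _).trans (mul_le_mul_of_nonneg_left (Finset.sum_le_sum_of_subset_of_nonneg
      (Finset.range_mono (by omega)) fun _ _ _ => by positivity) (by norm_num))
  have hpos : 0 ≤ ∑ l ∈ Finset.range (n + 1), τ * ‖g l‖ := Finset.sum_nonneg fun _ _ => by positivity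
  refine ⟨fun m hm => ?_, fun m hm => ?_⟩
  · rcases le_or_gt m 0 with h | h
    · rw [he0 m h, map_zero, norm_zero]; positivity
    · obtain ⟨l, rfl⟩ : ∃ l : ℕ, m = l + 1 := ⟨(m - 1).toNat, by omega⟩
      have := hmono (show l ≤ n by omega)
      exact (hlow l).2.2.trans (by linarith)
  · rcases lt_or_ge m 0 with h | h
    · rw [he0 m h.le, he0 _ (by omega), sub_zero, map_zero, norm_zero]; positivity
    · obtain ⟨l, rfl⟩ : ∃ l : ℕ, m = l := ⟨m.toNat, by omega⟩
      have := hmono (show l ≤ n by omega)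
      refine (hlow l).2.1.trans ?_
      nlinarith

end Hilbert

end

section

/-! ### Five-point combinations -/

/-- The average of `‖φ‖` over four time steps around `t`. -/
def stepAvg {E : Type*} [NormedAddCommGroup E] (τ : ℝ) (φ : ℝ → E) (t : ℝ) : ℝ≥0∞ :=
  (ENNReal.ofReal τ)⁻¹ * ∫⁻ s in Icc (((⌊t / τ⌋ : ℤ) - 2 : ℝ) * τ) (((⌊t / τ⌋ : ℤ) + 2 : ℝ) * τ), ‖φ s‖ₑ

/-- The squared damped norm over the whole line. -/
def dampSq {E : Type*} [NormedAddCommGroup E] (ρ : ℝ) (φ : ℝ → E) : ℝ≥0∞ :=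
  ∫⁻ t, ‖φ t‖ₑ ^ 2 * damp ρ t

/-- The five points of the stencils. -/
abbrev stencil : Finset ℤ := Finset.Icc (-2) 2

theorem stencil_eq : stencil = {-2, -1, 0, 1, 2} := by decide

theorem floor_mul_le {τ : ℝ} (hτ : 0 < τ) (t : ℝ) : (⌊t / τ⌋ : ℝ) * τ ≤ t :=
  (le_div_iff₀ hτ).1 (Int.floor_le _)

theorem lt_floor_mul {τ : ℝ} (hτ : 0 < τ) (t : ℝ) : t < ((⌊t / τ⌋ : ℝ) + 1) * τ :=
  (div_lt_iff₀ hτ).1 (Int.lt_floor_add_one _)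

section Stencil

variable {E : Type*} [NormedAddCommGroup E]

/-- The window attached to the time step of t lies in [t − 3τ, t + 3τ]. After Cauchy–Schwarz the
bound for sliding averages applies. -/
theorem lintegral_stepAvg_sq_le {φ : ℝ → E} (hφ : AEStronglyMeasurable φ) {ρ τ : ℝ} (hρ : 0 < ρ)
    (hτ : 0 < τ) (hρτ : ρ * τ ≤ 1) :
    ∫⁻ t, stepAvg τ φ t ^ 2 * damp ρ t ≤ ENNReal.ofReal (24 * Real.exp 6) * dampSq ρ φ := by
  set T := ENNReal.ofReal τ with hT
  have hT0 : T ≠ 0 := (ENNReal.ofReal_pos.2 hτ).ne'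
  have hTt : T ≠ ⊤ := ENNReal.ofReal_ne_top
  have h1 : ∀ t, stepAvg τ φ t ^ 2 ≤ 4 * T⁻¹ * ∫⁻ s in Icc (t - 3 * τ) (t + 3 * τ), ‖φ s‖ₑ ^ 2 := by
    intro t
    rw [stepAvg, mul_pow]
    refine (mul_le_mul_right (sq_lintegral_le hφ.enorm.restrict) _).trans ?_
    rw [Measure.restrict_apply_univ, Real.volume_Icc, ← mul_assoc]
    have h2 := floor_mul_le hτ t
    have h3 := lt_floor_mul hτ t
    refine mul_le_mul' (le_of_eq ?_) (lintegral_mono_set (Icc_subset_Icc (by linarith) (by linarith)))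
    rw [show ((⌊t / τ⌋ : ℝ) + 2) * τ - ((⌊t / τ⌋ : ℝ) - 2) * τ = 4 * τ by ring,
      ENNReal.ofReal_mul (by norm_num), ← hT, sq]
    calc T⁻¹ * T⁻¹ * (ENNReal.ofReal 4 * T) = ENNReal.ofReal 4 * T⁻¹ * (T⁻¹ * T) := by ring
      _ = _ := by rw [ENNReal.inv_mul_cancel hT0 hTt, mul_one]; norm_num
  refine (lintegral_mono fun t => mul_le_mul_left (h1 t) _).trans ?_
  simp_rw [mul_assoc (4 * T⁻¹)]
  rw [lintegral_const_mul' _ _ (by finiteness)]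
  refine (mul_le_mul_right (lintegral_average_le (hφ.enorm.pow_const 2) hρ hτ hρτ) _).trans_eq ?_
  rw [dampSq, ← mul_assoc]
  congr 1
  rw [show 6 * τ * Real.exp 6 = τ * (6 * Real.exp 6) by ring, ENNReal.ofReal_mul hτ.le, ← hT,
    show 24 * Real.exp 6 = 4 * (6 * Real.exp 6) by ring, ENNReal.ofReal_mul (by norm_num : (0 : ℝ) ≤ 4)]
  calc _ = 4 * (T⁻¹ * T) * ENNReal.ofReal (6 * Real.exp 6) := by ring
    _ = _ := by rw [ENNReal.inv_mul_cancel hT0 hTt, mul_one]; norm_num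

variable [NormedSpace ℝ E] [CompleteSpace E]

/-- All five values are expanded at z, so the moments of the coefficients decide which derivatives
appear. The constant is 3200 = 5 · 10 · 4³: five points, coefficients at most 10, a window of length
4τ and m ≤ 3. -/
theorem stencil_expansion {m : ℕ} (hm : m ≤ 3) {D : ℕ → ℝ → E}
    (h : ∀ r ≤ m, IsPrimitive (D r) (D (r + 1))) {τ : ℝ} (hτ : 0 < τ) (t : ℝ) {n : ℤ}
    (hn : n = ⌊t / τ⌋) {a : ℤ → ℝ} (ha : ∀ j ∈ stencil, |a j| ≤ 10) {z : ℝ} {θ : ℝ}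
    (hθ : 0 ≤ θ) (hθ1 : θ ≤ 1) (hz : z = (n + θ) * τ) :
    ‖∑ j ∈ stencil, a j • D 0 (((n + j : ℤ) : ℝ) * τ) - ∑ l ∈ Finset.range (m + 1),
        (τ ^ l * (∑ j ∈ stencil, a j * (j - θ) ^ l) / (l.factorial : ℝ)) • D l z‖ₑ ≤
      3200 * ENNReal.ofReal τ ^ (m + 1) * stepAvg τ (D (m + 1)) t := by
  have h1 := enorm_sum_sub_taylor_le m h (a := (n - 2 : ℝ) * τ) (b := (n + 2 : ℝ) * τ) (t := z)
    ⟨by rw [hz]; nlinarith, by rw [hz]; nlinarith⟩ stencil a (fun j => ((n + j : ℤ) : ℝ) * τ)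
    (fun j hj => by
      have h2 : (-2 : ℝ) ≤ j := by exact_mod_cast (Finset.mem_Icc.1 hj).1
      have h3 : (j : ℝ) ≤ 2 := by exact_mod_cast (Finset.mem_Icc.1 hj).2
      push_cast
      constructor <;> nlinarith) ha
  have h2 : ∀ l : ℕ, ∑ j ∈ stencil, a j * (((n + j : ℤ) : ℝ) * τ - z) ^ l =
      τ ^ l * ∑ j ∈ stencil, a j * (j - θ) ^ l := fun l => by
    rw [Finset.mul_sum]
    refine Finset.sum_congr rfl fun j _ => ?_
    rw [hz, show ((n + j : ℤ) : ℝ) * τ - (n + θ) * τ = τ * (j - θ) by push_cast; ring, mul_pow]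
    ring
  simp_rw [h2] at h1
  refine h1.trans ?_
  rw [stepAvg, ← hn]
  set T := ENNReal.ofReal τ with hT
  have hT0 : T ≠ 0 := (ENNReal.ofReal_pos.2 hτ).ne'
  have hTt : T ≠ ⊤ := ENNReal.ofReal_ne_top
  generalize ∫⁻ s in Icc ((n - 2 : ℝ) * τ) ((n + 2 : ℝ) * τ), ‖D (m + 1) s‖ₑ = I
  rw [show ((n + 2 : ℝ) * τ - (n - 2 : ℝ) * τ) = 4 * τ by ring, mul_pow, ENNReal.ofReal_mul (by positivity),
    ENNReal.ofReal_pow hτ.le, ← hT, stencil_eq]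
  calc _ = (((5 : ℕ) : ℝ≥0∞) * ENNReal.ofReal 10 * ENNReal.ofReal (4 ^ m)) * (T ^ m * I) := by
        rw [show Finset.card ({-2, -1, 0, 1, 2} : Finset ℤ) = 5 by decide]; ring
    _ ≤ 3200 * (T ^ m * I) := by
        refine mul_le_mul_left ?_ _
        rw [← ENNReal.ofReal_natCast, ← ENNReal.ofReal_mul (by norm_num), ← ENNReal.ofReal_mul (by norm_num),
          show (3200 : ℝ≥0∞) = ENNReal.ofReal 3200 by norm_num]
        refine ENNReal.ofReal_le_ofReal ?_
        interval_cases m <;> norm_num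
    _ = 3200 * (T ^ m * (T * T⁻¹) * I) := by rw [ENNReal.mul_inv_cancel hT0 hTt, mul_one]
    _ = _ := by ring

end Stencil

/-- Piecewise polynomial reconstructions `∑ⱼ cⱼ(θ) Wⁿ⁺ʲ` of second order, where `c'` is the
derivative of `c`. -/
structure IsReconstruction (c c' : ℤ → ℝ → ℝ) : Prop where
  hasDerivAt : ∀ j θ, HasDerivAt (c j) (c' j θ) θ
  bound : ∀ j, ∀ θ ∈ Icc (0 : ℝ) 1, |c j θ| ≤ 10
  bound' : ∀ j, ∀ θ ∈ Icc (0 : ℝ) 1, |c' j θ| ≤ 10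
  sum : ∀ θ, ∑ j ∈ stencil, c j θ = 1
  sum_mul : ∀ θ, ∑ j ∈ stencil, c j θ * j = θ
  sum' : ∀ θ, ∑ j ∈ stencil, c' j θ = 0
  sum_mul' : ∀ θ, ∑ j ∈ stencil, c' j θ * j = 1
  sum_mul_sq' : ∀ θ, ∑ j ∈ stencil, c' j θ * j ^ 2 = 2 * θ

section

variable {E : Type*} [NormedAddCommGroup E] [NormedSpace ℝ E] [CompleteSpace E] {D : ℕ → ℝ → E}
  {τ : ℝ} {n : ℤ} {θ t : ℝ} {c c' : ℤ → ℝ → ℝ}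

theorem sum_shift_one (a : ℤ → ℝ) (θ : ℝ) : ∑ j ∈ stencil, a j * ((j : ℝ) - θ) ^ 1 =
    ∑ j ∈ stencil, a j * j - θ * ∑ j ∈ stencil, a j := by
  rw [Finset.mul_sum, ← Finset.sum_sub_distrib]
  exact Finset.sum_congr rfl fun j _ => by ring

theorem sum_shift_two (a : ℤ → ℝ) (θ : ℝ) : ∑ j ∈ stencil, a j * ((j : ℝ) - θ) ^ 2 =
    ∑ j ∈ stencil, a j * j ^ 2 - 2 * θ * ∑ j ∈ stencil, a j * j + θ ^ 2 * ∑ j ∈ stencil, a j := by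
  rw [Finset.mul_sum, Finset.mul_sum, ← Finset.sum_sub_distrib, ← Finset.sum_add_distrib]
  exact Finset.sum_congr rfl fun j _ => by ring

/-- In this and the next three lemmas the moment conditions remove the low order terms of the
expansion: c reproduces affine functions, c' annihilates constants and differentiates quadratics
exactly. The smooth solution takes the long expansions; the projection error takes the short ones,
since it is already small. -/
theorem IsReconstruction.value_zero (hc : IsReconstruction c c') (h : IsPrimitive (D 0) (D 1)) (hτ : 0 < τ)
    (hn : n = ⌊t / τ⌋) (hθ : 0 ≤ θ) (hθ1 : θ ≤ 1) (hz : t = (n + θ) * τ) :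
    ‖∑ j ∈ stencil, c j θ • D 0 (((n + j : ℤ) : ℝ) * τ) - D 0 t‖ₑ ≤
      3200 * ENNReal.ofReal τ * stepAvg τ (D 1) t := by
  have h1 := stencil_expansion (m := 0) (by omega) (D := D) (fun r hr => by
    obtain rfl : r = 0 := by omega
    exact h) hτ t hn (a := fun j => c j θ) (fun j _ => hc.bound j θ ⟨hθ, hθ1⟩) hθ hθ1 hz
  simpa [hc.sum] using h1

theorem IsReconstruction.value_one (hc : IsReconstruction c c')
    (h : ∀ r ≤ 1, IsPrimitive (D r) (D (r + 1))) (hτ : 0 < τ)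
    (hn : n = ⌊t / τ⌋) (hθ : 0 ≤ θ) (hθ1 : θ ≤ 1) (hz : t = (n + θ) * τ) :
    ‖∑ j ∈ stencil, c j θ • D 0 (((n + j : ℤ) : ℝ) * τ) - D 0 t‖ₑ ≤
      3200 * ENNReal.ofReal τ ^ 2 * stepAvg τ (D 2) t := by
  have h1 := stencil_expansion (m := 1) (by omega) h hτ t hn (a := fun j => c j θ)
    (fun j _ => hc.bound j θ ⟨hθ, hθ1⟩) hθ hθ1 hz
  have h2 := sum_shift_one (fun j => c j θ) θ
  rw [hc.sum_mul, hc.sum, mul_one, sub_self] at h2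
  rw [Finset.sum_range_succ, Finset.sum_range_one, h2] at h1
  simpa [hc.sum] using h1

theorem IsReconstruction.deriv_zero (hc : IsReconstruction c c') (h : IsPrimitive (D 0) (D 1)) (hτ : 0 < τ)
    (hn : n = ⌊t / τ⌋) (hθ : 0 ≤ θ) (hθ1 : θ ≤ 1) (hz : t = (n + θ) * τ) :
    ‖∑ j ∈ stencil, c' j θ • D 0 (((n + j : ℤ) : ℝ) * τ)‖ₑ ≤
      3200 * ENNReal.ofReal τ * stepAvg τ (D 1) t := by
  have h1 := stencil_expansion (m := 0) (by omega) (D := D) (fun r hr => by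
    obtain rfl : r = 0 := by omega
    exact h) hτ t hn (a := fun j => c' j θ) (fun j _ => hc.bound' j θ ⟨hθ, hθ1⟩) hθ hθ1 hz
  simpa [hc.sum'] using h1

theorem IsReconstruction.deriv_two (hc : IsReconstruction c c')
    (h : ∀ r ≤ 2, IsPrimitive (D r) (D (r + 1))) (hτ : 0 < τ)
    (hn : n = ⌊t / τ⌋) (hθ : 0 ≤ θ) (hθ1 : θ ≤ 1) (hz : t = (n + θ) * τ) :
    ‖∑ j ∈ stencil, c' j θ • D 0 (((n + j : ℤ) : ℝ) * τ) - τ • D 1 t‖ₑ ≤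
      3200 * ENNReal.ofReal τ ^ 3 * stepAvg τ (D 3) t := by
  have h1 := stencil_expansion (m := 2) (by omega) h hτ t hn (a := fun j => c' j θ)
    (fun j _ => hc.bound' j θ ⟨hθ, hθ1⟩) hθ hθ1 hz
  have h2 := sum_shift_one (fun j => c' j θ) θ
  have h3 := sum_shift_two (fun j => c' j θ) θ
  rw [hc.sum_mul', hc.sum', mul_zero, sub_zero] at h2
  rw [hc.sum_mul', hc.sum', hc.sum_mul_sq', mul_one, mul_zero, sub_self, zero_add] at h3
  rw [Finset.sum_range_succ, Finset.sum_range_succ, Finset.sum_range_one, h2, h3] at h1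
  simpa [hc.sum'] using h1

/-- The coefficients of the second difference. -/
def diffTwo (j : ℤ) : ℝ := if j = 0 then -2 else if j = 1 ∨ j = -1 then 1 else 0

theorem abs_diffTwo_le (j : ℤ) : |diffTwo j| ≤ 10 := by
  unfold diffTwo
  split_ifs <;> norm_num

theorem sum_diffTwo {F : Type*} [AddCommGroup F] [Module ℝ F] (x : ℤ → F) :
    ∑ j ∈ stencil, diffTwo j • x j = x 1 - (2 : ℝ) • x 0 + x (-1) := by
  rw [stencil_eq]
  simp [diffTwo, Finset.sum_insert]
  abel

theorem diffTwo_one (h : ∀ r ≤ 1, IsPrimitive (D r) (D (r + 1))) (hτ : 0 < τ) (hn : n = ⌊t / τ⌋) :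
    ‖∑ j ∈ stencil, diffTwo j • D 0 (((n + j : ℤ) : ℝ) * τ)‖ₑ ≤
      3200 * ENNReal.ofReal τ ^ 2 * stepAvg τ (D 2) t := by
  have h1 := stencil_expansion (m := 1) (by omega) h hτ t hn (fun j _ => abs_diffTwo_le j) le_rfl
    zero_le_one rfl
  simp_rw [← smul_eq_mul (diffTwo _), sum_diffTwo] at h1
  rw [Finset.sum_range_succ, Finset.sum_range_one] at h1
  norm_num at h1
  rw [sum_diffTwo]
  norm_num
  exact h1

/-- By symmetry the odd moments of the second difference vanish, so the remainder is of fourth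
order. -/
theorem diffTwo_three (h : ∀ r ≤ 3, IsPrimitive (D r) (D (r + 1))) (hτ : 0 < τ) (hn : n = ⌊t / τ⌋) :
    ‖∑ j ∈ stencil, diffTwo j • D 0 (((n + j : ℤ) : ℝ) * τ) - τ ^ 2 • D 2 (n * τ)‖ₑ ≤
      3200 * ENNReal.ofReal τ ^ 4 * stepAvg τ (D 4) t := by
  have h1 := stencil_expansion (m := 3) (by omega) h hτ t hn (fun j _ => abs_diffTwo_le j) le_rfl
    zero_le_one rfl
  simp_rw [← smul_eq_mul (diffTwo _), sum_diffTwo] at h1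
  rw [Finset.sum_range_succ, Finset.sum_range_succ, Finset.sum_range_succ, Finset.sum_range_one] at h1
  norm_num [Nat.factorial] at h1
  rw [sum_diffTwo]
  norm_num
  exact h1

end

end

section

/-! ### The error of the fully discrete scheme in Hilbert spaces -/

theorem measurable_comp_floor {β : Type*} [MeasurableSpace β] (τ : ℝ) (F : ℤ → β) :
    Measurable fun t : ℝ => F ⌊t / τ⌋ :=
  measurable_from_top.comp (Int.measurable_floor.comp (measurable_id.div_const τ))

theorem measurable_stepAvg {E : Type*} [NormedAddCommGroup E] (τ : ℝ) (φ : ℝ → E) :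
    Measurable (stepAvg τ φ) :=
  measurable_comp_floor τ fun n => (ENNReal.ofReal τ)⁻¹ * ∫⁻ s in Icc ((n - 2 : ℝ) * τ) ((n + 2 : ℝ) * τ), ‖φ s‖ₑ

/-- The sum over the steps is the integral of a step function, which makes the continuous Hardy
inequality applicable to it. -/
theorem ofReal_sum_le_lintegral {H : Type*} [NormedAddCommGroup H] {τ : ℝ} (hτ : 0 < τ) (g : ℤ → H) (n : ℕ) :
    ENNReal.ofReal (∑ l ∈ Finset.range n, τ * ‖g l‖) = ∫⁻ s in Ico 0 (n * τ), ‖g ⌊s / τ⌋‖ₑ := by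
  induction n with
  | zero => simp
  | succ n ih =>
    have h1 : Ico (0 : ℝ) ((n + 1 : ℕ) * τ) = Ico 0 (n * τ) ∪ Ico (n * τ) ((n + 1 : ℕ) * τ) := by
      rw [Ico_union_Ico_eq_Ico (by positivity)]
      push_cast; nlinarith
    rw [h1, lintegral_union measurableSet_Ico (Ico_disjoint_Ico_same), ← ih, Finset.sum_range_succ,
      ENNReal.ofReal_add (Finset.sum_nonneg fun _ _ => by positivity) (by positivity)]
    congr 1
    have h2 : ∀ s ∈ Ico (n * τ) ((n + 1 : ℕ) * τ), ‖g ⌊s / τ⌋‖ₑ = ‖g n‖ₑ := fun s hs => by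
      have : ⌊s / τ⌋ = (n : ℤ) := by
        rw [Int.floor_eq_iff]
        refine ⟨by rw [le_div_iff₀ hτ]; exact_mod_cast hs.1, by rw [div_lt_iff₀ hτ]; exact_mod_cast hs.2⟩
      rw [this]
    rw [setLIntegral_congr_fun measurableSet_Ico h2, setLIntegral_const, Real.volume_Ico,
      show ((n + 1 : ℕ) : ℝ) * τ - n * τ = τ by push_cast; ring, mul_comm, ENNReal.ofReal_mul (norm_nonneg _), ofReal_norm]

section Hilbert

variable {V H G : Type*} [NormedAddCommGroup V] [InnerProductSpace ℝ V]
  [NormedAddCommGroup H] [InnerProductSpace ℝ H] [NormedAddCommGroup G] [InnerProductSpace ℝ G]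

/-- The data of a fully discrete approximation `W` of the solution `D 0` of an abstract wave
equation, where `D r` is the `r`-th derivative in time, everything being extended by zero to
negative times. -/
structure IsDiscretization (i : V →L[ℝ] H) (N : V →L[ℝ] G) (K : Submodule ℝ V) (P : V →L[ℝ] V)
    (κ τ : ℝ) (D : ℕ → ℝ → V) (W : ℤ → V) (F : ℤ → H) : Prop where
  le_kappa : ∀ v, ‖i v‖ ≤ κ * ‖N v‖
  ritz_mem : ∀ v, P v ∈ K
  ritz : ∀ v, ∀ w ∈ K, inner ℝ (N (v - P v)) (N w) = 0
  stable : ∀ v ∈ K, τ ^ 2 * ‖N v‖ ^ 2 ≤ ‖i v‖ ^ 2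
  prim : ∀ r ≤ 3, IsPrimitive (D r) (D (r + 1))
  zero : ∀ r ≤ 3, ∀ t ≤ 0, D r t = 0
  mem : ∀ n, W n ∈ K
  zero' : ∀ n ≤ 0, W n = 0
  eqn : ∀ n : ℤ, ∀ v ∈ K, inner ℝ (i (D 2 (n * τ))) (i v) + inner ℝ (N (D 0 (n * τ))) (N v) =
    inner ℝ (F n) (i v)
  step : ∀ n, ∀ v ∈ K, 1 / τ ^ 2 * inner ℝ (i (W (n + 1) - (2 : ℝ) • W n + W (n - 1))) (i v) +
    inner ℝ (N (W n)) (N v) = inner ℝ (F n) (i v)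

variable {i : V →L[ℝ] H} {N : V →L[ℝ] G} {K : Submodule ℝ V} {P : V →L[ℝ] V}
    {κ τ : ℝ} {D : ℕ → ℝ → V} {W : ℤ → V} {F : ℤ → H}

/-- The consistency error of the scheme. -/
def consErr (i : V →L[ℝ] H) (P : V →L[ℝ] V) (τ : ℝ) (D : ℕ → ℝ → V) (n : ℤ) : H :=
  i (D 2 (n * τ)) - (1 / τ ^ 2) • i (∑ j ∈ stencil, diffTwo j • P (D 0 ((n + j : ℤ) * τ)))

theorem IsDiscretization.enorm_le (h : IsDiscretization i N K P κ τ D W F) (v : V) :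
    ‖i v‖ₑ ≤ ENNReal.ofReal κ * ‖N v‖ₑ := by
  rw [← ofReal_norm, ← ofReal_norm, ← ENNReal.ofReal_mul' (norm_nonneg _)]
  exact ENNReal.ofReal_le_ofReal (h.le_kappa v)

/-- The Ritz projection does not change the stiffness term tested in K. Hence subtracting the two
equations leaves the leapfrog scheme for W − P u with the consistency error as its source. -/
theorem IsDiscretization.stable_error (h : IsDiscretization i N K P κ τ D W F) (hτ : 0 < τ) (n : ℕ) :
    (∀ m : ℤ, m ≤ n + 1 → ‖N (W m - P (D 0 (m * τ)))‖ ≤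
      4 * ∑ l ∈ Finset.range (n + 1), τ * ‖consErr i P τ D l‖) ∧
    ∀ m : ℤ, m ≤ n → ‖i ((W (m + 1) - P (D 0 ((m + 1 : ℤ) * τ))) - (W m - P (D 0 (m * τ))))‖ ≤
      τ * (4 * ∑ l ∈ Finset.range (n + 1), τ * ‖consErr i P τ D l‖) := by
  refine leapfrog_stable i N K hτ h.stable (e := fun m => W m - P (D 0 (m * τ)))
    (fun m => sub_mem (h.mem m) (h.ritz_mem _)) (fun m hm => ?_) (fun m v hv => ?_) n
  · rw [h.zero' m hm, h.zero 0 (by omega) _ (mul_nonpos_of_nonpos_of_nonneg (by exact_mod_cast hm) hτ.le)]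
    simp
  · have h1 := h.eqn m v hv
    have h2 := h.step m v hv
    have h3 := h.ritz (D 0 (m * τ)) v hv
    rw [consErr, sum_diffTwo, inner_sub_left, real_inner_smul_left]
    simp only [add_zero]
    rw [← sub_eq_add_neg m 1]
    have h4 : W (m + 1) - P (D 0 ((m + 1 : ℤ) * τ)) - (2 : ℝ) • (W m - P (D 0 (m * τ))) +
        (W (m - 1) - P (D 0 ((m - 1 : ℤ) * τ))) = (W (m + 1) - (2 : ℝ) • W m + W (m - 1)) -
        (P (D 0 ((m + 1 : ℤ) * τ)) - (2 : ℝ) • P (D 0 (m * τ)) + P (D 0 ((m - 1 : ℤ) * τ))) := by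
      rw [smul_sub]; abel
    rw [h4, map_sub i, inner_sub_left, map_sub N, inner_sub_left, mul_sub]
    rw [map_sub N, inner_sub_left] at h3
    linarith

variable [CompleteSpace V] [CompleteSpace G]

/-- The gradients of the time derivatives. -/
abbrev gradDeriv (N : V →L[ℝ] G) (D : ℕ → ℝ → V) (r : ℕ) (t : ℝ) : G := N (D r t)

/-- The gradients of the projection errors of the time derivatives. -/
abbrev ritzErr (N : V →L[ℝ] G) (P : V →L[ℝ] V) (D : ℕ → ℝ → V) (r : ℕ) (t : ℝ) : G :=
  N (D r t - P (D r t))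

theorem IsDiscretization.prim_grad (h : IsDiscretization i N K P κ τ D W F) {r : ℕ} (hr : r ≤ 3) :
    IsPrimitive (gradDeriv N D r) (gradDeriv N D (r + 1)) := (h.prim r hr).clm N

theorem IsDiscretization.prim_ritz (h : IsDiscretization i N K P κ τ D W F) {r : ℕ} (hr : r ≤ 3) :
    IsPrimitive (ritzErr N P D r) (ritzErr N P D (r + 1)) :=
  (h.prim r hr).clm (N.comp (ContinuousLinearMap.id ℝ V - P))

theorem enorm_inv_smul {E : Type*} [NormedAddCommGroup E] [NormedSpace ℝ E] {a : ℝ} (ha : 0 < a) (x : E) :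
    ‖(1 / a) • x‖ₑ = (ENNReal.ofReal a)⁻¹ * ‖x‖ₑ := by
  rw [enorm_smul, one_div, enorm_inv ha.ne', Real.enorm_of_nonneg ha.le]

/-- The second difference of u is added and subtracted. One part is the Taylor remainder of u, the
other the second difference of u − Pu. Both are estimated in the gradient norm, with one factor κ.
-/
theorem IsDiscretization.consErr_le (h : IsDiscretization i N K P κ τ D W F) (hτ : 0 < τ) (s : ℝ) :
    ‖consErr i P τ D ⌊s / τ⌋‖ₑ ≤ 3200 * ENNReal.ofReal κ *
      (ENNReal.ofReal τ ^ 2 * stepAvg τ (gradDeriv N D 4) s + stepAvg τ (ritzErr N P D 2) s) := by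
  set n := ⌊s / τ⌋ with hn
  have h1 := diffTwo_three (D := gradDeriv N D) (fun r hr => h.prim_grad hr) hτ hn
  have h2 := diffTwo_one (D := ritzErr N P D) (fun r hr => h.prim_ritz (by omega)) hτ hn
  set T := ENNReal.ofReal τ with hT
  have hT0 : T ≠ 0 := (ENNReal.ofReal_pos.2 hτ).ne'
  have hTt : T ≠ ⊤ := ENNReal.ofReal_ne_top
  have h3 : consErr i P τ D n = (1 / τ ^ 2) • (i (∑ j ∈ stencil, diffTwo j •
      (D 0 ((n + j : ℤ) * τ) - P (D 0 ((n + j : ℤ) * τ)))) -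
      i (∑ j ∈ stencil, diffTwo j • D 0 ((n + j : ℤ) * τ) - τ ^ 2 • D 2 (n * τ))) := by
    rw [consErr, ← map_sub i]
    simp_rw [smul_sub, Finset.sum_sub_distrib]
    rw [sub_sub_sub_cancel_left, map_sub i, map_smul i, smul_sub, smul_smul, one_div,
      inv_mul_cancel₀ (by positivity), one_smul]
  have h4 : ∀ (x : ℝ → V) (L : V →L[ℝ] G), L (∑ j ∈ stencil, diffTwo j • x ((n + j : ℤ) * τ)) =
      ∑ j ∈ stencil, diffTwo j • L (x ((n + j : ℤ) * τ)) := fun x L => by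
    rw [map_sum]; exact Finset.sum_congr rfl fun j _ => map_smul _ _ _
  rw [h3, enorm_inv_smul (by positivity), ENNReal.ofReal_pow hτ.le, ← hT]
  have h5 := h.enorm_le (∑ j ∈ stencil, diffTwo j • (D 0 ((n + j : ℤ) * τ) - P (D 0 ((n + j : ℤ) * τ))))
  have h6 := h.enorm_le (∑ j ∈ stencil, diffTwo j • D 0 ((n + j : ℤ) * τ) - τ ^ 2 • D 2 (n * τ))
  rw [h4 (fun t => D 0 t - P (D 0 t))] at h5
  rw [map_sub N, h4 (fun t => D 0 t), map_smul N] at h6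
  have h7 := (enorm_sub_le (a := i (∑ j ∈ stencil, diffTwo j •
      (D 0 ((n + j : ℤ) * τ) - P (D 0 ((n + j : ℤ) * τ)))))
      (b := i (∑ j ∈ stencil, diffTwo j • D 0 ((n + j : ℤ) * τ) - τ ^ 2 • D 2 (n * τ)))).trans
      (add_le_add (h5.trans (mul_le_mul_right h2 _)) (h6.trans (mul_le_mul_right h1 _)))
  refine (mul_le_mul_right h7 _).trans_eq ?_
  have h8 : (T ^ 2)⁻¹ * T ^ 2 = 1 := ENNReal.inv_mul_cancel (by positivity) (by finiteness)
  generalize stepAvg τ (ritzErr N P D 2) s = A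
  generalize stepAvg τ (gradDeriv N D 4) s = B
  calc _ = 3200 * ENNReal.ofReal κ * (((T ^ 2)⁻¹ * T ^ 2) * (T ^ 2 * B + A)) := by ring
    _ = _ := by rw [h8, one_mul]

end Hilbert

end

/-! ### Error bounds at a fixed time -/

section

theorem enorm_stencil_le {E : Type*} [NormedAddCommGroup E] [NormedSpace ℝ E] {c : ℤ → ℝ}
    (hc : ∀ j ∈ stencil, |c j| ≤ 10) {x : ℤ → E} {B : ℝ≥0∞} (hx : ∀ j ∈ stencil, ‖x j‖ₑ ≤ B) :
    ‖∑ j ∈ stencil, c j • x j‖ₑ ≤ 50 * B := by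
  refine (enorm_sum_le _ _).trans ((Finset.sum_le_card_nsmul _ _ (10 * B) fun j hj => ?_).trans_eq ?_)
  · rw [enorm_smul]
    refine mul_le_mul' ?_ (hx j hj)
    rw [← ofReal_norm, show (10 : ℝ≥0∞) = ENNReal.ofReal 10 by norm_num]
    exact ENNReal.ofReal_le_ofReal (hc j hj)
  · rw [show stencil.card = 5 by decide, nsmul_eq_mul, ← mul_assoc]
    norm_num

section Hilbert

variable {V H G : Type*} [NormedAddCommGroup V] [InnerProductSpace ℝ V]
  [NormedAddCommGroup H] [InnerProductSpace ℝ H] [NormedAddCommGroup G] [InnerProductSpace ℝ G]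
  {i : V →L[ℝ] H} {N : V →L[ℝ] G} {K : Submodule ℝ V} {P : V →L[ℝ] V}
  {κ τ : ℝ} {D : ℕ → ℝ → V} {W : ℤ → V} {F : ℤ → H} {c c' : ℤ → ℝ → ℝ}

/-- The accumulated consistency error. -/
def accErr (i : V →L[ℝ] H) (P : V →L[ℝ] V) (τ : ℝ) (D : ℕ → ℝ → V) (t : ℝ) : ℝ≥0∞ :=
  ∫⁻ s in Ioc 0 t, ‖consErr i P τ D ⌊s / τ⌋‖ₑ

/-- The stencil at t reaches two steps ahead, so the errors of the steps up to ⌊t/τ⌋ + 1 enter.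
Their intervals end before t + 2τ. -/
theorem IsDiscretization.stable_error_le (h : IsDiscretization i N K P κ τ D W F) (hτ : 0 < τ) {t : ℝ}
    (ht : 0 ≤ t) :
    (∀ m : ℤ, m ≤ ⌊t / τ⌋ + 2 → ‖N (W m - P (D 0 (m * τ)))‖ₑ ≤ 4 * accErr i P τ D (t + 2 * τ)) ∧
    ∀ m : ℤ, m ≤ ⌊t / τ⌋ + 1 →
      ‖i ((W (m + 1) - P (D 0 ((m + 1 : ℤ) * τ))) - (W m - P (D 0 (m * τ))))‖ₑ ≤
      ENNReal.ofReal τ * (4 * accErr i P τ D (t + 2 * τ)) := by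
  obtain ⟨n, hn⟩ : ∃ n : ℕ, ⌊t / τ⌋ = n := ⟨_, (Int.toNat_of_nonneg (Int.floor_nonneg.2 (by positivity))).symm⟩
  have h1 := h.stable_error hτ (n + 1)
  have hS : ENNReal.ofReal (4 * ∑ l ∈ Finset.range (n + 1 + 1), τ * ‖consErr i P τ D l‖) ≤
      4 * accErr i P τ D (t + 2 * τ) := by
    rw [ENNReal.ofReal_mul (by norm_num), ofReal_sum_le_lintegral hτ (consErr i P τ D), accErr,
      setLIntegral_congr Ico_ae_eq_Ioc]
    have h2 := floor_mul_le hτ t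
    rw [hn] at h2
    norm_num
    refine mul_le_mul_right (lintegral_mono_set (Ioc_subset_Ioc_right ?_)) _
    push_cast at h2 ⊢
    linarith
  rw [hn]
  refine ⟨fun m hm => ?_, fun m hm => ?_⟩
  · rw [← ofReal_norm]
    exact (ENNReal.ofReal_le_ofReal (h1.1 m (by push_cast; omega))).trans hS
  · rw [← ofReal_norm]
    refine (ENNReal.ofReal_le_ofReal (h1.2 m (by push_cast; omega))).trans ?_
    rw [ENNReal.ofReal_mul hτ.le]
    exact mul_le_mul_right hS _

/-- Stability controls increments of the error in H of size τ, and at most four of them join the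
leftmost stencil point to any other. The factor τ compensates the division by τ in the derivative of
the reconstruction. -/
theorem IsDiscretization.stable_error_sub_le (h : IsDiscretization i N K P κ τ D W F) (hτ : 0 < τ) {t : ℝ}
    (ht : 0 ≤ t) {j : ℤ} (hj : j ∈ stencil) :
    ‖i ((W (⌊t / τ⌋ + j) - P (D 0 ((⌊t / τ⌋ + j : ℤ) * τ))) -
      (W (⌊t / τ⌋ - 2) - P (D 0 ((⌊t / τ⌋ - 2 : ℤ) * τ))))‖ₑ ≤
      ENNReal.ofReal τ * (16 * accErr i P τ D (t + 2 * τ)) := by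
  set n := ⌊t / τ⌋ with hn
  set e : ℤ → V := fun m => W m - P (D 0 (m * τ)) with he
  have h1 := (h.stable_error_le hτ ht).2
  set B := ENNReal.ofReal τ * (4 * accErr i P τ D (t + 2 * τ)) with hB
  have h2 : ∀ k : ℕ, k ≤ 4 → ‖i (e (n - 2 + k) - e (n - 2))‖ₑ ≤ k * B := by
    intro k
    induction k with
    | zero => simp
    | succ k ih =>
      intro hk
      have h3 := h1 (n - 2 + k) (by omega)
      have h4 : i (e (n - 2 + (k + 1 : ℕ)) - e (n - 2)) =
          i (e (n - 2 + k + 1) - e (n - 2 + k)) + i (e (n - 2 + k) - e (n - 2)) := by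
        rw [← map_add]; push_cast; rw [← add_assoc]; abel_nf
      rw [h4]
      refine (enorm_add_le _ _).trans ((add_le_add h3 (ih (by omega))).trans_eq ?_)
      push_cast; ring
  obtain ⟨hj1, hj2⟩ := Finset.mem_Icc.1 hj
  have h3 := h2 (j + 2).toNat (by omega)
  rw [show n - 2 + ((j + 2).toNat : ℤ) = n + j by omega] at h3
  refine h3.trans ?_
  have h4 : (((j + 2).toNat : ℕ) : ℝ≥0∞) ≤ (4 : ℕ) := by exact_mod_cast (show (j + 2).toNat ≤ 4 by omega)
  refine (mul_le_mul_left h4 _).trans_eq ?_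
  rw [hB]; push_cast; ring

variable [CompleteSpace V] [CompleteSpace G]

/-- The error is split into the reconstruction error of u, the projection error, the reconstruction
error of u − Pu, and the reconstructed discrete error. -/
theorem IsDiscretization.grad_error_le (h : IsDiscretization i N K P κ τ D W F)
    (hc : IsReconstruction c c') (hτ : 0 < τ) {t : ℝ} (ht : 0 ≤ t) :
    ‖N (D 0 t - ∑ j ∈ stencil, c j (Int.fract (t / τ)) • W (⌊t / τ⌋ + j))‖ₑ ≤
      3200 * ENNReal.ofReal τ ^ 2 * stepAvg τ (gradDeriv N D 2) t + ‖ritzErr N P D 0 t‖ₑ +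
      3200 * ENNReal.ofReal τ * stepAvg τ (ritzErr N P D 1) t +
      200 * accErr i P τ D (t + 2 * τ) := by
  obtain ⟨n, hn⟩ : ∃ n, n = ⌊t / τ⌋ := ⟨_, rfl⟩
  obtain ⟨θ, hθ⟩ : ∃ θ, θ = Int.fract (t / τ) := ⟨_, rfl⟩
  have hθ0 : 0 ≤ θ := hθ ▸ Int.fract_nonneg _
  have hθ1 : θ ≤ 1 := hθ ▸ (Int.fract_lt_one _).le
  have hz : t = (n + θ) * τ := by rw [hn, hθ, Int.floor_add_fract]; field_simp
  have h1 := hc.value_one (D := gradDeriv N D) (fun r hr => h.prim_grad (by omega)) hτ hn hθ0 hθ1 hz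
  have h2 := hc.value_zero (D := ritzErr N P D) (h.prim_ritz (by omega)) hτ hn hθ0 hθ1 hz
  have h3 : ‖∑ j ∈ stencil, c j θ • N (W (n + j) - P (D 0 ((n + j : ℤ) * τ)))‖ₑ ≤
      50 * (4 * accErr i P τ D (t + 2 * τ)) :=
    enorm_stencil_le (fun j _ => hc.bound j θ ⟨hθ0, hθ1⟩) fun j hj =>
      (h.stable_error_le hτ ht).1 _ (by rw [hn]; have := (Finset.mem_Icc.1 hj).2; omega)
  rw [← hn, ← hθ]
  have h4 : N (D 0 t - ∑ j ∈ stencil, c j θ • W (n + j)) =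
      -(∑ j ∈ stencil, c j θ • gradDeriv N D 0 ((n + j : ℤ) * τ) - gradDeriv N D 0 t) +
      ritzErr N P D 0 t + (∑ j ∈ stencil, c j θ • ritzErr N P D 0 ((n + j : ℤ) * τ) - ritzErr N P D 0 t) +
      -∑ j ∈ stencil, c j θ • N (W (n + j) - P (D 0 ((n + j : ℤ) * τ))) := by
    simp only [map_sub, map_sum, map_smul, smul_sub, Finset.sum_sub_distrib]
    abel
  rw [h4]
  refine (enorm_add_le _ _).trans (add_le_add ((enorm_add_le _ _).trans (add_le_add
    ((enorm_add_le _ _).trans (add_le_add ?_ le_rfl)) h2)) ?_)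
  · rw [enorm_neg]; exact h1
  · rw [enorm_neg]
    refine h3.trans_eq ?_
    rw [← mul_assoc]; norm_num

/-- The split is similar to that for the gradient. Since the cⱼ' sum to zero, the leftmost discrete
error can be subtracted from all the others, so only increments over the stencil occur. The terms
with u and u − Pu are passed to gradients with a factor κ. -/
theorem IsDiscretization.deriv_error_le (h : IsDiscretization i N K P κ τ D W F)
    (hc : IsReconstruction c c') (hτ : 0 < τ) {t : ℝ} (ht : 0 ≤ t) :
    ‖i (D 1 t) - (1 / τ) • ∑ j ∈ stencil, c' j (Int.fract (t / τ)) • i (W (⌊t / τ⌋ + j))‖ₑ ≤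
      3200 * ENNReal.ofReal κ * ENNReal.ofReal τ ^ 2 * stepAvg τ (gradDeriv N D 3) t +
      3200 * ENNReal.ofReal κ * stepAvg τ (ritzErr N P D 1) t +
      800 * accErr i P τ D (t + 2 * τ) := by
  obtain ⟨n, hn⟩ : ∃ n, n = ⌊t / τ⌋ := ⟨_, rfl⟩
  obtain ⟨θ, hθ⟩ : ∃ θ, θ = Int.fract (t / τ) := ⟨_, rfl⟩
  have hθ0 : 0 ≤ θ := hθ ▸ Int.fract_nonneg _
  have hθ1 : θ ≤ 1 := hθ ▸ (Int.fract_lt_one _).le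
  have hz : t = (n + θ) * τ := by rw [hn, hθ, Int.floor_add_fract]; field_simp
  have h1 := hc.deriv_two (D := gradDeriv N D) (fun r hr => h.prim_grad (by omega)) hτ hn hθ0 hθ1 hz
  have h2 := hc.deriv_zero (D := ritzErr N P D) (h.prim_ritz (by omega)) hτ hn hθ0 hθ1 hz
  have h3 : ‖∑ j ∈ stencil, c' j θ • i ((W (n + j) - P (D 0 ((n + j : ℤ) * τ))) -
      (W (n - 2) - P (D 0 ((n - 2 : ℤ) * τ))))‖ₑ ≤
      50 * (ENNReal.ofReal τ * (16 * accErr i P τ D (t + 2 * τ))) :=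
    enorm_stencil_le (fun j _ => hc.bound' j θ ⟨hθ0, hθ1⟩) fun j hj => by
      rw [hn]; exact h.stable_error_sub_le hτ ht hj
  rw [← hn, ← hθ]
  have h4 : i (D 1 t) - (1 / τ) • ∑ j ∈ stencil, c' j θ • i (W (n + j)) =
      (1 / τ) • (-i (∑ j ∈ stencil, c' j θ • D 0 ((n + j : ℤ) * τ) - τ • D 1 t) +
      i (∑ j ∈ stencil, c' j θ • (D 0 ((n + j : ℤ) * τ) - P (D 0 ((n + j : ℤ) * τ)))) +
      -∑ j ∈ stencil, c' j θ • i ((W (n + j) - P (D 0 ((n + j : ℤ) * τ))) -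
      (W (n - 2) - P (D 0 ((n - 2 : ℤ) * τ))))) := by
    have h5 : ∑ j ∈ stencil, c' j θ • i (W (n - 2) - P (D 0 ((n - 2 : ℤ) * τ))) = 0 := by
      rw [← Finset.sum_smul, hc.sum', zero_smul]
    have h6 : i (D 1 t) = (1 / τ) • i (τ • D 1 t) := by
      rw [← map_smul, smul_smul, one_div, inv_mul_cancel₀ hτ.ne', one_smul]
    simp only [map_sub i (_ - _) (W (n - 2) - _), smul_sub (c' _ _) (i (W _ - P _)), Finset.sum_sub_distrib, h5]
    rw [h6, ← smul_sub]
    congr 1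
    simp only [map_sub, map_sum, map_smul, smul_sub, Finset.sum_sub_distrib]
    abel
  set T := ENNReal.ofReal τ with hT
  have hT0 : T ≠ 0 := (ENNReal.ofReal_pos.2 hτ).ne'
  have hTt : T ≠ ⊤ := ENNReal.ofReal_ne_top
  have h7 := h.enorm_le (∑ j ∈ stencil, c' j θ • D 0 ((n + j : ℤ) * τ) - τ • D 1 t)
  have h8 := h.enorm_le (∑ j ∈ stencil, c' j θ • (D 0 ((n + j : ℤ) * τ) - P (D 0 ((n + j : ℤ) * τ))))
  rw [map_sub N, map_sum N, map_smul N] at h7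
  simp_rw [map_smul N] at h7
  rw [map_sum N] at h8
  simp_rw [map_smul N] at h8
  rw [h4, enorm_inv_smul hτ, ← hT]
  have h9 := (enorm_add_le (-i (∑ j ∈ stencil, c' j θ • D 0 ((n + j : ℤ) * τ) - τ • D 1 t) +
      i (∑ j ∈ stencil, c' j θ • (D 0 ((n + j : ℤ) * τ) - P (D 0 ((n + j : ℤ) * τ)))))
      (-∑ j ∈ stencil, c' j θ • i ((W (n + j) - P (D 0 ((n + j : ℤ) * τ))) -
      (W (n - 2) - P (D 0 ((n - 2 : ℤ) * τ)))))).trans (add_le_add ((enorm_add_le _ _).trans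
      (add_le_add ((enorm_neg _).trans_le (h7.trans (mul_le_mul_right h1 _)))
        (h8.trans (mul_le_mul_right h2 _)))) ((enorm_neg _).trans_le h3))
  refine (mul_le_mul_right h9 _).trans_eq ?_
  have h10 : T⁻¹ * T = 1 := ENNReal.inv_mul_cancel hT0 hTt
  generalize stepAvg τ (ritzErr N P D 1) t = A
  generalize stepAvg τ (gradDeriv N D 3) t = B
  generalize accErr i P τ D (t + 2 * τ) = C
  calc _ = (T⁻¹ * T) * (3200 * ENNReal.ofReal κ * T ^ 2 * B + 3200 * ENNReal.ofReal κ * A + 800 * C) := by ring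
    _ = _ := by rw [h10, one_mul]

end Hilbert

end

/-! ### The damped energy error over all times -/

section

theorem ennreal_add_sq_le (a b : ℝ≥0∞) : (a + b) ^ 2 ≤ 2 * a ^ 2 + 2 * b ^ 2 := by
  wlog h : a ≤ b generalizing a b
  · rw [add_comm a, add_comm (2 * a ^ 2)]
    exact this b a (le_of_not_ge h)
  obtain ⟨c, rfl⟩ := exists_add_of_le h
  calc (a + (a + c)) ^ 2 ≤ (a + (a + c)) ^ 2 + c ^ 2 := le_self_add
    _ = _ := by ring

theorem ennreal_add_four_sq_le (a b c d : ℝ≥0∞) :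
    (a + b + c + d) ^ 2 ≤ 4 * (a ^ 2 + b ^ 2 + c ^ 2 + d ^ 2) := by
  rw [add_assoc (a + b)]
  refine (ennreal_add_sq_le _ _).trans ((add_le_add (mul_le_mul_right (ennreal_add_sq_le a b) 2)
    (mul_le_mul_right (ennreal_add_sq_le c d) 2)).trans_eq ?_)
  ring

theorem measurable_sq_mul_damp {f : ℝ → ℝ≥0∞} (hf : Measurable f) (ρ : ℝ) (c : ℝ≥0∞) :
    Measurable fun t => c * (f t ^ 2 * damp ρ t) :=
  ((hf.pow_const 2).mul (continuous_damp ρ).measurable).const_mul c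

theorem lintegral_shift_le (F : ℝ → ℝ≥0∞) {ρ s N : ℝ} (hs : 0 ≤ s) (hN : ρ * s ≤ N) :
    ∫⁻ t in Ioi (0 : ℝ), F (t + s) * damp ρ t ≤
      ENNReal.ofReal (Real.exp (2 * N)) * ∫⁻ t in Ioi (0 : ℝ), F t * damp ρ t := by
  rw [← lintegral_indicator measurableSet_Ioi, ← lintegral_indicator measurableSet_Ioi,
    ← lintegral_const_mul' _ _ ENNReal.ofReal_ne_top, ← lintegral_add_right_eq_self (fun a => _ * _) s]
  refine lintegral_mono fun t => ?_
  by_cases ht : t ∈ Ioi (0 : ℝ)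
  · have h2 : t + s ∈ Ioi (0 : ℝ) := add_pos_of_pos_of_nonneg ht hs
    rw [indicator_of_mem ht, indicator_of_mem h2]
    calc F (t + s) * damp ρ t ≤ F (t + s) * (ENNReal.ofReal (Real.exp (2 * N)) * damp ρ (t + s)) :=
          mul_le_mul_right (damp_shift_le hN t) _
      _ = _ := by ring
  · rw [indicator_of_notMem ht]; exact zero_le

/-- Hardy's inequality for functions vanishing at negative times: a missing time derivative is
gained for a factor ρ⁻¹. -/
theorem dampSq_le_of_primitive {E : Type*} [NormedAddCommGroup E] [NormedSpace ℝ E] {x y : ℝ → E}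
    (h : IsPrimitive x y) (hx : ∀ t ≤ 0, x t = 0) (hy : Continuous y) {ρ : ℝ} (hρ : 0 < ρ) :
    dampSq ρ x ≤ ENNReal.ofReal (ρ⁻¹ ^ 2) * dampSq ρ y := by
  have h1 : dampSq ρ x = ∫⁻ t in Ioi (0 : ℝ), ‖x t‖ₑ ^ 2 * damp ρ t := by
    rw [dampSq, ← lintegral_indicator measurableSet_Ioi]
    refine lintegral_congr fun t => ?_
    by_cases ht : t ∈ Ioi (0 : ℝ)
    · rw [indicator_of_mem ht]
    · rw [indicator_of_notMem ht, hx t (by simpa using ht)]; simp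
  rw [h1]
  refine le_trans (setLIntegral_mono' measurableSet_Ioi fun t ht => ?_)
    ((lintegral_primitive_sq_le hy.enorm.measurable hρ).trans
      (mul_le_mul_right (lintegral_mono' Measure.restrict_le_self le_rfl) _))
  refine mul_le_mul_left (pow_le_pow_left₀ zero_le ?_ 2) _
  have h2 := (h 0 t).2
  rw [hx 0 le_rfl, sub_zero, intervalIntegral.integral_of_le (le_of_lt ht)] at h2
  rw [h2]
  exact enorm_integral_le_lintegral_enorm _

section Hilbert

variable {V H G : Type*} [NormedAddCommGroup V] [InnerProductSpace ℝ V]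
  [NormedAddCommGroup H] [InnerProductSpace ℝ H] [NormedAddCommGroup G] [InnerProductSpace ℝ G]
  {i : V →L[ℝ] H} {N : V →L[ℝ] G} {K : Submodule ℝ V} {P : V →L[ℝ] V}
  {κ τ : ℝ} {D : ℕ → ℝ → V} {W : ℤ → V} {F : ℤ → H} {c c' : ℤ → ℝ → ℝ}

theorem measurable_accErr (s : ℝ) : Measurable fun t => accErr i P τ D (t + s) :=
  Monotone.measurable fun _ _ hab => lintegral_mono_set (Ioc_subset_Ioc_right (by linarith))

variable [CompleteSpace V] [CompleteSpace G]

theorem IsDiscretization.lintegral_consErr_le (h : IsDiscretization i N K P κ τ D W F) {ρ : ℝ}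
    (hρ : 0 < ρ) (hτ : 0 < τ) (hρτ : ρ * τ ≤ 1) :
    ∫⁻ t in Ioi (0 : ℝ), ‖consErr i P τ D ⌊t / τ⌋‖ₑ ^ 2 * damp ρ t ≤
      2 * 3200 ^ 2 * ENNReal.ofReal κ ^ 2 * ENNReal.ofReal (24 * Real.exp 6) *
        (ENNReal.ofReal τ ^ 4 * dampSq ρ (gradDeriv N D 4) + dampSq ρ (ritzErr N P D 2)) := by
  have h1 := lintegral_stepAvg_sq_le (h.prim_grad (r := 3) (by omega)).aestronglyMeasurable hρ hτ hρτ
  have h2 := lintegral_stepAvg_sq_le (h.prim_ritz (r := 1) (by omega)).aestronglyMeasurable hρ hτ hρτ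
  set a := stepAvg τ (gradDeriv N D 4) with ha
  set b := stepAvg τ (ritzErr N P D 2) with hb
  have ham : Measurable a := measurable_stepAvg _ _
  have h3 : ∀ t, ‖consErr i P τ D ⌊t / τ⌋‖ₑ ^ 2 * damp ρ t ≤ 2 * 3200 ^ 2 * ENNReal.ofReal κ ^ 2 *
      (ENNReal.ofReal τ ^ 4 * (a t ^ 2 * damp ρ t) + b t ^ 2 * damp ρ t) := fun t => by
    refine (mul_le_mul_left ((pow_le_pow_left₀ zero_le (h.consErr_le hτ t) 2).trans_eq (mul_pow _ _ 2)) _).trans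
      ((mul_le_mul_left (mul_le_mul_right (ennreal_add_sq_le _ _) _) _).trans_eq ?_)
    ring
  refine (lintegral_mono' Measure.restrict_le_self h3).trans ?_
  rw [lintegral_const_mul' _ _ (by finiteness), lintegral_add_left (measurable_sq_mul_damp ham ρ _),
    lintegral_const_mul' _ _ (by finiteness)]
  refine (mul_le_mul_right (add_le_add (mul_le_mul_right h1 _) h2) _).trans_eq ?_
  ring

theorem IsDiscretization.lintegral_accErr_le (h : IsDiscretization i N K P κ τ D W F) {ρ : ℝ}
    (hρ : 0 < ρ) (hτ : 0 < τ) (hρτ : ρ * τ ≤ 1) (hκ : ρ⁻¹ ≤ κ) :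
    ∫⁻ t in Ioi (0 : ℝ), accErr i P τ D (t + 2 * τ) ^ 2 * damp ρ t ≤
      2 * 3200 ^ 2 * ENNReal.ofReal (24 * Real.exp 6) * ENNReal.ofReal (Real.exp 4) *
      (ENNReal.ofReal κ ^ 4 * (ENNReal.ofReal τ ^ 4 * dampSq ρ (gradDeriv N D 4) +
        dampSq ρ (ritzErr N P D 2))) := by
  have h1 := lintegral_shift_le (fun t => accErr i P τ D t ^ 2) (ρ := ρ) (s := 2 * τ) (N := 2)
    (by positivity) (by linarith)
  have h2 := lintegral_primitive_sq_le (measurable_comp_floor τ fun n => ‖consErr i P τ D n‖ₑ) hρ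
  have h3 := h.lintegral_consErr_le hρ hτ hρτ
  have h4 : ENNReal.ofReal (ρ⁻¹ ^ 2) ≤ ENNReal.ofReal κ ^ 2 := by
    rw [← ENNReal.ofReal_pow ((inv_pos.2 hρ).le.trans hκ)]
    exact ENNReal.ofReal_le_ofReal (pow_le_pow_left₀ (by positivity) hκ 2)
  refine h1.trans ((mul_le_mul_right (h2.trans (mul_le_mul' h4 h3)) _).trans_eq ?_)
  norm_num
  ring

/-- The constant in the error estimate. -/
def errConst : ℝ≥0∞ :=
  8 * 3200 ^ 2 * ENNReal.ofReal (24 * Real.exp 6) + 4 +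
    (4 * 200 ^ 2 + 4 * 800 ^ 2) * (2 * 3200 ^ 2 * ENNReal.ofReal (24 * Real.exp 6) *
      ENNReal.ofReal (Real.exp 4))

theorem errConst_ne_top : errConst ≠ ⊤ := by
  unfold errConst; finiteness

/-- The error estimate in the damped energy norm. -/
theorem IsDiscretization.energy_error_le (h : IsDiscretization i N K P κ τ D W F)
    (hc : IsReconstruction c c') {ρ : ℝ} (hρ : 0 < ρ) (hτ : 0 < τ) (hρτ : ρ * τ ≤ 1) (hκ : ρ⁻¹ ≤ κ) :
    ∫⁻ t in Ioi (0 : ℝ),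
      (‖i (D 1 t) - (1 / τ) • ∑ j ∈ stencil, c' j (Int.fract (t / τ)) • i (W (⌊t / τ⌋ + j))‖ₑ ^ 2 +
      ‖N (D 0 t - ∑ j ∈ stencil, c j (Int.fract (t / τ)) • W (⌊t / τ⌋ + j))‖ₑ ^ 2) * damp ρ t ≤
    errConst * (ENNReal.ofReal τ ^ 4 * (ENNReal.ofReal κ ^ 2 * dampSq ρ (gradDeriv N D 3) +
        ENNReal.ofReal κ ^ 4 * dampSq ρ (gradDeriv N D 4)) + (dampSq ρ (ritzErr N P D 0) +
        ENNReal.ofReal κ ^ 2 * dampSq ρ (ritzErr N P D 1) +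
        ENNReal.ofReal κ ^ 4 * dampSq ρ (ritzErr N P D 2))) := by
  set T := ENNReal.ofReal τ with hT
  set k := ENNReal.ofReal κ with hk
  set C₁ := ENNReal.ofReal (24 * Real.exp 6) with hC₁
  have hTk : T ≤ k := by
    refine ENNReal.ofReal_le_ofReal (le_trans ?_ hκ)
    rw [← one_div, le_div_iff₀ hρ]; linarith
  have h1 := lintegral_stepAvg_sq_le (h.prim_grad (r := 1) (by omega)).aestronglyMeasurable hρ hτ hρτ
  have h2 := lintegral_stepAvg_sq_le (h.prim_grad (r := 2) (by omega)).aestronglyMeasurable hρ hτ hρτ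
  have h3 := lintegral_stepAvg_sq_le (h.prim_ritz (r := 0) (by omega)).aestronglyMeasurable hρ hτ hρτ
  have h4 := h.lintegral_accErr_le hρ hτ hρτ hκ
  -- The gradient error involves the second time derivative. Hardy raises it to the third, the
  -- lowest order occurring in the bound.
  have h5 : dampSq ρ (gradDeriv N D 2) ≤ k ^ 2 * dampSq ρ (gradDeriv N D 3) := by
    refine (dampSq_le_of_primitive (h.prim_grad (r := 2) (by omega))
      (fun t ht => by simp only [gradDeriv]; rw [h.zero 2 (by omega) t ht, map_zero])
      (h.prim_grad (r := 3) (by omega)).continuous hρ).trans (mul_le_mul_left ?_ _)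
    rw [hk, ← ENNReal.ofReal_pow ((inv_pos.2 hρ).le.trans hκ)]
    exact ENNReal.ofReal_le_ofReal (pow_le_pow_left₀ (by positivity) hκ 2)
  have hym : Measurable fun t => ‖ritzErr N P D 0 t‖ₑ :=
    (h.prim_ritz (r := 0) (by omega)).continuous.enorm.measurable
  have hSm : Measurable fun t => accErr i P τ D (t + 2 * τ) := measurable_accErr (2 * τ)
  have ham := measurable_stepAvg τ (gradDeriv N D 2)
  have hbm := measurable_stepAvg τ (gradDeriv N D 3)
  have hpt : ∀ t ∈ Ioi (0 : ℝ),
      (‖i (D 1 t) - (1 / τ) • ∑ j ∈ stencil, c' j (Int.fract (t / τ)) • i (W (⌊t / τ⌋ + j))‖ₑ ^ 2 +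
      ‖N (D 0 t - ∑ j ∈ stencil, c j (Int.fract (t / τ)) • W (⌊t / τ⌋ + j))‖ₑ ^ 2) * damp ρ t ≤
      4 * 3200 ^ 2 * T ^ 4 * (stepAvg τ (gradDeriv N D 2) t ^ 2 * damp ρ t) +
      (4 * 3200 ^ 2 * k ^ 2 * T ^ 4 * (stepAvg τ (gradDeriv N D 3) t ^ 2 * damp ρ t) +
      (4 * (‖ritzErr N P D 0 t‖ₑ ^ 2 * damp ρ t) +
      ((4 * 200 ^ 2 + 4 * 800 ^ 2) * (accErr i P τ D (t + 2 * τ) ^ 2 * damp ρ t) +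
      8 * 3200 ^ 2 * k ^ 2 * (stepAvg τ (ritzErr N P D 1) t ^ 2 * damp ρ t)))) := by
    intro t ht
    have h6 := h.grad_error_le hc hτ (le_of_lt ht)
    have h7 := h.deriv_error_le hc hτ (le_of_lt ht)
    -- A zero summand pads the three terms to four, so that the same inequality for the square of a
    -- sum applies to both errors.
    rw [← add_zero (_ + 800 * _)] at h7
    refine (mul_le_mul_left (add_le_add ((pow_le_pow_left₀ zero_le h7 2).trans
      (ennreal_add_four_sq_le _ _ _ _)) ((pow_le_pow_left₀ zero_le h6 2).trans
      (ennreal_add_four_sq_le _ _ _ _))) _).trans ?_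
    rw [← hT, ← hk]
    generalize stepAvg τ (ritzErr N P D 1) t = x1
    generalize stepAvg τ (gradDeriv N D 2) t = x2
    generalize stepAvg τ (gradDeriv N D 3) t = x3
    generalize accErr i P τ D (t + 2 * τ) = x4
    generalize ‖ritzErr N P D 0 t‖ₑ = x5
    generalize damp ρ t = e
    have h8 : 4 * 3200 ^ 2 * T ^ 2 * (x1 ^ 2 * e) ≤ 4 * 3200 ^ 2 * k ^ 2 * (x1 ^ 2 * e) :=
      mul_le_mul_left (mul_le_mul_right (pow_le_pow_left₀ zero_le hTk 2) _) _
    refine le_trans (le_of_eq ?_) (add_le_add_left h8 (4 * 3200 ^ 2 * T ^ 4 * (x2 ^ 2 * e) +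
      (4 * 3200 ^ 2 * k ^ 2 * T ^ 4 * (x3 ^ 2 * e) + (4 * (x5 ^ 2 * e) +
      ((4 * 200 ^ 2 + 4 * 800 ^ 2) * (x4 ^ 2 * e) + 4 * 3200 ^ 2 * k ^ 2 * (x1 ^ 2 * e)))))
        |>.trans (le_of_eq ?_))
    · ring
    · ring
  refine (setLIntegral_mono' measurableSet_Ioi hpt).trans ?_
  rw [lintegral_add_left (measurable_sq_mul_damp ham ρ _),
    lintegral_add_left (measurable_sq_mul_damp hbm ρ _),
    lintegral_add_left (measurable_sq_mul_damp hym ρ _),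
    lintegral_add_left (measurable_sq_mul_damp hSm ρ _),
    lintegral_const_mul' _ _ (by finiteness), lintegral_const_mul' _ _ (by finiteness),
    lintegral_const_mul' _ _ (by finiteness), lintegral_const_mul' _ _ (by finiteness),
    lintegral_const_mul' _ _ (by finiteness)]
  have hr : ∀ f : ℝ → ℝ≥0∞, ∫⁻ t in Ioi (0 : ℝ), f t ≤ ∫⁻ t, f t := fun f =>
    lintegral_mono' Measure.restrict_le_self le_rfl
  refine (add_le_add (mul_le_mul_right ((hr _).trans (h1.trans (mul_le_mul_right h5 _))) _)
    (add_le_add (mul_le_mul_right ((hr _).trans h2) _) (add_le_add (mul_le_mul_right (hr _) _)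
    (add_le_add (mul_le_mul_right h4 _) (mul_le_mul_right ((hr _).trans h3) _))))).trans ?_
  rw [← hC₁, ← hT, ← hk, errConst, ← hC₁]
  change _ + (_ + (4 * dampSq ρ (ritzErr N P D 0) + _)) ≤ _
  generalize dampSq ρ (gradDeriv N D 3) = Q3
  generalize dampSq ρ (gradDeriv N D 4) = Q4
  generalize dampSq ρ (ritzErr N P D 0) = Z0
  generalize dampSq ρ (ritzErr N P D 1) = Z1
  generalize dampSq ρ (ritzErr N P D 2) = Z2
  generalize hB : (4 * 200 ^ 2 + 4 * 800 ^ 2) * (2 * 3200 ^ 2 * C₁ * ENNReal.ofReal (Real.exp 4)) = B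
  calc _ = 8 * 3200 ^ 2 * C₁ * (T ^ 4 * (k ^ 2 * Q3) + k ^ 2 * Z1) + 4 * Z0 +
        B * (T ^ 4 * (k ^ 4 * Q4) + k ^ 4 * Z2) := by rw [← hB]; ring
    _ ≤ (8 * 3200 ^ 2 * C₁ + 4 + B) * (T ^ 4 * (k ^ 2 * Q3) + k ^ 2 * Z1) +
        (8 * 3200 ^ 2 * C₁ + 4 + B) * Z0 +
        (8 * 3200 ^ 2 * C₁ + 4 + B) * (T ^ 4 * (k ^ 4 * Q4) + k ^ 4 * Z2) := by
        refine add_le_add (add_le_add (mul_le_mul_left ?_ _) (mul_le_mul_left ?_ _)) (mul_le_mul_left ?_ _)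
        · rw [add_assoc]; exact le_self_add
        · exact le_add_self.trans le_self_add
        · exact le_add_self
    _ = _ := by ring

end Hilbert

end

section

/-! ### The two time reconstructions -/

/-- A polynomial of degree four with given coefficients. -/
def quartic (a : Fin 5 → ℝ) (θ : ℝ) : ℝ := a 0 + a 1 * θ + a 2 * θ ^ 2 + a 3 * θ ^ 3 + a 4 * θ ^ 4

/-- The derivative of `quartic`. -/
def quarticDeriv (a : Fin 5 → ℝ) (θ : ℝ) : ℝ := a 1 + 2 * a 2 * θ + 3 * a 3 * θ ^ 2 + 4 * a 4 * θ ^ 3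

theorem hasDerivAt_quartic (a : Fin 5 → ℝ) (θ : ℝ) : HasDerivAt (quartic a) (quarticDeriv a θ) θ := by
  have h1 := ((((hasDerivAt_const θ (a 0)).add ((hasDerivAt_id θ).const_mul (a 1))).add
    ((hasDerivAt_pow 2 θ).const_mul (a 2))).add ((hasDerivAt_pow 3 θ).const_mul (a 3))).add
    ((hasDerivAt_pow 4 θ).const_mul (a 4))
  refine h1.congr_deriv ?_
  simp only [quarticDeriv]
  push_cast
  ring

theorem abs_mul_pow_le {a θ : ℝ} (ha : |a| ≤ 1) (h0 : 0 ≤ θ) (h1 : θ ≤ 1) (n : ℕ) : |a * θ ^ n| ≤ 1 := by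
  rw [abs_mul, abs_of_nonneg (pow_nonneg h0 n)]
  exact mul_le_one₀ ha (pow_nonneg h0 n) (pow_le_one₀ h0 h1)

theorem abs_quartic_le {a : Fin 5 → ℝ} (ha : ∀ i, |a i| ≤ 1) {θ : ℝ} (hθ : θ ∈ Icc (0 : ℝ) 1) :
    |quartic a θ| ≤ 10 := by
  have h := fun i n => abs_le.1 (abs_mul_pow_le (ha i) hθ.1 hθ.2 n)
  have h0 := abs_le.1 (ha 0)
  have h1 := h 1 1
  rw [pow_one] at h1
  rw [quartic, abs_le]
  constructor <;> linarith [h0.1, h0.2, h1.1, h1.2, (h 2 2).1, (h 2 2).2, (h 3 3).1, (h 3 3).2,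
    (h 4 4).1, (h 4 4).2]

theorem abs_quarticDeriv_le {a : Fin 5 → ℝ} (ha : ∀ i, |a i| ≤ 1) {θ : ℝ} (hθ : θ ∈ Icc (0 : ℝ) 1) :
    |quarticDeriv a θ| ≤ 10 := by
  have h := fun i n => abs_le.1 (abs_mul_pow_le (ha i) hθ.1 hθ.2 n)
  have h0 := abs_le.1 (ha 1)
  have h1 := h 2 1
  rw [pow_one] at h1
  rw [quarticDeriv, abs_le]
  constructor <;> linarith [h0.1, h0.2, h1.1, h1.2, (h 3 2).1, (h 3 2).2, (h 4 3).1, (h 4 3).2]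

/-- The coefficients of the quadratic reconstruction. -/
def coefR (j : ℤ) : Fin 5 → ℝ :=
  if j = 0 then ![1, 0, -1, 0, 0] else if j = 1 then ![0, 1 / 2, 1 / 2, 0, 0]
  else if j = -1 then ![0, -1 / 2, 1 / 2, 0, 0] else 0

/-- The coefficients of the quartic reconstruction. -/
def coefL (j : ℤ) : Fin 5 → ℝ :=
  if j = 0 then ![17 / 24, 1 / 4, -1, 0, 1 / 4]
  else if j = 1 then ![1 / 8, 5 / 12, 1 / 2, -1 / 6, -1 / 6]
  else if j = -1 then ![5 / 24, -3 / 4, 1 / 2, 1 / 6, -1 / 6]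
  else if j = 2 then ![0, 0, 0, 1 / 12, 1 / 24]
  else if j = -2 then ![-1 / 24, 1 / 12, 0, -1 / 12, 1 / 24] else 0

theorem abs_coefR_le (j : ℤ) (l : Fin 5) : |coefR j l| ≤ 1 := by
  unfold coefR
  split_ifs <;> fin_cases l <;> norm_num [abs_le]

theorem abs_coefL_le (j : ℤ) (l : Fin 5) : |coefL j l| ≤ 1 := by
  unfold coefL
  split_ifs <;> fin_cases l <;> norm_num [abs_le]

theorem sum_stencil {F : Type*} [AddCommMonoid F] (x : ℤ → F) :
    ∑ j ∈ stencil, x j = x (-2) + (x (-1) + (x 0 + (x 1 + x 2))) := by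
  rw [stencil_eq]
  simp [Finset.sum_insert]

theorem isReconstruction_coefR :
    IsReconstruction (fun j => quartic (coefR j)) fun j => quarticDeriv (coefR j) where
  hasDerivAt j θ := hasDerivAt_quartic _ _
  bound j θ hθ := abs_quartic_le (abs_coefR_le j) hθ
  bound' j θ hθ := abs_quarticDeriv_le (abs_coefR_le j) hθ
  sum θ := by rw [sum_stencil]; simp [quartic, coefR]; ring
  sum_mul θ := by rw [sum_stencil]; simp [quartic, coefR]; ring
  sum' θ := by rw [sum_stencil]; simp [quarticDeriv, coefR]; ring
  sum_mul' θ := by rw [sum_stencil]; simp [quarticDeriv, coefR]; ring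
  sum_mul_sq' θ := by rw [sum_stencil]; simp [quarticDeriv, coefR]; ring

theorem isReconstruction_coefL :
    IsReconstruction (fun j => quartic (coefL j)) fun j => quarticDeriv (coefL j) where
  hasDerivAt j θ := hasDerivAt_quartic _ _
  bound j θ hθ := abs_quartic_le (abs_coefL_le j) hθ
  bound' j θ hθ := abs_quarticDeriv_le (abs_coefL_le j) hθ
  sum θ := by rw [sum_stencil]; simp [quartic, coefL]; ring
  sum_mul θ := by rw [sum_stencil]; simp [quartic, coefL]; ring
  sum' θ := by rw [sum_stencil]; simp [quarticDeriv, coefL]; ring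
  sum_mul' θ := by rw [sum_stencil]; simp [quarticDeriv, coefL]; ring
  sum_mul_sq' θ := by rw [sum_stencil]; simp [quarticDeriv, coefL]; ring

section Rec

variable {Y : Type*} [AddCommGroup Y] [Module ℝ Y]

/-- The reconstruction with coefficient functions `c`. -/
def recon (c : ℤ → ℝ → ℝ) (τ : ℝ) (W : ℤ → Y) (t : ℝ) : Y :=
  ∑ j ∈ stencil, c j (Int.fract (t / τ)) • W (⌊t / τ⌋ + j)

theorem fract_mul {τ : ℝ} (hτ : 0 < τ) (t : ℝ) : t - ⌊t / τ⌋ * τ = Int.fract (t / τ) * τ := by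
  have : t = t / τ * τ := by field_simp
  conv_lhs => rw [this, mul_div_assoc, div_self hτ.ne', mul_one]
  rw [← Int.self_sub_floor, sub_mul]

theorem recR_eq {τ : ℝ} (hτ : 0 < τ) (U : ℕ → Y) (t : ℝ) :
    recR τ U t = recon (fun j => quartic (coefR j)) τ (extendZero U) t := by
  rw [recR, recon, sum_stencil]
  simp only [fract_mul hτ]
  generalize Int.fract (t / τ) = θ
  generalize ⌊t / τ⌋ = n
  rw [← sub_eq_add_neg n 2, ← sub_eq_add_neg n 1, add_zero]
  generalize extendZero U (n - 2) = a
  generalize extendZero U (n - 1) = b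
  generalize extendZero U n = c
  generalize extendZero U (n + 1) = e
  generalize extendZero U (n + 2) = f
  have h1 : θ * τ / (2 * τ) = θ / 2 := by field_simp
  have h2 : (θ * τ) ^ 2 / (2 * τ ^ 2) = θ ^ 2 / 2 := by field_simp
  rw [h1, h2]
  simp [quartic, coefR]
  module

theorem recL_eq {τ : ℝ} (hτ : 0 < τ) (U : ℕ → Y) (t : ℝ) :
    recL τ U t = recon (fun j => quartic (coefL j)) τ (extendZero U) t := by
  rw [recL, recon, sum_stencil]
  simp only [fract_mul hτ]
  generalize Int.fract (t / τ) = θ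
  generalize ⌊t / τ⌋ = n
  rw [← sub_eq_add_neg n 2, ← sub_eq_add_neg n 1, add_zero]
  generalize extendZero U (n - 2) = a
  generalize extendZero U (n - 1) = b
  generalize extendZero U n = c
  generalize extendZero U (n + 1) = e
  generalize extendZero U (n + 2) = f
  have h1 : θ * τ * (1 / (12 * τ)) = θ / 12 := by field_simp
  have h2 : (θ * τ) ^ 2 / 2 * (1 / τ ^ 2) = θ ^ 2 / 2 := by field_simp
  have h3 : (θ * τ) ^ 3 / 6 * (1 / (2 * τ ^ 3)) = θ ^ 3 / 12 := by field_simp; ring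
  have h4 : (θ * τ) ^ 4 / 24 * (1 / τ ^ 4) = θ ^ 4 / 24 := by field_simp
  simp only [smul_smul (θ * τ), smul_smul ((θ * τ) ^ 2 / 2), smul_smul ((θ * τ) ^ 3 / 6),
    smul_smul ((θ * τ) ^ 4 / 24), h1, h2, h3, h4]
  simp [quartic, coefL]
  module

end Rec

/-- Between grid points the floor is locally constant and the reconstruction is a polynomial. The
grid is countable, hence negligible in the energy. -/
theorem hasDerivAt_recon {H : Type*} [NormedAddCommGroup H] [NormedSpace ℝ H] {c c' : ℤ → ℝ → ℝ}
    (hc : IsReconstruction c c') {τ : ℝ} (hτ : 0 < τ) (W : ℤ → H) {t : ℝ}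
    (ht : ∀ n : ℤ, t ≠ n * τ) :
    HasDerivAt (recon c τ W) ((1 / τ) • ∑ j ∈ stencil, c' j (Int.fract (t / τ)) • W (⌊t / τ⌋ + j)) t := by
  obtain ⟨n, hn⟩ : ∃ n, n = ⌊t / τ⌋ := ⟨_, rfl⟩
  have h1 : (n : ℝ) * τ < t := lt_of_le_of_ne (by rw [hn]; exact floor_mul_le hτ t) (ht n).symm
  have h2 : t < (n + 1) * τ := by rw [hn]; exact lt_floor_mul hτ t
  have h3 : recon c τ W =ᶠ[nhds t] fun s => ∑ j ∈ stencil, c j (s / τ - n) • W (n + j) := by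
    filter_upwards [Ioo_mem_nhds h1 h2] with s hs
    have h4 : ⌊s / τ⌋ = n := by
      rw [Int.floor_eq_iff, le_div_iff₀ hτ, div_lt_iff₀ hτ]
      exact ⟨hs.1.le, hs.2⟩
    rw [recon, ← Int.self_sub_floor, h4]
  refine HasDerivAt.congr_of_eventuallyEq ?_ h3
  rw [← hn, ← Int.self_sub_floor, ← hn, Finset.smul_sum]
  refine HasDerivAt.fun_sum fun j _ => ?_
  rw [smul_smul]
  refine HasDerivAt.smul_const ?_ _
  have h5 : HasDerivAt (fun s => s / τ - n) (1 / τ) t := ((hasDerivAt_id t).div_const τ).sub_const _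
  rw [mul_comm]
  exact (hc.hasDerivAt j (t / τ - n)).comp t h5

theorem map_recon {Y Z : Type*} [NormedAddCommGroup Y] [NormedSpace ℝ Y] [NormedAddCommGroup Z]
    [NormedSpace ℝ Z] (L : Y →L[ℝ] Z) (c : ℤ → ℝ → ℝ) (τ : ℝ) (W : ℤ → Y) (t : ℝ) :
    L (recon c τ W t) = recon c τ (fun n => L (W n)) t := by
  rw [recon, recon, map_sum]
  exact Finset.sum_congr rfl fun j _ => map_smul _ _ _

theorem ae_ne_grid (τ : ℝ) : ∀ᵐ t : ℝ, ∀ n : ℤ, t ≠ n * τ := by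
  rw [ae_all_iff]
  intro n
  simp [ae_iff, measure_singleton]

end

section

/-! ### Regularity in time -/

section Time

variable {E : Type*} [NormedAddCommGroup E] [NormedSpace ℝ E]

/-- With its initial value removed, the function extends by zero to a primitive on the whole line.
Stencils that reach below time 0 then need no separate treatment. -/
theorem HasTimeDeriv.isPrimitive {v g : ℝ → E} (h : HasTimeDeriv v g) :
    IsPrimitive ((Ioi (0 : ℝ)).indicator fun t => v t - v 0) ((Ioi (0 : ℝ)).indicator g) := by
  have key : ∀ b, IntervalIntegrable ((Ioi (0 : ℝ)).indicator g) volume 0 b ∧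
      (Ioi (0 : ℝ)).indicator (fun t => v t - v 0) b = ∫ s in (0 : ℝ)..b, (Ioi (0 : ℝ)).indicator g s := by
    intro b
    rcases le_or_gt b 0 with hb | hb
    · have h1 : EqOn ((Ioi (0 : ℝ)).indicator g) 0 (uIoc 0 b) := fun s hs => by
        rw [uIoc_of_ge hb] at hs
        exact indicator_of_notMem (by simpa using hs.2) _
      rw [indicator_of_notMem (by simpa using hb)]
      refine ⟨(intervalIntegrable_congr h1).2 (intervalIntegrable_const (c := (0 : E))), ?_⟩
      rw [intervalIntegral.integral_congr_ae (Filter.Eventually.of_forall h1)]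
      simp
    · have h1 : EqOn ((Ioi (0 : ℝ)).indicator g) g (uIoc 0 b) := fun s hs => by
        rw [uIoc_of_le hb.le] at hs
        exact indicator_of_mem hs.1 _
      rw [indicator_of_mem (mem_Ioi.2 hb)]
      refine ⟨(intervalIntegrable_congr h1).2 (h b hb.le).1, ?_⟩
      rw [intervalIntegral.integral_congr_ae (Filter.Eventually.of_forall h1), (h b hb.le).2]
      abel
  intro a b
  refine ⟨(key a).1.symm.trans (key b).1, ?_⟩
  rw [(key a).2, (key b).2, intervalIntegral.integral_interval_sub_left (key b).1 (key a).1]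

theorem HasTimeDeriv.continuousOn {v g : ℝ → E} (h : HasTimeDeriv v g) : ContinuousOn v (Ici 0) := by
  have h1 : EqOn v (fun t => (Ioi (0 : ℝ)).indicator (fun t => v t - v 0) t + v 0) (Ici 0) := by
    intro t ht
    rcases eq_or_lt_of_le (mem_Ici.1 ht) with h0 | h0
    · simp [← h0]
    · simp only
      rw [indicator_of_mem (mem_Ioi.2 h0)]
      abel
  exact ((h.isPrimitive.continuous.add continuous_const).continuousOn).congr h1

variable [CompleteSpace E]

theorem HasTimeDeriv.hasDerivWithinAt {v g : ℝ → E} (h : HasTimeDeriv v g) (hg : ContinuousOn g (Ici 0))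
    {t : ℝ} (ht : 0 ≤ t) : HasDerivWithinAt v (g t) (Ici 0) t := by
  have hc : Continuous fun s => g (max 0 s) :=
    hg.comp_continuous (by fun_prop) fun s => mem_Ici.2 (le_max_left _ _)
  have h1 := ((hc.integral_hasStrictDerivAt 0 t).hasDerivAt.const_add (v 0)).hasDerivWithinAt (s := Ici 0)
  rw [max_eq_right ht] at h1
  have h2 : ∀ s ∈ Ici (0 : ℝ), v s = v 0 + ∫ σ in (0 : ℝ)..s, g (max 0 σ) := fun s hs => by
    rw [(h s hs).2]
    congr 1
    refine intervalIntegral.integral_congr fun σ hσ => ?_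
    rw [uIcc_of_le hs] at hσ
    rw [max_eq_right hσ.1]
  exact h1.congr h2 (h2 t ht)

end Time

section Hilbert

variable {V H G : Type*} [NormedAddCommGroup V] [InnerProductSpace ℝ V] [CompleteSpace V]
  [NormedAddCommGroup H] [InnerProductSpace ℝ H] [NormedAddCommGroup G] [InnerProductSpace ℝ G]

theorem derivWithin_comp_eq {D : ℕ → ℝ → V} (hD : ∀ r < 4, HasTimeDeriv (D r) (D (r + 1))) (i : V →L[ℝ] H)
    {r : ℕ} (hr : r ≤ 2) {t : ℝ} (ht : 0 ≤ t) :
    HasDerivWithinAt (fun s => i (D r s)) (i (D (r + 1) t)) (Ici 0) t :=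
  i.hasFDerivAt.comp_hasDerivWithinAt t
    ((hD r (by omega)).hasDerivWithinAt (hD (r + 1) (by omega)).continuousOn ht)

theorem iteratedDerivWithin_two_eq {D : ℕ → ℝ → V} (hD : ∀ r < 4, HasTimeDeriv (D r) (D (r + 1)))
    (i : V →L[ℝ] H) {t : ℝ} (ht : 0 ≤ t) :
    iteratedDerivWithin 2 (fun s => i (D 0 s)) (Ici 0) t = i (D 2 t) := by
  have hu : ∀ s ∈ Ici (0 : ℝ), UniqueDiffWithinAt ℝ (Ici (0 : ℝ)) s := uniqueDiffOn_Ici 0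
  have h1 : ∀ s ∈ Ici (0 : ℝ), iteratedDerivWithin 1 (fun s => i (D 0 s)) (Ici 0) s = i (D 1 s) := by
    intro s hs
    rw [iteratedDerivWithin_one]
    exact (derivWithin_comp_eq hD i (by omega) hs).derivWithin (hu s hs)
  rw [iteratedDerivWithin_succ, derivWithin_congr h1 (h1 t ht)]
  exact (derivWithin_comp_eq hD i (by omega) ht).derivWithin (hu t ht)

/-- The time derivatives up to order three of a solution with a source vanishing near zero and zero
initial data vanish at zero. -/
theorem derivs_zero {D : ℕ → ℝ → V} (hD : ∀ r < 4, HasTimeDeriv (D r) (D (r + 1))) (i : V →L[ℝ] H)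
    (N : V →L[ℝ] G) (hi : ∀ v, i v = 0 → v = 0) {f : ℝ → H} (h0 : i (D 0 0) = 0) (h1 : i (D 1 0) = 0)
    (heq : ∀ t, 0 ≤ t → ∀ v, inner ℝ (i (D 2 t)) (i v) + inner ℝ (N (D 0 t)) (N v) = inner ℝ (f t) (i v))
    (hf : ∃ δ > 0, ∀ t, 0 ≤ t → t ≤ δ → f t = 0) : ∀ r ≤ 3, D r 0 = 0 := by
  obtain ⟨δ, hδ, hf⟩ := hf
  have hD0 := hi _ h0
  have hD1 := hi _ h1
  -- At time 0 both the source and u vanish, so the equation tested with the second derivative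
  -- itself gives zero.
  have hD2 : D 2 0 = 0 := by
    have h2 := heq 0 le_rfl (D 2 0)
    rw [hD0, hf 0 le_rfl hδ.le, map_zero, inner_zero_left, inner_zero_left, add_zero] at h2
    exact hi _ (inner_self_eq_zero.1 h2)
  -- The source vanishes on a whole interval, so the equation can be differentiated at 0 from the
  -- right. There the first derivative of u is zero.
  have hD3 : D 3 0 = 0 := by
    have h2 : ∀ v, inner ℝ (i (D 3 0)) (i v) = 0 := by
      intro v
      have h3 := ((derivWithin_comp_eq hD i (r := 2) le_rfl le_rfl).inner ℝ
        (hasDerivWithinAt_const (0 : ℝ) (Ici 0) (i v))).add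
        ((derivWithin_comp_eq hD N (r := 0) (by omega) le_rfl).inner ℝ
        (hasDerivWithinAt_const (0 : ℝ) (Ici 0) (N v)))
      simp only [inner_zero_right, zero_add, hD1, map_zero, inner_zero_left, add_zero] at h3
      have h4 : HasDerivWithinAt (fun _ : ℝ => (0 : ℝ)) (inner ℝ (i (D 3 0)) (i v)) (Ici 0) 0 := by
        refine h3.congr_of_eventuallyEq ?_ ?_
        · filter_upwards [self_mem_nhdsWithin, mem_nhdsWithin_of_mem_nhds (Iic_mem_nhds hδ)] with t ht ht'
          have h5 := heq t ht v
          rw [hf t ht ht', inner_zero_left] at h5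
          exact h5.symm
        · have h5 := heq 0 le_rfl v
          rw [hf 0 le_rfl hδ.le, inner_zero_left] at h5
          exact h5.symm
      exact (uniqueDiffOn_Ici (0 : ℝ) 0 self_mem_Ici).eq_deriv _ h4 (hasDerivWithinAt_const _ _ _)
    exact hi _ (inner_self_eq_zero.1 (h2 _))
  intro r hr
  interval_cases r <;> assumption

end Hilbert

end

/-! ### From the leapfrog scheme on a subspace to the abstract estimate -/

section

theorem dampSq_indicator {E : Type*} [NormedAddCommGroup E] (ρ : ℝ) (φ : ℝ → E) :
    dampSq ρ ((Ioi (0 : ℝ)).indicator φ) = ∫⁻ t in Ioi (0 : ℝ), ‖φ t‖ₑ ^ 2 * damp ρ t := by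
  rw [dampSq, ← lintegral_indicator measurableSet_Ioi]
  refine lintegral_congr fun t => ?_
  by_cases ht : t ∈ Ioi (0 : ℝ)
  · rw [indicator_of_mem ht, indicator_of_mem ht]
  · rw [indicator_of_notMem ht, indicator_of_notMem ht]; simp

section Hilbert

variable {V H G : Type*} [NormedAddCommGroup V] [InnerProductSpace ℝ V] [CompleteSpace V]
  [NormedAddCommGroup H] [InnerProductSpace ℝ H] [NormedAddCommGroup G] [InnerProductSpace ℝ G]
  [CompleteSpace G]

/-- The leapfrog scheme on a subspace fits into the framework of `IsDiscretization`. -/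
theorem exists_isDiscretization (i : V →L[ℝ] H) (N : V →L[ℝ] G) {β : ℝ} (hβ : 0 < β)
    (hN : ∀ v, β * ‖v‖ ≤ ‖N v‖) {κ : ℝ} (hκ : ∀ v, ‖i v‖ ≤ κ * ‖N v‖) (Vh : Submodule ℝ V) {τ : ℝ}
    (hτ : 0 < τ) (hst : ∀ v ∈ Vh, τ ^ 2 * ‖N v‖ ^ 2 ≤ ‖i v‖ ^ 2) {D : ℕ → ℝ → V}
    (hD : ∀ r < 4, HasTimeDeriv (D r) (D (r + 1))) (hD0 : ∀ r ≤ 3, D r 0 = 0) {f : ℝ → H}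
    (heq : ∀ t, 0 ≤ t → ∀ v, inner ℝ (i (D 2 t)) (i v) + inner ℝ (N (D 0 t)) (N v) = inner ℝ (f t) (i v))
    {U : ℕ → V} (hU : ∀ n, U n ∈ Vh) (hU0 : U 0 = 0) (hU1 : U 1 = 0)
    (hstep : ∀ n, 1 ≤ n → ∀ v ∈ Vh,
      1 / τ ^ 2 * inner ℝ (i (U (n + 1) - (2 : ℝ) • U n + U (n - 1))) (i v) +
        inner ℝ (N (U n)) (N v) = inner ℝ (f (n * τ)) (i v)) :
    ∃ (P : V →L[ℝ] V) (F : ℤ → H), IsDiscretization i N Vh.topologicalClosure P κ τ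
      (fun r => (Ioi (0 : ℝ)).indicator (D r)) (extendZero U) F := by
  -- The projection goes onto the closure of the subspace, which is complete. The scheme and the
  -- stability condition extend to the closure by continuity.
  obtain ⟨P, hPK, hP⟩ := exists_ritz N hβ hN Vh.topologicalClosure Vh.isClosed_topologicalClosure
  have hneg : ∀ n : ℤ, n ≤ 1 → extendZero U n = 0 := by
    intro n hn
    rw [extendZero]
    split_ifs with h
    · obtain rfl | rfl : n = 0 ∨ n = 1 := by omega
      · exact hU0
      · exact hU1
    · rfl
  have hnn : ∀ n : ℕ, extendZero U n = U n := fun n => by simp [extendZero]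
  -- For n ≤ 0 both equations read 0 = 0. At n = 0 the scheme reaches U¹, which is zero as well.
  refine ⟨P, fun n => if 0 < n then f (n * τ) else 0, hκ, hPK, hP, ?_, ?_, ?_, ?_, ?_, ?_, ?_⟩
  · intro v hv
    have hcl : IsClosed {v : V | τ ^ 2 * ‖N v‖ ^ 2 ≤ ‖i v‖ ^ 2} :=
      isClosed_le (by fun_prop) (by fun_prop)
    exact hcl.closure_subset_iff.2 (fun w hw => hst w hw) hv
  · intro r hr
    have h1 := (hD r (by omega)).isPrimitive
    rw [hD0 r hr] at h1
    simpa using h1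
  · intro r _ t ht
    exact indicator_of_notMem (by simpa using ht) _
  · intro n
    refine Vh.le_topologicalClosure ?_
    rw [extendZero]
    split_ifs
    · exact hU _
    · exact zero_mem _
  · exact fun n hn => hneg n (by omega)
  · intro n v _
    by_cases hn : 0 < n
    · have h1 : (n : ℝ) * τ ∈ Ioi (0 : ℝ) := mul_pos (by exact_mod_cast hn) hτ
      rw [if_pos hn, indicator_of_mem h1, indicator_of_mem h1]
      exact heq _ (le_of_lt h1) v
    · have h1 : (n : ℝ) * τ ∉ Ioi (0 : ℝ) := by
        simpa using mul_nonpos_of_nonpos_of_nonneg (by exact_mod_cast not_lt.1 hn) hτ.le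
      rw [if_neg hn, indicator_of_notMem h1, indicator_of_notMem h1]
      simp
  · intro n v hv
    by_cases hn : 0 < n
    · obtain ⟨m, rfl⟩ : ∃ m : ℕ, n = m + 1 := ⟨(n - 1).toNat, by omega⟩
      have hcl : IsClosed {v : V | 1 / τ ^ 2 * inner ℝ (i (U (m + 1 + 1) - (2 : ℝ) • U (m + 1) + U m)) (i v) +
          inner ℝ (N (U (m + 1))) (N v) = inner ℝ (f ((m + 1 : ℕ) * τ)) (i v)} :=
        isClosed_eq (by fun_prop) (by fun_prop)
      have h1 := hcl.closure_subset_iff.2 (fun w hw => hstep (m + 1) (by omega) w hw) hv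
      rw [if_pos hn, add_sub_cancel_right, hnn, show (m : ℤ) + 1 + 1 = (m + 1 + 1 : ℕ) by push_cast; ring,
        hnn, show (m : ℤ) + 1 = (m + 1 : ℕ) by push_cast; ring, hnn]
      exact h1
    · rw [if_neg hn, hneg n (by omega), hneg (n + 1) (by omega), hneg (n - 1) (by omega)]
      simp

/-- The error estimate for the leapfrog scheme on a subspace, in terms of best approximations. -/
theorem leapfrog_energy_error_le (i : V →L[ℝ] H) (N : V →L[ℝ] G) {β : ℝ} (hβ : 0 < β)
    (hN : ∀ v, β * ‖v‖ ≤ ‖N v‖) {κ : ℝ} (hκ : ∀ v, ‖i v‖ ≤ κ * ‖N v‖) (Vh : Submodule ℝ V) {τ ρ : ℝ}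
    (hτ : 0 < τ) (hρ : 0 < ρ) (hρτ : ρ * τ ≤ 1) (hρκ : ρ⁻¹ ≤ κ)
    (hst : ∀ v ∈ Vh, τ ^ 2 * ‖N v‖ ^ 2 ≤ ‖i v‖ ^ 2) {D : ℕ → ℝ → V}
    (hD : ∀ r < 4, HasTimeDeriv (D r) (D (r + 1))) (hD0 : ∀ r ≤ 3, D r 0 = 0) {f : ℝ → H}
    (heq : ∀ t, 0 ≤ t → ∀ v, inner ℝ (i (D 2 t)) (i v) + inner ℝ (N (D 0 t)) (N v) = inner ℝ (f t) (i v))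
    {U : ℕ → V} (hU : ∀ n, U n ∈ Vh) (hU0 : U 0 = 0) (hU1 : U 1 = 0)
    (hstep : ∀ n, 1 ≤ n → ∀ v ∈ Vh,
      1 / τ ^ 2 * inner ℝ (i (U (n + 1) - (2 : ℝ) • U n + U (n - 1))) (i v) +
        inner ℝ (N (U n)) (N v) = inner ℝ (f (n * τ)) (i v))
    {A : ℕ → ℝ → ℝ≥0∞} (hA : ∀ r t, ∃ w ∈ Vh, ‖N (D r t) - N w‖ₑ ^ 2 ≤ A r t)
    {c c' : ℤ → ℝ → ℝ} (hc : IsReconstruction c c') :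
    ∫⁻ t in Ioi (0 : ℝ), (‖i (D 1 t) - (1 / τ) • ∑ j ∈ stencil,
        c' j (Int.fract (t / τ)) • i (extendZero U (⌊t / τ⌋ + j))‖ₑ ^ 2 +
      ‖N (D 0 t - recon c τ (extendZero U) t)‖ₑ ^ 2) * damp ρ t ≤
    errConst * (ENNReal.ofReal τ ^ 4 *
        (ENNReal.ofReal κ ^ 2 * (∫⁻ t in Ioi (0 : ℝ), ‖N (D 3 t)‖ₑ ^ 2 * damp ρ t) +
        ENNReal.ofReal κ ^ 4 * ∫⁻ t in Ioi (0 : ℝ), ‖N (D 4 t)‖ₑ ^ 2 * damp ρ t) +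
      ((∫⁻ t in Ioi (0 : ℝ), A 0 t * damp ρ t) +
        ENNReal.ofReal κ ^ 2 * (∫⁻ t in Ioi (0 : ℝ), A 1 t * damp ρ t) +
        ENNReal.ofReal κ ^ 4 * ∫⁻ t in Ioi (0 : ℝ), A 2 t * damp ρ t)) := by
  obtain ⟨P, F, h⟩ := exists_isDiscretization i N hβ hN hκ Vh hτ hst hD hD0 heq hU hU0 hU1 hstep
  have hgrad : ∀ r, dampSq ρ (gradDeriv N (fun r => (Ioi (0 : ℝ)).indicator (D r)) r) =
      ∫⁻ t in Ioi (0 : ℝ), ‖N (D r t)‖ₑ ^ 2 * damp ρ t := fun r => by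
    rw [← dampSq_indicator]
    congr 1
    ext t
    exact (indicator_comp_of_zero (g := N) (map_zero N)).symm ▸ rfl
  have hritz : ∀ r, dampSq ρ (ritzErr N P (fun r => (Ioi (0 : ℝ)).indicator (D r)) r) ≤
      ∫⁻ t in Ioi (0 : ℝ), A r t * damp ρ t := fun r => by
    have h1 : dampSq ρ (ritzErr N P (fun r => (Ioi (0 : ℝ)).indicator (D r)) r) =
        dampSq ρ ((Ioi (0 : ℝ)).indicator fun t => N (D r t - P (D r t))) := by
      congr 1
      ext t
      by_cases ht : t ∈ Ioi (0 : ℝ)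
      · simp only [ritzErr, indicator_of_mem ht]
      · simp only [ritzErr, indicator_of_notMem ht, map_zero, sub_zero]
    rw [h1, dampSq_indicator]
    refine lintegral_mono fun t => mul_le_mul_left ?_ _
    obtain ⟨w, hw, hwA⟩ := hA r t
    refine le_trans (pow_le_pow_left₀ zero_le ?_ 2) hwA
    have h2 := norm_sub_ritz_le h.ritz_mem h.ritz (D r t) (Vh.le_topologicalClosure hw)
    rw [← ofReal_norm, ← ofReal_norm]
    exact ENNReal.ofReal_le_ofReal h2
  have h1 := h.energy_error_le hc hρ hτ hρτ hρκ
  rw [hgrad, hgrad] at h1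
  refine le_trans (le_of_eq (setLIntegral_congr_fun measurableSet_Ioi fun t ht => ?_)) (h1.trans ?_)
  · simp only [indicator_of_mem ht, recon]
  · exact mul_le_mul_right (add_le_add_right (add_le_add (add_le_add (hritz 0)
      (mul_le_mul_right (hritz 1) _)) (mul_le_mul_right (hritz 2) _)) _) _

end Hilbert

end

section

/-! ### The error estimate for the wave equation -/

variable {Ω : Set (Eu d)}

theorem dampedNorm_sq (ρ : ℝ) (n : ℝ → ℝ≥0∞) :
    dampedNorm ρ n ^ 2 = ∫⁻ t in Ioi (0 : ℝ), n t ^ 2 * damp ρ t := rpow_half_sq _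

/-- A sum of squares of nonnegative terms is at most the square of their sum; the same holds for the
spatial quantity below. -/
theorem sq_le_Ctim_sq {ρ : ℝ} (hκ : 0 ≤ kappa Ω ρ) (D : ℕ → ℝ → H10 Ω) :
    ENNReal.ofReal (kappa Ω ρ) ^ 2 * (∫⁻ t in Ioi (0 : ℝ), ‖gradL Ω (D 3 t)‖ₑ ^ 2 * damp ρ t) +
      ENNReal.ofReal (kappa Ω ρ) ^ 4 * (∫⁻ t in Ioi (0 : ℝ), ‖gradL Ω (D 4 t)‖ₑ ^ 2 * damp ρ t) ≤
      Ctim ρ D ^ 2 := by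
  simp only [gradL_apply]
  rw [← dampedNorm_sq ρ fun t => ‖grad (D 3 t)‖ₑ, ← dampedNorm_sq ρ fun t => ‖grad (D 4 t)‖ₑ]
  have h1 : Ctim ρ D = ENNReal.ofReal (kappa Ω ρ) ^ 1 * dampedNorm ρ (fun t => ‖grad (D 3 t)‖ₑ) +
      ENNReal.ofReal (kappa Ω ρ) ^ 2 * dampedNorm ρ (fun t => ‖grad (D 4 t)‖ₑ) := by
    rw [Ctim, show Finset.Icc 3 4 = {3, 4} by decide, Finset.sum_pair (by norm_num),
      ENNReal.ofReal_pow hκ, ENNReal.ofReal_pow hκ]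
  rw [h1]
  generalize dampedNorm ρ (fun t => ‖grad (D 3 t)‖ₑ) = a
  generalize dampedNorm ρ (fun t => ‖grad (D 4 t)‖ₑ) = b
  generalize ENNReal.ofReal (kappa Ω ρ) = x
  calc x ^ 2 * a ^ 2 + x ^ 4 * b ^ 2 ≤ x ^ 2 * a ^ 2 + x ^ 4 * b ^ 2 + 2 * (x ^ 1 * a) * (x ^ 2 * b) :=
        le_self_add
    _ = _ := by ring

theorem sq_le_Cspa_sq (T : Mesh Ω) (k : ℕ) {ρ : ℝ} (hκ : 0 ≤ kappa Ω ρ) (D : ℕ → ℝ → H10 Ω) :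
    (∫⁻ t in Ioi (0 : ℝ), T.brokenSeminorm (k + 1) (fn (D 0 t)) ^ 2 * damp ρ t) +
      ENNReal.ofReal (kappa Ω ρ) ^ 2 *
        (∫⁻ t in Ioi (0 : ℝ), T.brokenSeminorm (k + 1) (fn (D 1 t)) ^ 2 * damp ρ t) +
      ENNReal.ofReal (kappa Ω ρ) ^ 4 *
        (∫⁻ t in Ioi (0 : ℝ), T.brokenSeminorm (k + 1) (fn (D 2 t)) ^ 2 * damp ρ t) ≤
      Cspa T k ρ D ^ 2 := by
  rw [← dampedNorm_sq, ← dampedNorm_sq, ← dampedNorm_sq]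
  have h1 : Cspa T k ρ D = ∑ r ∈ Finset.Icc 0 3, ENNReal.ofReal (kappa Ω ρ) ^ r *
      dampedNorm ρ (fun t => T.brokenSeminorm (k + 1) (fn (D r t))) := by
    rw [Cspa]
    exact Finset.sum_congr rfl fun r _ => by rw [ENNReal.ofReal_pow hκ]
  rw [h1]
  rw [show Finset.Icc 0 3 = {0, 1, 2, 3} by decide]
  simp only [Finset.sum_insert, Finset.mem_insert, Finset.mem_singleton, Finset.sum_singleton,
    show (0 : ℕ) ≠ 1 by decide, show (0 : ℕ) ≠ 2 by decide, show (0 : ℕ) ≠ 3 by decide,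
    show (1 : ℕ) ≠ 2 by decide, show (1 : ℕ) ≠ 3 by decide, show (2 : ℕ) ≠ 3 by decide, or_self,
    not_false_eq_true]
  generalize dampedNorm ρ (fun t => T.brokenSeminorm (k + 1) (fn (D 0 t))) = a
  generalize dampedNorm ρ (fun t => T.brokenSeminorm (k + 1) (fn (D 1 t))) = b
  generalize dampedNorm ρ (fun t => T.brokenSeminorm (k + 1) (fn (D 2 t))) = e
  generalize dampedNorm ρ (fun t => T.brokenSeminorm (k + 1) (fn (D 3 t))) = g
  generalize ENNReal.ofReal (kappa Ω ρ) = x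
  calc a ^ 2 + x ^ 2 * b ^ 2 + x ^ 4 * e ^ 2 ≤ a ^ 2 + x ^ 2 * b ^ 2 + x ^ 4 * e ^ 2 +
        (2 * a * (x * b + x ^ 2 * e + x ^ 3 * g) + 2 * (x * b) * (x ^ 2 * e + x ^ 3 * g) +
          2 * (x ^ 2 * e) * (x ^ 3 * g) + x ^ 6 * g ^ 2) := le_self_add
    _ = _ := by ring

theorem hasDerivAt_comp_sub_recon {V H : Type*} [NormedAddCommGroup V] [NormedSpace ℝ V]
    [NormedAddCommGroup H] [NormedSpace ℝ H] (i : V →L[ℝ] H) {c c' : ℤ → ℝ → ℝ}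
    (hc : IsReconstruction c c') {τ : ℝ} (hτ : 0 < τ) (W : ℤ → V) {t : ℝ} (ht : ∀ n : ℤ, t ≠ n * τ)
    {u : ℝ → V} {w : H} (hu : HasDerivAt (fun s => i (u s)) w t) :
    HasDerivAt (fun s => i (u s - recon c τ W s)) (w - (1 / τ) • ∑ j ∈ stencil,
      c' j (Int.fract (t / τ)) • i (W (⌊t / τ⌋ + j))) t := by
  simp only [map_sub, map_recon]
  exact hu.sub (hasDerivAt_recon hc hτ (fun n => i (W n)) ht)


theorem dampedEnergySq_le (ρ : ℝ) {φ : ℝ → H10 Ω} {φ' : ℝ → L2 Ω}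
    (h : ∀ᵐ t ∂volume.restrict (Ioi (0 : ℝ)), HasDerivAt (fun s => fn (φ s)) (φ' t) t) :
    dampedEnergySq ρ φ ≤ ∫⁻ t in Ioi (0 : ℝ), (‖φ' t‖ₑ ^ 2 + ‖grad (φ t)‖ₑ ^ 2) * damp ρ t := by
  refine lintegral_mono_ae ?_
  filter_upwards [h] with t ht
  rw [if_pos ht.differentiableAt, ht.deriv]
  exact le_rfl

theorem add_spatial_le {X S Z₀ Z₁ Z₂ x C h : ℝ≥0∞} (hS : Z₀ + x ^ 2 * Z₁ + x ^ 4 * Z₂ ≤ S) :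
    X + (C * h * Z₀ + x ^ 2 * (C * h * Z₁) + x ^ 4 * (C * h * Z₂)) ≤ (1 + C) * (X + h * S) :=
  calc _ = X + C * (h * (Z₀ + x ^ 2 * Z₁ + x ^ 4 * Z₂)) := by ring
    _ ≤ X + C * (h * S) := by gcongr
    _ ≤ X + C * (h * S) + (C * X + h * S) := le_self_add
    _ = _ := by ring

theorem lintegral_const_mul_brokenSeminorm (T : Mesh Ω) (k : ℕ) (ρ : ℝ) {C h : ℝ≥0∞} (hC : C ≠ ⊤)
    (hh : h ≠ ⊤) (v : ℝ → H10 Ω) :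
    ∫⁻ t in Ioi (0 : ℝ), C * (h * T.brokenSeminorm (k + 1) (fn (v t)) ^ 2) * damp ρ t =
      C * h * ∫⁻ t in Ioi (0 : ℝ), T.brokenSeminorm (k + 1) (fn (v t)) ^ 2 * damp ρ t := by
  rw [← lintegral_const_mul' _ _ (ENNReal.mul_ne_top hC hh)]
  exact lintegral_congr fun t => by ring

theorem mul_norm_le_norm_gradL {κ : ℝ} (hκ : 0 ≤ κ) {v : H10 Ω} (h : ‖fn v‖ ≤ κ * ‖grad v‖) :
    (1 + κ)⁻¹ * ‖v‖ ≤ ‖gradL Ω v‖ := by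
  rw [inv_mul_le_iff₀ (by positivity), gradL_apply]
  refine abs_le_of_sq_le_sq' ?_ (by positivity) |>.2
  rw [norm_sq_eq]
  nlinarith [norm_nonneg (fn v), norm_nonneg (grad v), mul_nonneg hκ (sq_nonneg ‖grad v‖)]

theorem Mesh.IsStableStep.sq_norm_le {T : Mesh Ω} {k : ℕ} {μ₀ τ : ℝ} (h : T.IsStableStep k μ₀ τ)
    (hμ₀ : 0 < μ₀) {v : H10 Ω} (hv : v ∈ T.feSpace k) : τ ^ 2 * ‖gradL Ω v‖ ^ 2 ≤ ‖fnL Ω v‖ ^ 2 := by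
  have h1 := (h v hv).1
  rw [mForm, real_inner_self_eq_norm_sq, real_inner_self_eq_norm_sq] at h1
  rw [fnL_apply, gradL_apply]
  nlinarith [mul_nonneg hμ₀.le (sq_nonneg ‖fn v‖)]

theorem IsStrongSolution.weak_eq {f : ℝ → L2 Ω} {u : ℝ → H10 Ω} (hu : IsStrongSolution f u)
    {D : ℕ → ℝ → H10 Ω} (hD : IsTimeDerivs 4 u D) (t : ℝ) (ht : 0 ≤ t) (v : H10 Ω) :
    inner ℝ (fnL Ω (D 2 t)) (fnL Ω v) + inner ℝ (gradL Ω (D 0 t)) (gradL Ω v) =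
      inner ℝ (f t) (fnL Ω v) := by
  obtain ⟨rfl, hD⟩ := hD
  rw [← iteratedDerivWithin_two_eq hD (fnL Ω) ht]
  exact hu.eqn t ht v

theorem IsStrongSolution.derivs_zero {f : ℝ → L2 Ω} {u : ℝ → H10 Ω} (hΩ : IsOpen Ω)
    (hf : IsSource f) (hu : IsStrongSolution f u) {D : ℕ → ℝ → H10 Ω} (hD : IsTimeDerivs 4 u D) :
    ∀ r ≤ 3, D r 0 = 0 := by
  have heq := hu.weak_eq hD
  obtain ⟨rfl, hD⟩ := hD
  have h1 := (derivWithin_comp_eq hD (fnL Ω) (r := 0) (by omega) le_rfl).derivWithin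
      (uniqueDiffOn_Ici (0 : ℝ) 0 self_mem_Ici)
  exact WaveFEM.derivs_zero hD (fnL Ω) (gradL Ω) (fun v hv => fn_injective hΩ hv) hu.init
    (h1.symm.trans hu.init_deriv) heq hf.away_from_zero

/-- The error of a reconstruction of the leapfrog approximations, as an integral. -/
theorem lintegral_recon_le (hd : 1 ≤ d) (hΩ : IsOpen Ω) (hb : Bornology.IsBounded Ω) (T : Mesh Ω)
    {k : ℕ} {μ₀ τ ρ : ℝ} (hμ₀ : 0 < μ₀) (hτ : 0 < τ) (hρ : 0 < ρ) (hρτ : ρ * τ ≤ 1)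
    (hst : T.IsStableStep k μ₀ τ) {f : ℝ → L2 Ω} {u : ℝ → H10 Ω} {U : ℕ → H10 Ω} {D : ℕ → ℝ → H10 Ω}
    (hf : IsSource f) (hu : IsStrongSolution f u) (hU : IsLeapfrog T k τ f U) (hD : IsTimeDerivs 4 u D)
    {C h : ℝ≥0∞} (hC : C ≠ ⊤) (hh : h ≠ ⊤) (hA : ∀ v : H10 Ω, ∃ w ∈ T.feSpace k,
      ‖grad v - grad w‖ₑ ^ 2 ≤ C * (h * T.brokenSeminorm (k + 1) (fn v) ^ 2))
    {c c' : ℤ → ℝ → ℝ} (hc : IsReconstruction c c') :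
    ∫⁻ t in Ioi (0 : ℝ), (‖fnL Ω (D 1 t) - (1 / τ) • ∑ j ∈ stencil,
        c' j (Int.fract (t / τ)) • fnL Ω (extendZero U (⌊t / τ⌋ + j))‖ₑ ^ 2 +
      ‖gradL Ω (D 0 t - recon c τ (extendZero U) t)‖ₑ ^ 2) * damp ρ t ≤
      errConst * ((1 + C) * (ENNReal.ofReal τ ^ 4 * Ctim ρ D ^ 2 + h * Cspa T k ρ D ^ 2)) := by
  have hρκ : ρ⁻¹ ≤ kappa Ω ρ := le_max_right _ _
  have hκ0 : 0 ≤ kappa Ω ρ := (inv_pos.2 hρ).le.trans hρκ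
  have hR : ∀ v : H10 Ω, ‖fn v‖ ≤ kappa Ω ρ * ‖grad v‖ := fun v =>
    (norm_fn_le hd hb v).trans (mul_le_mul_of_nonneg_right (le_max_left _ _) (norm_nonneg _))
  have hmain := leapfrog_energy_error_le (fnL Ω) (gradL Ω) (inv_pos.2 (by positivity))
    (fun v => mul_norm_le_norm_gradL hκ0 (hR v)) hR
    (T.feSpace k) hτ hρ hρτ hρκ (fun v hv => hst.sq_norm_le hμ₀ hv) hD.2 (hu.derivs_zero hΩ hf hD)
    (hu.weak_eq hD) hU.mem hU.zero hU.one hU.step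
    (A := fun r t => C * (h * T.brokenSeminorm (k + 1) (fn (D r t)) ^ 2)) (fun r t => hA (D r t)) hc
  refine hmain.trans (mul_le_mul_right ?_ _)
  simp only [lintegral_const_mul_brokenSeminorm T k ρ hC hh]
  exact (add_le_add (mul_le_mul_right (sq_le_Ctim_sq hκ0 D) _) le_rfl).trans
    (add_spatial_le (sq_le_Cspa_sq T k hκ0 D))

/-- The error of a reconstruction of the leapfrog approximations. -/
theorem dampedEnergySq_recon_le (hd : 1 ≤ d) (hΩ : IsOpen Ω) (hb : Bornology.IsBounded Ω) (T : Mesh Ω)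
    {k : ℕ} {μ₀ τ ρ : ℝ} (hμ₀ : 0 < μ₀) (hτ : 0 < τ) (hρ : 0 < ρ) (hρτ : ρ * τ ≤ 1)
    (hst : T.IsStableStep k μ₀ τ) {f : ℝ → L2 Ω} {u : ℝ → H10 Ω} {U : ℕ → H10 Ω} {D : ℕ → ℝ → H10 Ω}
    (hf : IsSource f) (hu : IsStrongSolution f u) (hU : IsLeapfrog T k τ f U) (hD : IsTimeDerivs 4 u D)
    {C h : ℝ≥0∞} (hC : C ≠ ⊤) (hh : h ≠ ⊤) (hA : ∀ v : H10 Ω, ∃ w ∈ T.feSpace k,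
      ‖grad v - grad w‖ₑ ^ 2 ≤ C * (h * T.brokenSeminorm (k + 1) (fn v) ^ 2))
    {c c' : ℤ → ℝ → ℝ} (hc : IsReconstruction c c') :
    dampedEnergySq ρ (fun t => u t - recon c τ (extendZero U) t) ≤
      errConst * ((1 + C) * (ENNReal.ofReal τ ^ 4 * Ctim ρ D ^ 2 + h * Cspa T k ρ D ^ 2)) := by
  refine le_trans ?_ (lintegral_recon_le hd hΩ hb T hμ₀ hτ hρ hρτ hst hf hu hU hD hC hh hA hc)
  obtain ⟨rfl, hD⟩ := hD
  refine dampedEnergySq_le ρ ?_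
  filter_upwards [ae_restrict_of_ae (ae_ne_grid τ), ae_restrict_mem measurableSet_Ioi] with t ht ht0
  exact hasDerivAt_comp_sub_recon (fnL Ω) hc hτ (extendZero U) ht
    ((derivWithin_comp_eq hD (fnL Ω) (r := 0) (by omega) (le_of_lt ht0)).hasDerivAt (Ici_mem_nhds ht0))

end

/-! ### Uniform constants and the two reconstructions -/

section

/-- Every `v` in `H¹₀(Ω)` can be approximated in `V_h` to order `h ^ k`, with the constant `C`. -/
def IsApproxConst (d k : ℕ) (σ : ℝ) (C : ℝ≥0∞) : Prop :=
  ∀ (Ω : Set (Eu d)), IsOpen Ω → Bornology.IsBounded Ω → IsLipschitzDomain Ω →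
    ∀ (T : Mesh Ω), T.IsShapeRegular σ → ∀ u : H10 Ω, ∃ w ∈ T.feSpace k,
      ‖grad u - grad w‖ₑ ^ 2 ≤ C * (ENNReal.ofReal (T.size ^ (2 * k)) *
        T.brokenSeminorm (k + 1) (fn u) ^ 2)

theorem exists_isApproxConst {k : ℕ} (hd : 1 ≤ d) (hk : 1 ≤ k) (σ : ℝ) :
    ∃ C : ℝ≥0∞, C ≠ ⊤ ∧ IsApproxConst d k σ C := by
  cases d with
  | zero => omega
  | succ n => exact exists_approx n k hk σ

theorem IsApproxConst.dampedEnergySq_recon_le {k : ℕ} {σ : ℝ} {C : ℝ≥0∞} (h : IsApproxConst d k σ C)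
    (hC : C ≠ ⊤) (hd : 1 ≤ d) {Ω : Set (Eu d)} (hΩ : IsOpen Ω) (hb : Bornology.IsBounded Ω)
    (hL : IsLipschitzDomain Ω) {T : Mesh Ω} (hT : T.IsShapeRegular σ) {μ₀ τ ρ : ℝ} (hμ₀ : 0 < μ₀)
    (hτ : 0 < τ) (hρ : 0 < ρ) (hρτ : ρ * τ ≤ 1)
    (hst : T.IsStableStep k μ₀ τ) {f : ℝ → L2 Ω} {u : ℝ → H10 Ω} {U : ℕ → H10 Ω} {D : ℕ → ℝ → H10 Ω}
    (hf : IsSource f) (hu : IsStrongSolution f u) (hU : IsLeapfrog T k τ f U) (hD : IsTimeDerivs 4 u D)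
    {c c' : ℤ → ℝ → ℝ} (hc : IsReconstruction c c') :
    dampedEnergySq ρ (fun t => u t - recon c τ (extendZero U) t) ≤
      errConst * (1 + C) * (ENNReal.ofReal (τ ^ 4) * Ctim ρ D ^ 2 +
        ENNReal.ofReal (T.size ^ (2 * k)) * Cspa T k ρ D ^ 2) := by
  rw [ENNReal.ofReal_pow hτ.le, mul_assoc]
  exact WaveFEM.dampedEnergySq_recon_le hd hΩ hb T hμ₀ hτ hρ hρτ hst hf hu hU hD hC
    ENNReal.ofReal_ne_top (h Ω hΩ hb hL T hT) hc

theorem le_ofReal_toReal_add_one {K : ℝ≥0∞} (hK : K ≠ ⊤) : K ≤ ENNReal.ofReal (K.toReal + 1) := by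
  conv_lhs => rw [← ENNReal.ofReal_toReal hK]
  exact ENNReal.ofReal_le_ofReal (by linarith)

theorem dampedEnergySq_recR {Ω : Set (Eu d)} {τ : ℝ} (hτ : 0 < τ) (ρ : ℝ) (u : ℝ → H10 Ω)
    (U : ℕ → H10 Ω) : dampedEnergySq ρ (fun t => u t - recR τ U t) =
      dampedEnergySq ρ (fun t => u t - recon (fun j => quartic (coefR j)) τ (extendZero U) t) :=
  congrArg _ (funext fun t => congrArg _ (recR_eq hτ U t))

theorem dampedEnergySq_recL {Ω : Set (Eu d)} {τ : ℝ} (hτ : 0 < τ) (ρ : ℝ) (u : ℝ → H10 Ω)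
    (U : ℕ → H10 Ω) : dampedEnergySq ρ (fun t => u t - recL τ U t) =
      dampedEnergySq ρ (fun t => u t - recon (fun j => quartic (coefL j)) τ (extendZero U) t) :=
  congrArg _ (funext fun t => congrArg _ (recL_eq hτ U t))

end

end WaveFEM

end

theorem theorem8p4 (d k : ℕ) (hd : 1 ≤ d) (hk : 1 ≤ k)
    (Ω : Set (WaveFEM.Eu d)) (hopen : IsOpen Ω) (hbdd : Bornology.IsBounded Ω)
    (hne : Ω.Nonempty) (hLip : WaveFEM.IsLipschitzDomain Ω)
    (σ μ₀ : ℝ) (hσ : 0 < σ) (hμ₀ : 0 < μ₀) (hμ₁ : μ₀ < 1) :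
    (∃ c : ℝ, 0 < c ∧ ∀ T : WaveFEM.Mesh Ω, T.IsShapeRegular σ →
      ∀ τ : ℝ, 0 < τ → τ ≤ c * T.minSize → T.IsStableStep k μ₀ τ) ∧
    ∃ C : ℝ, 0 < C ∧ ∀ T : WaveFEM.Mesh Ω, T.IsShapeRegular σ →
      ∀ τ ρ : ℝ, 0 < τ → 0 < ρ → ρ * τ ≤ 1 → T.IsStableStep k μ₀ τ →
      ∀ (f : ℝ → WaveFEM.L2 Ω) (u : ℝ → WaveFEM.H10 Ω) (U : ℕ → WaveFEM.H10 Ω)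
        (D : ℕ → ℝ → WaveFEM.H10 Ω),
        WaveFEM.IsSource f → WaveFEM.IsStrongSolution f u → WaveFEM.IsLeapfrog T k τ f U →
        WaveFEM.IsTimeDerivs 4 u D →
        WaveFEM.Ctim ρ D < ⊤ → WaveFEM.Cspa T k ρ D < ⊤ →
        WaveFEM.dampedEnergySq ρ (fun t => u t - WaveFEM.recR τ U t) ≤
          ENNReal.ofReal C * (ENNReal.ofReal (τ ^ 4) * WaveFEM.Ctim ρ D ^ 2
            + ENNReal.ofReal (T.size ^ (2 * k)) * WaveFEM.Cspa T k ρ D ^ 2) ∧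
        ∀ F : ℕ → ℝ → WaveFEM.L2 Ω, WaveFEM.IsTimeDerivs 3 f F →
          WaveFEM.CtimSource ρ F < ⊤ →
          WaveFEM.dampedEnergySq ρ (fun t => u t - WaveFEM.recL τ U t) ≤
            ENNReal.ofReal C * (ENNReal.ofReal (τ ^ 4) *
                (WaveFEM.Ctim ρ D ^ 2
                  + ENNReal.ofReal (WaveFEM.kappa Ω ρ ^ 2) * WaveFEM.CtimSource ρ F ^ 2)
              + ENNReal.ofReal (T.size ^ (2 * k)) * WaveFEM.Cspa T k ρ D ^ 2) := by
  refine ⟨WaveFEM.stable_of_cfl d k Ω hopen hLip hσ hμ₁, ?_⟩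
  refine (WaveFEM.exists_isApproxConst hd hk σ).elim fun A hA => ?_
  have hK : WaveFEM.errConst * (1 + A) ≠ ⊤ :=
    ENNReal.mul_ne_top WaveFEM.errConst_ne_top (ENNReal.add_ne_top.2 ⟨ENNReal.one_ne_top, hA.1⟩)
  -- One constant serves both reconstructions. The added 1 makes it positive.
  refine ⟨(WaveFEM.errConst * (1 + A)).toReal + 1, by positivity, ?_⟩
  intro T hT τ ρ hτ hρ hρτ hst f u U D hf hu hU hD _ _
  refine ⟨?_, fun F _ _ => ?_⟩
  · rw [WaveFEM.dampedEnergySq_recR hτ]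
    exact (hA.2.dampedEnergySq_recon_le hA.1 hd hopen hbdd hLip hT hμ₀ hτ hρ hρτ hst hf hu hU hD
      WaveFEM.isReconstruction_coefR).trans
        (mul_le_mul_left (WaveFEM.le_ofReal_toReal_add_one hK) _)
  · rw [WaveFEM.dampedEnergySq_recL hτ]
    -- The estimate is the one for the quadratic reconstruction, as only the moment conditions
    -- matter. The source term on the right is a nonnegative summand, added by monotonicity.
    exact (hA.2.dampedEnergySq_recon_le hA.1 hd hopen hbdd hLip hT hμ₀ hτ hρ hρτ hst hf hu hU hD
      WaveFEM.isReconstruction_coefL).trans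
        (mul_le_mul' (WaveFEM.le_ofReal_toReal_add_one hK)
          (add_le_add_left (mul_le_mul_right le_self_add _) _))
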